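/- Let $X$ be a smooth manifold with boundary of dimension $b+f+1$, let $Z\to\partial X\to Y$ be a smooth fibration, with $\dim Y=b$, $\dim Z=f$ and $Y,Z$ without boundary, and let $g$ be an edge metric on $X$: a smooth Riemannian metric on the interior of $X$ such that near each boundary point there are coordinates $(x,y,z)$, with $x\ge 0$ defining the boundary and $y|_{\partial X}$ pulled back from $Y$, in which $$g=dx^2+h(x,y,dy)+x\,h'(x,y,z,dx,dy)+x^2k(x,y,z,dx,dy,dz),$$ where $h,h',k$ are smooth up to $x=0$, $h$ is a metric in $y$ and $k$ is positive definite on the fibres of $\partial X$. Let $M=\mathbb R_t\times X$, let ${}^eT^*M$ be the edge cotangent bundle, i.e. the dual of the bundle with local frame $x\partial_t,x\partial_x,x\partial_y,\partial_z$, with fibre coordinates $(\tau,\xi,\eta,\zeta)$ standing for the covector $$\tau\frac{dt}{x}+\xi\frac{dx}{x}+\eta\cdot\frac{dy}{x}+\zeta\cdot dz ,$$ and with the symplectic form $d\big(\tau\frac{dt}{x}+\xi\frac{dx}{x}+\eta\cdot\frac{dy}{x}+\zeta\cdot dz\big)$ over the interior $M^\circ$. The Poisson bracket of two functions smooth up to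 the boundary on ${}^eT^*M$ extends smoothly from the interior to the boundary. Let $\mathcal R=\mathcal R_I\cup\mathcal R_O$ be the set of points over $\partial M$ with $x=0$, $\zeta=0$, $\tau^2=\xi^2+|\eta|_h^2$ and $\xi\neq0$ (the endpoints of non-glancing rays), in coordinates as above, where $\operatorname{sgn}\xi=\operatorname{sgn}\tau$ on $\mathcal R_I$ (incoming) and $\operatorname{sgn}\xi=-\operatorname{sgn}\tau$ on $\mathcal R_O$ (outgoing). For a conic open set $U\subset{}^eT^*M$ let $\mathcal F_{I}(U)$, resp. $\mathcal F_O(U)$, be the union, over $r\in\mathcal R_I\cap U$, resp. $r\in\mathcal R_O\cap U$, of $\{r\}$ and all null bicharacteristic segments of $D_t^2-\Delta_g$ that lie over $M^\circ$, stay in $U$, and converge to $r$ in the edge cosphere bundle (i.e. after multiplication by positive factors in the fibres); put $\mathcal F(U)=\mathcal F_I(U)\cup\mathcal F_O(U)$. Theorem. There is a conic open neighbourhood $U$ of $\mathcal R$ in ${}^eT^*M$ such that $\mathcal F(U)$ is a coisotropic submanifold of ${}^eT^*M$ of codimension $f+1$. That is, near each of its points (boundary points included) $\mathcal F(U)$ is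 the common zero set of $f+1$ functions that are smooth up to the boundary, whose differentials are linearly independent along $\mathcal F(U)$ (together with $dx$ at boundary points), and whose pairwise Poisson brackets vanish on $\mathcal F(U)$; and at every point of $\mathcal F(U)$ over $M^\circ$ the tangent space of $\mathcal F(U)$ contains its symplectic orthocomplement. -/

import Mathlib

open scoped Manifold ContDiff Topology

namespace EdgeGeometry

/-! ### Coordinates

On `X`, of dimension `b + f + 1`, coordinates are `u = (x, y, z)`: `u 0 = x` is the boundary
defining function, the indices `1, …, b` are the base variables `y` and the indices
`b + 1, …, b + f` are the fibre variables `z`. -/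

/-- The coordinate space of `X`. -/
abbrev Coord (b f : ℕ) := EuclideanSpace ℝ (Fin (b + f + 1))

/-- The coordinate space of a cotangent bundle of `M = ℝ × X`: tuples `(t, u, τ, v)` with `t` the
time, `u = (x, y, z)` the position in `X`, `τ` the momentum dual to `t` and
`v = (ξ, η, ζ)` the momenta dual to `(x, y, z)`. -/
abbrev Phase (b f : ℕ) := ℝ × Coord b f × ℝ × Coord b f

/-- The scaling factors of the edge vector fields `x ∂_x, x ∂_y, ∂_z`: the `i`-th one is
`edgeScale x i • ∂_i`. -/
def edgeScale {b f : ℕ} (x : ℝ) (i : Fin (b + f + 1)) : ℝ := if i.val ≤ b then x else 1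

/-- The `i`-th coordinate vector. -/
noncomputable def basisVec {b f : ℕ} (i : Fin (b + f + 1)) : Coord b f :=
  EuclideanSpace.single i 1

/-- The half space `x ≥ 0` in phase space. -/
def phaseHalfSpace (b f : ℕ) : Set (Phase b f) := {w | 0 ≤ w.2.1 0}

/-- Over `x > 0`, the passage from the edge coordinates `(t, u, τ, v)`, standing for the covector
`τ dt/x + ξ dx/x + η dy/x + ζ dz`, to the canonical coordinates of the same covector
with respect to `dt, dx, dy, dz`. -/
noncomputable def toCanonical {b f : ℕ} (w : Phase b f) : Phase b f :=
  (w.1, w.2.1, w.2.2.1 / w.2.1 0,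
    WithLp.toLp 2 fun i => w.2.2.2 i / edgeScale (w.2.1 0) i)

/-! ### The symplectic structure -/

/-- The symplectic form `dτ ∧ dt + ∑ dv_i ∧ du_i` in canonical coordinates. -/
noncomputable def canonicalForm {b f : ℕ} (δ δ' : Phase b f) : ℝ :=
  (δ.2.2.1 * δ'.1 - δ'.2.2.1 * δ.1) +
    ∑ i, (δ.2.2.2 i * δ'.2.1 i - δ'.2.2.2 i * δ.2.1 i)

/-- The symplectic form `d(τ dt/x + ξ dx/x + η dy/x + ζ dz)` of the edge cotangent bundle at a
point `w` with `x > 0`, in edge coordinates. -/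
noncomputable def edgeForm {b f : ℕ} (w δ δ' : Phase b f) : ℝ :=
  canonicalForm (fderiv ℝ toCanonical w δ) (fderiv ℝ toCanonical w δ')

/-- The Hamilton vector field of `P` in canonical coordinates. -/
noncomputable def hamiltonField {b f : ℕ} (P : Phase b f → ℝ) (w : Phase b f) : Phase b f :=
  (fderiv ℝ P w (0, 0, 1, 0),
    WithLp.toLp 2 fun i => fderiv ℝ P w (0, 0, 0, basisVec i),
    -fderiv ℝ P w (1, 0, 0, 0),
    WithLp.toLp 2 fun i => -fderiv ℝ P w (0, basisVec i, 0, 0))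

/-- The differential at `w` of a function that is defined on `x ≥ 0` only. -/
noncomputable def edgeDeriv {b f : ℕ} (a : Phase b f → ℝ) (w : Phase b f) : Phase b f →L[ℝ] ℝ :=
  fderivWithin ℝ a (phaseHalfSpace b f) w

/-- The vector field `τ ∂_τ + ξ ∂_ξ + η ∂_η`. -/
noncomputable def slowEuler {b f : ℕ} (w : Phase b f) : Phase b f :=
  (0, 0, w.2.2.1, WithLp.toLp 2 fun i => if i.val ≤ b then w.2.2.2 i else 0)

/-- The Poisson bracket of the edge cotangent bundle in edge coordinates,
`{a, c} = x (a_τ c_t - a_t c_τ) + a_ξ (x c_x + E c) - c_ξ (x a_x + E a)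
  + x (a_η c_y - a_y c_η) + (a_ζ c_z - a_z c_ζ)` with `E = τ ∂_τ + ξ ∂_ξ + η ∂_η`.
Over `x > 0` it is the bracket of the symplectic form; the formula is its
smooth extension up to `x = 0`. -/
noncomputable def edgeBracket {b f : ℕ} (a c : Phase b f → ℝ) (w : Phase b f) : ℝ :=
  let A := edgeDeriv a w
  let C := edgeDeriv c w
  w.2.1 0 * (A (0, 0, 1, 0) * C (1, 0, 0, 0) - A (1, 0, 0, 0) * C (0, 0, 1, 0)) +
    (A (0, 0, 0, basisVec 0) * C (slowEuler w) - C (0, 0, 0, basisVec 0) * A (slowEuler w)) +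
    ∑ i, edgeScale (w.2.1 0) i *
      (A (0, 0, 0, basisVec i) * C (0, basisVec i, 0, 0) -
        A (0, basisVec i, 0, 0) * C (0, 0, 0, basisVec i))

section Manifold

variable {b f : ℕ} {X Y : Type*}
  [TopologicalSpace X] [ChartedSpace (EuclideanHalfSpace (b + f + 1)) X]
  [TopologicalSpace Y] [ChartedSpace (EuclideanSpace ℝ (Fin b)) Y]

/-! ### Fibred boundaries and adapted charts -/

/-- `fib : ∂X → Y` is a smooth fibration with fibre `Z`: over a neighbourhood `V` of any point of
`Y` there is a diffeomorphism from `fib ⁻¹ V` onto `V × Z` over `V`. It is given by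
`Φ`, whose smoothness on the boundary is expressed through a smooth extension to an open
subset of `X`, and by its inverse `Ψ`. -/
def IsBoundaryFibration (Z : Type*) [TopologicalSpace Z]
    [ChartedSpace (EuclideanSpace ℝ (Fin f)) Z]
    (fib : (𝓡∂ (b + f + 1)).boundary X → Y) : Prop :=
  ∀ y₀ : Y, ∃ (V : Set Y) (W : Set X) (Φ : X → Y × Z) (Ψ : Y × Z → X),
    IsOpen V ∧ y₀ ∈ V ∧ IsOpen W ∧
    ContMDiffOn (𝓡∂ (b + f + 1)) ((𝓡 b).prod (𝓡 f)) ∞ Φ W ∧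
    ContMDiffOn ((𝓡 b).prod (𝓡 f)) (𝓡∂ (b + f + 1)) ∞ Ψ (V ×ˢ Set.univ) ∧
    (∀ q : (𝓡∂ (b + f + 1)).boundary X, fib q ∈ V →
      (q : X) ∈ W ∧ (Φ q).1 = fib q ∧ Ψ (Φ q) = q) ∧
    (∀ y ∈ V, ∀ z : Z, ∃ h : Ψ (y, z) ∈ (𝓡∂ (b + f + 1)).boundary X,
      fib ⟨Ψ (y, z), h⟩ = y ∧ Φ (Ψ (y, z)) = (y, z))

/-- A chart of `X` (in the smooth maximal atlas) with coordinates `(x, y, z)` is adapted to the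
boundary fibration if on the boundary the coordinates `y` are pulled back from a chart of `Y`. -/
def IsEdgeChart (fib : (𝓡∂ (b + f + 1)).boundary X → Y)
    (e : OpenPartialHomeomorph X (EuclideanHalfSpace (b + f + 1))) : Prop :=
  e ∈ IsManifold.maximalAtlas (𝓡∂ (b + f + 1)) ∞ X ∧
  ∃ ψ ∈ IsManifold.maximalAtlas (𝓡 b) ∞ Y,
    ∀ q : (𝓡∂ (b + f + 1)).boundary X, (q : X) ∈ e.source →
      fib q ∈ ψ.source ∧
      ∀ j : Fin b, (e.extend (𝓡∂ (b + f + 1)) q) (Fin.castAdd f j).succ = ψ (fib q) j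

/-- The type of adapted charts. (Over the interior every small chart of `X` is adapted.) -/
def EdgeChart (fib : (𝓡∂ (b + f + 1)).boundary X → Y) :=
  {e : OpenPartialHomeomorph X (EuclideanHalfSpace (b + f + 1)) // IsEdgeChart fib e}

namespace EdgeChart

variable {fib : (𝓡∂ (b + f + 1)).boundary X → Y}

/-- The domain of an adapted chart. -/
def source (e : EdgeChart fib) : Set X := e.1.source

/-- The coordinate map `p ↦ (x, y, z)` of an adapted chart. -/
noncomputable def coord (e : EdgeChart fib) : X → Coord b f := e.1.extend (𝓡∂ (b + f + 1))

/-- The inverse of the coordinate map. -/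
noncomputable def symm (e : EdgeChart fib) : Coord b f → X :=
  (e.1.extend (𝓡∂ (b + f + 1))).symm

/-- The range of the coordinate map, a relatively open subset of the half space `x ≥ 0`. -/
noncomputable def target (e : EdgeChart fib) : Set (Coord b f) :=
  (e.1.extend (𝓡∂ (b + f + 1))).target

/-- The change of coordinates from `e` to `e'`. -/
noncomputable def transition (e e' : EdgeChart fib) (u : Coord b f) : Coord b f :=
  e'.coord (e.symm u)

/-- The matrix of the change of edge frame over the interior: if `V_i = edgeScale x i • ∂_i` are
the edge vector fields `x ∂_x, x ∂_y, ∂_z` of `e` and `V'_k` are those of `e'`,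
then `V_i = ∑ k, frameChange e e' u k i • V'_k`. -/
noncomputable def frameChange (e e' : EdgeChart fib) (u : Coord b f)
    (k i : Fin (b + f + 1)) : ℝ :=
  edgeScale (u 0) i * (fderiv ℝ (transition e e') u (basisVec i)) k /
    edgeScale (transition e e' u 0) k

end EdgeChart

/-! ### The edge cotangent bundle of `M = ℝ × X` -/

/-- The edge cotangent bundle of `M = ℝ × X`. A point consists of a time, a point `pt` of `X` and
an edge covector: its components `(τ, v) = (τ, ξ, η, ζ)` in every adapted chart around
`pt`, subject to the transformation law of covectors with respect to the edge frames
`x ∂_t, x ∂_x, x ∂_y, ∂_z`. Over the interior the transformation law is an identity; at the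
boundary its coefficients are the continuous extensions from the interior. -/
structure EdgeCotangent (fib : (𝓡∂ (b + f + 1)).boundary X → Y) where
  time : ℝ
  pt : X
  comp : EdgeChart fib → ℝ × Coord b f
  comp_eq_zero : ∀ e : EdgeChart fib, pt ∉ e.source → comp e = 0
  compat : ∀ e e' : EdgeChart fib, pt ∈ e.source → pt ∈ e'.source →
    Filter.Tendsto (fun u : Coord b f => u 0 / e.transition e' u 0 * (comp e').1)
      (𝓝[{u | 0 < u 0}] (e.coord pt)) (𝓝 (comp e).1) ∧
    ∀ i, Filter.Tendsto (fun u : Coord b f => ∑ k, e.frameChange e' u k i * (comp e').2 k)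
      (𝓝[{u | 0 < u 0}] (e.coord pt)) (𝓝 ((comp e).2 i))

namespace EdgeCotangent

variable {fib : (𝓡∂ (b + f + 1)).boundary X → Y}

/-- The edge coordinates `(t, u, τ, v)` in an adapted chart `e`, for points over `e.source`. -/
noncomputable def coords (e : EdgeChart fib) (w : EdgeCotangent fib) : Phase b f :=
  (w.time, e.coord w.pt, w.comp e)

/-- The topology of the edge cotangent bundle, generated by the coordinate patches. -/
instance : TopologicalSpace (EdgeCotangent fib) :=
  TopologicalSpace.generateFrom
    {S | ∃ (e : EdgeChart fib) (N : Set (Phase b f)), IsOpen N ∧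
      S = {w | w.pt ∈ e.source ∧ coords e w ∈ N}}

/-- Multiplication by `c` in the fibres. -/
noncomputable def dilate (c : ℝ) (w : EdgeCotangent fib) : EdgeCotangent fib where
  time := w.time
  pt := w.pt
  comp := fun e => c • w.comp e
  comp_eq_zero := fun e he => by rw [w.comp_eq_zero e he, smul_zero]
  compat := fun e e' he he' => by
    obtain ⟨h1, h2⟩ := w.compat e e' he he'
    refine ⟨?_, fun i => ?_⟩
    · refine (h1.const_mul c).congr fun u => ?_
      simp only [Prod.smul_fst, smul_eq_mul]
      ring
    · refine ((h2 i).const_mul c).congr fun u => ?_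
      simp only [Prod.smul_snd, PiLp.smul_apply, smul_eq_mul, Finset.mul_sum]
      exact Finset.sum_congr rfl fun k _ => by ring

/-- A subset is conic if it is invariant under multiplication by positive numbers. -/
def IsConic (U : Set (EdgeCotangent fib)) : Prop :=
  ∀ c : ℝ, 0 < c → ∀ w ∈ U, dilate c w ∈ U

end EdgeCotangent

/-! ### Edge metrics -/

/-- The components `g(∂_i, ∂_j)` of `g` in an adapted chart, at a point `u` with `x > 0`. -/
noncomputable def metricMatrix {fib : (𝓡∂ (b + f + 1)).boundary X → Y}
    (g : ∀ p : X, TangentSpace (𝓡∂ (b + f + 1)) p →L[ℝ]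
      TangentSpace (𝓡∂ (b + f + 1)) p →L[ℝ] ℝ)
    (e : EdgeChart fib) (u : Coord b f) :
    Matrix (Fin (b + f + 1)) (Fin (b + f + 1)) ℝ :=
  Matrix.of fun i j =>
    g (e.symm u) (mfderiv 𝓘(ℝ, Coord b f) (𝓡∂ (b + f + 1)) e.symm u (basisVec i))
      (mfderiv 𝓘(ℝ, Coord b f) (𝓡∂ (b + f + 1)) e.symm u (basisVec j))

/-- In the adapted chart `e`, `g` has the form
`dx² + h(x,y,dy) + x h'(x,y,z,dx,dy) + x² k(x,y,z,dx,dy,dz)` with `h` a metric in `y` and `k`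
positive definite on the fibres. Equivalently, in terms of the matrix `γ` of
`x⁻² g` with respect to the edge frame `x ∂_x, x ∂_y, ∂_z`: it is smooth up to `x = 0`, where it
is positive definite and block diagonal with blocks `1`, `h` (which does not depend on `z`)
and `k`. -/
structure IsNormalChart {fib : (𝓡∂ (b + f + 1)).boundary X → Y}
    (g : ∀ p : X, TangentSpace (𝓡∂ (b + f + 1)) p →L[ℝ]
      TangentSpace (𝓡∂ (b + f + 1)) p →L[ℝ] ℝ)
    (e : EdgeChart fib)
    (γ : Coord b f → Matrix (Fin (b + f + 1)) (Fin (b + f + 1)) ℝ) : Prop where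
  smooth : ∀ i j, ContDiffOn ℝ ∞ (fun u => γ u i j) e.target
  eq_metric : ∀ u ∈ e.target, 0 < u 0 → ∀ i j,
    edgeScale (u 0) i * edgeScale (u 0) j * metricMatrix g e u i j = u 0 ^ 2 * γ u i j
  posDef : ∀ u ∈ e.target, u 0 = 0 → (γ u).PosDef
  normal : ∀ u ∈ e.target, u 0 = 0 → γ u 0 0 = 1 ∧ ∀ j, j ≠ 0 → γ u 0 j = 0
  base_fibre : ∀ u ∈ e.target, u 0 = 0 →
    ∀ i j : Fin (b + f + 1), i.val ≤ b → b < j.val → γ u i j = 0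
  base : ∀ u ∈ e.target, ∀ u' ∈ e.target, u 0 = 0 → u' 0 = 0 →
    (∀ j : Fin (b + f + 1), j.val ≤ b → u j = u' j) →
    ∀ i j : Fin (b + f + 1), i.val ≤ b → j.val ≤ b → γ u i j = γ u' i j

/-- `g` is an edge metric: a smooth Riemannian metric on the interior of `X` (only its values there
matter) which near every boundary point has the edge form in some adapted chart. -/
structure IsEdgeMetric (fib : (𝓡∂ (b + f + 1)).boundary X → Y)
    (g : ∀ p : X, TangentSpace (𝓡∂ (b + f + 1)) p →L[ℝ]
      TangentSpace (𝓡∂ (b + f + 1)) p →L[ℝ] ℝ) : Prop where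
  symm : ∀ p ∈ (𝓡∂ (b + f + 1)).interior X, ∀ V W, g p V W = g p W V
  pos : ∀ p ∈ (𝓡∂ (b + f + 1)).interior X, ∀ V, V ≠ 0 → 0 < g p V V
  smooth : ∀ (e : EdgeChart fib) (i j : Fin (b + f + 1)),
    ContDiffOn ℝ ∞ (fun u => metricMatrix g e u i j) (e.target ∩ {u | 0 < u 0})
  edge : ∀ q ∈ (𝓡∂ (b + f + 1)).boundary X, ∃ (e : EdgeChart fib)
    (γ : Coord b f → Matrix (Fin (b + f + 1)) (Fin (b + f + 1)) ℝ),
    q ∈ e.source ∧ IsNormalChart g e γ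

/-! ### Bicharacteristics and their flowouts from the boundary -/

section Flowout

variable {fib : (𝓡∂ (b + f + 1)).boundary X → Y}
  (g : ∀ p : X, TangentSpace (𝓡∂ (b + f + 1)) p →L[ℝ]
    TangentSpace (𝓡∂ (b + f + 1)) p →L[ℝ] ℝ)

/-- The principal symbol `τ² - g⁻¹(v, v)` of the wave operator `D_t² - Δ_g` over the interior, in
canonical coordinates. -/
noncomputable def waveSymbol (e : EdgeChart fib) (w : Phase b f) : ℝ :=
  w.2.2.1 ^ 2 - ∑ i, ∑ j, (metricMatrix g e w.2.1)⁻¹ i j * w.2.2.2 i * w.2.2.2 j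

/-- The characteristic radial points over `∂M` away from glancing, the endpoints of the normal
bicharacteristics: in a chart in which the metric has the edge form these are
the points with `x = 0`, `ζ = 0`, `τ² = ξ² + |η|²_h` and `ξ ≠ 0`. They are incoming for `ε = 1`,
i.e. `sgn ξ = sgn τ`, and outgoing for `ε = -1`, i.e. `sgn ξ = - sgn τ`. -/
def radialSet (ε : ℝ) : Set (EdgeCotangent fib) :=
  {w | w.pt ∈ (𝓡∂ (b + f + 1)).boundary X ∧
    ∃ (e : EdgeChart fib) (γ : Coord b f → Matrix (Fin (b + f + 1)) (Fin (b + f + 1)) ℝ),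
      w.pt ∈ e.source ∧ IsNormalChart g e γ ∧
      (∀ k : Fin (b + f + 1), b < k.val → (w.comp e).2 k = 0) ∧
      (w.comp e).1 ^ 2 =
        ∑ i, ∑ j, (γ (e.coord w.pt))⁻¹ i j * (w.comp e).2 i * (w.comp e).2 j ∧
      0 < ε * ((w.comp e).2 0 * (w.comp e).1)}

/-- `c : (0, 1] → U` is a null bicharacteristic over the interior of `M`: a curve in the
characteristic set that is an integral curve of the Hamilton vector field of the
symbol of the wave operator, up to a constant factor `κ` in the parameter. -/
def IsBicharacteristic (U : Set (EdgeCotangent fib)) (κ : ℝ) (c : ℝ → EdgeCotangent fib) : Prop :=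
  ContinuousOn c (Set.Ioc 0 1) ∧
  ∀ s ∈ Set.Ioc (0 : ℝ) 1, c s ∈ U ∧ (c s).pt ∈ (𝓡∂ (b + f + 1)).interior X ∧
    ∀ e : EdgeChart fib, (c s).pt ∈ e.source →
      waveSymbol g e (toCanonical (EdgeCotangent.coords e (c s))) = 0 ∧
      HasDerivWithinAt (fun s' => toCanonical (EdgeCotangent.coords e (c s')))
        (κ • hamiltonField (waveSymbol g e) (toCanonical (EdgeCotangent.coords e (c s))))
        (Set.Ioc 0 1) s

/-- The part in `U` of the bicharacteristic ending at a boundary point `r`: the point `r`, and the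
points of bicharacteristics in `U` over the interior which tend to `r` in the
cosphere bundle, i.e. after multiplication by positive numbers. -/
def ray (U : Set (EdgeCotangent fib)) (r : EdgeCotangent fib) : Set (EdgeCotangent fib) :=
  {w | w ∈ U ∧ (w = r ∨ ∃ (κ : ℝ) (c : ℝ → EdgeCotangent fib) (l : ℝ → ℝ),
    IsBicharacteristic g U κ c ∧ c 1 = w ∧ (∀ s, 0 < l s) ∧
    Filter.Tendsto (fun s => EdgeCotangent.dilate (l s) (c s)) (𝓝[>] 0) (𝓝 r))}

/-- The union in `U` of the incoming (`ε = 1`) or outgoing (`ε = -1`) bicharacteristics. -/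
def flowout (ε : ℝ) (U : Set (EdgeCotangent fib)) : Set (EdgeCotangent fib) :=
  ⋃ r ∈ radialSet g ε ∩ U, ray g U r

end Flowout

/-! ### Coisotropic submanifolds -/

variable {fib : (𝓡∂ (b + f + 1)).boundary X → Y}

/-- `α_1, …, α_m` are local defining functions, in the open set `N` of the coordinate patch of
`e`, of the set `S`: they are smooth up to `x = 0`, `S` is their common zero set, and at
the points of `S` their differentials are linearly independent, at `x = 0` even together
with `dx` (so that `S` is a submanifold with boundary, transversal to `x = 0`). -/
structure IsDefiningSystem {m : ℕ} (S : Set (EdgeCotangent fib)) (e : EdgeChart fib)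
    (N : Set (Phase b f)) (α : Fin m → Phase b f → ℝ) : Prop where
  smooth : ∀ i, ContDiffOn ℝ ∞ (α i) (N ∩ {w | w.2.1 ∈ e.target})
  mem_iff : ∀ w : EdgeCotangent fib, w.pt ∈ e.source → EdgeCotangent.coords e w ∈ N →
    (w ∈ S ↔ ∀ i, α i (EdgeCotangent.coords e w) = 0)
  indep : ∀ w ∈ S, w.pt ∈ e.source → EdgeCotangent.coords e w ∈ N →
    LinearIndependent ℝ fun i => edgeDeriv (α i) (EdgeCotangent.coords e w)
  transversal : ∀ w ∈ S, w.pt ∈ e.source → EdgeCotangent.coords e w ∈ N →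
    w.pt ∈ (𝓡∂ (b + f + 1)).boundary X →
    ∀ (a : Fin m → ℝ) (a₀ : ℝ),
      (∀ δ : Phase b f,
        ∑ i, a i * edgeDeriv (α i) (EdgeCotangent.coords e w) δ + a₀ * δ.2.1 0 = 0) →
      (∀ i, a i = 0) ∧ a₀ = 0

/-- The tangent space of the common zero set of the `α_i`, in edge coordinates. -/
def tangentVectors {m : ℕ} (α : Fin m → Phase b f → ℝ) (w : Phase b f) : Set (Phase b f) :=
  {δ | ∀ i, edgeDeriv (α i) w δ = 0}

/-- `S` is a coisotropic submanifold of codimension `m` of the edge cotangent bundle: near each of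
its points it has `m` local defining functions, smooth up to the boundary, whose
Poisson brackets vanish on `S` (up to and including the boundary), and over the interior, where
the edge cotangent bundle is symplectic, the tangent spaces of `S` contain their symplectic
orthocomplements. -/
def IsCoisotropicSubmanifold (m : ℕ) (S : Set (EdgeCotangent fib)) : Prop :=
  ∀ w₀ ∈ S, ∃ (e : EdgeChart fib) (N : Set (Phase b f)) (α : Fin m → Phase b f → ℝ),
    w₀.pt ∈ e.source ∧ IsOpen N ∧ EdgeCotangent.coords e w₀ ∈ N ∧
    IsDefiningSystem S e N α ∧
    ∀ w ∈ S, w.pt ∈ e.source → EdgeCotangent.coords e w ∈ N →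
      (∀ i j, edgeBracket (α i) (α j) (EdgeCotangent.coords e w) = 0) ∧
      (w.pt ∈ (𝓡∂ (b + f + 1)).interior X →
        ∀ δ : Phase b f,
          (∀ δ' ∈ tangentVectors α (EdgeCotangent.coords e w),
            edgeForm (EdgeCotangent.coords e w) δ δ' = 0) →
          δ ∈ tangentVectors α (EdgeCotangent.coords e w))

end Manifold

end EdgeGeometry

/-!
The flowout of the radial points is coisotropic up to the boundary because near each of them it is
a graph over `x, y, ξ, η` whose fibre covector is a smooth function vanishing at `x = 0`.

Local model. In normal coordinates near the base point of a radial point, divide the components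
of a covector in the edge frame by `τ`. On `τ² = g⁻¹` the Hamilton vector field, multiplied by
`x² / τ`, becomes `hatField`, which is tangent to `x = 0`; at a radial point, `x` and the fibre
covector `ζ` have opposite exponential rates. Substituting `x = μ²`, `ζ = μ ω` (`blowDown`) and
taking `μ` as the time turns the equation of the bicharacteristics that reach the boundary into
`μ Y' = -3 P Y + μ K(Y)`, where `P` projects to `ω`. This has a unique solution for each initial
value at `μ = 0`, smooth in `μ` and the initial value (`exists_singularFlow`), and the reflection
`(μ, ω) ↦ (-μ, -ω)` is a symmetry. Hence `ζ = μ ω` is an even function of `μ` along the solutions,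
that is, a smooth function `Z` of the remaining variables up to `x = 0`
(`contDiffOn_comp_sqrt_of_even`, `exists_isHatGraph`). The flowout is `{g⁻¹ = τ², ζ = Z}`: these
are `f + 1` equations. That no other bicharacteristic reaches a radial point follows from a
differential inequality for the defect `ζ - Z`, which a bicharacteristic can only satisfy near
`x = 0` if the defect is identically zero (`IsHatGraph.defect_eq_zero_of_tendsto`).

Coisotropy. Over the interior, the derivatives of the flow box in the time and in the initial
values of the `z` are `f + 1` independent vectors, symplectically orthogonal to the flowout: the
symplectic form is constant along the flow and the contribution of the initial `z` vanishes at
`x = 0` (`IsHatGraph.symplForm_nullDir`). By dimension they span the orthocomplement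
(`orthocomplement_of_null_vectors`), so that the brackets of the defining functions vanish on the
flowout; at the boundary this follows by continuity (`IsHatGraph.bracket_boundary`).

Globalization. Neither the bicharacteristics nor the topology of the edge cotangent bundle depend
on the chart (`EdgeChart.bicharacteristic_of_chart`). Countably many local flowouts cover the
radial points. On neighbourhoods swept out by bicharacteristics (`IsNormalBox.exists_swept_nhds`)
on which the local flowouts agree (`coherentSets`), the flowout is given by the local ones
(`flowout_inter`).

Local notation. `Smooth` means `C^∞`; `ℐ`, `ℰ`, `ℙ`, `ℋ` are the index set of the coordinates, the coordinate space,
the phase space and the space of `(t, u, v / τ)`; `ℍ`, `ℍ₊` are the sets `0 ≤ x`, `0 < x`; `𝓍` is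
the coordinate `x`, and `setX c u` replaces it by `c`; `𝒩` and `𝒢` are the assumptions
`IsNormalCoeff` and `IsHatGraph` for the variables of the section; `ϱ Y` is the `x`-component of
the vector dual to the covector of `Y`; `𝒯` is the type of metrics, `𝒮` of sets of edge covectors;
`ℛ` is the set of radial points, `𝓉` the coordinate change from `e` to `e'`, and `𝒥` the
projection to the `x` and `y` components; `𝒞` stands for paths over the unit interval.
-/

namespace EdgeGeometry

open Filter
open Metric (ball isOpen_ball ball_subset_ball mem_ball_self ball_mem_nhds closedBall)
open Set (Icc Ioc Ioo Ico uIcc mem_iUnion mem_preimage mem_iInter range univ)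
open Finset (sum_congr mul_sum sum_neg_distrib sum_add_distrib sum_sub_distrib sum_eq_single
  sum_mul sum_comm sum_le_sum)
open ContinuousLinearMap (fst snd)
open Real (norm_eq_abs)
local notation "Smooth" => ContDiff ℝ ∞
local notation "SmoothOn" => ContDiffOn ℝ ∞
local notation "SmoothAt" => ContDiffAt ℝ ∞

/-! ### Derivatives along lines -/

section Line

variable {E F : Type*} [NormedAddCommGroup E] [NormedSpace ℝ E] [NormedAddCommGroup F]
  [NormedSpace ℝ F] {φ : E → F} {φ' : E →L[ℝ] F} {x : E}

theorem eventually_add_smul_mem {S : Set E} {x : E} (hS : S ∈ 𝓝 x) (v : E) :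
    ∀ᶠ s : ℝ in 𝓝 0, x + s • v ∈ S := by
  have hc : Continuous fun s : ℝ => x + s • v := by fun_prop
  have h := hc.tendsto 0
  simp only [zero_smul, add_zero] at h
  exact h.eventually hS

theorem hasDerivAt_add_smul (x v : E) : HasDerivAt (fun s : ℝ => x + s • v) v 0 := by
  simpa using ((hasDerivAt_id (0 : ℝ)).smul_const v).const_add x

theorem hasDerivAt_line (h : HasFDerivAt φ φ' x) (v : E) :
    HasDerivAt (fun s : ℝ => φ (x + s • v)) (φ' v) 0 := h.hasLineDerivAt v

theorem hasDerivAt_line_of_within {S : Set E} (h : HasFDerivWithinAt φ φ' S x) {v : E}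
    (hS : ∀ᶠ s : ℝ in 𝓝 0, x + s • v ∈ S) : HasDerivAt (fun s : ℝ => φ (x + s • v)) (φ' v) 0 :=
  (h.hasLineDerivWithinAt v).hasDerivAt hS

end Line

/-! ### Superposition operators -/

section Superposition

universe u

variable {I : Type*} [TopologicalSpace I] [CompactSpace I]
  {E F : Type u} [NormedAddCommGroup E] [NormedSpace ℝ E] [NormedAddCommGroup F] [NormedSpace ℝ F]

/-- Pointwise application of a family of linear maps, as a bounded bilinear map. -/
noncomputable def pointwiseApply (I : Type*) [TopologicalSpace I] [CompactSpace I] (E F : Type u)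
    [NormedAddCommGroup E] [NormedSpace ℝ E] [NormedAddCommGroup F] [NormedSpace ℝ F] :
    C(I, E →L[ℝ] F) →L[ℝ] C(I, E) →L[ℝ] C(I, F) :=
  LinearMap.mkContinuous₂ (LinearMap.mk₂ ℝ (fun (A : C(I, E →L[ℝ] F)) (h : C(I, E)) =>
        (⟨fun s => A s (h s), by fun_prop⟩ : C(I, F)))
      (fun _ _ _ => by ext; simp) (fun _ _ _ => by ext; simp)
      (fun _ _ _ => by ext; simp) (fun _ _ _ => by ext; simp)) 1
    (fun A h => by
      rw [ContinuousMap.norm_le _ (by positivity)]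
      intro s
      simp only [LinearMap.mk₂_apply, ContinuousMap.coe_mk, one_mul]
      exact ((A s).le_opNorm _).trans (mul_le_mul (ContinuousMap.norm_coe_le_norm A s)
        (ContinuousMap.norm_coe_le_norm h s) (norm_nonneg _) (norm_nonneg A)))

theorem hasFDerivAt_postcomp {K : E → F} {K' : E → E →L[ℝ] F} (hK : Continuous K)
    (hK' : Continuous K') (h : ∀ x, HasFDerivAt K (K' x) x) (y : C(I, E)) :
    HasFDerivAt (fun y : C(I, E) => (⟨K, hK⟩ : C(E, F)).comp y)
      (pointwiseApply I E F ((⟨K', hK'⟩ : C(E, E →L[ℝ] F)).comp y)) y := by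
  rw [hasFDerivAt_iff_isLittleO_nhds_zero, Asymptotics.isLittleO_iff]
  intro ε hε
  have hc : ContinuousAt (fun z : C(I, E) => (⟨K', hK'⟩ : C(E, E →L[ℝ] F)).comp z) y :=
    (ContinuousMap.continuous_postcomp _).continuousAt
  obtain ⟨δ, hδ, hball⟩ := (Metric.continuousAt_iff (α := C(I, E)) (β := C(I, E →L[ℝ] F))).1 hc ε hε
  filter_upwards [ball_mem_nhds (0 : C(I, E)) hδ] with k hk
  rw [ContinuousMap.norm_le _ (by positivity)]
  intro s
  have key : ∀ x ∈ segment ℝ (y s) (y s + k s), ‖K' x - K' (y s)‖ ≤ ε := fun x hx => by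
    rw [segment_eq_image'] at hx
    obtain ⟨θ, hθ, rfl⟩ := hx
    have h1 : dist (y + θ • k) y < δ := by
      rw [dist_eq_norm, add_sub_cancel_left, norm_smul, Real.norm_of_nonneg hθ.1]
      rw [mem_ball_zero_iff] at hk
      exact (mul_le_of_le_one_left (norm_nonneg _) hθ.2).trans_lt hk
    have h2 := hball h1
    have h3 : dist (K' ((y + θ • k) s)) (K' (y s)) < ε :=
      (ContinuousMap.dist_apply_le_dist s).trans_lt h2
    rw [dist_eq_norm] at h3
    simpa using h3.le
  have := (convex_segment (𝕜 := ℝ) (y s) (y s + k s)).norm_image_sub_le_of_norm_hasFDerivWithin_le'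
    (fun x _ => (h x).hasFDerivWithinAt) key (left_mem_segment _ _ _) (right_mem_segment _ _ _)
  simp only [add_sub_cancel_left] at this
  exact this.trans (mul_le_mul_of_nonneg_left (k.norm_coe_le_norm s) hε.le)

/-- The superposition operator `y ↦ K ∘ y` on continuous maps of a compact space is as smooth as
`K`: its derivative is again made from a superposition operator, that of the derivative of `K`. -/
theorem contDiff_postcomp {K : E → F} (hK : Smooth K) :
    Smooth (fun y : C(I, E) => (⟨K, hK.continuous⟩ : C(E, F)).comp y) := by
  rw [contDiff_infty]
  intro n
  induction n generalizing F with
  | zero =>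
    rw [Nat.cast_zero, contDiff_zero]
    exact ContinuousMap.continuous_postcomp _
  | succ n ih =>
    have hd : Smooth (fderiv ℝ K) := hK.fderiv_right (by simp)
    push_cast
    rw [contDiff_succ_iff_hasFDerivAt]
    refine ⟨fun y => pointwiseApply I E F ((⟨fderiv ℝ K, hd.continuous⟩ : C(E, E →L[ℝ] F)).comp y),
      ?_, fun y => ?_⟩
    · have hp : ContDiff ℝ n (pointwiseApply I E F) :=
        ContinuousLinearMap.contDiff (E := C(I, E →L[ℝ] F)) (F := C(I, E) →L[ℝ] C(I, F)) _
      exact hp.comp (ih hd)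
    · exact hasFDerivAt_postcomp _ _ (fun x => (hK.differentiable (by simp) x).hasFDerivAt) y

end Superposition

/-! ### Calculus up to the boundary of a half space -/

section HalfSpace

universe u

variable {E F : Type u} [NormedAddCommGroup E] [NormedSpace ℝ E]
  [NormedAddCommGroup F] [NormedSpace ℝ F]

/-- A function that is `C¹` up to the boundary of a convex set is strictly differentiable there. -/
theorem exists_ball_norm_sub_sub_le {f : E → F} {f' : E → E →L[ℝ] F} {s : Set E} {x : E}
    (hs : Convex ℝ s) (hf : ∀ y ∈ s, HasFDerivWithinAt f (f' y) s y)
    (hc : ContinuousWithinAt f' s x) {ε : ℝ} (hε : 0 < ε) :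
    ∃ δ > 0, ∀ y ∈ ball x δ ∩ s, ∀ z ∈ ball x δ ∩ s, ‖f z - f y - f' x (z - y)‖ ≤ ε * ‖z - y‖ := by
  obtain ⟨δ, hδ, h⟩ := Metric.mem_nhdsWithin_iff.1 (hc (Metric.closedBall_mem_nhds _ hε))
  refine ⟨δ, hδ, fun y hy z hz => ?_⟩
  refine ((convex_ball x δ).inter hs).norm_image_sub_le_of_norm_hasFDerivWithin_le'
    (f' := f') (fun w hw => (hf w hw.2).mono Set.inter_subset_right) (fun w hw => ?_) hy hz
  simpa [dist_eq_norm] using h hw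

/-- The point with the same `ker ℓ` component (along `e`) as `Y`, and with `ℓ`-coordinate `c`. -/
def setCoord (ℓ : E →L[ℝ] ℝ) (e : E) (c : ℝ) (Y : E) : E := Y + (c - ℓ Y) • e

theorem apply_setCoord {ℓ : E →L[ℝ] ℝ} {e : E} (he : ℓ e = 1) (c : ℝ) (Y : E) :
    ℓ (setCoord ℓ e c Y) = c := by
  simp [setCoord, he]

theorem setCoord_self (ℓ : E →L[ℝ] ℝ) (e : E) (Y : E) : setCoord ℓ e (ℓ Y) Y = Y := by
  simp [setCoord]

/-- Hadamard's lemma: a smooth function vanishing on the hyperplane `ℓ = 0` is divisible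
by `ℓ`. -/
theorem exists_eq_smul_of_eq_zero [CompleteSpace F] {ℓ : E →L[ℝ] ℝ} {e : E} (he : ℓ e = 1)
    {f : E → F} (hf : Smooth f) (h0 : ∀ Y, ℓ Y = 0 → f Y = 0) :
    ∃ a : E → F, Smooth a ∧ ∀ Y, f Y = ℓ Y • a Y := by
  have hd : Smooth (fun Y => fderiv ℝ f Y e) :=
    (hf.fderiv_right (by simp)).clm_apply contDiff_const
  -- the average of the `e`-derivative over the segment from the hyperplane to `Y`
  let line : E →L[ℝ] C(unitInterval, E) := LinearMap.mkContinuous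
    { toFun := fun Y => ⟨fun θ => Y + ((θ : ℝ) - 1) • ℓ Y • e, by fun_prop⟩
      map_add' := fun Y Z => by ext θ; simp [add_smul, smul_add]; abel
      map_smul' := fun c Y => by
        ext θ; simp only [map_smul, smul_eq_mul, RingHom.id_apply, ContinuousMap.coe_mk,
          ContinuousMap.coe_smul, Pi.smul_apply, smul_add, smul_smul]; congr 2; ring }
    (1 + ‖ℓ‖ * ‖e‖) (fun Y => by
      rw [ContinuousMap.norm_le _ (by positivity)]
      intro θ
      simp only [LinearMap.coe_mk, AddHom.coe_mk, ContinuousMap.coe_mk]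
      refine (norm_add_le _ _).trans ?_
      rw [norm_smul, norm_smul]
      have h1 : ‖(θ : ℝ) - 1‖ ≤ 1 := by
        rw [norm_eq_abs, abs_le]; constructor <;> linarith [θ.2.1, θ.2.2]
      have h2 := ℓ.le_opNorm Y
      calc ‖Y‖ + ‖(θ : ℝ) - 1‖ * (‖ℓ Y‖ * ‖e‖) ≤ ‖Y‖ + 1 * ((‖ℓ‖ * ‖Y‖) * ‖e‖) := by gcongr
        _ = _ := by ring)
  let avg : C(unitInterval, F) →L[ℝ] F := LinearMap.mkContinuous
    { toFun := fun h => ∫ θ, h θ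
      map_add' := fun g h => MeasureTheory.integral_add
        (g.continuous.integrable_of_hasCompactSupport (HasCompactSupport.of_compactSpace _))
        (h.continuous.integrable_of_hasCompactSupport (HasCompactSupport.of_compactSpace _))
      map_smul' := fun c h => MeasureTheory.integral_smul c _ } 1 (fun h => by
      have := MeasureTheory.norm_integral_le_of_norm_le_const
        (μ := (MeasureTheory.volume : MeasureTheory.Measure unitInterval))
        (Eventually.of_forall fun θ => h.norm_coe_le_norm θ)
      simpa using this)
  refine ⟨fun Y => avg ((⟨_, hd.continuous⟩ : C(E, F)).comp (line Y)),
    avg.contDiff.comp ((contDiff_postcomp hd).comp line.contDiff), fun Y => ?_⟩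
  have hint : avg ((⟨_, hd.continuous⟩ : C(E, F)).comp (line Y)) =
      ∫ θ in 0..1, fderiv ℝ f (Y + (θ - 1) • ℓ Y • e) e := by
    change (∫ θ : unitInterval, fderiv ℝ f (Y + ((θ : ℝ) - 1) • ℓ Y • e) e) = _
    rw [unitInterval.volume_def, MeasureTheory.integral_subtype_comap measurableSet_Icc
      (fun θ => fderiv ℝ f (Y + (θ - 1) • ℓ Y • e) e),
      intervalIntegral.integral_of_le zero_le_one, MeasureTheory.integral_Icc_eq_integral_Ioc]
  have hcont : Continuous fun θ : ℝ => fderiv ℝ f (Y + (θ - 1) • ℓ Y • e) e :=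
    hd.continuous.comp (by fun_prop)
  have hder : ∀ θ : ℝ, HasDerivAt (fun θ : ℝ => f (Y + (θ - 1) • ℓ Y • e))
      (ℓ Y • fderiv ℝ f (Y + (θ - 1) • ℓ Y • e) e) θ := fun θ => by
    have h1 : HasDerivAt (fun θ : ℝ => Y + (θ - 1) • ℓ Y • e) (ℓ Y • e) θ := by
      simpa using (((hasDerivAt_id θ).sub_const 1).smul_const (ℓ Y • e)).const_add Y
    have h2 := ((hf.differentiable (by simp) _).hasFDerivAt.comp_hasDerivAt θ h1)
    rw [map_smul] at h2
    exact h2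
  have := intervalIntegral.integral_eq_sub_of_hasDerivAt (a := 0) (b := 1) (fun θ _ => hder θ)
    ((hcont.const_smul (ℓ Y)).intervalIntegrable _ _)
  rw [intervalIntegral.integral_smul, ← hint] at this
  rw [this, h0 (Y + ((0 : ℝ) - 1) • ℓ Y • e) (by simp [he])]
  simp

/-- A smooth function that is even in the coordinate `ℓ` is a smooth function of `ℓ²`, up to
`ℓ² = 0`. -/
theorem contDiffOn_comp_sqrt_of_even [CompleteSpace F] {ℓ : E →L[ℝ] ℝ} {e : E} (he : ℓ e = 1)
    {f : E → F} (hf : Smooth f) (heven : ∀ Y, f (setCoord ℓ e (-ℓ Y) Y) = f Y) :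
    SmoothOn (fun Y => f (setCoord ℓ e (√(ℓ Y)) Y)) {Y | 0 ≤ ℓ Y} := by
  have hopen : IsOpen {Y | 0 < ℓ Y} := isOpen_lt continuous_const ℓ.continuous
  have hconv : Convex ℝ {Y | 0 < ℓ Y} := by
    exact (convex_Ioi (0 : ℝ)).is_linear_preimage ℓ.toLinearMap.isLinear
  have hcl : closure {Y | 0 < ℓ Y} = {Y | 0 ≤ ℓ Y} := by
    refine (closure_minimal (fun Y hY => le_of_lt hY)
      (isClosed_le continuous_const ℓ.continuous)).antisymm fun Y hY => ?_
    have ht : Tendsto (fun c : ℝ => Y + c • e) (𝓝[>] 0) (𝓝 Y) := by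
      have : Continuous fun c : ℝ => Y + c • e := by fun_prop
      simpa using this.continuousWithinAt (s := Set.Ioi 0) (x := 0) |>.tendsto
    refine mem_closure_of_tendsto ht ?_
    filter_upwards [self_mem_nhdsWithin] with c hc
    have h1 : (0 : ℝ) < c := hc
    have h2 : 0 ≤ ℓ Y := hY
    change 0 < ℓ (Y + c • e)
    rw [map_add, map_smul, he, smul_eq_mul, mul_one]
    linarith
  have huniq : UniqueDiffOn ℝ {Y | 0 ≤ ℓ Y} := by
    rw [← hcl]
    refine uniqueDiffOn_convex hconv.closure ⟨e, interior_mono subset_closure ?_⟩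
    rw [hopen.interior_eq]
    change 0 < ℓ e
    rw [he]; exact one_pos
  have hcontR : Continuous fun Y => setCoord ℓ e (√(ℓ Y)) Y := by unfold setCoord; fun_prop
  rw [contDiffOn_infty]
  intro n
  induction n generalizing F with
  | zero =>
    rw [Nat.cast_zero, contDiffOn_zero]
    exact (hf.continuous.comp hcontR).continuousOn
  | succ n ih =>
    have hfd : ∀ Y, HasFDerivAt f (fderiv ℝ f Y) Y :=
      fun Y => (hf.differentiable (by simp) Y).hasFDerivAt
    have hd : Smooth (fderiv ℝ f) := hf.fderiv_right (by simp)
    let σ : E →L[ℝ] E := ContinuousLinearMap.id ℝ E - (2 : ℝ) • ℓ.smulRight e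
    have hσ : ∀ Y, setCoord ℓ e (-ℓ Y) Y = σ Y := fun Y => by
      change Y + (-ℓ Y - ℓ Y) • e = Y - (2 : ℝ) • ℓ Y • e
      module
    have hdσ : ∀ Y δ, fderiv ℝ f (σ Y) (σ δ) = fderiv ℝ f Y δ := fun Y δ => by
      have h1 : HasFDerivAt (fun Y => f (σ Y)) ((fderiv ℝ f (σ Y)).comp σ) Y :=
        (hfd (σ Y)).comp Y σ.hasFDerivAt
      have h2 : (fun Y => f (σ Y)) = f := by ext Y; rw [← hσ, heven]
      rw [h2] at h1
      exact congrArg (· δ) h1.fderiv.symm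
    have hσe : σ e = -e := by
      change e - (2 : ℝ) • ℓ e • e = -e
      rw [he]; module
    -- the normal derivative is odd, hence divisible by `ℓ`
    obtain ⟨a, ha, hae⟩ := exists_eq_smul_of_eq_zero he (f := fun Y => (1 / 2 : ℝ) • fderiv ℝ f Y e)
      ((hd.clm_apply contDiff_const).const_smul _) (fun Y hY => by
        have h1 := hdσ Y e
        have h2 : σ Y = Y := by rw [← hσ, hY, neg_zero, ← hY, setCoord_self]
        rw [h2, hσe, map_neg] at h1
        have : fderiv ℝ f Y e = 0 := by
          have h3 : (2 : ℝ) • fderiv ℝ f Y e = 0 := by rw [two_smul]; nth_rewrite 1 [← h1]; simp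
          simpa using h3
        simp [this])
    have haσ : ∀ Y, a (σ Y) = a Y := by
      have hne : ∀ Y, ℓ Y ≠ 0 → a (σ Y) = a Y := fun Y hY => by
        have h2 := hae Y
        have h3 := hdσ Y e
        rw [hσe, map_neg] at h3
        have h4 : ℓ (σ Y) = -ℓ Y := by rw [← hσ, apply_setCoord he]
        have h5 : fderiv ℝ f (σ Y) e = - fderiv ℝ f Y e := by rw [← h3, neg_neg]
        have h6 := hae (σ Y)
        simp only [h4, h5, smul_neg, neg_smul, neg_inj] at h6
        exact smul_right_injective _ hY (h6.symm.trans h2)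
      intro Y
      by_cases hY : ℓ Y = 0
      · rw [← hσ, hY, neg_zero, ← hY, setCoord_self]
      · exact hne Y hY
    -- the derivative of the composite, as a composite of the same kind
    let f₁ : E → E →L[ℝ] F := fun Y =>
      ℓ.smulRight (a Y) + (fderiv ℝ f Y).comp (ContinuousLinearMap.id ℝ E - ℓ.smulRight e)
    have hf₁ : Smooth f₁ := by
      refine ContDiff.add ?_ (hd.clm_comp contDiff_const)
      exact (ContinuousLinearMap.smulRightL ℝ E F ℓ).contDiff.comp ha
    have hf₁even : ∀ Y, f₁ (setCoord ℓ e (-ℓ Y) Y) = f₁ Y := fun Y => by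
      rw [hσ]
      ext δ
      have h1 := hdσ Y (δ - ℓ δ • e)
      have h2 : σ (δ - ℓ δ • e) = δ - ℓ δ • e := by
        rw [map_sub, map_smul, hσe]
        change δ - (2 : ℝ) • ℓ δ • e - ℓ δ • -e = _
        module
      rw [h2] at h1
      change ℓ δ • a (σ Y) + fderiv ℝ f (σ Y) (δ - ℓ δ • e) = ℓ δ • a Y + fderiv ℝ f Y (δ - ℓ δ • e)
      rw [haσ, h1]
    have hcont₁ : Continuous fun Y => f₁ (setCoord ℓ e (√(ℓ Y)) Y) := hf₁.continuous.comp hcontR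
    have hint : ∀ Y, 0 < ℓ Y → HasFDerivAt (fun Y => f (setCoord ℓ e (√(ℓ Y)) Y))
        (f₁ (setCoord ℓ e (√(ℓ Y)) Y)) Y := fun Y hY => by
      have hs : HasFDerivAt (fun Y => √(ℓ Y)) ((1 / (2 * √(ℓ Y))) • ℓ) Y :=
        ℓ.hasFDerivAt.sqrt hY.ne'
      have hR : HasFDerivAt (fun Y => setCoord ℓ e (√(ℓ Y)) Y)
          (ContinuousLinearMap.id ℝ E + ((1 / (2 * √(ℓ Y))) • ℓ - ℓ).smulRight e) Y :=
        (hasFDerivAt_id Y).add ((hs.sub ℓ.hasFDerivAt).smul_const e)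
      have := HasFDerivAt.comp (g := f) (f := fun Y => setCoord ℓ e (√(ℓ Y)) Y) Y
        (hfd (setCoord ℓ e (√(ℓ Y)) Y)) hR
      refine this.congr_fderiv (Eq.symm ?_)
      ext δ
      have h1 := hae (setCoord ℓ e (√(ℓ Y)) Y)
      rw [apply_setCoord he] at h1
      have hpos : 0 < √(ℓ Y) := Real.sqrt_pos.2 hY
      have h2 : a (setCoord ℓ e (√(ℓ Y)) Y) =
          (1 / (2 * √(ℓ Y))) • fderiv ℝ f (setCoord ℓ e (√(ℓ Y)) Y) e := by
        refine smul_right_injective F hpos.ne' ?_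
        simp only
        rw [← h1, smul_smul]
        congr 1; field_simp
      change ℓ δ • a _ + fderiv ℝ f _ (δ - ℓ δ • e) =
        fderiv ℝ f _ (δ + (1 / (2 * √(ℓ Y)) * ℓ δ - ℓ δ) • e)
      rw [h2, map_sub, map_add, map_smul, map_smul]
      module
    push_cast
    rw [contDiffOn_succ_iff_hasFDerivWithinAt_of_uniqueDiffOn huniq]
    refine ⟨by simp, fun Y => f₁ (setCoord ℓ e (√(ℓ Y)) Y), ih hf₁ hf₁even, fun Y _ => ?_⟩
    rw [← hcl]
    refine hasFDerivWithinAt_closure_of_tendsto_fderiv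
      (fun Z hZ => (hint Z hZ).differentiableAt.differentiableWithinAt) hconv hopen
      (fun Z _ => (hf.continuous.comp hcontR).continuousWithinAt) ?_
    refine (hcont₁.continuousWithinAt (s := {Y | 0 < ℓ Y}) (x := Y)).tendsto.congr' ?_
    filter_upwards [self_mem_nhdsWithin] with Z hZ
    exact (hint Z hZ).fderiv.symm

end HalfSpace

/-! ### A singular ordinary differential equation -/

section SingularFlow

universe u

variable {V : Type u} [NormedAddCommGroup V] [NormedSpace ℝ V]

set_option hygiene false in
local notation "𝒞" => C(unitInterval, V)

/-- The weight `(1 - P) + θ³ P`, for a linear map `P`. -/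
def cubicWeight (P : V →L[ℝ] V) (θ : ℝ) (v : V) : V := v - P v + θ ^ 3 • P v

theorem continuous_cubicWeight (P : V →L[ℝ] V) :
    Continuous fun x : ℝ × V => cubicWeight P x.1 x.2 := by
  unfold cubicWeight; fun_prop

theorem norm_cubicWeight_le (P : V →L[ℝ] V) (θ : unitInterval) (v : V) :
    ‖cubicWeight P θ v‖ ≤ (1 + 2 * ‖P‖) * ‖v‖ := by
  have h1 := P.le_opNorm v
  have h2 : ‖(θ : ℝ) ^ 3 • P v‖ ≤ ‖P v‖ := by
    rw [norm_smul, norm_pow, Real.norm_of_nonneg θ.2.1]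
    exact mul_le_of_le_one_left (norm_nonneg _) (pow_le_one₀ θ.2.1 θ.2.2)
  calc ‖cubicWeight P θ v‖ ≤ ‖v - P v‖ + ‖(θ : ℝ) ^ 3 • P v‖ := norm_add_le _ _
    _ ≤ ‖v‖ + ‖P v‖ + ‖P v‖ := add_le_add (norm_sub_le _ _) h2
    _ ≤ _ := by linarith

theorem integrable_unitInterval {V : Type*} [NormedAddCommGroup V] {h : unitInterval → V}
    (hh : Continuous h) :
    MeasureTheory.Integrable h :=
  hh.integrable_of_hasCompactSupport (HasCompactSupport.of_compactSpace _)

theorem continuous_cubicAverage (P : V →L[ℝ] V) (h : 𝒞) :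
    Continuous fun s : unitInterval =>
      (s : ℝ) • ∫ θ : unitInterval, cubicWeight P θ (h (s * θ)) := by
  refine continuous_subtype_val.smul ?_
  have := continuous_parametric_integral_of_continuous
    (μ := (MeasureTheory.volume : MeasureTheory.Measure unitInterval))
    (f := fun s θ : unitInterval => cubicWeight P θ (h (s * θ)))
    ((continuous_cubicWeight P).comp (f := fun x : unitInterval × unitInterval =>
      ((x.2 : ℝ), h (x.1 * x.2))) (by fun_prop)) isCompact_univ
  simpa using this

/-- The operator inverting the linear part of the singular equation:
`h ↦ (s ↦ s ∫₀¹ ((1 - P) + θ³ P) h (s θ) dθ)`. -/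
noncomputable def cubicAverage (P : V →L[ℝ] V) : 𝒞 →L[ℝ] 𝒞 := LinearMap.mkContinuous
    { toFun := fun h => ⟨_, continuous_cubicAverage P h⟩
      map_add' := fun g h => by
        ext s
        have hi : ∀ h : 𝒞, MeasureTheory.Integrable
            fun θ : unitInterval => cubicWeight P θ (h (s * θ)) := fun h =>
          integrable_unitInterval ((continuous_cubicWeight P).comp
            (f := fun θ : unitInterval => ((θ : ℝ), h (s * θ))) (by fun_prop))
        simp only [ContinuousMap.coe_mk, ContinuousMap.add_apply]
        rw [← smul_add, ← MeasureTheory.integral_add (hi g) (hi h)]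
        congr 2; funext θ; simp only [cubicWeight, ContinuousMap.add_apply, map_add, smul_add]; abel
      map_smul' := fun c h => by
        ext s
        simp only [ContinuousMap.coe_mk, ContinuousMap.smul_apply, RingHom.id_apply]
        rw [smul_comm c, ← MeasureTheory.integral_smul c]
        congr 2; funext θ; simp only [cubicWeight, ContinuousMap.smul_apply, map_smul]; module }
    (1 + 2 * ‖P‖) (fun h => by
      rw [ContinuousMap.norm_le _ (by positivity)]
      intro s
      have h1 := MeasureTheory.norm_integral_le_of_norm_le_const
        (μ := (MeasureTheory.volume : MeasureTheory.Measure unitInterval))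
        (f := fun θ : unitInterval => cubicWeight P θ (h (s * θ)))
        (C := (1 + 2 * ‖P‖) * ‖h‖) (Eventually.of_forall fun θ =>
          (norm_cubicWeight_le P θ _).trans (by gcongr; exact h.norm_coe_le_norm _))
      simp only [LinearMap.coe_mk, AddHom.coe_mk, ContinuousMap.coe_mk, norm_smul]
      rw [Real.norm_of_nonneg s.2.1]
      refine (mul_le_of_le_one_left (norm_nonneg _) s.2.2).trans (by simpa using h1))

/-- Constant functions, as a linear map. -/
noncomputable def constMap : V →L[ℝ] 𝒞 := LinearMap.mkContinuous
    { toFun := fun v => ContinuousMap.const _ v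
      map_add' := fun _ _ => rfl
      map_smul' := fun _ _ => rfl } 1
    (fun v => by rw [ContinuousMap.norm_le _ (by positivity)]; intro s; exact (one_mul ‖v‖).ge)

/-- The singular initial value problem `μ Y' = - 3 P Y + μ K(Y)`, `Y(0) = p`, in integrated form:
it has a solution `Y(m) = Φ (m, p)` that is smooth in `(m, p)` across the singular value `m = 0`.
The solution is found on rescaled intervals: `s ↦ Y(m s)` is a fixed point, in the space of
continuous functions on `[0, 1]`, of an equation that depends smoothly on `(m, p)` and is
trivial for `m = 0`. Uniqueness makes it inherit the symmetries of the equation. -/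
theorem exists_singularFlow [CompleteSpace V] {K : V → V} (hK : Smooth K) (P : V →L[ℝ] V) (p₀ : V) :
    ∃ (Φ : ℝ × V → V) (ε : ℝ), 0 < ε ∧ SmoothOn Φ (ball (0, p₀) ε) ∧
      (∀ x ∈ ball (0, p₀) ε, Φ x = x.2 + x.1 • ∫ θ : unitInterval,
        cubicWeight P θ (K (Φ ((θ : ℝ) * x.1, x.2)))) ∧
      ∀ ρ : V →L[ℝ] V, (∀ v, ‖ρ v‖ = ‖v‖) → ρ p₀ = p₀ → (∀ v, ρ (P v) = P (ρ v)) →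
        (∀ v, K (ρ v) = -ρ (K v)) → ∀ x ∈ ball (0, p₀) ε, Φ (-x.1, ρ x.2) = ρ (Φ x) := by
  let N : 𝒞 → 𝒞 := fun y => (⟨K, hK.continuous⟩ : C(V, V)).comp y
  have hN : Smooth N := contDiff_postcomp hK
  let Ψ : (ℝ × V) × 𝒞 → (ℝ × V) × 𝒞 := fun x =>
    (x.1, x.2 - constMap x.1.2 - x.1.1 • cubicAverage P (N x.2))
  have hLN : Smooth fun y => cubicAverage P (N y) := (cubicAverage P).contDiff.comp hN
  have hΨ : Smooth Ψ := by
    have hc : Smooth (constMap : V →L[ℝ] 𝒞) := ContinuousLinearMap.contDiff (F := 𝒞) _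
    exact contDiff_fst.prodMk ((contDiff_snd.sub (hc.comp (contDiff_snd.comp contDiff_fst))).sub
        ((contDiff_fst.comp contDiff_fst).smul (hLN.comp contDiff_snd)))
  set Y₀ : 𝒞 := constMap p₀ with hY₀
  set x₀ : (ℝ × V) × 𝒞 := ((0, p₀), Y₀) with hx₀
  have hΨ₀ : Ψ x₀ = ((0, p₀), 0) := by simp [Ψ, hx₀, hY₀]
  -- for `m = 0` the derivative of `Ψ` is unipotent
  let J : (ℝ × V) →L[ℝ] 𝒞 := constMap.comp (snd ℝ ℝ V) +
      (fst ℝ ℝ V).smulRight (cubicAverage P (N Y₀))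
  let D : ((ℝ × V) × 𝒞) ≃L[ℝ] ((ℝ × V) × 𝒞) :=
    ContinuousLinearEquiv.equivOfInverse ((fst ℝ _ _).prod (snd ℝ _ _ - J.comp (fst ℝ _ _)))
      ((fst ℝ _ _).prod (snd ℝ _ _ + J.comp (fst ℝ _ _)))
      (fun x => by ext <;> simp) (fun x => by ext <;> simp)
  have hD : HasFDerivAt Ψ (D : _ →L[ℝ] _) x₀ := by
    have h1 : HasFDerivAt (fun x : (ℝ × V) × 𝒞 => cubicAverage P (N x.2))
        ((fderiv ℝ (fun y => cubicAverage P (N y)) Y₀).comp (snd ℝ _ _)) x₀ :=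
      HasFDerivAt.comp (g := fun y => cubicAverage P (N y)) x₀
        (hLN.differentiable (by simp) Y₀).hasFDerivAt hasFDerivAt_snd
    have h2 : HasFDerivAt (fun x : (ℝ × V) × 𝒞 => x.1.1) ((fst ℝ ℝ V).comp (fst ℝ _ _)) x₀ :=
      HasFDerivAt.comp x₀ hasFDerivAt_fst hasFDerivAt_fst
    have h3 : HasFDerivAt (fun x : (ℝ × V) × 𝒞 => constMap x.1.2)
        (constMap.comp ((snd ℝ ℝ V).comp (fst ℝ _ _))) x₀ :=
      HasFDerivAt.comp x₀ (ContinuousLinearMap.hasFDerivAt (F := 𝒞) constMap)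
        (HasFDerivAt.comp x₀ hasFDerivAt_snd hasFDerivAt_fst)
    refine (hasFDerivAt_fst.prodMk ((hasFDerivAt_snd.sub h3).sub (h2.smul h1))).congr_fderiv ?_
    refine ContinuousLinearMap.ext fun δ => Prod.ext rfl ?_
    simp [D, J, hx₀, sub_sub]
  let T := hΨ.contDiffAt.toOpenPartialHomeomorph Ψ hD (by simp)
  have hTc : ∀ x, T x = Ψ x := fun _ => rfl
  have hx₀T : x₀ ∈ T.source := ContDiffAt.mem_toOpenPartialHomeomorph_source _ hD (by simp)
  let S : Set ((ℝ × V) × 𝒞) := T.source ∩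
    (fderiv ℝ Ψ) ⁻¹' range ContinuousLinearEquiv.toContinuousLinearMap
  have hS : IsOpen S := T.open_source.inter
    (ContinuousLinearEquiv.isOpen.preimage (hΨ.continuous_fderiv (by simp)))
  have hx₀S : x₀ ∈ S := ⟨hx₀T, D, hD.fderiv.symm⟩
  obtain ⟨ε₁, hε₁, hball₁⟩ := Metric.isOpen_iff.1 hS x₀ hx₀S
  have hsymm₀ : T.symm ((0, p₀), 0) = x₀ := by rw [← hΨ₀, ← hTc, T.left_inv hx₀T]
  have htar₀ : ((0, p₀), (0 : 𝒞)) ∈ T.target := by rw [← hΨ₀, ← hTc]; exact T.map_source hx₀T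
  have hev : ∀ᶠ x : ℝ × V in 𝓝 (0, p₀), (x, (0 : 𝒞)) ∈ T.target ∧ T.symm (x, 0) ∈ ball x₀ ε₁ := by
    have hc : ContinuousAt (fun x : ℝ × V => (x, (0 : 𝒞))) (0, p₀) := by fun_prop
    refine (hc.eventually (T.open_target.mem_nhds htar₀)).and ?_
    refine (ContinuousAt.comp (g := T.symm)
      (f := fun x : ℝ × V => (x, (0 : 𝒞))) (x := (0, p₀))
        (T.continuousAt_symm htar₀) hc).eventually ?_
    change ball x₀ ε₁ ∈ 𝓝 (T.symm ((0, p₀), 0))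
    rw [hsymm₀]
    exact ball_mem_nhds _ hε₁
  obtain ⟨ε₂, hε₂, hball₂⟩ := Metric.eventually_nhds_iff_ball.1 hev
  set ε := min ε₁ ε₂ with hεdef
  have hε : 0 < ε := lt_min hε₁ hε₂
  let Y : ℝ × V → 𝒞 := fun x => (T.symm (x, 0)).2
  have hfst : ∀ x ∈ ball (0, p₀) ε, T.symm (x, 0) = (x, Y x) := fun x hx => by
    have h1 := T.right_inv (hball₂ x (ball_subset_ball (min_le_right _ _) hx)).1
    rw [hTc] at h1
    have h2 : (T.symm (x, 0)).1 = x := congrArg Prod.fst h1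
    exact Prod.ext h2 rfl
  have hYeq : ∀ x ∈ ball (0, p₀) ε, Y x = constMap x.2 + x.1 • cubicAverage P (N (Y x)) := by
    intro x hx
    have h1 := T.right_inv (hball₂ x (ball_subset_ball (min_le_right _ _) hx)).1
    rw [hTc, hfst x hx] at h1
    have h2 : Y x - constMap x.2 - x.1 • cubicAverage P (N (Y x)) = 0 := congrArg Prod.snd h1
    rw [sub_sub] at h2
    exact sub_eq_zero.1 h2
  have hYball : ∀ x ∈ ball (0, p₀) ε, Y x ∈ ball Y₀ ε₁ := fun x hx => by
    have h1 := (hball₂ x (ball_subset_ball (min_le_right _ _) hx)).2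
    rw [hfst x hx, Metric.mem_ball, Prod.dist_eq] at h1
    exact (le_max_right _ _).trans_lt h1
  have huniq : ∀ x ∈ ball (0, p₀) ε, ∀ Z ∈ ball Y₀ ε₁,
      Z = constMap x.2 + x.1 • cubicAverage P (N Z) → Z = Y x := fun x hx Z hZ hZe => by
    have h1 : (x, Z) ∈ T.source := by
      refine (hball₁ ?_).1
      rw [Metric.mem_ball, Prod.dist_eq, max_lt_iff]
      exact ⟨lt_of_lt_of_le hx (min_le_left _ _), hZ⟩
    have h2 : T (x, Z) = (x, 0) := by
      rw [hTc]
      refine Prod.ext rfl ?_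
      change Z - constMap x.2 - x.1 • cubicAverage P (N Z) = 0
      rw [sub_sub]; exact sub_eq_zero.2 hZe
    have h3 := T.left_inv h1
    rw [h2, hfst x hx] at h3
    exact (congrArg Prod.snd h3).symm
  have hYpt : ∀ x ∈ ball (0, p₀) ε, ∀ s : unitInterval,
      Y x s = x.2 + x.1 • (s : ℝ) • ∫ θ : unitInterval, cubicWeight P θ (K (Y x (s * θ))) := by
    intro x hx s
    exact congrArg (fun y : 𝒞 => y s) (hYeq x hx)
  have hYnear : ∀ x ∈ ball (0, p₀) ε, ∀ s, ‖Y x s - p₀‖ ≤ ‖Y x - Y₀‖ :=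
    fun x _ s => (Y x - Y₀).norm_coe_le_norm s
  have hmem : ∀ x ∈ ball (0, p₀) ε, ∀ Z : 𝒞,
      (∀ s, ∃ s', ‖Z s - p₀‖ ≤ ‖Y x s' - p₀‖) → Z ∈ ball Y₀ ε₁ := fun x hx Z hZ => by
    have h1 := hYball x hx
    rw [mem_ball_iff_norm] at h1 ⊢
    refine lt_of_le_of_lt ((ContinuousMap.norm_le _ (norm_nonneg _)).2 fun s => ?_) h1
    obtain ⟨s', hs'⟩ := hZ s
    exact hs'.trans (hYnear x hx s')
  -- the solution on a shorter interval is the rescaled solution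
  have hscale : ∀ x ∈ ball (0, p₀) ε, ∀ s : unitInterval,
      Y x s = Y ((s : ℝ) * x.1, x.2) 1 := fun x hx s => by
    have hx' : ((s : ℝ) * x.1, x.2) ∈ ball (0, p₀) ε := by
      rw [Metric.mem_ball, Prod.dist_eq, max_lt_iff] at hx ⊢
      refine ⟨lt_of_le_of_lt ?_ hx.1, hx.2⟩
      rw [dist_zero_right, dist_zero_right, norm_mul, Real.norm_of_nonneg s.2.1]
      exact mul_le_of_le_one_left (norm_nonneg _) s.2.2
    let Z : 𝒞 := ⟨fun r => Y x (s * r), by fun_prop⟩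
    have hZ : Z = Y ((s : ℝ) * x.1, x.2) := by
      refine huniq _ hx' Z (hmem x hx Z fun r => ⟨s * r, le_rfl⟩) ?_
      ext r
      change Y x (s * r) = x.2 + ((s : ℝ) * x.1) • (r : ℝ) •
        ∫ θ : unitInterval, cubicWeight P θ (K (Y x (s * (r * θ))))
      rw [hYpt x hx]
      simp only [mul_assoc, smul_smul, Icc.coe_mul]
      congr 2; ring
    rw [← hZ]
    simp [Z]
  refine ⟨fun x => Y x 1, ε, hε, fun x hx => ?_, fun x hx => ?_, ?_⟩
  · have h1 := hball₂ x (ball_subset_ball (min_le_right _ _) hx)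
    obtain ⟨e, he⟩ := (hball₁ h1.2).2
    have h2 : SmoothAt T.symm (x, 0) := by
      refine T.contDiffAt_symm (f₀' := e) h1.1 ?_ hΨ.contDiffAt
      rw [he]
      exact (hΨ.differentiable (by simp) _).hasFDerivAt
    have h3 : SmoothAt (fun x : ℝ × V => T.symm (x, 0)) x :=
      ContDiffAt.comp x (g := T.symm) h2 (contDiffAt_id.prodMk contDiffAt_const)
    have h4 : Smooth (ContinuousMap.evalCLM ℝ (1 : unitInterval) : 𝒞 →L[ℝ] V) :=
      ContinuousLinearMap.contDiff _
    exact (h4.contDiffAt.comp x h3.snd).contDiffWithinAt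
  · have h1 := hYpt x hx 1
    simp only [Icc.coe_one, one_smul, one_mul] at h1
    simp only
    rw [h1]
    simp only [hscale x hx]
  · intro ρ hρ hρ₀ hρP hρK x hx
    have hx' : (-x.1, ρ x.2) ∈ ball (0, p₀) ε := by
      rw [Metric.mem_ball, Prod.dist_eq, max_lt_iff] at hx ⊢
      refine ⟨by simpa using hx.1, ?_⟩
      have := hx.2
      rw [dist_eq_norm] at this ⊢
      rw [← hρ, map_sub, hρ₀] at this
      exact this
    let Z : 𝒞 := ⟨fun r => ρ (Y x r), by fun_prop⟩
    have hZ : Z = Y (-x.1, ρ x.2) := by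
      refine huniq _ hx' Z (hmem x hx Z fun r => ⟨r, ?_⟩) ?_
      · change ‖ρ (Y x r) - p₀‖ ≤ _
        rw [← hρ (Y x r - p₀), map_sub, hρ₀]
      · ext r
        change ρ (Y x r) = ρ x.2 + (-x.1) • (r : ℝ) •
          ∫ θ : unitInterval, cubicWeight P θ (K (ρ (Y x (r * θ))))
        have h1 : ∀ θ : unitInterval, cubicWeight P θ (K (ρ (Y x (r * θ)))) =
            -ρ (cubicWeight P θ (K (Y x (r * θ)))) := fun θ => by
          simp only [hρK, cubicWeight, map_add, map_sub, map_smul, map_neg, hρP, smul_neg]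
          abel
        have h2 : MeasureTheory.Integrable
            fun θ : unitInterval => cubicWeight P θ (K (Y x (r * θ))) :=
          integrable_unitInterval ((continuous_cubicWeight P).comp
            (f := fun θ : unitInterval => ((θ : ℝ), K (Y x (r * θ))))
            (by have := hK.continuous; fun_prop))
        simp only [h1, MeasureTheory.integral_neg, ρ.integral_comp_comm h2]
        rw [hYpt x hx r]
        simp
    exact congrArg (fun y : 𝒞 => y 1) hZ.symm

end SingularFlow

section SingularODE

universe u

variable {V : Type u} [NormedAddCommGroup V] [NormedSpace ℝ V]

theorem smul_integral_unitInterval_comp_mul {g : ℝ → V} (m : ℝ) :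
    m • ∫ θ : unitInterval, g ((θ : ℝ) * m) = ∫ s in 0..m, g s := by
  have h1 : ∫ θ : unitInterval, g ((θ : ℝ) * m) = ∫ θ in 0..1, g (m * θ) := by
    rw [unitInterval.volume_def, MeasureTheory.integral_subtype_comap measurableSet_Icc
      (fun θ => g (θ * m)), intervalIntegral.integral_of_le zero_le_one,
      MeasureTheory.integral_Icc_eq_integral_Ioc]
    simp only [mul_comm]
  rw [h1, intervalIntegral.smul_integral_comp_mul_left]
  simp

theorem hasDerivAt_of_eq_integral [CompleteSpace V] {g y : ℝ → V} {c : V} {ε m : ℝ}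
    (hg : ContinuousOn g (Ioo (-ε) ε)) (hm : m ∈ Ioo (-ε) ε)
    (hy : ∀ σ ∈ Ioo (-ε) ε, y σ = c + σ • ∫ θ : unitInterval, g ((θ : ℝ) * σ)) :
    HasDerivAt y (g m) m := by
  have h0 : 0 ∈ Ioo (-ε) ε := by constructor <;> linarith [hm.1, hm.2]
  have hsub : uIcc 0 m ⊆ Ioo (-ε) ε := Set.OrdConnected.uIcc_subset inferInstance h0 hm
  have h1 : HasDerivAt (fun σ => c + ∫ s in 0..σ, g s) (g m) m :=
    (intervalIntegral.integral_hasDerivAt_right ((hg.mono hsub).intervalIntegrable)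
      (hg.stronglyMeasurableAtFilter isOpen_Ioo m hm)
      (hg.continuousAt (isOpen_Ioo.mem_nhds hm))).const_add c
  refine h1.congr_of_eventuallyEq ?_
  filter_upwards [isOpen_Ioo.mem_nhds hm] with σ hσ
  rw [hy σ hσ, smul_integral_unitInterval_comp_mul]

/-- The differential equations behind the integral equation of `exists_singularFlow`. -/
theorem hasDerivAt_singularFlow [CompleteSpace V] {K : V → V} (hK : Continuous K)
    {P : V →L[ℝ] V} (hP : ∀ v, P (P v) = P v) {p₀ : V} {Φ : ℝ × V → V} {ε : ℝ}
    (hΦ : ContinuousOn Φ (ball (0, p₀) ε))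
    (heq : ∀ x ∈ ball (0, p₀) ε, Φ x = x.2 + x.1 • ∫ θ : unitInterval,
        cubicWeight P θ (K (Φ ((θ : ℝ) * x.1, x.2)))) {m : ℝ} {p : V}
    (hx : (m, p) ∈ ball (0, p₀) ε) (hp : P p = 0) :
    HasDerivAt (fun σ => Φ (σ, p) - P (Φ (σ, p))) (K (Φ (m, p)) - P (K (Φ (m, p)))) m ∧
      HasDerivAt (fun σ => σ ^ 3 • P (Φ (σ, p))) (m ^ 3 • P (K (Φ (m, p)))) m := by
  rw [Metric.mem_ball, Prod.dist_eq, max_lt_iff] at hx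
  have hball : ∀ σ ∈ Ioo (-ε) ε, (σ, p) ∈ ball (0, p₀) ε := fun σ hσ => by
    rw [Metric.mem_ball, Prod.dist_eq, max_lt_iff]
    exact ⟨by rw [dist_zero_right, norm_eq_abs, abs_lt]; exact hσ, hx.2⟩
  have hm : m ∈ Ioo (-ε) ε := by
    have := hx.1
    rwa [dist_zero_right, norm_eq_abs, abs_lt] at this
  have hg : ContinuousOn (fun σ => K (Φ (σ, p))) (Ioo (-ε) ε) :=
    hK.comp_continuousOn (hΦ.comp (by fun_prop) hball)
  have hmem : ∀ σ ∈ Ioo (-ε) ε, ∀ θ : unitInterval, (θ : ℝ) * σ ∈ Ioo (-ε) ε := fun σ hσ θ => by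
    have h0 := abs_lt.2 hσ
    rw [Set.mem_Ioo, ← abs_lt, abs_mul, abs_of_nonneg θ.2.1]
    exact (mul_le_of_le_one_left (abs_nonneg _) θ.2.2).trans_lt h0
  have hcont : ∀ σ ∈ Ioo (-ε) ε, Continuous fun θ : unitInterval => K (Φ ((θ : ℝ) * σ, p)) := by
    intro σ hσ
    exact hg.comp_continuous (f := fun θ : unitInterval => (θ : ℝ) * σ) (by fun_prop) (hmem σ hσ)
  have hint : ∀ σ ∈ Ioo (-ε) ε, MeasureTheory.Integrable
      fun θ : unitInterval => cubicWeight P θ (K (Φ ((θ : ℝ) * σ, p))) := fun σ hσ =>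
    integrable_unitInterval ((continuous_cubicWeight P).comp
      (f := fun θ : unitInterval => ((θ : ℝ), K (Φ ((θ : ℝ) * σ, p))))
      (continuous_subtype_val.prodMk (hcont σ hσ)))
  constructor
  · refine hasDerivAt_of_eq_integral (g := fun σ => K (Φ (σ, p)) - P (K (Φ (σ, p)))) (c := p)
      (hg.sub (P.continuous.comp_continuousOn hg)) hm fun σ hσ => ?_
    have h1 := heq (σ, p) (hball σ hσ)
    have h2 : ∀ v, v - P v = (ContinuousLinearMap.id ℝ V - P) v := fun v => rfl
    rw [h2 (Φ (σ, p)), h1, map_add, map_smul, ← ContinuousLinearMap.integral_comp_comm _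
      (hint σ hσ)]
    congr 1
    · simp [hp]
    · congr 2
      funext θ
      simp [cubicWeight, hP]
  · refine hasDerivAt_of_eq_integral (g := fun σ => σ ^ 3 • P (K (Φ (σ, p)))) (c := 0)
      ((continuous_pow 3).continuousOn.smul (P.continuous.comp_continuousOn hg)) hm fun σ hσ => ?_
    have h1 := heq (σ, p) (hball σ hσ)
    rw [h1, map_add, map_smul, ← ContinuousLinearMap.integral_comp_comm _ (hint σ hσ), hp, zero_add,
      zero_add, smul_comm, ← MeasureTheory.integral_smul]
    congr 2
    funext θ
    simp [cubicWeight, hP, smul_smul, mul_pow, mul_comm]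

end SingularODE

/-! ### Smooth cutoffs and local inverses -/

section Cutoff

universe u

variable {E F : Type u} [NormedAddCommGroup E] [NormedSpace ℝ E]
  [NormedAddCommGroup F] [NormedSpace ℝ F]

/-- The function `f`, cut off where `d` is not small compared with `c`. -/
noncomputable def cutoff (d : E → ℝ) (c : ℝ) (f : E → F) (x : E) : F :=
  Real.smoothTransition (2 - 4 * d x / c) • f x

theorem cutoff_of_le {d : E → ℝ} {c : ℝ} (hc : 0 < c) (f : E → F) {x : E} (hx : d x ≤ c / 4) :
    cutoff d c f x = f x := by
  rw [cutoff, Real.smoothTransition.one_of_one_le, one_smul]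
  have : 4 * d x / c ≤ 1 := by rw [div_le_one hc]; linarith
  linarith

theorem contDiff_cutoff {d : E → ℝ} (hd : Smooth d) {c : ℝ} (hc : 0 < c) {f : E → F}
    (hf : SmoothOn f {x | d x < c}) : Smooth (cutoff d c f) := by
  rw [contDiff_iff_contDiffAt]
  intro x
  rcases lt_or_ge (d x) c with h | h
  · have h1 : SmoothAt f x := hf.contDiffAt ((isOpen_lt hd.continuous continuous_const).mem_nhds h)
    have h2 : Smooth fun x => Real.smoothTransition (2 - 4 * d x / c) :=
      Real.smoothTransition.contDiff.comp (by fun_prop)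
    exact h2.contDiffAt.smul h1
  · have h1 : ∀ᶠ y in 𝓝 x, cutoff d c f y = 0 := by
      have : x ∈ {y | c / 2 < d y} := by change c / 2 < d x; linarith
      filter_upwards [(isOpen_lt continuous_const hd.continuous).mem_nhds this] with y hy
      have hy' : c / 2 < d y := hy
      rw [cutoff, Real.smoothTransition.zero_of_nonpos, zero_smul]
      have : 2 ≤ 4 * d y / c := by rw [le_div_iff₀ hc]; linarith
      linarith
    exact contDiffAt_const.congr_of_eventuallyEq (h1.mono fun y hy => hy)

/-- The inverse function theorem for smooth functions, with a smooth inverse on the whole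
image. -/
theorem exists_openPartialHomeomorph_contDiffOn_symm [CompleteSpace E] {f : E → F} {s : Set E}
    (hs : IsOpen s) (hf : SmoothOn f s) {x : E} (hx : x ∈ s) {f' : E ≃L[ℝ] F}
    (hf' : HasFDerivAt f (f' : E →L[ℝ] F) x) :
    ∃ T : OpenPartialHomeomorph E F, (∀ y, T y = f y) ∧ x ∈ T.source ∧ T.source ⊆ s ∧
      SmoothOn T.symm T.target := by
  have hfx : SmoothAt f x := hf.contDiffAt (hs.mem_nhds hx)
  let T := hfx.toOpenPartialHomeomorph f hf' (by simp)
  let S : Set E := s ∩ (fderiv ℝ f) ⁻¹' range ContinuousLinearEquiv.toContinuousLinearMap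
  have hS : IsOpen S := (hf.continuousOn_fderiv_of_isOpen hs (by simp)).isOpen_inter_preimage hs
    ContinuousLinearEquiv.isOpen
  refine ⟨T.restrOpen S hS, fun _ => rfl,
    ⟨ContDiffAt.mem_toOpenPartialHomeomorph_source _ hf' (by simp), hx, f', hf'.fderiv.symm⟩,
    fun y hy => hy.2.1, fun y hy => ?_⟩
  have hy' := (T.restrOpen S hS).map_target hy
  obtain ⟨e, he⟩ := hy'.2.2
  have h1 : SmoothAt f ((T.restrOpen S hS).symm y) := hf.contDiffAt (hs.mem_nhds hy'.2.1)
  refine (OpenPartialHomeomorph.contDiffAt_symm (T.restrOpen S hS) (f₀' := e) hy ?_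
    h1).contDiffWithinAt
  rw [he]
  exact (h1.differentiableAt (by simp)).hasFDerivAt

end Cutoff

/-! ### Coordinates adapted to the singular equation -/

variable {b f : ℕ}

/-- Triples `(t, u, v)` of a time, a position and a spatial covector. -/
abbrev HatSpace (b f : ℕ) := ℝ × Coord b f × Coord b f

set_option hygiene false in
local notation "ℐ" => Fin (b + f + 1)
set_option hygiene false in
local notation "ℰ" => Coord b f
set_option hygiene false in
local notation "ℙ" => Phase b f
set_option hygiene false in
local notation "ℋ" => HatSpace b f
set_option hygiene false in
local notation "ℍ" => {u : Coord b f | 0 ≤ u 0}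
set_option hygiene false in
local notation "ℍ₊" => {u : Coord b f | 0 < u 0}

/-- The coordinate `x`. -/
noncomputable def xCoord : ℰ →L[ℝ] ℝ := EuclideanSpace.proj 0

set_option hygiene false in
local notation "𝓍" => xCoord (b := b) (f := f)

@[simp] theorem xCoord_apply (u : ℰ) : xCoord u = u 0 := rfl

theorem xCoord_basisVec : xCoord (basisVec 0 : ℰ) = 1 := by simp [basisVec]

theorem basisVec_apply (i j : ℐ) : (basisVec i : ℰ) j = if j = i then 1 else 0 := by
  simp [basisVec, Pi.single_apply]

/-- The reflection `x ↦ -x`. -/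
noncomputable def flip : ℰ →L[ℝ] ℰ :=
  ContinuousLinearMap.id ℝ _ - (2 : ℝ) • xCoord.smulRight (basisVec 0)

theorem flip_apply (u : ℰ) (i : ℐ) : flip u i = if i = 0 then -u 0 else u i := by
  have : flip u i = u i - 2 * (u 0 * (basisVec 0 : ℰ) i) := rfl
  rw [this, basisVec_apply]
  split_ifs with h
  · rw [h]; ring
  · ring

theorem norm_flip (u : ℰ) : ‖flip u‖ = ‖u‖ := by
  rw [EuclideanSpace.norm_eq, EuclideanSpace.norm_eq]
  congr 1
  refine sum_congr rfl fun i _ => ?_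
  by_cases h : i = 0 <;> simp [flip_apply, h]

theorem setCoord_xCoord_apply (c : ℝ) (u : ℰ) (i : ℐ) :
    setCoord xCoord (basisVec 0) c u i = if i = 0 then c else u i := by
  have : setCoord xCoord (basisVec 0) c u i = u i + (c - u 0) * (basisVec 0 : ℰ) i := rfl
  rw [this, basisVec_apply]
  split_ifs with h
  · rw [h]; ring
  · ring

theorem setCoord_neg_eq_flip (u : ℰ) : setCoord xCoord (basisVec 0) (-xCoord u) u = flip u := by
  ext i; rw [setCoord_xCoord_apply, flip_apply]; simp

/-- The substitution `x ↦ x²`. -/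
noncomputable def sq (u : ℰ) : ℰ := setCoord xCoord (basisVec 0) (u 0 ^ 2) u

theorem sq_apply (u : ℰ) (i : ℐ) :
    sq u i = if i = 0 then u 0 ^ 2 else u i := setCoord_xCoord_apply _ _ _

theorem sq_flip (u : ℰ) : sq (flip u) = sq u := by
  ext i; by_cases h : i = 0 <;> simp [sq_apply, flip_apply, h]

theorem contDiff_sq : Smooth (sq : ℰ → ℰ) := by
  have h : Smooth fun u : ℰ => u 0 := (𝓍).contDiff
  exact contDiff_id.add (((h.pow 2).sub h).smul contDiff_const)

theorem norm_sq_sub_le {u u₀ : ℰ} (h0 : u₀ 0 = 0) (hu : |u 0| ≤ 1) : ‖sq u - u₀‖ ≤ ‖u - u₀‖ := by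
  rw [EuclideanSpace.norm_eq, EuclideanSpace.norm_eq]
  refine Real.sqrt_le_sqrt (sum_le_sum fun i _ => ?_)
  by_cases h : i = 0
  · subst h
    simp only [PiLp.sub_apply, sq_apply, h0, sub_zero, if_true, norm_eq_abs, abs_pow]
    have := abs_nonneg (u 0)
    gcongr
    nlinarith
  · simp [sq_apply, h]

theorem abs_apply_le_norm (u : ℰ) (i : ℐ) : |u i| ≤ ‖u‖ := PiLp.norm_apply_le u i

/-- The components `ζ` of a covector `(ξ, η, ζ)`. -/
noncomputable def fibreProj : ℰ →L[ℝ] ℰ := LinearMap.toContinuousLinearMap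
    { toFun := fun v => WithLp.toLp 2 fun i => if i.val ≤ b then 0 else v i
      map_add' := fun v w => by ext i; by_cases h : i.val ≤ b <;> simp [h]
      map_smul' := fun c v => by ext i; by_cases h : i.val ≤ b <;> simp [h] }

theorem fibreProj_apply (v : ℰ) (i : ℐ) : fibreProj v i = if i.val ≤ b then 0 else v i := rfl

theorem zero_val_le : ((0 : ℐ) : ℕ) ≤ b := by simp

/-! ### Coefficients -/

/-- The properties, in the half ball of radius `ε` around a boundary point `u₀`, of the inverse
`Γ` of the matrix of `x⁻² g` in the edge frame of a normal chart. -/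
structure IsNormalCoeff (Γ : ℐ → ℐ → ℰ → ℝ) (u₀ : ℰ) (ε : ℝ) : Prop where
  pos : 0 < ε
  boundary : u₀ 0 = 0
  smooth : ∀ j k, SmoothOn (Γ j k) (ball u₀ ε ∩ ℍ)
  symm : ∀ j k u, Γ j k u = Γ k j u
  mixed : ∀ u ∈ ball u₀ ε, u 0 = 0 → ∀ j k : ℐ, j.val ≤ b → b < k.val → Γ j k u = 0
  base : ∀ u ∈ ball u₀ ε, ∀ u' ∈ ball u₀ ε, u 0 = 0 → u' 0 = 0 → (∀ j : ℐ, j.val ≤ b → u j = u' j) →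
    ∀ j k : ℐ, j.val ≤ b → k.val ≤ b → Γ j k u = Γ j k u'

/-- The function `h` on the half space, pulled back by `x ↦ x²` and cut off. -/
noncomputable def evenPullback (u₀ : ℰ) (ε : ℝ) (h : ℰ → ℝ) : ℰ → ℝ :=
  cutoff (fun u => ‖u - u₀‖ ^ 2) (min ε 1 ^ 2) (fun u => h (sq u))

theorem evenPullback_flip {u₀ : ℰ} (h0 : u₀ 0 = 0) (ε : ℝ) (h : ℰ → ℝ)
    (u : ℰ) : evenPullback u₀ ε h (flip u) = evenPullback u₀ ε h u := by
  have h1 : flip u₀ = u₀ := by ext i; by_cases h : i = 0 <;> simp [flip_apply, h, h0]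
  have h2 : ‖flip u - u₀‖ = ‖u - u₀‖ := by rw [← norm_flip (u - u₀), map_sub, h1]
  simp only [evenPullback, cutoff, h2, sq_flip]

theorem sq_mem_halfBall {u₀ u : ℰ} {ε : ℝ} (h0 : u₀ 0 = 0)
    (hu : u ∈ ball u₀ (min ε 1)) : sq u ∈ ball u₀ ε ∩ ℍ := by
  rw [mem_ball_iff_norm, lt_min_iff] at hu
  refine ⟨?_, ?_⟩
  · rw [mem_ball_iff_norm]
    refine (norm_sq_sub_le h0 ?_).trans_lt hu.1
    have := (abs_apply_le_norm (u - u₀) 0).trans hu.2.le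
    simpa [h0] using this
  · change 0 ≤ sq u 0
    rw [sq_apply, if_pos rfl]; positivity

theorem contDiff_evenPullback {u₀ : ℰ} (h0 : u₀ 0 = 0) {ε : ℝ} (hε : 0 < ε)
    {h : ℰ → ℝ} (hh : SmoothOn h (ball u₀ ε ∩ ℍ)) :
    Smooth (evenPullback u₀ ε h) := by
  have hm : 0 < min ε 1 := lt_min hε one_pos
  refine contDiff_cutoff ?_ (by positivity) (hh.comp contDiff_sq.contDiffOn fun u hu => ?_)
  · exact (contDiff_id.sub contDiff_const).norm_sq ℝ
  · have hu' : ‖u - u₀‖ ^ 2 < min ε 1 ^ 2 := hu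
    refine sq_mem_halfBall h0 ?_
    rw [mem_ball_iff_norm]
    exact lt_of_pow_lt_pow_left₀ 2 hm.le hu'

theorem evenPullback_eq {u₀ u : ℰ} {ε : ℝ} (hε : 0 < ε) (h : ℰ → ℝ)
    (hu : u ∈ ball u₀ (min ε 1 / 2)) : evenPullback u₀ ε h u = h (sq u) := by
  have hm : 0 < min ε 1 := lt_min hε one_pos
  refine cutoff_of_le (by positivity) _ ?_
  rw [mem_ball_iff_norm] at hu
  have := norm_nonneg (u - u₀)
  change ‖u - u₀‖ ^ 2 ≤ _
  nlinarith

/-- An even function is, up to terms of second order in `x`, its restriction to `x = 0`. -/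
theorem exists_eq_add_sq_mul {G : ℰ → ℝ} (hG : Smooth G) (heven : ∀ u, G (flip u) = G u) :
    ∃ a : ℰ → ℝ, Smooth a ∧ (∀ u, a (flip u) = a u) ∧
      ∀ u, G u = G (setCoord xCoord (basisVec 0) 0 u) + u 0 ^ 2 * a u := by
  have hset : Smooth fun u : ℰ => setCoord xCoord (basisVec 0) 0 u :=
    contDiff_id.add ((contDiff_const.sub xCoord.contDiff).smul contDiff_const)
  have hset0 : ∀ u : ℰ, u 0 = 0 → setCoord xCoord (basisVec 0) 0 u = u := by
    intro u hu; ext i; rw [setCoord_xCoord_apply]; split_ifs with h <;> simp [h, hu]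
  have hsetflip : ∀ u : ℰ, setCoord xCoord (basisVec 0) 0 (flip u) =
      setCoord xCoord (basisVec 0) 0 u := by
    intro u; ext i; simp only [setCoord_xCoord_apply, flip_apply]; split_ifs <;> rfl
  have hflip0 : ∀ u : ℰ, u 0 = 0 → flip u = u := by
    intro u hu; ext i; rw [flip_apply]; split_ifs with h <;> simp [h, hu]
  obtain ⟨a₁, ha₁, h₁⟩ := exists_eq_smul_of_eq_zero xCoord_basisVec
    (f := fun u => G u - G (setCoord xCoord (basisVec 0) 0 u)) (hG.sub (hG.comp hset))
    (fun u hu => by simp only [hset0 u hu, sub_self])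
  simp only [xCoord_apply, smul_eq_mul] at h₁
  have hodd : ∀ u, u 0 ≠ 0 → a₁ (flip u) = -a₁ u := fun u hu => by
    have h2 := h₁ (flip u)
    rw [heven, hsetflip, h₁ u, flip_apply, if_pos rfl] at h2
    have : u 0 * (a₁ u + a₁ (flip u)) = 0 := by linarith
    rcases mul_eq_zero.1 this with h | h
    · exact absurd h hu
    · linarith
  have hzero : ∀ u : ℰ, u 0 = 0 → a₁ u = 0 := fun u hu => by
    have hc : Continuous fun s : ℝ => a₁ (flip (u + s • basisVec 0)) + a₁ (u + s • basisVec 0) :=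
      (ha₁.continuous.comp (flip.continuous.comp (by fun_prop))).add
        (ha₁.continuous.comp (by fun_prop))
    have h2 : Tendsto (fun s : ℝ => a₁ (flip (u + s • basisVec 0)) +
        a₁ (u + s • basisVec 0)) (𝓝[≠] 0) (𝓝 0) := by
      refine tendsto_const_nhds.congr' ?_
      filter_upwards [self_mem_nhdsWithin] with s hs
      have hs' : s ≠ 0 := hs
      rw [hodd]
      · simp
      · simpa [hu, basisVec] using hs'
    have h3 := tendsto_nhds_unique h2 (hc.continuousWithinAt (s := {0}ᶜ) (x := 0)).tendsto
    simp only [zero_smul, add_zero, hflip0 u hu] at h3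
    linarith
  obtain ⟨a₂, ha₂, h₂⟩ := exists_eq_smul_of_eq_zero xCoord_basisVec ha₁ hzero
  simp only [xCoord_apply, smul_eq_mul] at h₂
  refine ⟨a₂, ha₂, fun u => ?_, fun u => ?_⟩
  · by_cases hu : u 0 = 0
    · rw [hflip0 u hu]
    · have h3 := hodd u hu
      rw [h₂, h₂ u, flip_apply, if_pos rfl] at h3
      have : u 0 * (a₂ (flip u) - a₂ u) = 0 := by linarith
      rcases mul_eq_zero.1 this with h | h
      · exact absurd h hu
      · linarith
  · have := h₁ u
    rw [h₂ u] at this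
    linarith

set_option hygiene false in
local notation "setX" => setCoord xCoord (basisVec 0)

section FlowBox

universe u

variable {V : Type u} [NormedAddCommGroup V] [NormedSpace ℝ V]

/-- Let `ℓ` be the time function of the singular equation `(Y - P Y)' = K - P K`,
`(ℓ ^ 3 P Y)' = ℓ ^ 3 P K`. The point `X q` lies at time `ℓ q` on the solution whose initial value
has the components of `q` other than `ℓ` and `P`, and `Ξ` recovers `q` from the components
of `X q` other than `P`. The reflection `ρ` reverses the time. -/
structure IsFlowBox (K : V → V) (P : V →L[ℝ] V) (ℓ : V →L[ℝ] ℝ) (e : V) (ρ : V →L[ℝ] V) (p₀ : V)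
    (X Ξ : V → V) (ε δ : ℝ) : Prop where
  pos : 0 < ε
  pos_inv : 0 < δ
  smooth : SmoothOn X (ball p₀ ε)
  smooth_inv : SmoothOn Ξ (ball p₀ δ)
  maps_inv : ∀ Y ∈ ball p₀ δ, Ξ Y ∈ ball p₀ ε
  initial : ∀ q ∈ ball p₀ ε, ℓ q = 0 → P q = 0 → X q = q
  proj : ∀ q, X (q - P q) = X q
  level : ∀ q ∈ ball p₀ ε, ℓ (X q) = ℓ q
  hasDerivAt : ∀ q ∈ ball p₀ ε,
    HasDerivAt (fun s : ℝ => X (q + s • e) - P (X (q + s • e))) (K (X q) - P (K (X q))) 0 ∧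
    HasDerivAt (fun s : ℝ => (ℓ q + s) ^ 3 • P (X (q + s • e))) (ℓ q ^ 3 • P (K (X q))) 0
  odd : ∀ q ∈ ball p₀ ε, X (ρ q) = ρ (X q)
  inv_odd : ∀ Y ∈ ball p₀ δ, Ξ (ρ Y) = ρ (Ξ Y)
  proj_inv : ∀ Y ∈ ball p₀ δ, P (Ξ Y) = P Y
  right_inv : ∀ Y ∈ ball p₀ δ, X (Ξ Y) - P (X (Ξ Y)) = Y - P Y
  left_inv : ∀ q ∈ ball p₀ ε, Ξ (X q - P (X q)) = q - P q
  inv_center : Ξ p₀ = p₀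

theorem exists_isFlowBox [CompleteSpace V] {K : V → V} (hK : Smooth K) {P : V →L[ℝ] V}
    (hP : ∀ v, P (P v) = P v) {ℓ : V →L[ℝ] ℝ} {e : V} (he : ℓ e = 1) (hPe : P e = 0)
    (hℓP : ∀ v, ℓ (P v) = 0) (hℓK : ∀ v, ℓ (K v) = 1) {ρ : V →L[ℝ] V} {p₀ : V}
    (hρ : ∀ v, ‖ρ v‖ = ‖v‖) (hρp : ρ p₀ = p₀) (hρP : ∀ v, ρ (P v) = P (ρ v))
    (hρK : ∀ v, K (ρ v) = -ρ (K v)) (hρℓ : ∀ v, ℓ (ρ v) = -ℓ v) (hρe : ρ e = -e)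
    (hρπ : ∀ v, P v = 0 → ℓ v = 0 → ρ v = v) (hp₀ : ℓ p₀ = 0) (hPp₀ : P p₀ = 0) :
    ∃ X Ξ : V → V, ∃ ε δ : ℝ, IsFlowBox K P ℓ e ρ p₀ X Ξ ε δ := by
  obtain ⟨Φ, ε₀, hε₀, hΦ, heq, hsymm⟩ := exists_singularFlow hK P p₀
  let π : V →L[ℝ] V := ContinuousLinearMap.id ℝ V - P - ℓ.smulRight e
  have hπ : ∀ v, π v = v - P v - ℓ v • e := fun v => rfl
  have hPπ : ∀ v, P (π v) = 0 := fun v => by simp [hπ, hP, hPe]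
  have hℓπ : ∀ v, ℓ (π v) = 0 := fun v => by simp [hπ, hℓP, he]
  have hππ : ∀ v, P v = 0 → ℓ v = 0 → π v = v := fun v h1 h2 => by simp [hπ, h1, h2]
  let j : V →L[ℝ] ℝ × V := ℓ.prod π
  have hj : ∀ v, j v = (ℓ v, π v) := fun v => rfl
  have hjp : j p₀ = (0, p₀) := by rw [hj, hp₀, hππ p₀ hPp₀ hp₀]
  let X : V → V := fun q => Φ (j q)
  let S : Set V := j ⁻¹' ball (0, p₀) ε₀
  have hS : IsOpen S := Metric.isOpen_ball.preimage j.continuous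
  have hpS : p₀ ∈ S := by change j p₀ ∈ ball (0, p₀) ε₀; rw [hjp]; exact mem_ball_self hε₀
  have hX : SmoothOn X S := hΦ.comp j.contDiff.contDiffOn fun q hq => hq
  have hlevel : ∀ q ∈ S, ℓ (X q) = ℓ q := fun q hq => by
    have h1 := heq (j q) hq
    have h2 : Continuous fun θ : unitInterval => K (Φ ((θ : ℝ) * ℓ q, π q)) := by
      refine hK.continuous.comp (hΦ.continuousOn.comp_continuous (by fun_prop) fun θ => ?_)
      have h3 : j q ∈ ball ((0 : ℝ), p₀) ε₀ := hq
      rw [hj, Metric.mem_ball, Prod.dist_eq, max_lt_iff] at h3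
      rw [Metric.mem_ball, Prod.dist_eq, max_lt_iff]
      refine ⟨lt_of_le_of_lt ?_ h3.1, h3.2⟩
      simp only [dist_zero_right, norm_mul, norm_eq_abs, abs_of_nonneg θ.2.1]
      exact mul_le_of_le_one_left (abs_nonneg _) θ.2.2
    have h3 : MeasureTheory.Integrable
        fun θ : unitInterval => cubicWeight P θ (K (Φ ((θ : ℝ) * ℓ q, π q))) :=
      integrable_unitInterval ((continuous_cubicWeight P).comp
        (f := fun θ : unitInterval => ((θ : ℝ), K (Φ ((θ : ℝ) * ℓ q, π q))))
        (continuous_subtype_val.prodMk h2))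
    change ℓ (Φ (j q)) = _
    rw [h1, hj]
    simp only
    rw [map_add, hℓπ, map_smul, ← ContinuousLinearMap.integral_comp_comm _ h3]
    simp [cubicWeight, hℓP, hℓK]
  have hinit : ∀ q ∈ S, ℓ q = 0 → P q = 0 → X q = q := fun q hq h0 h1 => by
    change Φ (j q) = q
    rw [heq (j q) hq, hj, h0, hππ q h1 h0]
    simp
  let Θ : V → V := fun q => X q - P (X q) + P q
  have hΘ : SmoothOn Θ S := (hX.sub (P.contDiff.comp_contDiffOn hX)).add P.contDiff.contDiffOn
  have hΘp : Θ p₀ = p₀ := by simp [Θ, hinit p₀ hpS hp₀ hPp₀, hPp₀]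
  -- the derivative of `Θ` at `p₀` is the identity up to a nilpotent map
  obtain ⟨D, hD⟩ : ∃ D : ℝ × V →L[ℝ] V, HasFDerivAt Φ D (0, p₀) :=
    ⟨_, ((hΦ.contDiffAt (Metric.isOpen_ball.mem_nhds
      (mem_ball_self hε₀))).differentiableAt (by simp)).hasFDerivAt⟩
  have hXD : HasFDerivAt X (D.comp j) p₀ := by
    have : HasFDerivAt Φ D (j p₀) := by rw [hjp]; exact hD
    exact this.comp p₀ j.hasFDerivAt
  have hD0 : ∀ v, D (0, v) = v := fun v => by
    have h1 : HasFDerivAt (fun p : V => Φ ((0 : ℝ), p))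
        (D.comp (ContinuousLinearMap.inr ℝ ℝ V)) p₀ :=
      HasFDerivAt.comp (g := Φ) (f := fun p : V => ((0 : ℝ), p)) p₀ hD
        (hasFDerivAt_prodMk_right (0 : ℝ) p₀)
    have h2 : HasFDerivAt (fun p : V => Φ ((0 : ℝ), p)) (ContinuousLinearMap.id ℝ V) p₀ := by
      refine (hasFDerivAt_id p₀).congr_of_eventuallyEq ?_
      filter_upwards [ball_mem_nhds p₀ hε₀] with p hp
      rw [heq _ (by rw [Metric.mem_ball, Prod.dist_eq, max_lt_iff]; exact ⟨by simpa using hε₀, hp⟩)]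
      simp
    have := h1.unique h2
    exact congrArg (fun L : V →L[ℝ] V => L v) this
  set w : V := D (1, 0) - P (D (1, 0)) - e with hw
  have hℓD : ℓ (D (1, 0)) = 1 := by
    have h1 : HasFDerivAt (fun q => ℓ (X q)) (ℓ.comp (D.comp j)) p₀ := ℓ.hasFDerivAt.comp p₀ hXD
    have h2 : HasFDerivAt (fun q => ℓ (X q)) ℓ p₀ := by
      refine ℓ.hasFDerivAt.congr_of_eventuallyEq ?_
      filter_upwards [hS.mem_nhds hpS] with q hq using hlevel q hq
    have h3 := congrArg (fun L : V →L[ℝ] ℝ => L e) (h1.unique h2)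
    have h4 : j e = (1, 0) := by rw [hj, hπ, he, hPe]; simp
    change ℓ (D (j e)) = ℓ e at h3
    rwa [h4, he] at h3
  have hℓw : ℓ w = 0 := by rw [hw, map_sub, map_sub, hℓP, hℓD, he]; ring
  let A : V ≃L[ℝ] V := ContinuousLinearEquiv.equivOfInverse
    (ContinuousLinearMap.id ℝ V + ℓ.smulRight w) (ContinuousLinearMap.id ℝ V - ℓ.smulRight w)
    (fun v => by simp [hℓw]) (fun v => by simp [hℓw])
  have hΘD : HasFDerivAt Θ (A : V →L[ℝ] V) p₀ := by
    refine ((hXD.sub (P.hasFDerivAt.comp p₀ hXD)).add P.hasFDerivAt).congr_fderiv ?_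
    ext v
    change D (j v) - P (D (j v)) + P v = v + ℓ v • w
    have h1 : D (j v) = ℓ v • D (1, 0) + π v := by
      have : j v = ℓ v • ((1 : ℝ), (0 : V)) + (0, π v) := by simp [hj]
      rw [this, map_add, map_smul, hD0]
    rw [h1, hw, map_add, map_smul, hPπ, hπ]
    module
  obtain ⟨T, hT, hpT, hTS, hTsymm⟩ := exists_openPartialHomeomorph_contDiffOn_symm hS hΘ hpS hΘD
  obtain ⟨ε, hε, hεball⟩ : ∃ ε > 0, ball p₀ ε ⊆ T.source ∩ (fun q => q - P q) ⁻¹' T.source := by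
    refine Metric.mem_nhds_iff.1 (inter_mem (T.open_source.mem_nhds hpT) ?_)
    refine (T.open_source.preimage (by fun_prop)).mem_nhds ?_
    change p₀ - P p₀ ∈ T.source
    rwa [hPp₀, sub_zero]
  have hTp : T p₀ = p₀ := by rw [hT, hΘp]
  have hTsp : T.symm p₀ = p₀ := by
    conv_lhs => rw [← hTp]
    exact T.left_inv hpT
  have hp₀t : p₀ ∈ T.target := by
    have := T.map_source hpT
    rwa [hTp] at this
  obtain ⟨δ, hδ, hδball⟩ : ∃ δ > 0, ball p₀ δ ⊆ T.target ∩ T.symm ⁻¹' ball p₀ ε := by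
    refine Metric.mem_nhds_iff.1 (inter_mem (T.open_target.mem_nhds hp₀t) ?_)
    refine (T.continuousAt_symm hp₀t).preimage_mem_nhds ?_
    rw [hTsp]
    exact ball_mem_nhds p₀ hε
  have hρball : ∀ (r : ℝ) v, v ∈ ball p₀ r → ρ v ∈ ball p₀ r := fun r v hv => by
    rw [mem_ball_iff_norm] at hv ⊢
    rwa [← hρp, ← map_sub, hρ]
  have hXρ : ∀ q ∈ S, X (ρ q) = ρ (X q) := fun q hq => by
    have h1 := hsymm ρ hρ hρp hρP hρK (j q) hq
    have h2 : ρ (π q) = π q := hρπ _ (hPπ q) (hℓπ q)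
    have h3 : π (ρ q) = ρ (π q) := by simp only [hπ, map_sub, map_smul, hρP, hρℓ, hρe]; module
    change Φ (j (ρ q)) = ρ (Φ (j q))
    rw [← h1, hj, hj, hρℓ, h3]
  have hPΘ : ∀ q, P (Θ q) = P q := fun q => by simp [Θ, hP]
  have hρsource : ∀ q ∈ ball p₀ ε, Θ (ρ q) = ρ (Θ q) := fun q hq => by
    simp only [Θ]
    rw [hXρ q (hTS (hεball hq).1), map_add, map_sub, hρP, hρP]
  refine ⟨X, T.symm, ε, δ, hε, hδ, hX.mono fun q hq => hTS (hεball hq).1,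
    hTsymm.mono fun q hq => (hδball hq).1, fun Y hY => (hδball hY).2,
    fun q hq => hinit q (hTS (hεball hq).1), fun q => ?_,
    fun q hq => hlevel q (hTS (hεball hq).1), fun q hq => ?_,
    fun q hq => hXρ q (hTS (hεball hq).1), fun Y hY => ?_, fun Y hY => ?_, fun Y hY => ?_,
    fun q hq => ?_, hTsp⟩
  · change Φ (j (q - P q)) = Φ (j q)
    congr 1
    simp [hj, hπ, hℓP, hP]
  · have hq' : (ℓ q, π q) ∈ ball ((0 : ℝ), p₀) ε₀ := hTS (hεball hq).1
    obtain ⟨h1, h2⟩ := hasDerivAt_singularFlow hK.continuous hP hΦ.continuousOn heq hq' (hPπ q)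
    have h3 : ∀ s : ℝ, X (q + s • e) = Φ (ℓ q + s, π q) := fun s => by
      change Φ (j (q + s • e)) = _
      congr 1
      rw [hj]
      refine Prod.ext ?_ ?_
      · simp [he]
      · simp only [hπ, map_add, map_smul, he, hPe]; module
    simp only [h3]
    have h4 : HasDerivAt (fun s : ℝ => ℓ q + s) 1 0 := (hasDerivAt_id 0).const_add _
    constructor
    · rw [← add_zero (ℓ q)] at h1
      have := HasDerivAt.scomp (0 : ℝ) h1 h4
      simpa [X, hj, Function.comp_def] using this
    · rw [← add_zero (ℓ q)] at h2
      have := HasDerivAt.scomp (0 : ℝ) h2 h4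
      simpa [X, hj, Function.comp_def] using this
  · have h1 := (hδball hY).2
    have h2 : T (ρ (T.symm Y)) = ρ Y := by rw [hT, hρsource _ h1, ← hT, T.right_inv (hδball hY).1]
    rw [← h2, T.left_inv (hεball (hρball ε _ h1)).1]
  · rw [← hPΘ, ← hT, T.right_inv (hδball hY).1]
  · have h1 : Θ (T.symm Y) = Y := by rw [← hT, T.right_inv (hδball hY).1]
    have h2 : P (T.symm Y) = P Y := by rw [← hPΘ, h1]
    conv_rhs => rw [← h2]
    rw [eq_sub_iff_add_eq]
    exact h1
  · have h1 : T (q - P q) = X q - P (X q) := by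
      rw [hT]
      have : X (q - P q) = X q := by
        change Φ (j (q - P q)) = Φ (j q)
        congr 1
        simp [hj, hπ, hℓP, hP]
      simp [Θ, this, hP]
    rw [← h1, T.left_inv (hεball hq).2]

end FlowBox

/-! ### The desingularized Hamilton vector field -/

/-- The spatial covector `(ξ, η, ζ)` with `ζ = U 0 • ω`, where `N = (ξ, η, ω)`. -/
noncomputable def scaledCovector (U N : ℰ) : ℰ :=
  WithLp.toLp 2 fun i => if i.val ≤ b then N i else U 0 * N i

theorem scaledCovector_apply (U N : ℰ) (i : ℐ) :
    scaledCovector U N i = if i.val ≤ b then N i else U 0 * N i := rfl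

/-- The projection onto the fibre components of the covector. -/
noncomputable def hatProj : ℋ →L[ℝ] ℋ := (0 : ℋ →L[ℝ] ℝ).prod ((0 : ℋ →L[ℝ] ℰ).prod
    (fibreProj.comp ((snd ℝ _ _).comp (snd ℝ _ _))))

theorem hatProj_apply (Y : ℋ) : hatProj Y = (0, 0, fibreProj Y.2.2) := rfl

/-- The time function of the singular equation, a square root of `x`. -/
noncomputable def hatTime : ℋ →L[ℝ] ℝ := xCoord.comp ((fst ℝ _ _).comp (snd ℝ _ _))

theorem hatTime_apply (Y : ℋ) : hatTime Y = Y.2.1 0 := rfl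

/-- The direction dual to `hatTime`. -/
noncomputable def hatVec : ℋ := (0, basisVec 0, 0)

/-- The reflection that reverses the sign of `U 0` and of the rescaled fibre covector. -/
noncomputable def hatReflect : ℋ →L[ℝ] ℋ := (fst ℝ _ _).prod
    ((flip.comp ((fst ℝ _ _).comp (snd ℝ _ _))).prod
    ((ContinuousLinearMap.id ℝ _ - (2 : ℝ) • fibreProj).comp ((snd ℝ _ _).comp (snd ℝ _ _))))

theorem hatReflect_apply (Y : ℋ) :
    hatReflect Y = (Y.1, flip Y.2.1, Y.2.2 - (2 : ℝ) • fibreProj Y.2.2) := rfl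

theorem reflect_fibre_apply (N : ℰ) (i : ℐ) :
    (N - (2 : ℝ) • fibreProj N) i = if i.val ≤ b then N i else -N i := by
  have : (N - (2 : ℝ) • fibreProj N) i = N i - 2 * fibreProj N i := rfl
  rw [this, fibreProj_apply]
  split_ifs <;> ring

section LiftField

variable (G a : ℐ → ℐ → ℰ → ℝ) (κ : ℝ → ℝ)

/-- The components of the vector with covector `v` for the bilinear form `G`. -/
noncomputable def raise (i : ℐ) (u v : ℰ) : ℝ := ∑ j, G i j u * v j

/-- The quotient by `U 0` of a fibre component of `raise`, continued to `U 0 = 0`. -/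
noncomputable def raiseQuot (i : ℐ) (U N : ℰ) : ℝ :=
  ∑ j : ℐ, if j.val ≤ b then U 0 * a i j U * N j else G i j U * N j

/-- The partial derivative of the quadratic form `G` in the `i`-th position variable. -/
noncomputable def quadDeriv (i : ℐ) (u v : ℰ) : ℝ :=
  ∑ j, ∑ k, fderiv ℝ (G j k) u (basisVec i) * v j * v k

/-- The quotient by `U 0 ^ 2` of a fibre derivative `quadDeriv`, continued to `U 0 = 0`. -/
noncomputable def quadDerivQuot (i : ℐ) (U N : ℰ) : ℝ :=
  ∑ j : ℐ, ∑ k : ℐ, if b < j.val ∧ b < k.val then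
    fderiv ℝ (G j k) U (basisVec i) * N j * N k else
    fderiv ℝ (a j k) U (basisVec i) * scaledCovector U N j * scaledCovector U N k

/-- The right-hand side of the singular equation satisfied by the bicharacteristics in the
variables `(t, U, N)`, where `U 0 = √x` is the independent variable; `κ` stands for the
inverse of `raise G 0`. -/
noncomputable def liftField (Y : ℋ) : ℋ :=
  (-(2 * Y.2.1 0) * κ (raise G 0 Y.2.1 (scaledCovector Y.2.1 Y.2.2)),
   WithLp.toLp 2 fun i => if i = 0 then 1 else if i.val ≤ b then
      2 * Y.2.1 0 * raise G i Y.2.1 (scaledCovector Y.2.1 Y.2.2) *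
        κ (raise G 0 Y.2.1 (scaledCovector Y.2.1 Y.2.2))
      else 2 * raiseQuot G a i Y.2.1 Y.2.2 * κ (raise G 0 Y.2.1 (scaledCovector Y.2.1 Y.2.2)),
   WithLp.toLp 2 fun i => if i = 0 then
      -(1 / 2 * quadDeriv G i Y.2.1 (scaledCovector Y.2.1 Y.2.2) -
        2 * ∑ j, fibreProj Y.2.2 j * raise G j Y.2.1 (scaledCovector Y.2.1 Y.2.2)) *
        κ (raise G 0 Y.2.1 (scaledCovector Y.2.1 Y.2.2))
      else if i.val ≤ b then
      -(Y.2.1 0 * quadDeriv G i Y.2.1 (scaledCovector Y.2.1 Y.2.2)) *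
        κ (raise G 0 Y.2.1 (scaledCovector Y.2.1 Y.2.2))
      else -quadDerivQuot G a i Y.2.1 Y.2.2 * κ (raise G 0 Y.2.1 (scaledCovector Y.2.1 Y.2.2)))

variable {G a κ}

theorem contDiff_liftField (hG : ∀ j k, Smooth (G j k)) (ha : ∀ j k, Smooth (a j k))
    (hκ : Smooth κ) : Smooth (liftField G a κ) := by
  have hU : Smooth fun Y : ℋ => Y.2.1 := contDiff_fst.comp contDiff_snd
  have hUi : ∀ i, Smooth fun Y : ℋ => Y.2.1 i := fun i => (contDiff_euclidean.1 hU) i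
  have hN : Smooth fun Y : ℋ => Y.2.2 := contDiff_snd.comp contDiff_snd
  have hNi : ∀ i, Smooth fun Y : ℋ => Y.2.2 i := fun i => (contDiff_euclidean.1 hN) i
  have hGU : ∀ j k, Smooth fun Y : ℋ => G j k Y.2.1 := fun j k => (hG j k).comp hU
  have haU : ∀ j k, Smooth fun Y : ℋ => a j k Y.2.1 := fun j k => (ha j k).comp hU
  have hdG : ∀ j k i, Smooth fun Y : ℋ => fderiv ℝ (G j k) Y.2.1 (basisVec i) :=
    fun j k i => (((hG j k).fderiv_right (m := ∞) (by simp)).comp hU).clm_apply contDiff_const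
  have hda : ∀ j k i, Smooth fun Y : ℋ => fderiv ℝ (a j k) Y.2.1 (basisVec i) :=
    fun j k i => (((ha j k).fderiv_right (m := ∞) (by simp)).comp hU).clm_apply contDiff_const
  have hv : ∀ i, Smooth fun Y : ℋ => scaledCovector Y.2.1 Y.2.2 i := fun i => by
    simp only [scaledCovector_apply]
    split_ifs
    exacts [hNi i, (hUi 0).mul (hNi i)]
  have hM : ∀ i, Smooth fun Y : ℋ => raise G i Y.2.1 (scaledCovector Y.2.1 Y.2.2) := fun i =>
    ContDiff.sum fun j _ => (hGU i j).mul (hv j)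
  have hk : Smooth fun Y : ℋ => κ (raise G 0 Y.2.1 (scaledCovector Y.2.1 Y.2.2)) := hκ.comp (hM 0)
  have hM' : ∀ i, Smooth fun Y : ℋ => raiseQuot G a i Y.2.1 Y.2.2 := fun i =>
    ContDiff.sum fun j _ => by
      split_ifs
      exacts [((hUi 0).mul (haU i j)).mul (hNi j), (hGU i j).mul (hNi j)]
  have hQ : ∀ i, Smooth fun Y : ℋ => quadDeriv G i Y.2.1 (scaledCovector Y.2.1 Y.2.2) := fun i =>
    ContDiff.sum fun j _ => ContDiff.sum fun k _ => ((hdG j k i).mul (hv j)).mul (hv k)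
  have hR : ∀ i, Smooth fun Y : ℋ => quadDerivQuot G a i Y.2.1 Y.2.2 := fun i =>
    ContDiff.sum fun j _ => ContDiff.sum fun k _ => by
      split_ifs
      exacts [((hdG j k i).mul (hNi j)).mul (hNi k), ((hda j k i).mul (hv j)).mul (hv k)]
  have hf : ∀ j, Smooth fun Y : ℋ => fibreProj Y.2.2 j := fun j =>
    (contDiff_euclidean.1 ((fibreProj (b := b) (f := f)).contDiff.comp hN)) j
  refine ContDiff.prodMk ?_ (ContDiff.prodMk ?_ ?_)
  · exact ((contDiff_const.mul (hUi 0)).neg).mul hk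
  · refine contDiff_euclidean.2 fun i => ?_
    simp only
    split_ifs
    exacts [contDiff_const, ((contDiff_const.mul (hUi 0)).mul (hM i)).mul hk,
      (contDiff_const.mul (hM' i)).mul hk]
  · refine contDiff_euclidean.2 fun i => ?_
    simp only
    split_ifs
    exacts [(((contDiff_const.mul (hQ i)).sub (contDiff_const.mul
      (ContDiff.sum fun j _ => (hf j).mul (hM j)))).neg).mul hk,
      (((hUi 0).mul (hQ i)).neg).mul hk, ((hR i).neg).mul hk]

theorem flip_basisVec (i : ℐ) :
    flip (basisVec i : ℰ) = if i = 0 then -basisVec i else basisVec i := by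
  ext j
  by_cases hi : i = 0
  · subst hi
    by_cases hj : j = 0 <;> simp [flip_apply, basisVec_apply, hj]
  · by_cases hj : j = 0
    · subst hj
      simp [flip_apply, basisVec_apply, hi, Ne.symm hi]
    · simp [flip_apply, hi, hj]

theorem fderiv_flip {h : ℰ → ℝ} (hh : Smooth h) (heven : ∀ u, h (flip u) = h u)
    (u : ℰ) (i : ℐ) : fderiv ℝ h (flip u) (basisVec i) =
      if i = 0 then -fderiv ℝ h u (basisVec i) else fderiv ℝ h u (basisVec i) := by
  have h1 : HasFDerivAt h ((fderiv ℝ h (flip u)).comp flip) u := by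
    have h2 : HasFDerivAt (fun u => h (flip u)) ((fderiv ℝ h (flip u)).comp flip) u :=
      ((hh.differentiable (by simp)) _).hasFDerivAt.comp u flip.hasFDerivAt
    simpa only [heven] using h2
  rw [h1.fderiv]
  change _ = if i = 0 then -fderiv ℝ h (flip u) (flip (basisVec i)) else
    fderiv ℝ h (flip u) (flip (basisVec i))
  rw [flip_basisVec]
  split_ifs
  · rw [map_neg, neg_neg]
  · rfl

theorem scaledCovector_reflect (U N : ℰ) :
    scaledCovector (flip U) (N - (2 : ℝ) • fibreProj N) = scaledCovector U N := by
  ext i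
  simp only [scaledCovector_apply, reflect_fibre_apply, flip_apply]
  split_ifs <;> simp

theorem liftField_reflect (hG : ∀ j k, Smooth (G j k)) (ha : ∀ j k, Smooth (a j k))
    (hGe : ∀ j k u, G j k (flip u) = G j k u) (hae : ∀ j k u, a j k (flip u) = a j k u)
    (Y : ℋ) : liftField G a κ (hatReflect Y) = -hatReflect (liftField G a κ Y) := by
  obtain ⟨t, U, N⟩ := Y
  have hM : ∀ i v, raise G i (flip U) v = raise G i U v := fun i v => by simp only [raise, hGe]
  have hM' : ∀ i, raiseQuot G a i (flip U) (N - (2 : ℝ) • fibreProj N) = -raiseQuot G a i U N := by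
    intro i
    simp only [raiseQuot, hGe, hae, reflect_fibre_apply, flip_apply, if_true, ← sum_neg_distrib]
    refine sum_congr rfl fun j _ => ?_
    split_ifs <;> ring
  have hQ : ∀ i v, quadDeriv G i (flip U) v =
      if i = 0 then -quadDeriv G i U v else quadDeriv G i U v := fun i v => by
    simp only [quadDeriv, fderiv_flip (hG _ _) (hGe _ _)]
    split_ifs
    · simp only [← sum_neg_distrib, neg_mul]
    · rfl
  have hR : ∀ i : ℐ, i ≠ 0 → quadDerivQuot G a i (flip U) (N - (2 : ℝ) • fibreProj N) =
      quadDerivQuot G a i U N := fun i hi => by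
    simp only [quadDerivQuot, scaledCovector_reflect, fderiv_flip (hG _ _) (hGe _ _),
      fderiv_flip (ha _ _) (hae _ _), if_neg hi, reflect_fibre_apply]
    refine sum_congr rfl fun j _ => sum_congr rfl fun k _ => ?_
    split_ifs <;> first | omega | ring
  have hf : ∀ j, fibreProj (N - (2 : ℝ) • fibreProj N) j = -fibreProj N j := fun j => by
    simp only [fibreProj_apply, reflect_fibre_apply]
    split_ifs <;> simp
  rw [hatReflect_apply, hatReflect_apply]
  refine Prod.ext ?_ (Prod.ext ?_ ?_)
  · simp only [liftField, scaledCovector_reflect, hM, flip_apply, if_true, Prod.fst_neg]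
    ring
  · ext i
    simp only [liftField, scaledCovector_reflect, hM, hM', Prod.snd_neg, Prod.fst_neg, flip_apply,
      PiLp.neg_apply, if_true]
    split_ifs <;> first | ring | simp_all
  · ext i
    simp only [liftField, scaledCovector_reflect, hM, hQ, hf, Prod.snd_neg,
      PiLp.neg_apply, reflect_fibre_apply, flip_apply, if_true]
    have h0 : i = 0 → i.val ≤ b := fun h => by rw [h]; exact zero_val_le
    split_ifs with h1 h2 h3
    · simp only [neg_mul, sum_neg_distrib]; ring
    · exact absurd (h0 h1) h2
    · ring
    · rw [hR i h1]; ring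

end LiftField

section Model

variable {Γ : ℐ → ℐ → ℰ → ℝ} {u₀ : ℰ} {ε : ℝ} {p₀ : ℋ} {K X Ξ : ℋ → ℋ} {Z : ℋ → ℰ} {r δ η θ : ℝ}
set_option hygiene false in
local notation "𝒩" => IsNormalCoeff Γ u₀ ε
set_option hygiene false in
local notation:max "ϱ" Y:max => raise Γ 0 (Prod.fst (Prod.snd Y)) (Prod.snd (Prod.snd Y))

/-! ### The Hamilton vector field in the edge frame -/

theorem hasDerivWithinAt_coord {γ : ℝ → ℰ} {γ' : ℰ} {s : Set ℝ} {x : ℝ} :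
    HasDerivWithinAt γ γ' s x ↔ ∀ i, HasDerivWithinAt (fun σ => γ σ i) (γ' i) s x := by
  have h := hasFDerivWithinAt_euclidean (𝕜 := ℝ) (f := γ) (t := s) (y := x)
    (f' := (ContinuousLinearMap.toSpanSingleton ℝ γ'))
  have e1 : ∀ (E : Type) [NormedAddCommGroup E] [NormedSpace ℝ E] (c : ℝ → E) (c' : E),
      HasDerivWithinAt c c' s x ↔
        HasFDerivWithinAt c (ContinuousLinearMap.toSpanSingleton ℝ c') s x :=
    fun E _ _ c c' => hasDerivWithinAt_iff_hasFDerivWithinAt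
  rw [e1, h]
  refine forall_congr' fun i => ?_
  rw [e1]
  have : (ContinuousLinearMap.toSpanSingleton ℝ (γ' i)) =
      (PiLp.proj 2 (fun _ : ℐ => ℝ) i : ℰ →L[ℝ] ℝ) ∘L
        (ContinuousLinearMap.toSpanSingleton ℝ γ') := by
    ext; simp
  rw [this]

theorem hasDerivAt_coord {γ : ℝ → ℰ} {γ' : ℰ} {x : ℝ} :
    HasDerivAt γ γ' x ↔ ∀ i, HasDerivAt (fun σ => γ σ i) (γ' i) x := by
  simp only [← hasDerivWithinAt_univ]
  exact hasDerivWithinAt_coord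

variable (Γ)

/-- The partial derivative of the quadratic form `Γ` in the `i`-th position variable, on the half
space `x ≥ 0`. -/
noncomputable def halfQuadDeriv (i : ℐ) (u v : ℰ) : ℝ :=
  ∑ j, ∑ k, fderivWithin ℝ (Γ j k) ℍ u (basisVec i) * v j * v k

/-- The Hamilton vector field of the wave operator in the variables `(t, u, v / τ)`, multiplied by
`x ^ 2 / τ`, where `(τ, v)` are the components of a covector in the edge frame. It is tangent to
`x = 0`. -/
noncomputable def hatField (Y : ℋ) : ℋ := (2 * Y.2.1 0,
   WithLp.toLp 2 fun i => -(2 * edgeScale (Y.2.1 0) i * raise Γ i Y.2.1 Y.2.2),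
   WithLp.toLp 2 fun i => edgeScale (Y.2.1 0) i * halfQuadDeriv Γ i Y.2.1 Y.2.2 +
    if i = 0 then -(2 * ∑ j, fibreProj Y.2.2 j * raise Γ j Y.2.1 Y.2.2)
    else if i.val ≤ b then 0 else 2 * ϱ Y * Y.2.2 i)

/-- The substitution `x = U 0 ^ 2`, `ζ = U 0 • ω`. -/
noncomputable def blowDown (Y : ℋ) : ℋ := (Y.1, sq Y.2.1, scaledCovector Y.2.1 Y.2.2)

/-- The velocity of the image under `blowDown` of a solution of the singular equation with right
hand side `k` at the point `Y`. -/
noncomputable def pushVec (Y k : ℋ) : ℋ :=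
  (k.1, WithLp.toLp 2 fun i => if i = 0 then 2 * Y.2.1 0 else k.2.1 i,
    WithLp.toLp 2 fun i => if i.val ≤ b then k.2.2 i else -(2 * Y.2.2 i) + Y.2.1 0 * k.2.2 i)

variable {Γ}

theorem hasDerivAt_blowDown (hX : IsFlowBox K hatProj hatTime hatVec hatReflect p₀ X Ξ ε δ) {q : ℋ}
    (hq : q ∈ ball p₀ ε) (h0 : q.2.1 0 ≠ 0) :
    HasDerivAt (fun s : ℝ => blowDown (X (q + s • hatVec))) (pushVec (X q) (K (X q))) 0 := by
  obtain ⟨h1, h2⟩ := hX.hasDerivAt q hq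
  have hlevel : ∀ᶠ s : ℝ in 𝓝 0, (X (q + s • hatVec)).2.1 0 = q.2.1 0 + s := by
    have hc : Continuous fun s : ℝ => q + s • (hatVec : ℋ) := by fun_prop
    filter_upwards [hc.continuousAt.preimage_mem_nhds (x := (0 : ℝ))
      (Metric.isOpen_ball.mem_nhds (by simpa using hq))] with s hs
    have h3 := hX.level _ hs
    rw [map_add, map_smul] at h3
    simpa [hatTime_apply, hatVec, basisVec] using h3
  have hlev0 : (X q).2.1 0 = q.2.1 0 := hX.level q hq
  have ht : HasDerivAt (fun s : ℝ => (X (q + s • hatVec)).1) (K (X q)).1 0 := by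
    have h3 : HasDerivAt (fun s : ℝ => (X (q + s • hatVec) - hatProj (X (q + s • hatVec))).1)
        (K (X q) - hatProj (K (X q))).1 0 := h1.fst
    simpa [hatProj_apply] using h3
  have hu : HasDerivAt (fun s : ℝ => (X (q + s • hatVec)).2.1) (K (X q)).2.1 0 := by
    have h3 : HasDerivAt (fun s : ℝ => (X (q + s • hatVec) - hatProj (X (q + s • hatVec))).2.1)
        (K (X q) - hatProj (K (X q))).2.1 0 := h1.snd.fst
    simpa [hatProj_apply] using h3
  have hv : ∀ i : ℐ, i.val ≤ b →
      HasDerivAt (fun s : ℝ => (X (q + s • hatVec)).2.2 i) ((K (X q)).2.2 i) 0 := fun i hi => by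
    have := hasDerivAt_coord.1 h1.snd.snd i
    simpa [hatProj_apply, fibreProj_apply, hi] using this
  have hid : HasDerivAt (fun s : ℝ => q.2.1 0 + s) 1 0 := (hasDerivAt_id 0).const_add _
  refine HasDerivAt.prodMk ht (HasDerivAt.prodMk ?_ ?_)
  · refine hasDerivAt_coord.2 fun i => ?_
    simp only [sq_apply]
    split_ifs with hi
    · have : HasDerivAt (fun s : ℝ => (q.2.1 0 + s) ^ 2) (2 * (X q).2.1 0) 0 := by
        refine (hid.pow 2).congr_deriv ?_
        rw [hlev0]; simp
      exact this.congr_of_eventuallyEq (hlevel.mono fun s hs => by simp only [hs])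
    · exact hasDerivAt_coord.1 hu i
  · refine hasDerivAt_coord.2 fun i => ?_
    simp only [scaledCovector_apply]
    split_ifs with hi
    · exact hv i hi
    · have h3 : HasDerivAt (fun s : ℝ => (q.2.1 0 + s) ^ 3 * (X (q + s • hatVec)).2.2 i)
          (q.2.1 0 ^ 3 * (K (X q)).2.2 i) 0 := by
        have := hasDerivAt_coord.1 h2.snd.snd i
        simpa [hatProj_apply, fibreProj_apply, hi, hatTime_apply] using this
      have h4 : HasDerivAt (fun s : ℝ => ((q.2.1 0 + s) ^ 2)⁻¹ *
          ((q.2.1 0 + s) ^ 3 * (X (q + s • hatVec)).2.2 i))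
          (-(2 * (X q).2.2 i) + (X q).2.1 0 * (K (X q)).2.2 i) 0 := by
        refine (((hid.pow 2).inv (by simpa using h0)).mul h3).congr_deriv ?_
        rw [hlev0]
        simp
        field_simp
      refine h4.congr_of_eventuallyEq ?_
      have hne : ∀ᶠ s : ℝ in 𝓝 0, q.2.1 0 + s ≠ 0 := by
        refine hid.continuousAt.eventually_ne ?_
        simpa using h0
      filter_upwards [hlevel, hne] with s hs hs'
      rw [hs]
      field_simp

section Normal

variable (hΓ : 𝒩)
  {a : ℐ → ℐ → ℰ → ℝ}

include hΓ

theorem IsNormalCoeff.half_le : min ε 1 / 2 ≤ ε := by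
  have := hΓ.pos
  have : 0 < min ε 1 := lt_min hΓ.pos one_pos
  have := min_le_left ε 1
  linarith

theorem IsNormalCoeff.setCoord_mem_ball {r : ℝ} {U : ℰ} (hU : U ∈ ball u₀ r) :
    setX 0 U ∈ ball u₀ r := by
  rw [mem_ball_iff_norm] at hU ⊢
  refine lt_of_le_of_lt ?_ hU
  rw [EuclideanSpace.norm_eq, EuclideanSpace.norm_eq]
  refine Real.sqrt_le_sqrt (sum_le_sum fun i _ => ?_)
  by_cases h : i = 0
  · subst h
    simp only [PiLp.sub_apply, setCoord_xCoord_apply, hΓ.boundary, if_true, sub_zero, norm_zero]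
    exact pow_le_pow_left₀ le_rfl (norm_nonneg _) 2
  · simp [setCoord_xCoord_apply, h]

theorem IsNormalCoeff.raise_evenPullback {U : ℰ} (hU : U ∈ ball u₀ (min ε 1 / 2)) (i : ℐ) (v : ℰ) :
    raise (fun j k => evenPullback u₀ ε (Γ j k)) i U v = raise Γ i (sq U) v := by
  simp only [raise, evenPullback_eq hΓ.pos _ hU]

theorem IsNormalCoeff.half_ball_subset {U : ℰ}
    (hU : U ∈ ball u₀ (min ε 1 / 2)) : sq U ∈ ball u₀ ε ∩ ℍ := by
  refine sq_mem_halfBall hΓ.boundary (ball_subset_ball ?_ hU)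
  have : 0 < min ε 1 := lt_min hΓ.pos one_pos
  linarith

theorem IsNormalCoeff.evenPullback_setCoord {U : ℰ} (hU : U ∈ ball u₀ (min ε 1 / 2)) (h : ℰ → ℝ) :
    evenPullback u₀ ε h (setX 0 U) = h (setX 0 U) := by
  rw [evenPullback_eq hΓ.pos _ (hΓ.setCoord_mem_ball hU)]
  congr 1
  ext i
  by_cases hi : i = 0 <;> simp [sq_apply, setCoord_xCoord_apply, hi]

theorem IsNormalCoeff.mem_ball_of_half {U : ℰ} (hU : U ∈ ball u₀ (min ε 1 / 2)) : U ∈ ball u₀ ε :=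
  ball_subset_ball hΓ.half_le hU

theorem IsNormalCoeff.fderiv_evenPullback {U : ℰ}
    (hU : U ∈ ball u₀ (min ε 1 / 2)) (h0 : U 0 ≠ 0) (j k i : ℐ) :
    fderiv ℝ (evenPullback u₀ ε (Γ j k)) U (basisVec i) = (if i = 0 then 2 * U 0 else 1) *
        fderivWithin ℝ (Γ j k) ℍ (sq U) (basisVec i) := by
  have hx : Continuous fun u : ℰ => u 0 := (𝓍).continuous
  have hpos : ℍ ∈ 𝓝 (sq U) := by
    have : sq U ∈ ℍ₊ := by
      change 0 < sq U 0
      rw [sq_apply, if_pos rfl]; positivity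
    exact mem_of_superset ((isOpen_lt continuous_const hx).mem_nhds this)
      fun u (hu : 0 < u 0) => hu.le
  have hd : HasFDerivAt (Γ j k) (fderivWithin ℝ (Γ j k) ℍ (sq U)) (sq U) := by
    rw [fderivWithin_of_mem_nhds hpos]
    exact ((hΓ.smooth j k).contDiffAt (inter_mem (Metric.isOpen_ball.mem_nhds
      (hΓ.half_ball_subset hU).1) hpos)).differentiableAt (by simp) |>.hasFDerivAt
  have hline : HasDerivAt (fun s : ℝ => U + s • (basisVec i : ℰ)) (basisVec i) 0 :=
    hasDerivAt_add_smul _ _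
  have hG : HasDerivAt (fun s : ℝ => evenPullback u₀ ε (Γ j k) (U + s • basisVec i))
      (fderiv ℝ (evenPullback u₀ ε (Γ j k)) U (basisVec i)) 0 :=
    hasDerivAt_line ((contDiff_evenPullback hΓ.boundary hΓ.pos (hΓ.smooth j k)).differentiable
      (by simp) U).hasFDerivAt _
  have hsq : HasDerivAt (fun s : ℝ => sq (U + s • (basisVec i : ℰ)))
      ((if i = 0 then 2 * U 0 else 1) • basisVec i) 0 := by
    refine hasDerivAt_coord.2 fun l => ?_
    have hl := hasDerivAt_coord.1 hline
    simp only [sq_apply]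
    split_ifs with h1 h2 h2
    · refine ((hl 0).pow 2).congr_deriv ?_
      simp [basisVec, h1, h2]
    · refine ((hl 0).pow 2).congr_deriv ?_
      simp [basisVec, h1, Ne.symm h2]
    · refine (hl l).congr_deriv ?_
      rw [h2, PiLp.smul_apply, basisVec_apply, if_neg h1, smul_zero]
    · simpa using hl l
  have hG' : HasDerivAt (fun s : ℝ => evenPullback u₀ ε (Γ j k) (U + s • basisVec i))
      (fderivWithin ℝ (Γ j k) ℍ (sq U) ((if i = 0 then 2 * U 0 else 1) • basisVec i)) 0 := by
    have h2 : HasDerivAt (fun s : ℝ => Γ j k (sq (U + s • (basisVec i : ℰ))))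
        (fderivWithin ℝ (Γ j k) ℍ (sq U) ((if i = 0 then 2 * U 0 else 1) •
        basisVec i)) 0 := by
      refine HasFDerivAt.comp_hasDerivAt (l := Γ j k) 0 ?_ hsq
      rw [zero_smul, add_zero]
      exact hd
    refine h2.congr_of_eventuallyEq ?_
    filter_upwards [hline.continuousAt.preimage_mem_nhds (Metric.isOpen_ball.mem_nhds
      (by simpa using hU))] with s hs
    exact evenPullback_eq hΓ.pos _ hs
  rw [hG.unique hG', map_smul, smul_eq_mul]

variable (ha : ∀ j k, Smooth (a j k)) (haG : ∀ j k u, evenPullback u₀ ε (Γ j k) u =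
  evenPullback u₀ ε (Γ j k) (setX 0 u) + u 0 ^ 2 * a j k u)

include haG

theorem IsNormalCoeff.raise_eq_mul_raiseQuot {U : ℰ}
    (hU : U ∈ ball u₀ (min ε 1 / 2)) (N : ℰ) {i : ℐ} (hi : b < i.val) :
    raise (fun j k => evenPullback u₀ ε (Γ j k)) i U (scaledCovector U N) =
      U 0 * raiseQuot (fun j k => evenPullback u₀ ε (Γ j k)) a i U N := by
  simp only [raise, raiseQuot, mul_sum]
  refine sum_congr rfl fun j _ => ?_
  rw [scaledCovector_apply]
  split_ifs with hj
  · rw [haG, hΓ.evenPullback_setCoord hU, hΓ.symm, hΓ.mixed _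
      (hΓ.mem_ball_of_half (hΓ.setCoord_mem_ball hU)) (by simp [setCoord_xCoord_apply]) _ _ hj hi]
    ring
  · ring

include ha

theorem IsNormalCoeff.fderiv_eq_mul {U : ℰ}
    (hU : U ∈ ball u₀ (min ε 1 / 2)) {i j k : ℐ} (hi : b < i.val)
    (hjk : ¬ (b < j.val ∧ b < k.val)) :
    fderiv ℝ (evenPullback u₀ ε (Γ j k)) U (basisVec i) =
      U 0 ^ 2 * fderiv ℝ (a j k) U (basisVec i) := by
  have hi0 : i ≠ 0 := by rintro rfl; simp at hi
  have hline : HasDerivAt (fun s : ℝ => U + s • (basisVec i : ℰ)) (basisVec i) 0 :=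
    hasDerivAt_add_smul _ _
  have hcomp : ∀ {h : ℰ → ℝ}, Smooth h →
      HasDerivAt (fun s : ℝ => h (U + s • basisVec i)) (fderiv ℝ h U (basisVec i)) 0 := fun hh =>
    hasDerivAt_line (hh.differentiable (by simp) U).hasFDerivAt _
  have h1 := hcomp (contDiff_evenPullback hΓ.boundary hΓ.pos (hΓ.smooth j k))
  have h2 := ((hcomp (ha j k)).const_mul (U 0 ^ 2)).const_add (evenPullback u₀ ε (Γ j k) (setX 0 U))
  refine h1.unique (h2.congr_of_eventuallyEq ?_)
  filter_upwards [hline.continuousAt.preimage_mem_nhds (Metric.isOpen_ball.mem_nhds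
    (by simpa using hU))] with s hs
  have hs' : U + s • basisVec i ∈ ball u₀ (min ε 1 / 2) := hs
  have h3 : (U + s • basisVec i) 0 = U 0 := by simp [basisVec, Ne.symm hi0]
  rw [haG, h3, hΓ.evenPullback_setCoord hs', hΓ.evenPullback_setCoord hU]
  congr 1
  have m1 := hΓ.mem_ball_of_half (hΓ.setCoord_mem_ball hs')
  have m2 := hΓ.mem_ball_of_half (hΓ.setCoord_mem_ball hU)
  have z1 : ∀ u : ℰ, setX 0 u 0 = 0 := fun u => by simp [setCoord_xCoord_apply]
  rcases le_or_gt j.val b with hj | hj <;> rcases le_or_gt k.val b with hk | hk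
  · refine hΓ.base _ m1 _ m2 (z1 _) (z1 _) (fun l hl => ?_) j k hj hk
    have hli : l ≠ i := by rintro rfl; omega
    rw [setCoord_xCoord_apply, setCoord_xCoord_apply]
    simp [basisVec, hli]
  · rw [hΓ.mixed _ m1 (z1 _) _ _ hj hk, hΓ.mixed _ m2 (z1 _) _ _ hj hk]
  · rw [hΓ.symm, hΓ.symm j, hΓ.mixed _ m1 (z1 _) _ _ hk hj, hΓ.mixed _ m2 (z1 _) _ _ hk hj]
  · exact absurd ⟨hj, hk⟩ hjk

theorem IsNormalCoeff.quadDeriv_eq_mul {U : ℰ}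
    (hU : U ∈ ball u₀ (min ε 1 / 2)) (N : ℰ) {i : ℐ} (hi : b < i.val) :
    quadDeriv (fun j k => evenPullback u₀ ε (Γ j k)) i U (scaledCovector U N) =
      U 0 ^ 2 * quadDerivQuot (fun j k => evenPullback u₀ ε (Γ j k)) a i U N := by
  simp only [quadDeriv, quadDerivQuot, mul_sum]
  refine sum_congr rfl fun j _ => sum_congr rfl fun k _ => ?_
  split_ifs with hjk
  · rw [scaledCovector_apply, scaledCovector_apply, if_neg (by omega), if_neg (by omega)]
    ring
  · rw [hΓ.fderiv_eq_mul ha haG hU hi hjk]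
    ring

/-- The field `liftField` lifts a multiple of the Hamilton vector field. -/
theorem IsNormalCoeff.pushVec_liftField {κ : ℝ → ℝ} {Y : ℋ}
    (hU : Y.2.1 ∈ ball u₀ (min ε 1 / 2)) (h0 : Y.2.1 0 ≠ 0)
    (hD : ϱ (blowDown Y) ≠ 0)
    (hκ : κ (ϱ (blowDown Y)) = (ϱ (blowDown Y))⁻¹) :
    pushVec Y (liftField (fun j k => evenPullback u₀ ε (Γ j k)) a κ Y) =
      (-(Y.2.1 0 * ϱ (blowDown Y))⁻¹) • hatField Γ (blowDown Y) := by
  obtain ⟨t, U, N⟩ := Y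
  simp only [blowDown] at hU h0 hD hκ ⊢
  set D := raise Γ 0 (sq U) (scaledCovector U N) with hDdef
  have hM : ∀ i, raise (fun j k => evenPullback u₀ ε (Γ j k)) i U (scaledCovector U N) =
      raise Γ i (sq U) (scaledCovector U N) := fun i => hΓ.raise_evenPullback hU i _
  have hQ : ∀ i, quadDeriv (fun j k => evenPullback u₀ ε (Γ j k)) i U (scaledCovector U N) =
      (if i = 0 then 2 * U 0 else 1) * halfQuadDeriv Γ i (sq U) (scaledCovector U N) := fun i => by
    simp only [quadDeriv, halfQuadDeriv, hΓ.fderiv_evenPullback hU h0, mul_sum, mul_assoc]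
  have hx : sq U 0 = U 0 ^ 2 := by rw [sq_apply, if_pos rfl]
  have h0b : ∀ i : ℐ, i = 0 → i.val ≤ b := fun i hi => by rw [hi]; exact zero_val_le
  refine Prod.ext ?_ (Prod.ext ?_ ?_)
  · simp only [pushVec, liftField, hatField, hM, ← hDdef, hκ, Prod.smul_fst, smul_eq_mul, hx]
    field_simp
  · ext i
    simp only [pushVec, liftField, hatField, hM, ← hDdef, hκ, Prod.smul_snd, Prod.smul_fst,
      PiLp.smul_apply, smul_eq_mul, hx, edgeScale]
    split_ifs with h1 h2 h2
    · subst h1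
      rw [← hDdef]
      field_simp
    · exact absurd (h0b i h1) h2
    · field_simp
    · have := hΓ.raise_eq_mul_raiseQuot haG hU N (i := i) (by omega)
      rw [hM] at this
      rw [this]
      field_simp
  · ext i
    simp only [pushVec, liftField, hatField, hM, hQ, ← hDdef, hκ, Prod.smul_snd,
      PiLp.smul_apply, smul_eq_mul, hx, edgeScale]
    split_ifs with h1 h2 h2
    · have h3 : ∑ j, fibreProj (scaledCovector U N) j * raise Γ j (sq U) (scaledCovector U N) =
          U 0 * ∑ j, fibreProj N j * raise Γ j (sq U) (scaledCovector U N) := by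
        rw [mul_sum]
        refine sum_congr rfl fun j _ => ?_
        simp only [fibreProj_apply, scaledCovector_apply]
        split_ifs <;> ring
      rw [h3]
      field_simp
      ring
    · field_simp
      try ring
    · exact absurd (h0b i h2) h1
    · have h3 := hΓ.quadDeriv_eq_mul ha haG hU N (i := i) (by omega)
      rw [hQ, if_neg h2, one_mul] at h3
      rw [h3, scaledCovector_apply, if_neg h1]
      field_simp
      ring

end Normal

theorem IsFlowBox.exists_shrink {V : Type*} [NormedAddCommGroup V] [NormedSpace ℝ V] {K : V → V}
    {P : V →L[ℝ] V} {ℓ : V →L[ℝ] ℝ} {e : V} {ρ : V →L[ℝ] V} {p₀ : V} {X Ξ : V → V} {ε δ : ℝ}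
    (h : IsFlowBox K P ℓ e ρ p₀ X Ξ ε δ) {s : Set V} (hs : s ∈ 𝓝 p₀) :
    ∃ ε' > 0, ∃ δ' > 0, ε' ≤ ε ∧ δ' ≤ δ ∧ ball p₀ ε' ⊆ s ∧ IsFlowBox K P ℓ e ρ p₀ X Ξ ε' δ' := by
  obtain ⟨r, hr, hrs⟩ := Metric.mem_nhds_iff.1 hs
  have hε' : 0 < min ε r := lt_min h.pos hr
  have hc : ContinuousAt Ξ p₀ := h.smooth_inv.continuousOn.continuousAt (ball_mem_nhds p₀ h.pos_inv)
  obtain ⟨d, hd, hds⟩ := Metric.mem_nhds_iff.1 (hc.preimage_mem_nhds (t := ball p₀ (min ε r))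
    (by rw [h.inv_center]; exact ball_mem_nhds p₀ hε'))
  have hδ' : 0 < min δ d := lt_min h.pos_inv hd
  have h1 : ball p₀ (min ε r) ⊆ ball p₀ ε := ball_subset_ball (min_le_left _ _)
  have h2 : ball p₀ (min δ d) ⊆ ball p₀ δ := ball_subset_ball (min_le_left _ _)
  exact ⟨min ε r, hε', min δ d, hδ', min_le_left _ _, min_le_left _ _,
    (ball_subset_ball (min_le_right _ _)).trans hrs,
    { pos := hε'
      pos_inv := hδ'
      smooth := h.smooth.mono h1
      smooth_inv := h.smooth_inv.mono h2
      maps_inv := fun Y hY => hds (ball_subset_ball (min_le_right _ _) hY)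
      initial := fun q hq => h.initial q (h1 hq)
      proj := h.proj
      level := fun q hq => h.level q (h1 hq)
      hasDerivAt := fun q hq => h.hasDerivAt q (h1 hq)
      odd := fun q hq => h.odd q (h1 hq)
      inv_odd := fun q hq => h.inv_odd q (h2 hq)
      proj_inv := fun q hq => h.proj_inv q (h2 hq)
      right_inv := fun q hq => h.right_inv q (h2 hq)
      left_inv := fun q hq => h.left_inv q (h1 hq)
      inv_center := h.inv_center }⟩

/-! ### The flowout as a graph -/

theorem fibreProj_fibreProj (v : ℰ) : fibreProj (fibreProj v) = fibreProj v := by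
  ext i; simp only [fibreProj_apply]; split_ifs <;> rfl

/-- The inverse of `blowDown` on the components other than the fibre covector. -/
noncomputable def sqrtLift (Y : ℋ) : ℋ := (Y.1, setX √(Y.2.1 0) Y.2.1, Y.2.2 - fibreProj Y.2.2)

theorem setCoord_hatTime (c : ℝ) (Y : ℋ) :
    setCoord hatTime hatVec c Y = (Y.1, setX c Y.2.1, Y.2.2) := by
  refine Prod.ext ?_ (Prod.ext ?_ ?_)
  · simp [setCoord, hatVec]
  · simp [setCoord, hatVec, hatTime_apply]
  · simp [setCoord, hatVec]

theorem continuous_sqrtLift : Continuous (sqrtLift : ℋ → ℋ) := by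
  have hx : Continuous fun Y : ℋ => Y.2.1 0 :=
    (𝓍).continuous.comp (by fun_prop : Continuous fun Y : ℋ => Y.2.1)
  have h1 : Continuous fun Y : ℋ => setX √(Y.2.1 0) Y.2.1 := by
    simp only [setCoord, xCoord_apply]
    exact (continuous_fst.comp continuous_snd).add ((hx.sqrt.sub hx).smul continuous_const)
  exact continuous_fst.prodMk (h1.prodMk (by fun_prop))

/-- The image of the flow box under `blowDown` is the graph of the function `Z`, smooth up to
`x = 0`, which gives the fibre covector in terms of the remaining variables. -/
structure IsHatGraph (Γ : ℐ → ℐ → ℰ → ℝ) (u₀ : ℰ) (ε : ℝ) (p₀ : ℋ) (K X Ξ : ℋ → ℋ) (Z : ℋ → ℰ)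
    (r δ η : ℝ) : Prop extends IsFlowBox K hatProj hatTime hatVec hatReflect p₀ X Ξ r δ where
  coeff : 𝒩
  center : p₀.2.1 = u₀
  fibre : fibreProj p₀.2.2 = 0
  pos_hat : 0 < η
  flow : ∀ q ∈ ball p₀ r, q.2.1 0 ≠ 0 → HasDerivAt (fun s : ℝ => blowDown (X (q + s • hatVec)))
      ((-(q.2.1 0 * ϱ (blowDown (X q)))⁻¹) • hatField Γ (blowDown (X q))) 0
  mem_ball : ∀ q ∈ ball p₀ r, (X q).2.1 ∈ ball u₀ (min ε 1 / 2)
  raise_pos : ∀ q ∈ ball p₀ r, 0 < raise Γ 0 u₀ p₀.2.2 * ϱ (blowDown (X q))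
  smooth_Z : SmoothOn Z {Y | 0 ≤ Y.2.1 0}
  zero_Z : ∀ Y, Y.2.1 0 = 0 → Z Y = 0
  fibre_Z : ∀ Y, fibreProj (Z Y) = Z Y
  proj_Z : ∀ Y, Z (Y - hatProj Y) = Z Y
  lift_mem : ∀ Y ∈ ball p₀ η, 0 ≤ Y.2.1 0 → sqrtLift Y ∈ ball p₀ δ
  graph : ∀ Y ∈ ball p₀ η, 0 ≤ Y.2.1 0 →
    blowDown (X (Ξ (sqrtLift Y))) = (Y.1, Y.2.1, Y.2.2 - fibreProj Y.2.2 + Z Y)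
  lift_blowDown : ∀ q ∈ ball p₀ r, 0 ≤ q.2.1 0 → sqrtLift (blowDown (X q)) = X q - hatProj (X q)
  fibre_blowDown : ∀ q ∈ ball p₀ r, 0 ≤ q.2.1 0 →
    fibreProj (blowDown (X q)).2.2 = Z (blowDown (X q))

set_option hygiene false in
local notation "𝒢" => IsHatGraph Γ u₀ ε p₀ K X Ξ Z r δ η

theorem IsHatGraph.center_time (h : 𝒢) : p₀.2.1 0 = 0 := by rw [h.center, h.coeff.boundary]

theorem IsHatGraph.raise_ne (h : 𝒢) (q : ℋ) (hq : q ∈ ball p₀ r) :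
    ϱ (blowDown (X q)) ≠ 0 := fun h0 => by
  have := h.raise_pos q hq
  rw [h0, mul_zero] at this
  exact lt_irrefl _ this

theorem exists_isHatGraph (hΓ : 𝒩) (t₀ : ℝ) {N₀ : ℰ} (hN₀ : fibreProj N₀ = 0)
    (hD : raise Γ 0 u₀ N₀ ≠ 0) :
    ∃ K X Ξ Z, ∃ r δ η : ℝ, IsHatGraph Γ u₀ ε (t₀, u₀, N₀) K X Ξ Z r δ η := by
  set p₀ : ℋ := (t₀, u₀, N₀) with hp₀
  set G : ℐ → ℐ → ℰ → ℝ := fun j k => evenPullback u₀ ε (Γ j k) with hGdef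
  have hG : ∀ j k, Smooth (G j k) := fun j k =>
    contDiff_evenPullback hΓ.boundary hΓ.pos (hΓ.smooth j k)
  have hGe : ∀ j k u, G j k (flip u) = G j k u := fun j k u => evenPullback_flip hΓ.boundary ε _ u
  choose a ha hae haG using fun j k => exists_eq_add_sq_mul (hG j k) (hGe j k)
  set D := raise Γ 0 u₀ N₀ with hDdef
  set κ : ℝ → ℝ := cutoff (fun x => (x - D) ^ 2) (D ^ 2) (fun x => x⁻¹) with hκdef
  have hκ : Smooth κ := by
    refine contDiff_cutoff (by fun_prop) (by positivity) fun x hx => ?_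
    have hx' : x ≠ 0 := by
      rintro rfl
      have : (0 - D) ^ 2 < D ^ 2 := hx
      simp at this
    exact ((contDiffAt_id).inv hx').contDiffWithinAt
  have hflip₀ : flip u₀ = u₀ := by ext i; by_cases h : i = 0 <;> simp [flip_apply, h, hΓ.boundary]
  have hxe : hatTime (hatVec : ℋ) = 1 := by rw [hatTime_apply]; simp [hatVec, basisVec]
  have hPP : ∀ v : ℋ, hatProj (hatProj v) = hatProj v := fun v => by
    simp only [hatProj_apply, fibreProj_fibreProj]
  obtain ⟨X, Ξ, r₀, δ₀, hbox⟩ := exists_isFlowBox (contDiff_liftField hG ha hκ)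
    (P := hatProj) hPP (ℓ := hatTime) (e := hatVec) hxe
    (by simp [hatProj_apply, hatVec]) (fun v => by simp [hatTime_apply, hatProj_apply])
    (fun v => by simp [hatTime_apply, liftField]) (ρ := hatReflect) (p₀ := p₀)
    (fun v => by
      have h1 : ‖v.2.2 - (2 : ℝ) • fibreProj v.2.2‖ = ‖v.2.2‖ := by
        rw [EuclideanSpace.norm_eq, EuclideanSpace.norm_eq]
        congr 1
        refine sum_congr rfl fun i _ => ?_
        rw [reflect_fibre_apply]
        split_ifs <;> simp
      rw [hatReflect_apply, Prod.norm_def, Prod.norm_def, Prod.norm_def, Prod.norm_def]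
      simp only [norm_flip, h1])
    (by rw [hatReflect_apply]; simp [hp₀, hN₀, hflip₀])
    (fun v => by
      rw [hatReflect_apply, hatProj_apply, hatProj_apply, hatReflect_apply]
      simp [fibreProj_fibreProj])
    (fun v => liftField_reflect hG ha hGe hae v)
    (fun v => by simp [hatTime_apply, hatReflect_apply, flip_apply])
    (by simp [hatReflect_apply, hatVec, flip_basisVec])
    (fun v h1 h2 => by
      have h3 : fibreProj v.2.2 = 0 := by
        rw [hatProj_apply] at h1
        exact congrArg (fun w : ℋ => w.2.2) h1
      have h4 : flip v.2.1 = v.2.1 := by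
        have : v.2.1 0 = 0 := h2
        ext i; by_cases h : i = 0 <;> simp [flip_apply, h, this]
      rw [hatReflect_apply, h3, h4]
      simp)
    (by rw [hatTime_apply]; exact hΓ.boundary)
    (by rw [hatProj_apply, hp₀, hN₀]; rfl)
  -- the function whose composition with the square root of `x` is the graph
  let d : ℋ → ℝ := fun W => (W.1 - t₀) ^ 2 + ‖W.2.1 - u₀‖ ^ 2 + ‖W.2.2 - fibreProj W.2.2 - N₀‖ ^ 2
  have hd : Smooth d := by
    refine ((ContDiff.pow (by fun_prop) 2).add (ContDiff.norm_sq ℝ (by fun_prop))).add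
      (ContDiff.norm_sq ℝ ?_)
    exact ((contDiff_snd.comp contDiff_snd).sub ((fibreProj (b := b) (f := f)).contDiff.comp
      (contDiff_snd.comp contDiff_snd))).sub contDiff_const
  have hdball : ∀ W, d W < δ₀ ^ 2 → W - hatProj W ∈ ball p₀ δ₀ := fun W hW => by
    have e1 : W - hatProj W - p₀ = (W.1 - t₀, W.2.1 - u₀, W.2.2 - fibreProj W.2.2 - N₀) := by
      rw [hatProj_apply]
      refine Prod.ext ?_ (Prod.ext ?_ ?_) <;> simp [hp₀]
    rw [mem_ball_iff_norm, e1, Prod.norm_def, Prod.norm_def, max_lt_iff, max_lt_iff]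
    have hδ := hbox.pos_inv
    have p1 := sq_nonneg (W.1 - t₀)
    have p2 := sq_nonneg ‖W.2.1 - u₀‖
    have p3 := sq_nonneg ‖W.2.2 - fibreProj W.2.2 - N₀‖
    have hW' : (W.1 - t₀) ^ 2 + ‖W.2.1 - u₀‖ ^ 2 + ‖W.2.2 - fibreProj W.2.2 - N₀‖ ^ 2 < δ₀ ^ 2 := hW
    refine ⟨?_, ?_, ?_⟩
    · rw [norm_eq_abs]
      exact abs_lt_of_sq_lt_sq (by linarith) hδ.le
    · exact lt_of_pow_lt_pow_left₀ 2 hδ.le (by linarith)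
    · exact lt_of_pow_lt_pow_left₀ 2 hδ.le (by linarith)
  let F : ℋ → ℰ := fun W => W.2.1 0 • fibreProj (X (Ξ (W - hatProj W))).2.2
  have hF : SmoothOn F {W | d W < δ₀ ^ 2} := by
    have h1 : SmoothOn (fun W : ℋ => X (Ξ (W - hatProj W))) {W | d W < δ₀ ^ 2} := by
      refine hbox.smooth.comp (hbox.smooth_inv.comp
        (contDiff_id.sub hatProj.contDiff).contDiffOn fun W hW => hdball W hW) fun W hW => ?_
      exact hbox.maps_inv _ (hdball W hW)
    exact ((hatTime (b := b) (f := f)).contDiff.contDiffOn).smul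
      ((fibreProj (b := b) (f := f)).contDiff.comp_contDiffOn
        (contDiff_snd.comp contDiff_snd |>.comp_contDiffOn h1))
  let F' : ℋ → ℰ := cutoff d (δ₀ ^ 2) F
  have hF' : Smooth F' := contDiff_cutoff hd (by have := hbox.pos_inv; positivity) hF
  have hsetflip : ∀ W : ℋ, setCoord hatTime hatVec (-hatTime W) W = (W.1, flip W.2.1, W.2.2) := by
    intro W
    rw [setCoord_hatTime, hatTime_apply, ← xCoord_apply, setCoord_neg_eq_flip]
  have hdflip : ∀ W : ℋ, d (W.1, flip W.2.1, W.2.2) = d W := fun W => by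
    have : ‖flip W.2.1 - u₀‖ = ‖W.2.1 - u₀‖ := by rw [← norm_flip (W.2.1 - u₀), map_sub, hflip₀]
    simp only [d, this]
  have hF'even : ∀ W, F' (setCoord hatTime hatVec (-hatTime W) W) = F' W := fun W => by
    rw [hsetflip]
    simp only [F', cutoff, hdflip]
    by_cases hW : d W < δ₀ ^ 2
    · congr 1
      have e1 : ((W.1, flip W.2.1, W.2.2) : ℋ) -
          hatProj ((W.1, flip W.2.1, W.2.2) : ℋ) = hatReflect (W - hatProj W) := by
        rw [hatReflect_apply, hatProj_apply, hatProj_apply]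
        refine Prod.ext ?_ (Prod.ext ?_ ?_)
        · simp
        · simp
        · simp [fibreProj_fibreProj]
      have hb := hdball W hW
      simp only [F]
      rw [e1, hbox.inv_odd _ hb, hbox.odd _ (hbox.maps_inv _ hb), hatReflect_apply, flip_apply,
        if_pos rfl]
      simp only [map_sub, map_smul, fibreProj_fibreProj]
      module
    · have h1 : Real.smoothTransition (2 - 4 * d W / δ₀ ^ 2) = 0 := by
        refine Real.smoothTransition.zero_of_nonpos ?_
        have hδ : 0 < δ₀ ^ 2 := by have := hbox.pos_inv; positivity
        have : 1 ≤ d W / δ₀ ^ 2 := by rw [le_div_iff₀ hδ]; linarith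
        rw [mul_div_assoc]; linarith
      rw [h1, zero_smul, zero_smul]
  let Z : ℋ → ℰ := fun Y => F' (setCoord hatTime hatVec √(hatTime Y) Y)
  have hZ : SmoothOn Z {Y | 0 ≤ Y.2.1 0} := contDiffOn_comp_sqrt_of_even hxe hF' hF'even
  have hZset : ∀ Y, Z Y = F' (Y.1, setX √(Y.2.1 0) Y.2.1, Y.2.2) := by
    intro Y
    simp only [Z, setCoord_hatTime, hatTime_apply]
  have hF'zero : ∀ W : ℋ, W.2.1 0 = 0 → F' W = 0 := fun W hW => by
    simp only [F', cutoff, F, hW, zero_smul, smul_zero]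
  have hF'eq : ∀ W : ℋ, d W < δ₀ ^ 2 / 4 →
      F' W = W.2.1 0 • fibreProj (X (Ξ (W - hatProj W))).2.2 := fun W hW => by
    exact cutoff_of_le (by have := hbox.pos_inv; positivity) _ hW.le
  have hXc : ContinuousAt X p₀ := hbox.smooth.continuousOn.continuousAt (ball_mem_nhds p₀ hbox.pos)
  have hXp : X p₀ = p₀ := hbox.initial p₀ (mem_ball_self hbox.pos) hΓ.boundary
    (by rw [hatProj_apply, hp₀, hN₀]; rfl)
  have hd₀ : d p₀ = 0 := by simp [d, hp₀, hN₀]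
  have hm : 0 < min ε 1 := lt_min hΓ.pos one_pos
  -- a neighbourhood in which the cutoffs play no role
  have hGD : Continuous fun Y : ℋ => raise G 0 Y.2.1 (scaledCovector Y.2.1 Y.2.2) := by
    have hU : Smooth fun Y : ℋ => Y.2.1 := contDiff_fst.comp contDiff_snd
    have hUc : ∀ i, Continuous fun Y : ℋ => Y.2.1 i := fun i =>
      ((contDiff_euclidean.1 hU) i).continuous
    have hN : Smooth fun Y : ℋ => Y.2.2 := contDiff_snd.comp contDiff_snd
    have hNc : ∀ i, Continuous fun Y : ℋ => Y.2.2 i := fun i =>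
      ((contDiff_euclidean.1 hN) i).continuous
    refine continuous_finsetSum _ fun j _ => ((hG 0 j).continuous.comp hU.continuous).mul ?_
    simp only [scaledCovector_apply]
    split_ifs
    exacts [hNc j, (hUc 0).mul (hNc j)]
  have hsc₀ : scaledCovector u₀ N₀ = N₀ := by
    ext i
    rw [scaledCovector_apply]
    split_ifs with h
    · rfl
    · have := congrArg (fun w : ℰ => w i) hN₀
      simp only [fibreProj_apply, h, if_false] at this
      rw [this]; simp
  have hsq₀ : sq u₀ = u₀ := by ext i; by_cases h : i = 0 <;> simp [sq_apply, h, hΓ.boundary]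
  have hu₀mem : u₀ ∈ ball u₀ (min ε 1 / 2) := mem_ball_self (by linarith)
  have hGD₀ : raise G 0 u₀ (scaledCovector u₀ N₀) = D := by
    rw [hsc₀, hGdef, hΓ.raise_evenPullback hu₀mem, hsq₀]
  have hs : {q | (X q).2.1 ∈ ball u₀ (min ε 1 / 2) ∧
      |raise G 0 (X q).2.1 (scaledCovector (X q).2.1 (X q).2.2) - D| < |D| / 2 ∧
      d (X q) < δ₀ ^ 2 / 4} ∈ 𝓝 p₀ := by
    refine inter_mem ?_ (inter_mem ?_ ?_)
    · refine (continuous_fst.comp continuous_snd).continuousAt.comp hXc |>.preimage_mem_nhds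
        (Metric.isOpen_ball.mem_nhds ?_)
      change (X p₀).2.1 ∈ ball u₀ (min ε 1 / 2)
      rw [hXp]; exact hu₀mem
    · have hc : ContinuousAt
          (fun q => |raise G 0 (X q).2.1 (scaledCovector (X q).2.1 (X q).2.2) - D|)
          p₀ := (((hGD.continuousAt.comp hXc)).sub continuousAt_const).abs
      refine hc.preimage_mem_nhds (isOpen_Iio.mem_nhds ?_)
      have : (X p₀).2.1 = u₀ ∧ (X p₀).2.2 = N₀ := by rw [hXp]; exact ⟨rfl, rfl⟩
      change |raise G 0 (X p₀).2.1 (scaledCovector (X p₀).2.1 (X p₀).2.2) - D| < |D| / 2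
      rw [this.1, this.2, hGD₀, sub_self, abs_zero]
      have := abs_pos.2 hD
      linarith
    · have hc : ContinuousAt (fun q => d (X q)) p₀ := hd.continuous.continuousAt.comp hXc
      refine hc.preimage_mem_nhds (isOpen_Iio.mem_nhds ?_)
      have hδ := hbox.pos_inv
      have h1 : d (X p₀) = 0 := by rw [hXp]; exact hd₀
      change d (X p₀) < _
      rw [h1]
      positivity
  obtain ⟨r, hr, δ, hδ, hrr, hδδ, hrs, hbox'⟩ := hbox.exists_shrink hs
  have hlift₀ : sqrtLift p₀ = p₀ := by
    have : setX √(u₀ 0) u₀ = u₀ := by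
      rw [hΓ.boundary, Real.sqrt_zero]
      ext i
      rw [setCoord_xCoord_apply]
      split_ifs with h <;> simp [h, hΓ.boundary]
    simp [sqrtLift, hp₀, hN₀, this]
  have hs2 : {Y : ℋ | sqrtLift Y ∈ ball p₀ δ ∧ d (sqrtLift Y) < δ₀ ^ 2 / 4} ∈ 𝓝 p₀ := by
    refine inter_mem ?_ ?_
    · refine continuous_sqrtLift.continuousAt.preimage_mem_nhds (Metric.isOpen_ball.mem_nhds ?_)
      rw [hlift₀]; exact mem_ball_self hδ
    · refine (hd.continuous.comp continuous_sqrtLift).continuousAt.preimage_mem_nhds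
        (isOpen_Iio.mem_nhds ?_)
      have hδ := hbox.pos_inv
      have h1 : d (sqrtLift p₀) = 0 := by rw [hlift₀]; exact hd₀
      change d (sqrtLift p₀) < _
      rw [h1]
      positivity
  obtain ⟨η, hη, hηs⟩ := Metric.mem_nhds_iff.1 hs2
  have hliftP : ∀ Y : ℋ, sqrtLift Y - hatProj (sqrtLift Y) = sqrtLift Y := fun Y => by
    rw [hatProj_apply]
    refine Prod.ext ?_ (Prod.ext ?_ ?_) <;> simp [sqrtLift, fibreProj_fibreProj]
  have hdP : ∀ W W' : ℋ, W.1 = W'.1 → W.2.1 = W'.2.1 →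
      W.2.2 - fibreProj W.2.2 = W'.2.2 - fibreProj W'.2.2 → d W = d W' := fun W W' h1 h2 h3 => by
    simp only [d, h1, h2, h3]
  have hF'P : ∀ W W' : ℋ, W.1 = W'.1 → W.2.1 = W'.2.1 →
      W.2.2 - fibreProj W.2.2 = W'.2.2 - fibreProj W'.2.2 → F' W = F' W' := fun W W' h1 h2 h3 => by
    have h4 : W - hatProj W = W' - hatProj W' := by
      rw [hatProj_apply, hatProj_apply]
      refine Prod.ext ?_ (Prod.ext ?_ ?_)
      · simpa using h1
      · simpa using h2
      · exact h3
    simp only [F', cutoff, F, hdP W W' h1 h2 h3, h4, h2]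
  have hblow : ∀ q ∈ ball p₀ r, 0 ≤ q.2.1 0 →
      setX √((blowDown (X q)).2.1 0) (blowDown (X q)).2.1 = (X q).2.1 := by
    intro q hq h0
    have h1 : (X q).2.1 0 = q.2.1 0 := hbox'.level q hq
    ext i
    simp only [blowDown, setCoord_xCoord_apply, sq_apply, if_true]
    split_ifs with h
    · rw [h, Real.sqrt_sq (by rw [h1]; exact h0)]
    · rfl
  have hscP : ∀ U N : ℰ, scaledCovector U N - fibreProj (scaledCovector U N) = N - fibreProj N := by
    intro U N
    ext i
    simp only [PiLp.sub_apply, fibreProj_apply, scaledCovector_apply]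
    split_ifs <;> simp
  refine ⟨liftField G a κ, X, Ξ, Z, r, δ, η, {
      toIsFlowBox := hbox'
      coeff := hΓ
      center := rfl
      fibre := hN₀
      pos_hat := hη
      flow := fun q hq h0 => ?_
      mem_ball := fun q hq => (hrs hq).1
      raise_pos := fun q hq => ?_
      smooth_Z := hZ
      zero_Z := fun Y hY => ?_
      fibre_Z := fun Y => ?_
      proj_Z := fun Y => ?_
      lift_mem := fun Y hY _ => (hηs hY).1
      graph := fun Y hY h0 => ?_
      lift_blowDown := fun q hq h0 => ?_
      fibre_blowDown := fun q hq h0 => ?_ }⟩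
  · have h1 := hasDerivAt_blowDown hbox' hq h0
    have h2 : (X q).2.1 0 = q.2.1 0 := hbox'.level q hq
    obtain ⟨m1, m2, -⟩ := hrs hq
    have m3 : raise G 0 (X q).2.1 (scaledCovector (X q).2.1 (X q).2.2) =
        ϱ (blowDown (X q)) := hΓ.raise_evenPullback m1 _ _
    rw [m3] at m2
    have m4 : ϱ (blowDown (X q)) ≠ 0 := fun h => by
      rw [h, zero_sub, abs_neg] at m2
      have := abs_pos.2 hD
      linarith
    have h3 := hΓ.pushVec_liftField ha haG m1 (by rw [h2]; exact h0) m4 (κ := κ) (by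
      refine cutoff_of_le (by positivity) _ ?_
      have := sq_lt_sq' (by linarith [(abs_lt.1 m2).1, neg_abs_le (|D| / 2)]) (abs_lt.1 m2).2
      rw [div_pow, sq_abs] at this
      norm_num at this ⊢
      exact this.le)
    rw [h3, h2] at h1
    exact h1
  · obtain ⟨m1, m2, -⟩ := hrs hq
    have m3 : raise G 0 (X q).2.1 (scaledCovector (X q).2.1 (X q).2.2) =
        ϱ (blowDown (X q)) := hΓ.raise_evenPullback m1 _ _
    rw [m3] at m2
    have h1 : (ϱ (blowDown (X q)) - D) ^ 2 < (D / 2) ^ 2 := by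
      rw [sq_lt_sq, abs_div, abs_two]; exact m2
    have := sq_pos_of_ne_zero hD
    change 0 < D * _
    nlinarith [sq_nonneg (ϱ (blowDown (X q)))]
  · rw [hZset]
    refine hF'zero _ ?_
    simp [setCoord_xCoord_apply, hY]
  · rw [hZset]
    simp only [F', cutoff, F, map_smul, fibreProj_fibreProj]
  · rw [hZset, hZset]
    refine hF'P _ _ ?_ ?_ ?_
    · simp [hatProj_apply]
    · simp [hatProj_apply]
    · simp [hatProj_apply, fibreProj_fibreProj]
  · obtain ⟨m1, m2⟩ := hηs hY
    have h1 := hbox'.right_inv _ m1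
    rw [hliftP] at h1
    have hZY : Z Y = √(Y.2.1 0) • fibreProj (X (Ξ (sqrtLift Y))).2.2 := by
      rw [hZset, hF'P (Y.1, setX √(Y.2.1 0) Y.2.1, Y.2.2) (sqrtLift Y) rfl rfl
        (by simp [sqrtLift, fibreProj_fibreProj]), hF'eq _ m2,
        hliftP]
      simp [sqrtLift, setCoord_xCoord_apply]
    set W := X (Ξ (sqrtLift Y)) with hW
    have e1 : W.1 = Y.1 := by
      have := congrArg (fun w : ℋ => w.1) h1
      simpa [hatProj_apply, sqrtLift] using this
    have e2 : W.2.1 = setX √(Y.2.1 0) Y.2.1 := by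
      have := congrArg (fun w : ℋ => w.2.1) h1
      simpa [hatProj_apply, sqrtLift] using this
    have e3 : W.2.2 - fibreProj W.2.2 = Y.2.2 - fibreProj Y.2.2 := by
      have := congrArg (fun w : ℋ => w.2.2) h1
      simpa [hatProj_apply, sqrtLift] using this
    refine Prod.ext e1 (Prod.ext ?_ ?_)
    · change sq W.2.1 = Y.2.1
      rw [e2]
      ext i
      rw [sq_apply, setCoord_xCoord_apply, setCoord_xCoord_apply, if_pos rfl, Real.sq_sqrt h0]
      split_ifs with h
      · rw [h]
      · rfl
    · change scaledCovector W.2.1 W.2.2 = Y.2.2 - fibreProj Y.2.2 + Z Y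
      rw [hZY, ← e3]
      ext i
      simp only [scaledCovector_apply, PiLp.add_apply, PiLp.sub_apply, PiLp.smul_apply,
        fibreProj_apply, smul_eq_mul]
      split_ifs with h
      · simp
      · rw [e2, setCoord_xCoord_apply, if_pos rfl]; ring
  · rw [hatProj_apply]
    refine Prod.ext ?_ (Prod.ext ?_ ?_)
    · simp [sqrtLift, blowDown]
    · simpa [sqrtLift] using hblow q hq h0
    · simp only [sqrtLift, blowDown, hscP]
      simp
  · have e0 : X (q - hatProj q) = X q := hbox'.proj q
    have hdX := (hrs hq).2.2
    have h1 : (X q).2.1 0 = q.2.1 0 := hbox'.level q hq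
    rw [hZset, hblow q hq h0,
      hF'P ((blowDown (X q)).1, (X q).2.1, (blowDown (X q)).2.2) (X q) rfl rfl (hscP _ _),
        hF'eq _ hdX,
      hbox'.left_inv q hq, e0]
    ext i
    simp only [blowDown, fibreProj_apply, scaledCovector_apply, PiLp.smul_apply, smul_eq_mul]
    split_ifs <;> simp

/-! ### The decay of the defect along bicharacteristics -/

theorem uniqueDiffOn_halfSpace {E : Type*} [NormedAddCommGroup E] [NormedSpace ℝ E] {ℓ : E →L[ℝ] ℝ}
    {e : E} (he : ℓ e = 1) : UniqueDiffOn ℝ {Y | 0 ≤ ℓ Y} := by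
  refine uniqueDiffOn_convex ?_ ⟨e, ?_⟩
  · exact convex_halfSpace_ge ℓ.isLinear 0
  · rw [mem_interior_iff_mem_nhds]
    refine mem_of_superset ((isOpen_lt continuous_const ℓ.continuous).mem_nhds
      (x := e) (by change 0 < ℓ e; rw [he]; exact one_pos)) fun Y (hY : 0 < ℓ Y) => hY.le

theorem uniqueDiffOn_coordHalf : UniqueDiffOn ℝ ℍ := uniqueDiffOn_halfSpace xCoord_basisVec

theorem hatTime_hatVec : hatTime (hatVec : ℋ) = 1 := by rw [hatTime_apply]; simp [hatVec, basisVec]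

theorem uniqueDiffOn_hatHalf : UniqueDiffOn ℝ {Y : ℋ | 0 ≤ Y.2.1 0} :=
  uniqueDiffOn_halfSpace hatTime_hatVec

/-- The part of the half space over which the coefficients are smooth. -/
def hatDomain (u₀ : ℰ) (ε : ℝ) : Set ℋ := {Y | 0 ≤ Y.2.1 0} ∩ {Y | Y.2.1 ∈ ball u₀ ε}

theorem isOpen_hatBall (u₀ : ℰ) (ε : ℝ) : IsOpen {Y : ℋ | Y.2.1 ∈ ball u₀ ε} :=
  Metric.isOpen_ball.preimage (continuous_fst.comp continuous_snd)

theorem convex_hatDomain (u₀ : ℰ) (ε : ℝ) : Convex ℝ (hatDomain u₀ ε) := by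
  refine (convex_halfSpace_ge (hatTime (b := b) (f := f)).isLinear 0).inter ?_
  exact (convex_ball u₀ ε).is_linear_preimage ((fst ℝ _ _).comp (snd ℝ ℝ _)).isLinear

theorem uniqueDiffOn_hatDomain (u₀ : ℰ) (ε : ℝ) : UniqueDiffOn ℝ (hatDomain u₀ ε) :=
  uniqueDiffOn_hatHalf.inter (isOpen_hatBall u₀ ε)

theorem contDiff_hat_pos (i : ℐ) : Smooth fun Y : ℋ => Y.2.1 i :=
  contDiff_euclidean.1 (contDiff_fst.comp contDiff_snd) i

theorem contDiff_hat_cov (i : ℐ) : Smooth fun Y : ℋ => Y.2.2 i :=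
  contDiff_euclidean.1 (contDiff_snd.comp contDiff_snd) i

section

variable (hΓ : 𝒩)

include hΓ

theorem IsNormalCoeff.contDiffOn_fderivWithin (i j k : ℐ) :
    SmoothOn (fun u => fderivWithin ℝ (Γ j k) ℍ u (basisVec i)) (ball u₀ ε ∩ ℍ) := by
  have huniq : UniqueDiffOn ℝ (ball u₀ ε ∩ ℍ) := by
    rw [Set.inter_comm]
    exact uniqueDiffOn_coordHalf.inter isOpen_ball
  have h := ((hΓ.smooth j k).fderivWithin huniq (m := ∞) (by simp)).clm_apply
    (contDiffOn_const (c := basisVec i))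
  refine h.congr fun u hu => ?_
  rw [Set.inter_comm, fderivWithin_inter (Metric.isOpen_ball.mem_nhds hu.1)]

theorem IsNormalCoeff.contDiffOn_raise (i : ℐ) :
    SmoothOn (fun Y : ℋ => raise Γ i Y.2.1 Y.2.2) (hatDomain u₀ ε) :=
  ContDiffOn.sum fun j _ => ((hΓ.smooth i j).comp
    ((contDiff_fst.comp contDiff_snd).contDiffOn) fun _ hY => ⟨hY.2, hY.1⟩).mul
      (contDiff_hat_cov j).contDiffOn

theorem IsNormalCoeff.contDiffOn_hatField : SmoothOn (hatField Γ) (hatDomain u₀ ε) := by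
  have hM := hΓ.contDiffOn_raise
  have hx : ∀ i : ℐ, SmoothOn (fun Y : ℋ => edgeScale (Y.2.1 0) i) (hatDomain u₀ ε) := by
    intro i
    simp only [edgeScale]
    split_ifs
    exacts [(contDiff_hat_pos 0).contDiffOn, contDiffOn_const]
  have hQ : ∀ i, SmoothOn (fun Y : ℋ => halfQuadDeriv Γ i Y.2.1 Y.2.2) (hatDomain u₀ ε) := fun i =>
    ContDiffOn.sum fun j _ => ContDiffOn.sum fun k _ =>
      (((hΓ.contDiffOn_fderivWithin i j k).comp ((contDiff_fst.comp contDiff_snd).contDiffOn)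
        fun _ hY => ⟨hY.2, hY.1⟩).mul (contDiff_hat_cov j).contDiffOn).mul
          (contDiff_hat_cov k).contDiffOn
  have hf : ∀ j, Smooth fun Y : ℋ => fibreProj Y.2.2 j := fun j =>
    (contDiff_euclidean.1 ((fibreProj (b := b) (f := f)).contDiff.comp
      (contDiff_snd.comp contDiff_snd))) j
  refine ContDiffOn.prodMk ?_ (ContDiffOn.prodMk ?_ ?_)
  · exact (contDiff_const.mul (contDiff_hat_pos 0)).contDiffOn
  · refine contDiffOn_euclidean.2 fun i => ?_
    exact ((contDiffOn_const.mul (hx i)).mul (hM i)).neg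
  · refine contDiffOn_euclidean.2 fun i => ?_
    refine ((hx i).mul (hQ i)).add ?_
    split_ifs
    exacts [(contDiffOn_const.mul (ContDiffOn.sum fun j _ => (hf j).contDiffOn.mul (hM j))).neg,
      contDiffOn_const, (contDiffOn_const.mul (hM 0)).mul (contDiff_hat_cov i).contDiffOn]

/-- At the boundary the fibre derivatives only see the fibre block of the metric. -/
theorem IsNormalCoeff.fderivWithin_eq_zero {i j k : ℐ} (hi : b < i.val)
    (hjk : ¬ (b < j.val ∧ b < k.val)) :
    fderivWithin ℝ (Γ j k) ℍ u₀ (basisVec i) = 0 := by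
  have hi0 : i ≠ 0 := by rintro rfl; simp at hi
  have hu₀ : u₀ ∈ ball u₀ ε := mem_ball_self hΓ.pos
  have hd := ((hΓ.smooth j k) u₀ ⟨hu₀, hΓ.boundary.ge⟩).differentiableWithinAt (by simp)
  rw [Set.inter_comm, differentiableWithinAt_inter (Metric.isOpen_ball.mem_nhds hu₀)] at hd
  have hz : ∀ s : ℝ, (u₀ + s • (basisVec i : ℰ)) 0 = 0 := fun s => by
    simp [basisVec, Ne.symm hi0, hΓ.boundary]
  have h1 := hasDerivAt_line_of_within hd.hasFDerivWithinAt (.of_forall fun s => (hz s).ge)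
  refine h1.unique ((hasDerivAt_const 0 (Γ j k u₀)).congr_of_eventuallyEq ?_)
  filter_upwards [eventually_add_smul_mem (isOpen_ball.mem_nhds hu₀) _] with s hs'
  rcases le_or_gt j.val b with hj | hj <;> rcases le_or_gt k.val b with hk | hk
  · refine hΓ.base _ hs' _ hu₀ (hz s) hΓ.boundary (fun l hl => ?_) j k hj hk
    have hli : l ≠ i := by rintro rfl; omega
    simp [basisVec, hli]
  · rw [hΓ.mixed _ hs' (hz s) _ _ hj hk, hΓ.mixed _ hu₀ hΓ.boundary _ _ hj hk]
  · rw [hΓ.symm, hΓ.symm j, hΓ.mixed _ hs' (hz s) _ _ hk hj, hΓ.mixed _ hu₀ hΓ.boundary _ _ hk hj]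
  · exact absurd ⟨hj, hk⟩ hjk

end

/-- The deviation of the fibre covector from the graph of `Z`. -/
noncomputable def defect (Z : ℋ → ℰ) (Y : ℋ) : ℰ := fibreProj Y.2.2 - Z Y

/-- Along a bicharacteristic this is, up to a factor, the derivative of `x` times the defect. -/
noncomputable def defectRate (Γ : ℐ → ℐ → ℰ → ℝ) (Z : ℋ → ℰ) (Y : ℋ) : ℰ :=
  fderivWithin ℝ (defect Z) {Y | 0 ≤ Y.2.1 0} Y (hatField Γ Y) - (2 * ϱ Y) • defect Z Y

theorem IsHatGraph.center_mem (h : 𝒢) : p₀ ∈ hatDomain u₀ ε :=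
  ⟨h.center_time.ge, by change p₀.2.1 ∈ ball u₀ ε; rw [h.center]; exact mem_ball_self h.coeff.pos⟩

theorem IsHatGraph.continuousWithinAt_raise (h : 𝒢) :
    ContinuousWithinAt (fun Y : ℋ => ϱ Y) {Y | 0 ≤ Y.2.1 0} p₀ :=
  (continuousWithinAt_inter ((isOpen_hatBall u₀ ε).mem_nhds h.center_mem.2)).1
    ((h.coeff.contDiffOn_raise 0).continuousOn p₀ h.center_mem)

theorem IsHatGraph.contDiffOn_defect (h : 𝒢) : SmoothOn (defect Z) {Y | 0 ≤ Y.2.1 0} :=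
  ((fibreProj (b := b) (f := f)).contDiff.comp
    (contDiff_snd.comp contDiff_snd)).contDiffOn.sub h.smooth_Z

theorem IsHatGraph.fibreProj_defect (h : 𝒢) (Y : ℋ) : fibreProj (defect Z Y) = defect Z Y := by
  simp only [defect, map_sub, fibreProj_fibreProj, h.fibre_Z]

theorem hat_halfSpace_mem_nhds {Y : ℋ} (hY : 0 < Y.2.1 0) : {Y : ℋ | 0 ≤ Y.2.1 0} ∈ 𝓝 Y :=
  mem_of_superset ((isOpen_lt continuous_const
    (contDiff_hat_pos (b := b) (f := f) 0).continuous).mem_nhds hY)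
      fun Z (hZ : 0 < Z.2.1 0) => hZ.le

theorem IsHatGraph.hasFDerivAt_defect (h : 𝒢) {Y : ℋ} (hY : 0 < Y.2.1 0) :
    HasFDerivAt (defect Z) (fderivWithin ℝ (defect Z) {Y | 0 ≤ Y.2.1 0} Y) Y := by
  rw [fderivWithin_of_mem_nhds (hat_halfSpace_mem_nhds hY)]
  exact ((h.contDiffOn_defect.contDiffAt (hat_halfSpace_mem_nhds hY)).differentiableAt
    (by simp)).hasFDerivAt

theorem IsHatGraph.time_pos (h : 𝒢) {Y : ℋ} (hY : Y ∈ ball p₀ η) (hx : 0 ≤ Y.2.1 0) :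
    (Ξ (sqrtLift Y)).2.1 0 = √(Y.2.1 0) := by
  have h1 := h.lift_mem Y hY hx
  have h2 := h.right_inv _ h1
  have h3 : (X (Ξ (sqrtLift Y))).2.1 0 = (Ξ (sqrtLift Y)).2.1 0 := h.level _ (h.maps_inv _ h1)
  have h4 := congrArg (fun w : ℋ => w.2.1 0) h2
  rw [← h3]
  simpa [hatProj_apply, sqrtLift, setCoord_xCoord_apply] using h4

theorem IsHatGraph.blowDown_eq (h : 𝒢) {Y : ℋ}
    (hY : Y ∈ ball p₀ η) (hx : 0 ≤ Y.2.1 0) (h0 : defect Z Y = 0) :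
    blowDown (X (Ξ (sqrtLift Y))) = Y := by
  rw [h.graph Y hY hx]
  have : fibreProj Y.2.2 = Z Y := sub_eq_zero.1 h0
  rw [this]
  simp

/-- The graph is invariant under the Hamilton flow. -/
theorem IsHatGraph.defectRate_eq_zero (h : 𝒢) {Y : ℋ}
    (hY : Y ∈ ball p₀ η) (hx : 0 < Y.2.1 0) (h0 : defect Z Y = 0) :
    defectRate Γ Z Y = 0 := by
  have hq := h.maps_inv _ (h.lift_mem Y hY hx.le)
  have hb := h.blowDown_eq hY hx.le h0
  have ht := h.time_pos hY hx.le
  set q := Ξ (sqrtLift Y) with hqdef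
  have htpos : 0 < q.2.1 0 := by rw [ht]; exact Real.sqrt_pos.2 hx
  have hflow := h.flow q hq htpos.ne'
  have hne := h.raise_ne q hq
  rw [hb] at hflow hne
  have hD : HasFDerivAt (defect Z) (fderivWithin ℝ (defect Z) {Y | 0 ≤ Y.2.1 0} Y)
      (blowDown (X (q + (0 : ℝ) • hatVec))) := by
    rw [zero_smul, add_zero, hb]
    exact h.hasFDerivAt_defect hx
  have h1 := hD.comp_hasDerivAt (0 : ℝ) hflow
  have hc : Continuous fun s : ℝ => q + s • (hatVec : ℋ) := by fun_prop
  have h2 : HasDerivAt (defect Z ∘ fun s : ℝ => blowDown (X (q + s • hatVec))) 0 0 := by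
    refine (hasDerivAt_const (0 : ℝ) (0 : ℰ)).congr_of_eventuallyEq ?_
    filter_upwards [hc.continuousAt.preimage_mem_nhds (x := 0)
      (Metric.isOpen_ball.mem_nhds (by simpa using hq)), hc.continuousAt.preimage_mem_nhds
      (x := 0) (hat_halfSpace_mem_nhds (by simpa using htpos))] with s hs hs'
    exact sub_eq_zero.2 (h.fibre_blowDown _ hs hs')
  have h3 := h1.unique h2
  rw [map_smul, smul_eq_zero] at h3
  rw [defectRate, h0, smul_zero, sub_zero]
  refine h3.resolve_left ?_
  exact neg_ne_zero.2 (inv_ne_zero (mul_ne_zero htpos.ne' hne))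

theorem IsHatGraph.fderivWithin_defect_of_tangent (h : 𝒢)
    {Y v : ℋ} (hY : Y.2.1 0 = 0) (hv : v.2.1 0 = 0) :
    fderivWithin ℝ (defect Z) {Y | 0 ≤ Y.2.1 0} Y v = fibreProj v.2.2 := by
  have hz : ∀ s : ℝ, (Y + s • v).2.1 0 = 0 := fun s => by simp [hY, hv]
  have h1 := hasDerivAt_line_of_within (.of_forall fun s => (hz s).ge) (h := ((h.contDiffOn_defect Y
    hY.ge).differentiableWithinAt (by simp)).hasFDerivWithinAt)
  simp only [defect, h.zero_Z _ (hz _), sub_zero] at h1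
  exact h1.unique (hasDerivAt_line
    (fibreProj.comp ((snd ℝ _ _).comp (snd ℝ ℝ (ℰ × ℰ)))).hasFDerivAt v)

theorem IsHatGraph.defectRate_boundary (h : 𝒢) {Y : ℋ} (hY : Y.2.1 0 = 0) (i : ℐ) :
    defectRate Γ Z Y i = if i.val ≤ b then 0 else halfQuadDeriv Γ i Y.2.1 Y.2.2 := by
  have h1 : (hatField Γ Y).2.1 0 = 0 := by simp [hatField, edgeScale, hY]
  rw [defectRate, h.fderivWithin_defect_of_tangent hY h1, defect, h.zero_Z Y hY, sub_zero]
  have hi0 : ¬ i.val ≤ b → i ≠ 0 := fun hi h => hi (by rw [h]; exact zero_val_le)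
  simp only [PiLp.sub_apply, PiLp.smul_apply, fibreProj_apply, hatField, smul_eq_mul, edgeScale]
  split_ifs with h1 h2
  · simp
  · exact absurd h2 (hi0 h1)
  · ring

/-- The defect and its rate at points near the centre: the rate is of second order. -/
theorem IsHatGraph.exists_norm_defectRate_le (h : 𝒢) (hD : raise Γ 0 u₀ p₀.2.2 ≠ 0) :
    ∃ θ > 0, θ ≤ η ∧ ∀ Y ∈ ball p₀ θ, 0 < Y.2.1 0 → ‖defectRate Γ Z Y‖ ≤ |ϱ Y| * ‖defect Z Y‖ := by
  set S := hatDomain u₀ ε with hS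
  have hp0 := h.center_time
  have hpS : p₀ ∈ S := h.center_mem
  have hEsm : SmoothOn (defectRate Γ Z) S := by
    have h1 := (h.contDiffOn_defect.fderivWithin uniqueDiffOn_hatHalf (m := ∞) (by simp)).mono
      (Set.inter_subset_left : S ⊆ _)
    exact (h1.clm_apply h.coeff.contDiffOn_hatField).sub
      ((contDiffOn_const.mul (h.coeff.contDiffOn_raise 0)).smul
        (h.contDiffOn_defect.mono Set.inter_subset_left))
  have huniq := uniqueDiffOn_hatDomain u₀ ε
  have hder : ∀ Y ∈ S,
      HasFDerivWithinAt (defectRate Γ Z) (fderivWithin ℝ (defectRate Γ Z) S Y) S Y :=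
    fun Y hY => ((hEsm Y hY).differentiableWithinAt (by simp)).hasFDerivWithinAt
  have hcont : ContinuousWithinAt (fderivWithin ℝ (defectRate Γ Z) S) S p₀ :=
    (hEsm.continuousOn_fderivWithin huniq (by simp)) p₀ hpS
  -- in the fibre directions the rate is a quadratic form at the boundary
  have hfib : ∀ w : ℰ, fibreProj w = w →
      fderivWithin ℝ (defectRate Γ Z) S p₀ ((0, 0, w) : ℋ) = 0 := fun w hw => by
    have hu : ∀ s : ℝ, (p₀ + s • ((0, 0, w) : ℋ)).2.1 = u₀ := fun s => by simp [h.center]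
    have hmaps : ∀ s : ℝ, p₀ + s • ((0, 0, w) : ℋ) ∈ S := fun s =>
      ⟨by change 0 ≤ (p₀ + s • ((0, 0, w) : ℋ)).2.1 0; rw [hu, h.coeff.boundary],
       by
         change (p₀ + s • ((0, 0, w) : ℋ)).2.1 ∈ ball u₀ ε
         rw [hu]; exact mem_ball_self h.coeff.pos⟩
    refine (hasDerivAt_line_of_within (hder p₀ hpS) (.of_forall hmaps)).unique ?_
    let c : ℰ := WithLp.toLp 2 fun i => if i.val ≤ b then 0 else
      ∑ j, ∑ k, fderivWithin ℝ (Γ j k) ℍ u₀ (basisVec i) * w j * w k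
    have h2 : (fun s : ℝ => defectRate Γ Z (p₀ + s • ((0, 0, w) : ℋ))) = fun s => s ^ 2 • c := by
      funext s
      ext i
      have hz : (p₀ + s • ((0, 0, w) : ℋ)).2.1 0 = 0 := by rw [hu, h.coeff.boundary]
      simp only [h.defectRate_boundary hz, hu, PiLp.smul_apply, smul_eq_mul, c]
      split_ifs with hi
      · simp
      · simp only [halfQuadDeriv, mul_sum]
        refine sum_congr rfl fun j _ => sum_congr rfl fun k _ => ?_
        by_cases hjk : b < j.val ∧ b < k.val
        · have hfj : ∀ j : ℐ, b < j.val → p₀.2.2 j = 0 := fun j hj => by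
            have := congrArg (fun w : ℰ => w j) h.fibre
            simpa [fibreProj_apply, not_le.2 hj] using this
          simp only [Prod.snd_add, Prod.smul_snd, PiLp.add_apply, PiLp.smul_apply, smul_eq_mul,
            hfj j hjk.1, hfj k hjk.2]
          ring
        · rw [h.coeff.fderivWithin_eq_zero (by omega) hjk]
          ring
    rw [h2]
    have := ((hasDerivAt_id (0 : ℝ)).pow 2).smul_const c
    simpa using this
  set D := raise Γ 0 u₀ p₀.2.2 with hDdef
  have hD' := abs_pos.2 hD
  obtain ⟨ν, hν, hest⟩ := exists_ball_norm_sub_sub_le (convex_hatDomain u₀ ε) hder hcont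
    (ε := |D| / 2) (by positivity)
  let Yz : ℋ → ℋ := fun Y => (Y.1, Y.2.1, Y.2.2 - fibreProj Y.2.2 + Z Y)
  have hYz0 : Yz p₀ = p₀ := by simp [Yz, h.fibre, h.zero_Z p₀ hp0]
  have hYzc : ContinuousWithinAt Yz {Y | 0 ≤ Y.2.1 0} p₀ := by
    refine ContinuousWithinAt.prodMk (by fun_prop) (ContinuousWithinAt.prodMk (by fun_prop) ?_)
    exact ContinuousWithinAt.add (by fun_prop) (h.smooth_Z.continuousOn p₀ hp0.ge)
  have hev : ∀ᶠ Y in 𝓝[{Y | 0 ≤ Y.2.1 0}] p₀, Yz Y ∈ ball p₀ (min ν η) ∧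
      |D| / 2 < |ϱ Y| ∧ Y.2.1 ∈ ball u₀ ε := by
    refine Eventually.and ?_ (Eventually.and ?_ ?_)
    · refine hYzc.eventually (Metric.isOpen_ball.mem_nhds ?_)
      rw [hYz0]; exact mem_ball_self (lt_min hν h.pos_hat)
    · refine h.continuousWithinAt_raise.abs.eventually (isOpen_Ioi.mem_nhds ?_)
      change |D| / 2 < |ϱ p₀|
      rw [h.center]; linarith
    · exact mem_nhdsWithin_of_mem_nhds ((isOpen_hatBall u₀ ε).mem_nhds hpS.2)
  obtain ⟨θ, hθ, hθs⟩ := Metric.mem_nhdsWithin_iff.1 hev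
  refine ⟨min θ (min ν η), lt_min hθ (lt_min hν h.pos_hat),
    (min_le_right _ _).trans (min_le_right _ _), fun Y hY hx => ?_⟩
  obtain ⟨e1, e2, e3⟩ := hθs ⟨ball_subset_ball (min_le_left _ _) hY, hx.le⟩
  have hYν : Y ∈ ball p₀ ν := ball_subset_ball ((min_le_right _ _).trans (min_le_left _ _)) hY
  have hdz : defect Z (Yz Y) = 0 := by
    have h1 : Z (Yz Y) = Z Y := by
      rw [← h.proj_Z, ← h.proj_Z Y]
      congr 1
      simp only [hatProj_apply, Yz]
      refine Prod.ext ?_ (Prod.ext ?_ ?_) <;> simp [fibreProj_fibreProj, h.fibre_Z]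
    rw [defect, h1]
    simp [Yz, fibreProj_fibreProj, h.fibre_Z]
  have hYzη := ball_subset_ball (min_le_right ν η) e1
  have hrz := h.defectRate_eq_zero hYzη (by exact hx) hdz
  have hYzS : Yz Y ∈ S := ⟨hx.le, e3⟩
  have hYS : Y ∈ S := ⟨hx.le, e3⟩
  have hdiff : Y - Yz Y = (0, 0, defect Z Y) := by
    refine Prod.ext ?_ (Prod.ext ?_ ?_)
    · simp [Yz]
    · simp [Yz]
    · simp only [Yz, defect, Prod.snd_sub]; abel
  have h1 := hest (Yz Y) ⟨ball_subset_ball (min_le_left ν η) e1, hYzS⟩ Y ⟨hYν, hYS⟩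
  rw [hrz, hdiff, hfib _ (h.fibreProj_defect Y), sub_zero, sub_zero] at h1
  refine h1.trans ?_
  have h2 : ‖((0, 0, defect Z Y) : ℋ)‖ = ‖defect Z Y‖ := by simp [Prod.norm_def]
  rw [h2]
  exact mul_le_mul_of_nonneg_right e2.le (norm_nonneg _)

/-! ### The wave symbol in canonical coordinates -/

variable (Γ)

/-- The canonical coordinates of the covector with time component `τ` over `x > 0` whose class
modulo scaling is given by `Y`. The formula makes sense up to `x = 0`. -/
noncomputable def canonLift (τ : ℝ) (Y : ℋ) : ℙ :=
  (Y.1, Y.2.1, τ, WithLp.toLp 2 fun i => τ * (if i.val ≤ b then 1 else Y.2.1 0) * Y.2.2 i)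

/-- The components in the edge frame of a covector in canonical coordinates, divided by the
time component. -/
noncomputable def hatOf (w : ℙ) : ℋ := (w.1, w.2.1, WithLp.toLp 2 fun i =>
    w.2.2.2 i / ((if i.val ≤ b then 1 else w.2.1 0) * w.2.2.1))

/-- The wave symbol in canonical coordinates, for the inverse `Γ` of the matrix of `x⁻² g` in the
edge frame. -/
noncomputable def modelSymbol (w : ℙ) : ℝ :=
  w.2.2.1 ^ 2 - ∑ j, ∑ k, Γ j k w.2.1 * (w.2.2.2 j / (if j.val ≤ b then 1 else w.2.1 0)) *
    (w.2.2.2 k / (if k.val ≤ b then 1 else w.2.1 0))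

/-- The quadratic form `Γ`. -/
noncomputable def quad (u v : ℰ) : ℝ := ∑ j, v j * raise Γ j u v

variable {Γ}

theorem hatOf_canonLift {τ : ℝ} (hτ : τ ≠ 0) {Y : ℋ} (hx : Y.2.1 0 ≠ 0) :
    hatOf (canonLift τ Y) = Y := by
  refine Prod.ext rfl (Prod.ext rfl ?_)
  ext i
  simp only [hatOf, canonLift]
  split_ifs <;> field_simp

theorem canonLift_hatOf {w : ℙ} (hτ : w.2.2.1 ≠ 0) (hx : w.2.1 0 ≠ 0) :
    canonLift w.2.2.1 (hatOf w) = w := by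
  refine Prod.ext rfl (Prod.ext rfl (Prod.ext rfl ?_))
  ext i
  simp only [hatOf, canonLift]
  split_ifs <;> field_simp

theorem modelSymbol_canonLift {τ : ℝ} {Y : ℋ} (hx : Y.2.1 0 ≠ 0) :
    modelSymbol Γ (canonLift τ Y) = τ ^ 2 * (1 - quad Γ Y.2.1 Y.2.2) := by
  simp only [modelSymbol, canonLift, quad, raise, mul_sub, mul_one, mul_sum]
  congr 1
  refine sum_congr rfl fun j _ => sum_congr rfl fun k _ => ?_
  split_ifs <;> field_simp

theorem hasDerivAt_quadraticForm {ι : Type*} [Fintype ι] {G : ι → ι → ℝ → ℝ} {q : ι → ℝ → ℝ}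
    {G' : ι → ι → ℝ} {q' : ι → ℝ} {s : ℝ} (hsymm : ∀ j k, G j k s = G k j s)
    (hG : ∀ j k, HasDerivAt (G j k) (G' j k) s) (hq : ∀ j, HasDerivAt (q j) (q' j) s) :
    HasDerivAt (fun s => ∑ j, ∑ k, G j k s * q j s * q k s)
      ((∑ j, ∑ k, G' j k * q j s * q k s) + 2 * ∑ j, q' j * ∑ k, G j k s * q k s) s := by
  have h : HasDerivAt (fun s => ∑ j, ∑ k, G j k s * q j s * q k s)
      (∑ j, ∑ k, ((G' j k * q j s + G j k s * q' j) * q k s + G j k s * q j s * q' k)) s :=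
    HasDerivAt.fun_sum fun j _ => HasDerivAt.fun_sum fun k _ => ((hG j k).mul (hq j)).mul (hq k)
  refine h.congr_deriv ?_
  have e1 : ∑ j, ∑ k, G j k s * q j s * q' k = ∑ j, q' j * ∑ k, G j k s * q k s := by
    rw [sum_comm]
    refine sum_congr rfl fun j _ => ?_
    rw [mul_sum]
    refine sum_congr rfl fun k _ => ?_
    rw [hsymm]; ring
  have e2 : ∑ j, ∑ k, (G' j k * q j s + G j k s * q' j) * q k s =
      (∑ j, ∑ k, G' j k * q j s * q k s) + ∑ j, q' j * ∑ k, G j k s * q k s := by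
    simp only [mul_sum, ← sum_add_distrib]
    refine sum_congr rfl fun j _ => sum_congr rfl fun k _ => ?_
    ring
  simp only [sum_add_distrib] at e1 e2 ⊢
  rw [e1, e2]
  ring

/-- The Hamilton vector field of the wave symbol at `canonLift τ Y`. -/
noncomputable def modelField (Γ : ℐ → ℐ → ℰ → ℝ) (τ : ℝ) (Y : ℋ) : ℙ := (2 * τ,
   WithLp.toLp 2 fun i => -(2 * τ * raise Γ i Y.2.1 Y.2.2) / (if i.val ≤ b then 1 else Y.2.1 0),
   0,
   WithLp.toLp 2 fun i => τ ^ 2 * (halfQuadDeriv Γ i Y.2.1 Y.2.2 -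
     if i = 0 then 2 / Y.2.1 0 * ∑ j, fibreProj Y.2.2 j * raise Γ j Y.2.1 Y.2.2 else 0))

theorem coord_halfSpace_mem_nhds {u : ℰ} (hu : 0 < u 0) : ℍ ∈ 𝓝 u :=
  mem_of_superset ((isOpen_lt continuous_const (𝓍).continuous).mem_nhds (show 0 < xCoord u from hu))
      fun v (hv : 0 < xCoord v) => hv.le

theorem contDiffAt_phase (w : ℙ) :
    SmoothAt (fun w : ℙ => w.2.1 0) w ∧ ∀ i, SmoothAt (fun w : ℙ => w.2.2.2 i) w :=
  ⟨(contDiff_euclidean.1 (contDiff_fst.comp contDiff_snd) 0).contDiffAt, fun i =>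
    (contDiff_euclidean.1 (contDiff_snd.comp (contDiff_snd.comp contDiff_snd)) i).contDiffAt⟩

section Hamilton

variable (hΓ : 𝒩)

include hΓ

theorem IsNormalCoeff.contDiffAt {u : ℰ} (hu : u ∈ ball u₀ ε) (hx : 0 < u 0)
    (j k : ℐ) : SmoothAt (Γ j k) u :=
  (hΓ.smooth j k).contDiffAt (inter_mem (Metric.isOpen_ball.mem_nhds hu)
    (coord_halfSpace_mem_nhds hx))

theorem IsNormalCoeff.hasFDerivAt {u : ℰ} (hu : u ∈ ball u₀ ε) (hx : 0 < u 0) (j k : ℐ) :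
    HasFDerivAt (Γ j k) (fderivWithin ℝ (Γ j k) ℍ u) u := by
  rw [fderivWithin_of_mem_nhds (coord_halfSpace_mem_nhds hx)]
  exact ((hΓ.contDiffAt hu hx j k).differentiableAt (by simp)).hasFDerivAt

theorem IsNormalCoeff.contDiffAt_modelSymbol {w : ℙ} (hu : w.2.1 ∈ ball u₀ ε)
    (hx : 0 < w.2.1 0) : SmoothAt (modelSymbol Γ) w := by
  obtain ⟨hui, hv⟩ := contDiffAt_phase w
  have hq : ∀ j : ℐ, SmoothAt
      (fun w : ℙ => w.2.2.2 j / (if j.val ≤ b then 1 else w.2.1 0)) w := fun j => by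
    split_ifs
    exacts [(hv j).div contDiffAt_const one_ne_zero, (hv j).div hui hx.ne']
  have hG : ∀ j k, SmoothAt (fun w : ℙ => Γ j k w.2.1) w := fun j k =>
    (hΓ.contDiffAt hu hx j k).comp w (contDiff_fst.comp contDiff_snd).contDiffAt
  exact ((contDiff_fst.comp (contDiff_snd.comp contDiff_snd)).contDiffAt.pow 2).sub
    (ContDiffAt.sum fun j _ => ContDiffAt.sum fun k _ => ((hG j k).mul (hq j)).mul (hq k))

/-- The derivative of the wave symbol along a line in phase space. -/
theorem IsNormalCoeff.fderiv_modelSymbol {τ : ℝ} {Y : ℋ}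
    (hu : Y.2.1 ∈ ball u₀ ε) (hx : 0 < Y.2.1 0) (δ : ℙ) :
    fderiv ℝ (modelSymbol Γ) (canonLift τ Y) δ = 2 * τ * δ.2.2.1 -
      (τ ^ 2 * (∑ j, ∑ k, fderivWithin ℝ (Γ j k) ℍ Y.2.1 δ.2.1 * Y.2.2 j * Y.2.2 k) +
        2 * τ * ∑ j, (if j.val ≤ b then δ.2.2.2 j else
          (δ.2.2.2 j - τ * Y.2.2 j * δ.2.1 0) / Y.2.1 0) * raise Γ j Y.2.1 Y.2.2) := by
  set w := canonLift τ Y with hw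
  have hline : HasDerivAt (fun s : ℝ => w + s • δ) δ 0 := hasDerivAt_add_smul _ _
  have h1 : HasDerivAt (fun s : ℝ => modelSymbol Γ (w + s • δ))
      (fderiv ℝ (modelSymbol Γ) w δ) 0 := by
    exact hasDerivAt_line
      ((hΓ.contDiffAt_modelSymbol (w := w) hu hx).differentiableAt (by simp)).hasFDerivAt δ
  have hpos : HasDerivAt (fun s : ℝ => Y.2.1 + s • δ.2.1) δ.2.1 0 := hasDerivAt_add_smul _ _
  have hxd : HasDerivAt (fun s : ℝ => Y.2.1 0 + s * δ.2.1 0) (δ.2.1 0) 0 := by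
    simpa using ((hasDerivAt_id (0 : ℝ)).mul_const (δ.2.1 0)).const_add (Y.2.1 0)
  have hτd : HasDerivAt (fun s : ℝ => (τ + s * δ.2.2.1) ^ 2) (2 * τ * δ.2.2.1) 0 := by
    refine ((((hasDerivAt_id (0 : ℝ)).mul_const δ.2.2.1).const_add τ).pow 2).congr_deriv ?_
    simp
  have hG : ∀ j k, HasDerivAt (fun s : ℝ => Γ j k (Y.2.1 + s • δ.2.1))
      (fderivWithin ℝ (Γ j k) ℍ Y.2.1 δ.2.1) 0 := fun j k =>
    hasDerivAt_line (hΓ.hasFDerivAt hu hx j k) _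
  have hq : ∀ j : ℐ, HasDerivAt (fun s : ℝ => (w.2.2.2 j + s * δ.2.2.2 j) /
      (if j.val ≤ b then 1 else Y.2.1 0 + s * δ.2.1 0)) (if j.val ≤ b then δ.2.2.2 j else
          (δ.2.2.2 j - τ * Y.2.2 j * δ.2.1 0) / Y.2.1 0) 0 := fun j => by
    have h2 : HasDerivAt (fun s : ℝ => w.2.2.2 j + s * δ.2.2.2 j) (δ.2.2.2 j) 0 := by
      simpa using ((hasDerivAt_id (0 : ℝ)).mul_const (δ.2.2.2 j)).const_add (w.2.2.2 j)
    split_ifs with hj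
    · simpa using h2
    · have h3 := h2.div hxd (by simpa using hx.ne')
      refine h3.congr_deriv ?_
      have : w.2.2.2 j = τ * Y.2.1 0 * Y.2.2 j := by simp [hw, canonLift, hj]
      rw [this]
      have := hx.ne'
      simp
      field_simp
  have h4 := hτd.sub (hasDerivAt_quadraticForm
    (G := fun j k s => Γ j k (Y.2.1 + s • δ.2.1)) (fun j k => hΓ.symm j k _) hG hq)
  have h5 : (fun s : ℝ => modelSymbol Γ (w + s • δ)) = fun s : ℝ => (τ + s * δ.2.2.1) ^ 2 -
      ∑ j : ℐ, ∑ k : ℐ, Γ j k (Y.2.1 + s • δ.2.1) *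
        ((w.2.2.2 j + s * δ.2.2.2 j) / (if j.val ≤ b then 1 else Y.2.1 0 + s * δ.2.1 0)) *
        ((w.2.2.2 k + s * δ.2.2.2 k) / (if k.val ≤ b then 1 else Y.2.1 0 + s * δ.2.1 0)) := by
    funext s
    simp [modelSymbol, hw, canonLift]
  rw [h5] at h1
  rw [h1.unique h4]
  have hw' : ∀ j : ℐ, (w.2.2.2 j + 0 * δ.2.2.2 j) /
      (if j.val ≤ b then 1 else Y.2.1 0 + 0 * δ.2.1 0) = τ * Y.2.2 j := fun j => by
    have := hx.ne'
    simp only [hw, canonLift, zero_mul, add_zero]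
    split_ifs
    · ring
    · field_simp
  simp only [hw', zero_smul, add_zero, raise, mul_sum]
  congr 1
  congr 1
  · refine sum_congr rfl fun j _ => sum_congr rfl fun k _ => ?_
    ring
  · refine sum_congr rfl fun j _ => sum_congr rfl fun k _ => ?_
    ring

theorem IsNormalCoeff.hamiltonField_modelSymbol {τ : ℝ} {Y : ℋ}
    (hu : Y.2.1 ∈ ball u₀ ε) (hx : 0 < Y.2.1 0) :
    hamiltonField (modelSymbol Γ) (canonLift τ Y) = modelField Γ τ Y := by
  have hF := hΓ.fderiv_modelSymbol (τ := τ) hu hx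
  refine Prod.ext ?_ (Prod.ext ?_ (Prod.ext ?_ ?_))
  · change fderiv ℝ (modelSymbol Γ) _ _ = _
    rw [hF]
    simp [modelField]
  · ext i
    change fderiv ℝ (modelSymbol Γ) _ _ = -(2 * τ * raise Γ i Y.2.1 Y.2.2) / _
    rw [hF]
    simp only [map_zero, zero_mul, Finset.sum_const_zero, mul_zero, basisVec_apply, PiLp.zero_apply,
      sub_zero, zero_add]
    rw [sum_eq_single i]
    · simp only [↓reduceIte]
      split_ifs <;> ring
    · intro j _ hj
      simp [hj]
    · simp
  · change -fderiv ℝ (modelSymbol Γ) _ _ = _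
    rw [hF]
    simp [modelField]
  · ext i
    change -fderiv ℝ (modelSymbol Γ) _ _ = τ ^ 2 * (halfQuadDeriv Γ i Y.2.1 Y.2.2 - _)
    rw [hF]
    simp only [halfQuadDeriv, PiLp.zero_apply, zero_sub, mul_zero, basisVec_apply]
    have h1 : ∑ j : ℐ, (if j.val ≤ b then 0 else
        -(τ * Y.2.2 j * if (0 : ℐ) = i then 1 else 0) / Y.2.1 0) * raise Γ j Y.2.1 Y.2.2 =
        -(τ / Y.2.1 0) * if i = 0 then ∑ j, fibreProj Y.2.2 j * raise Γ j Y.2.1 Y.2.2 else 0 := by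
      by_cases hi : i = 0
      · subst hi
        simp only [if_true, mul_sum, fibreProj_apply]
        refine sum_congr rfl fun j _ => ?_
        split_ifs <;> ring
      · simp [hi, Ne.symm hi]
    rw [h1]
    split_ifs <;> ring

/-- A bicharacteristic in canonical coordinates moves along the Hamilton vector field in the edge
frame. -/
theorem IsNormalCoeff.hasDerivWithinAt_hatOf {c : ℝ → ℙ} {κ s : ℝ} {S : Set ℝ}
    (hu : (c s).2.1 ∈ ball u₀ ε) (hx : 0 < (c s).2.1 0) (hτ : (c s).2.2.1 ≠ 0)
    (hc : HasDerivWithinAt c (κ • hamiltonField (modelSymbol Γ) (c s)) S s) :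
    HasDerivWithinAt (fun s => hatOf (c s))
      ((κ * (c s).2.2.1 / (c s).2.1 0) • hatField Γ (hatOf (c s))) S s := by
  have hw : c s = canonLift (c s).2.2.1 (hatOf (c s)) := (canonLift_hatOf hτ hx.ne').symm
  set Y := hatOf (c s) with hY
  set τ := (c s).2.2.1 with hτdef
  have hYu : Y.2.1 = (c s).2.1 := rfl
  rw [hw, hΓ.hamiltonField_modelSymbol (Y := Y) hu hx] at hc
  have ht : HasDerivWithinAt (fun s => (c s).1) (κ * (2 * τ)) S s := hc.fst
  have hud : HasDerivWithinAt (fun s => (c s).2.1) (κ • (modelField Γ τ Y).2.1) S s := hc.snd.fst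
  have hτd : HasDerivWithinAt (fun s => (c s).2.2.1) 0 S s := by
    have : HasDerivWithinAt (fun s => (c s).2.2.1) (κ • (modelField Γ τ Y).2.2.1) S s :=
      hc.snd.snd.fst
    simpa [modelField] using this
  have hvd : HasDerivWithinAt (fun s => (c s).2.2.2) (κ • (modelField Γ τ Y).2.2.2) S s :=
    hc.snd.snd.snd
  have hui := hasDerivWithinAt_coord.1 hud
  have hvi := hasDerivWithinAt_coord.1 hvd
  have hx' := hx.ne'
  refine HasDerivWithinAt.prodMk (ht.congr_deriv ?_) (HasDerivWithinAt.prodMk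
    (hud.congr_deriv ?_) (hasDerivWithinAt_coord.2 fun i => ?_))
  · simp only [hatField, smul_eq_mul, hYu]
    field_simp
  · ext i
    simp only [modelField, hatField, PiLp.smul_apply, smul_eq_mul, hYu, edgeScale]
    split_ifs <;> field_simp
  · have hv : (c s).2.2.2 i = τ * (if i.val ≤ b then 1 else (c s).2.1 0) * Y.2.2 i := by
      conv_lhs => rw [hw]
      rfl
    simp only [hatOf]
    split_ifs with hi
    · have h1 := (hvi i).div (hτd.const_mul 1) (by simpa using hτ)
      refine h1.congr_deriv ?_
      simp only [modelField, hatField, PiLp.smul_apply, smul_eq_mul, hYu, edgeScale, hi, if_true]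
      split_ifs
      · simp only [← hτdef]
        field_simp
        ring
      · simp only [← hτdef]
        field_simp
        try ring
    · have h0 : i ≠ 0 := fun h => hi (by rw [h]; exact zero_val_le)
      have h1 := (hvi i).div ((hui 0).mul hτd) (mul_ne_zero hx' hτ)
      refine h1.congr_deriv ?_
      rw [hv]
      simp only [modelField, hatField, PiLp.smul_apply, smul_eq_mul,
        hYu, edgeScale, hi, if_false, h0, zero_val_le, if_true, Pi.mul_apply, ← hτdef]
      field_simp
      ring

/-- Conversely, curves along the Hamilton vector field in the edge frame lift to
bicharacteristics. -/
theorem IsNormalCoeff.hasDerivAt_canonLift {c : ℝ → ℋ} {κ τ s : ℝ}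
    (hu : (c s).2.1 ∈ ball u₀ ε) (hx : 0 < (c s).2.1 0) (hτ : τ ≠ 0)
    (hc : HasDerivAt c (κ • hatField Γ (c s)) s) :
    HasDerivAt (fun s => canonLift τ (c s))
      ((κ * (c s).2.1 0 / τ) • hamiltonField (modelSymbol Γ) (canonLift τ (c s))) s := by
  rw [hΓ.hamiltonField_modelSymbol hu hx]
  have ht : HasDerivAt (fun s => (c s).1) (κ • (hatField Γ (c s)).1) s := hc.fst
  have hud : HasDerivAt (fun s => (c s).2.1) (κ • (hatField Γ (c s)).2.1) s := hc.snd.fst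
  have hvd : HasDerivAt (fun s => (c s).2.2) (κ • (hatField Γ (c s)).2.2) s := hc.snd.snd
  have hui := hasDerivAt_coord.1 hud
  have hvi := hasDerivAt_coord.1 hvd
  have hx' := hx.ne'
  refine HasDerivAt.prodMk (ht.congr_deriv ?_) (HasDerivAt.prodMk
    (hud.congr_deriv ?_) (HasDerivAt.prodMk ((hasDerivAt_const s τ).congr_deriv ?_)
      (hasDerivAt_coord.2 fun i => ?_)))
  · simp only [modelField, hatField, smul_eq_mul]
    field_simp
  · ext i
    simp only [modelField, hatField, PiLp.smul_apply, smul_eq_mul, edgeScale]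
    split_ifs <;> field_simp
  · simp [modelField]
  · simp only []
    split_ifs with hi
    · refine ((hvi i).const_mul (τ * 1)).congr_deriv ?_
      simp only [modelField, hatField, PiLp.smul_apply, smul_eq_mul, edgeScale, hi, if_true]
      split_ifs
      · field_simp
        ring
      · field_simp
        try ring
    · have h0 : i ≠ 0 := fun h => hi (by rw [h]; exact zero_val_le)
      refine (((hui 0).const_mul τ).mul (hvi i)).congr_deriv ?_
      simp only [modelField, hatField, PiLp.smul_apply, smul_eq_mul,
        edgeScale, hi, if_false, h0, zero_val_le, if_true]
      field_simp
      ring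

end Hamilton

/-! ### Uniqueness of the bicharacteristics ending at a radial point -/

/-- A differential inequality at a singular point: a bounded `α` with
`|(x α)'| ≤ |α| x' / 2` vanishes if `x` tends to zero at the initial point. -/
theorem eq_zero_of_norm_deriv_smul_le {E : Type*} [NormedAddCommGroup E] [NormedSpace ℝ E]
    {x x' : ℝ → ℝ} {α β' : ℝ → E} {a b : ℝ}
    (hx : ∀ s ∈ Ioc a b, HasDerivWithinAt x (x' s) (Ioc a b) s)
    (hβ : ∀ s ∈ Ioc a b, HasDerivWithinAt (fun s => x s • α s) (β' s) (Ioc a b) s)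
    (hle : ∀ s ∈ Ioc a b, ‖β' s‖ ≤ 1 / 2 * ‖α s‖ * x' s)
    (hx' : ∀ s ∈ Ioc a b, 0 ≤ x' s)
    (hpos : ∀ s ∈ Ioc a b, 0 < x s) (hlim : Tendsto x (𝓝[>] a) (𝓝 0))
    (hbd : ∀ s ∈ Ioc a b, ‖α s‖ ≤ 1) : ∀ s ∈ Ioc a b, α s = 0 := by
  have key : ∀ C : ℝ, 0 ≤ C → (∀ s ∈ Ioc a b, ‖α s‖ ≤ C) → ∀ s ∈ Ioc a b, ‖α s‖ ≤ C / 2 := by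
    intro C hC hα s hs
    have h1 : ∀ s' ∈ Ioo a s, ‖x s • α s‖ ≤ C * x s' + C / 2 * x s := fun s' hs' => by
      have hsub : Icc s' s ⊆ Ioc a b := fun σ hσ => ⟨hs'.1.trans_le hσ.1, hσ.2.trans hs.2⟩
      have hnh : ∀ σ ∈ Ico s' s, Ioc a b ∈ 𝓝[≥] σ := fun σ hσ =>
        mem_of_superset (Icc_mem_nhdsGE (hσ.2.trans_le hs.2)) fun y hy =>
          ⟨(hs'.1.trans_le hσ.1).trans_le hy.1, hy.2⟩
      have h2 := image_norm_le_of_norm_deriv_right_le_deriv_boundary'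
        (f := fun s => x s • α s) (f' := β') (a := s') (b := s)
        (B := fun σ => ‖x s' • α s'‖ + C / 2 * (x σ - x s')) (B' := fun σ => C / 2 * x' σ)
        (fun σ hσ => ((hβ σ (hsub hσ)).continuousWithinAt).mono hsub)
        (fun σ hσ => (hβ σ (hsub ⟨hσ.1, hσ.2.le⟩)).mono_of_mem_nhdsWithin (hnh σ hσ))
        (by simp)
        (fun σ hσ => (continuousWithinAt_const.add (continuousWithinAt_const.mul
          ((((hx σ (hsub hσ)).continuousWithinAt).mono hsub).sub continuousWithinAt_const))))
        (fun σ hσ => ((((hx σ (hsub ⟨hσ.1, hσ.2.le⟩)).mono_of_mem_nhdsWithin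
          (hnh σ hσ)).sub_const _).const_mul _).const_add _)
        (fun σ hσ => by
          have hσ' := hsub ⟨hσ.1, hσ.2.le⟩
          refine (hle σ hσ').trans ?_
          have := mul_le_mul_of_nonneg_right (hα σ hσ') (hx' σ hσ')
          nlinarith)
        (Set.right_mem_Icc.2 hs'.2.le)
      have hs'm : s' ∈ Ioc a b := ⟨hs'.1, hs'.2.le.trans hs.2⟩
      have h3 : ‖x s' • α s'‖ ≤ C * x s' := by
        rw [norm_smul, norm_eq_abs, abs_of_pos (hpos s' hs'm), mul_comm]
        exact mul_le_mul_of_nonneg_right (hα s' hs'm) (hpos s' hs'm).le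
      have h4 := hpos s' hs'm
      nlinarith
    have h2 : ‖x s • α s‖ ≤ C * 0 + C / 2 * x s := by
      refine ge_of_tendsto ((hlim.const_mul C).add_const (C / 2 * x s)) ?_
      filter_upwards [Ioo_mem_nhdsGT hs.1] with s' hs' using h1 s' hs'
    have h3 := hpos s hs
    rw [norm_smul, norm_eq_abs, abs_of_pos h3, mul_zero, zero_add, mul_comm] at h2
    exact le_of_mul_le_mul_right h2 h3
  have h1 : ∀ n : ℕ, ∀ s ∈ Ioc a b, ‖α s‖ ≤ (1 / 2) ^ n := fun n => by
    induction n with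
    | zero => simpa using hbd
    | succ n ih =>
      intro s hs
      have := key _ (by positivity) ih s hs
      rw [pow_succ]; linarith
  intro s hs
  have h2 : ‖α s‖ ≤ 0 := ge_of_tendsto'
    (tendsto_pow_atTop_nhds_zero_of_lt_one (by norm_num) (by norm_num)) fun n => h1 n s hs
  exact norm_le_zero_iff.1 h2

/-- A ball in which the estimates for the defect hold. -/
structure IsDecayBall (Γ : ℐ → ℐ → ℰ → ℝ) (u₀ : ℰ) (ε : ℝ) (p₀ : ℋ) (Z : ℋ → ℰ) (θ : ℝ) : Prop where
  pos : 0 < θ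
  rate : ∀ Y ∈ ball p₀ θ, 0 < Y.2.1 0 → ‖defectRate Γ Z Y‖ ≤ |ϱ Y| * ‖defect Z Y‖
  bound : ∀ Y ∈ ball p₀ θ, 0 ≤ Y.2.1 0 → ‖defect Z Y‖ ≤ 1
  raise_pos : ∀ Y ∈ ball p₀ θ, 0 ≤ Y.2.1 0 → 0 < raise Γ 0 u₀ p₀.2.2 * ϱ Y
  raise_le : ∀ Y ∈ ball p₀ θ, 0 ≤ Y.2.1 0 → |ϱ Y| ≤ 2 * |raise Γ 0 u₀ p₀.2.2|
  mem_ball : ∀ Y ∈ ball p₀ θ, Y.2.1 ∈ ball u₀ ε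

theorem IsDecayBall.mono (h : IsDecayBall Γ u₀ ε p₀ Z θ) {θ' : ℝ} (h0 : 0 < θ') (hle : θ' ≤ θ) :
    IsDecayBall Γ u₀ ε p₀ Z θ' where
  pos := h0
  rate Y hY := h.rate Y (ball_subset_ball hle hY)
  bound Y hY := h.bound Y (ball_subset_ball hle hY)
  raise_pos Y hY := h.raise_pos Y (ball_subset_ball hle hY)
  raise_le Y hY := h.raise_le Y (ball_subset_ball hle hY)
  mem_ball Y hY := h.mem_ball Y (ball_subset_ball hle hY)

theorem IsHatGraph.exists_isDecayBall (h : 𝒢)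
    (hD : raise Γ 0 u₀ p₀.2.2 ≠ 0) : ∃ θ, IsDecayBall Γ u₀ ε p₀ Z θ := by
  obtain ⟨θ, hθ, -, hrate⟩ := h.exists_norm_defectRate_le hD
  have hp0 := h.center_time
  have hpS := h.center_mem
  have hdc : ContinuousWithinAt (defect Z) {Y | 0 ≤ Y.2.1 0} p₀ :=
    h.contDiffOn_defect.continuousOn p₀ hp0.ge
  have hd0 : defect Z p₀ = 0 := by rw [defect, h.fibre, h.zero_Z p₀ hp0, sub_zero]
  have hev : ∀ᶠ Y in 𝓝[{Y | 0 ≤ Y.2.1 0}] p₀, ‖defect Z Y‖ < 1 ∧ 0 < raise Γ 0 u₀ p₀.2.2 * ϱ Y ∧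
      |ϱ Y| < 2 * |raise Γ 0 u₀ p₀.2.2| := by
    refine Eventually.and ?_ (Eventually.and ?_ ?_)
    · refine hdc.norm.eventually (isOpen_Iio.mem_nhds ?_)
      change ‖defect Z p₀‖ < 1
      rw [hd0]; simp
    · refine (continuousWithinAt_const.mul h.continuousWithinAt_raise).eventually
          (isOpen_Ioi.mem_nhds ?_)
      change 0 < raise Γ 0 u₀ p₀.2.2 * ϱ p₀
      rw [h.center]
      exact mul_self_pos.2 hD
    · refine h.continuousWithinAt_raise.abs.eventually (isOpen_Iio.mem_nhds ?_)
      change |ϱ p₀| < 2 * |raise Γ 0 u₀ p₀.2.2|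
      rw [h.center]
      have := abs_pos.2 hD
      linarith
  obtain ⟨ν, hν, hνs⟩ := Metric.mem_nhdsWithin_iff.1 hev
  obtain ⟨μ, hμ, hμs⟩ := Metric.isOpen_iff.1 (isOpen_hatBall u₀ ε) p₀ hpS.2
  have h1 : min θ (min ν μ) ≤ θ := min_le_left _ _
  have h2 : min θ (min ν μ) ≤ ν := (min_le_right _ _).trans (min_le_left _ _)
  have h3 : min θ (min ν μ) ≤ μ := (min_le_right _ _).trans (min_le_right _ _)
  exact ⟨min θ (min ν μ), lt_min hθ (lt_min hν hμ), fun Y hY => hrate Y (ball_subset_ball h1 hY),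
    fun Y hY hx => (hνs ⟨ball_subset_ball h2 hY, hx⟩).1.le,
    fun Y hY hx => (hνs ⟨ball_subset_ball h2 hY, hx⟩).2.1,
    fun Y hY hx => (hνs ⟨ball_subset_ball h2 hY, hx⟩).2.2.le,
    fun Y hY => hμs (ball_subset_ball h3 hY)⟩

theorem IsHatGraph.hasDerivWithinAt_smul_defect (h : 𝒢)
    {Y : ℝ → ℋ} {c s : ℝ} {S : Set ℝ} (hx : 0 < (Y s).2.1 0)
    (hY : HasDerivWithinAt Y ((c / (Y s).2.1 0) • hatField Γ (Y s)) S s) :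
    HasDerivWithinAt (fun s => (Y s).2.1 0) (-(2 * c * ϱ (Y s))) S s ∧
    HasDerivWithinAt (fun s => (Y s).2.1 0 • defect Z (Y s)) (c • defectRate Γ Z (Y s)) S s := by
  have hx' := hx.ne'
  have h1 : HasDerivWithinAt (fun s => (Y s).2.1 0) (-(2 * c * ϱ (Y s))) S s := by
    have h2 : HasDerivWithinAt (fun s => (Y s).2.1)
      ((c / (Y s).2.1 0) • hatField Γ (Y s)).2.1 S s := hY.snd.fst
    refine (hasDerivWithinAt_coord.1 h2 0).congr_deriv ?_
    simp only [hatField, Prod.smul_snd, Prod.smul_fst, PiLp.smul_apply, smul_eq_mul, edgeScale,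
      zero_val_le, if_true]
    field_simp
  refine ⟨h1, ?_⟩
  have h3 := (h.hasFDerivAt_defect hx).comp_hasDerivWithinAt s hY
  refine (h1.smul h3).congr_deriv ?_
  rw [defectRate, map_smul, Function.comp, smul_smul, mul_div_cancel₀ _ hx']
  module

/-- A bicharacteristic that tends to the boundary stays on the graph. -/
theorem IsHatGraph.defect_eq_zero_of_tendsto (h : 𝒢)
    (hθ : IsDecayBall Γ u₀ ε p₀ Z θ) {Y : ℝ → ℋ} {c a a' : ℝ}
    (hmem : ∀ s ∈ Ioc a a', Y s ∈ ball p₀ θ ∧ 0 < (Y s).2.1 0)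
    (hY : ∀ s ∈ Ioc a a', HasDerivWithinAt Y ((c / (Y s).2.1 0) • hatField Γ (Y s)) (Ioc a a') s)
    (hlim : Tendsto (fun s => (Y s).2.1 0) (𝓝[>] a) (𝓝 0)) :
    ∀ s ∈ Ioc a a', defect Z (Y s) = 0 := fun s hs => by
  set D := raise Γ 0 u₀ p₀.2.2 with hDdef
  have hd := fun s hs => h.hasDerivWithinAt_smul_defect (hmem s hs).2 (hY s hs)
  rcases lt_or_ge (c * D) 0 with hc | hc
  · have hsign : ∀ s ∈ Ioc a a', c * ϱ (Y s) < 0 := fun s hs => by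
      have h1 := hθ.raise_pos (Y s) (hmem s hs).1 (hmem s hs).2.le
      by_contra hcon
      rw [not_lt] at hcon
      have h2 : 0 < D ^ 2 := by
        refine sq_pos_of_ne_zero fun h0 => ?_
        rw [h0, mul_zero] at hc
        exact lt_irrefl _ hc
      nlinarith [mul_nonneg hcon h2.le, mul_pos h1 (neg_pos.2 hc)]
    refine eq_zero_of_norm_deriv_smul_le (fun s hs => (hd s hs).1) (fun s hs => (hd s hs).2)
      (fun s hs => ?_) (fun s hs => ?_) (fun s hs => (hmem s hs).2) hlim
      (fun s hs => hθ.bound _ (hmem s hs).1 (hmem s hs).2.le) s hs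
    · have h1 := hθ.rate (Y s) (hmem s hs).1 (hmem s hs).2
      have h2 : |c| * |ϱ (Y s)| = -(c * ϱ (Y s)) := by rw [← abs_mul, abs_of_neg (hsign s hs)]
      rw [norm_smul, norm_eq_abs]
      calc |c| * ‖defectRate Γ Z (Y s)‖
          ≤ |c| * (|ϱ (Y s)| * ‖defect Z (Y s)‖) := mul_le_mul_of_nonneg_left h1 (abs_nonneg c)
        _ = 1 / 2 * ‖defect Z (Y s)‖ * -(2 * c * ϱ (Y s)) := by rw [← mul_assoc, h2]; ring
    · have := hsign s hs
      nlinarith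
  · exfalso
    have hanti : AntitoneOn (fun s => (Y s).2.1 0) (Ioc a a') := by
      refine antitoneOn_of_hasDerivWithinAt_nonpos (convex_Ioc a a')
        (fun s hs => (hd s hs).1.continuousWithinAt)
        (fun s hs => ((hd s (interior_subset hs)).1).mono interior_subset) fun s hs => ?_
      have hs' := interior_subset hs
      have h1 := hθ.raise_pos (Y s) (hmem s hs').1 (hmem s hs').2.le
      have h2 : 0 < D ^ 2 := by
        refine sq_pos_of_ne_zero fun h0 => ?_
        change 0 < D * _ at h1
        rw [h0, zero_mul] at h1
        exact lt_irrefl _ h1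
      have h3 : 0 ≤ c * ϱ (Y s) := by
        by_contra hcon
        rw [not_le] at hcon
        nlinarith [mul_nonneg hc h1.le, mul_pos (neg_pos.2 hcon) h2]
      linarith
    have h1 : (Y s).2.1 0 ≤ 0 := by
      refine ge_of_tendsto hlim ?_
      filter_upwards [Ioc_mem_nhdsGT hs.1] with σ hσ
      exact hanti ⟨hσ.1, hσ.2.trans hs.2⟩ hs hσ.2
    exact absurd (hmem s hs).2 (not_lt.2 h1)

/-- A bicharacteristic that starts on the graph stays on the graph. -/
theorem IsHatGraph.defect_eq_zero_of_left (h : 𝒢)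
    (hθ : IsDecayBall Γ u₀ ε p₀ Z θ) {Y : ℝ → ℋ} {c a a' : ℝ}
    (hmem : ∀ s ∈ Icc a a', Y s ∈ ball p₀ θ ∧ 0 < (Y s).2.1 0)
    (hY : ∀ s ∈ Icc a a', HasDerivWithinAt Y ((c / (Y s).2.1 0) • hatField Γ (Y s))
      (Icc a a') s) (ha : defect Z (Y a) = 0) :
    ∀ s ∈ Icc a a', defect Z (Y s) = 0 := fun s₁ hs₁ => by
  have haa : a ≤ a' := hs₁.1.trans hs₁.2
  have hd := fun s hs => h.hasDerivWithinAt_smul_defect (hmem s hs).2 (hY s hs)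
  obtain ⟨m, hm, hmin⟩ := isCompact_Icc.exists_isMinOn (Set.nonempty_Icc.2 haa)
    (fun s hs => (hd s hs).1.continuousWithinAt)
  have hm0 := (hmem m hm).2
  set L := |c| * (2 * |raise Γ 0 u₀ p₀.2.2|) / (Y m).2.1 0 with hL
  have hgr := norm_le_gronwallBound_of_norm_deriv_right_le
    (f := fun s => (Y s).2.1 0 • defect Z (Y s)) (f' := fun s => c • defectRate Γ Z (Y s))
    (δ := 0) (K := L) (ε := 0) (a := a) (b := a')
    (fun s hs => (hd s hs).2.continuousWithinAt)
    (fun s hs => (hd s ⟨hs.1, hs.2.le⟩).2.mono_of_mem_nhdsWithin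
      (mem_of_superset (Icc_mem_nhdsGE hs.2) (Set.Icc_subset_Icc_left hs.1)))
    (by simp [ha])
    (fun s hs => by
      have hs' : s ∈ Icc a a' := ⟨hs.1, hs.2.le⟩
      have h1 := hθ.rate (Y s) (hmem s hs').1 (hmem s hs').2
      have h2 := hθ.raise_le (Y s) (hmem s hs').1 (hmem s hs').2.le
      have h3 : (Y m).2.1 0 ≤ (Y s).2.1 0 := hmin hs'
      have h4 := norm_nonneg (defect Z (Y s))
      rw [norm_smul, norm_smul, norm_eq_abs, norm_eq_abs, abs_of_pos (hmem s hs').2,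
        add_zero, hL, div_mul_eq_mul_div, le_div_iff₀ hm0]
      have h5 : ‖defectRate Γ Z (Y s)‖ ≤ 2 * |raise Γ 0 u₀ p₀.2.2| * ‖defect Z (Y s)‖ :=
        h1.trans (mul_le_mul_of_nonneg_right h2 h4)
      have h6 : 0 ≤ |c| * (2 * |raise Γ 0 u₀ p₀.2.2| * ‖defect Z (Y s)‖) := by positivity
      calc |c| * ‖defectRate Γ Z (Y s)‖ * (Y m).2.1 0
          ≤ |c| * (2 * |raise Γ 0 u₀ p₀.2.2| * ‖defect Z (Y s)‖) * (Y s).2.1 0 := by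
            refine mul_le_mul (mul_le_mul_of_nonneg_left h5 (abs_nonneg c)) h3 hm0.le h6
        _ = _ := by ring) s₁ hs₁
  have h0 : ‖(Y s₁).2.1 0 • defect Z (Y s₁)‖ ≤ 0 := by
    refine hgr.trans ?_
    rw [gronwallBound_ε0]
    simp
  have h1 := norm_le_zero_iff.1 h0
  exact (smul_eq_zero.1 h1).resolve_left (hmem s₁ hs₁).2.ne'

/-! ### The bicharacteristics on the graph -/

theorem exists_inverse_of_deriv_pos {T T' : ℝ → ℝ} {m m' : ℝ} (hm : 0 < m) (hmm : m < m')
    (hc : ContinuousOn T (Icc 0 m')) (hd : ∀ σ ∈ Ioo 0 m', HasDerivAt T (T' σ) σ)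
    (hpos : ∀ σ ∈ Ioo 0 m', 0 < T' σ) (h0 : T 0 = 0) :
    ∃ g : ℝ → ℝ, 0 < T m ∧ g (T m) = m ∧
      (∀ s ∈ Ioc 0 (T m), 0 < g s ∧ g s ≤ m ∧ HasDerivAt g (T' (g s))⁻¹ s) ∧
      Tendsto g (𝓝[>] 0) (𝓝 0) := by
  have hmono : StrictMonoOn T (Icc 0 m') := by
    refine strictMonoOn_of_deriv_pos (convex_Icc 0 m') hc fun σ hσ => ?_
    rw [interior_Icc] at hσ
    rw [(hd σ hσ).deriv]
    exact hpos σ hσ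
  have hm'0 : 0 ≤ m' := (hm.trans hmm).le
  have z0 : 0 ∈ Icc 0 m' := ⟨le_rfl, hm'0⟩
  have zm : m ∈ Icc 0 m' := ⟨hm.le, hmm.le⟩
  have zm' : m' ∈ Icc 0 m' := ⟨hm'0, le_rfl⟩
  have hTm : 0 < T m := by rw [← h0]; exact hmono z0 zm hm
  have hTm' : T m < T m' := hmono zm zm' hmm
  have hsurj : Set.SurjOn T (Icc 0 m') (Icc 0 (T m')) := by
    have := intermediate_value_Icc hm'0 hc
    rwa [h0] at this
  set g := Function.invFunOn T (Icc 0 m') with hg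
  have hg1 : ∀ s ∈ Icc 0 (T m'), g s ∈ Icc 0 m' := fun s hs => Function.invFunOn_mem (hsurj hs)
  have hg2 : ∀ s ∈ Icc 0 (T m'), T (g s) = s := fun s hs => Function.invFunOn_eq (hsurj hs)
  have hg3 : ∀ σ ∈ Icc 0 m', g (T σ) = σ := fun σ hσ => hmono.injOn.leftInvOn_invFunOn hσ
  have hTmaps : ∀ σ ∈ Icc 0 m', T σ ∈ Icc 0 (T m') := fun σ hσ =>
    ⟨by rw [← h0]; exact hmono.monotoneOn z0 hσ hσ.1, hmono.monotoneOn hσ zm' hσ.2⟩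
  have hgmono : MonotoneOn g (Icc 0 (T m')) := fun s hs s' hs' hss => by
    by_contra hcon
    have := hmono (hg1 s' hs') (hg1 s hs) (not_le.1 hcon)
    rw [hg2 s hs, hg2 s' hs'] at this
    exact absurd hss (not_le.2 this)
  have hgpos : ∀ s ∈ Icc 0 (T m'), 0 < s → 0 < g s := fun s hs hs0 => by
    refine lt_of_le_of_ne (hg1 s hs).1 fun h => ?_
    have := hg2 s hs
    rw [← h, h0] at this
    exact hs0.ne this
  refine ⟨g, hTm, hg3 m zm, fun s hs => ?_, ?_⟩
  · have hs' : s ∈ Icc 0 (T m') := ⟨hs.1.le, hs.2.trans hTm'.le⟩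
    have hle : g s ≤ m := by
      have := hgmono hs' (hTmaps m zm) hs.2
      rwa [hg3 m zm] at this
    have hgs : g s ∈ Ioo 0 m' := ⟨hgpos s hs' hs.1, hle.trans_lt hmm⟩
    refine ⟨hgs.1, hle, ?_⟩
    have hnh : Icc 0 (T m') ∈ 𝓝 s := Icc_mem_nhds hs.1 (hs.2.trans_lt hTm')
    have hcont : ContinuousAt g s := by
      refine continuousAt_of_monotoneOn_of_image_mem_nhds hgmono hnh ?_
      refine mem_of_superset (Icc_mem_nhds hgs.1 hgs.2) fun σ hσ => ?_
      exact ⟨T σ, hTmaps σ hσ, hg3 σ hσ⟩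
    exact HasDerivAt.of_local_left_inverse hcont (hd _ hgs) (hpos _ hgs).ne'
      (mem_of_superset hnh hg2)
  · rw [Metric.tendsto_nhdsWithin_nhds]
    intro ε hε
    set σ := min ε m with hσ
    have hσ0 : 0 < σ := lt_min hε hm
    have zσ : σ ∈ Icc 0 m' := ⟨hσ0.le, (min_le_right _ _).trans hmm.le⟩
    refine ⟨T σ, by rw [← h0]; exact hmono z0 zσ hσ0, fun s hs0 hs => ?_⟩
    rw [dist_zero_right, norm_eq_abs, abs_of_pos hs0] at hs
    have hs' : s ∈ Icc 0 (T m') := ⟨(show 0 < s from hs0).le, hs.le.trans (hTmaps σ zσ).2⟩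
    rw [dist_zero_right, norm_eq_abs, abs_of_nonneg (hg1 s hs').1]
    refine lt_of_lt_of_le ?_ (min_le_left ε m)
    by_contra hcon
    have := hmono.monotoneOn zσ (hg1 s hs') (not_lt.1 hcon)
    rw [hg2 s hs'] at this
    exact absurd hs (not_lt.2 this)

/-- The bicharacteristic through the point with parameter `q`, down to the boundary. -/
theorem IsHatGraph.exists_ray (h : 𝒢) {q : ℋ} {m : ℝ} (hq : q.2.1 0 = 0) (hm : 0 < m)
    (hball : ∀ σ ∈ Icc 0 m, q + σ • hatVec ∈ ball p₀ r) {τ : ℝ} (hτ : τ ≠ 0) :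
    ∃ (κ : ℝ) (g : ℝ → ℝ), g 1 = m ∧ (∀ s ∈ Ioc (0 : ℝ) 1, 0 < g s ∧ g s ≤ m) ∧
      Tendsto g (𝓝[>] 0) (𝓝 0) ∧ ∀ s ∈ Ioc (0 : ℝ) 1,
        HasDerivAt (fun s => canonLift τ (blowDown (X (q + g s • hatVec))))
          (κ • hamiltonField (modelSymbol Γ)
            (canonLift τ (blowDown (X (q + g s • hatVec))))) s := by
  set D := raise Γ 0 u₀ p₀.2.2 with hDdef
  have hx : ∀ σ : ℝ, (q + σ • (hatVec : ℋ)).2.1 0 = σ := fun σ => by simp [hatVec, basisVec, hq]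
  have hcont : Continuous fun σ : ℝ => q + σ • (hatVec : ℋ) := by fun_prop
  obtain ⟨m', hmm', hball'⟩ : ∃ m' > m, ∀ σ ∈ Icc 0 m', q + σ • hatVec ∈ ball p₀ r := by
    have := hcont.continuousAt.preimage_mem_nhds
      (Metric.isOpen_ball.mem_nhds (hball m ⟨hm.le, le_rfl⟩))
    obtain ⟨ν, hν, hνs⟩ := Metric.mem_nhds_iff.1 this
    refine ⟨m + ν / 2, by linarith, fun σ hσ => ?_⟩
    rcases le_or_gt σ m with h1 | h1
    · exact hball σ ⟨hσ.1, h1⟩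
    · have hmem : σ ∈ ball m ν := by
        rw [Metric.mem_ball, Real.dist_eq, abs_lt]
        constructor <;> linarith [hσ.2]
      exact hνs hmem
  have hD : D ≠ 0 := fun h0 => by
    have := h.raise_pos _ (hball m ⟨hm.le, le_rfl⟩)
    rw [← hDdef, h0, zero_mul] at this
    exact lt_irrefl _ this
  let Yc : ℝ → ℋ := fun σ => blowDown (X (q + σ • hatVec))
  have hYx : ∀ σ ∈ Icc 0 m', (Yc σ).2.1 0 = σ ^ 2 := fun σ hσ => by
    have h1 : (X (q + σ • hatVec)).2.1 0 = (q + σ • (hatVec : ℋ)).2.1 0 := h.level _ (hball' σ hσ)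
    simp only [Yc, blowDown, sq_apply, if_true]
    rw [h1, hx]
  have hYd : ∀ σ ∈ Ioo 0 m', HasDerivAt Yc
      ((-(σ * ϱ (Yc σ))⁻¹) • hatField Γ (Yc σ)) σ := fun σ hσ => by
    have h1 := h.flow _ (hball' σ ⟨hσ.1.le, hσ.2.le⟩) (by rw [hx]; exact hσ.1.ne')
    rw [hx] at h1
    have h2 : HasDerivAt (fun s => s - σ) 1 σ := (hasDerivAt_id σ).sub_const σ
    rw [← sub_self σ] at h1
    have h3 := HasDerivAt.scomp (h := fun s => s - σ) σ h1 h2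
    rw [one_smul] at h3
    refine h3.congr_of_eventuallyEq (Eventually.of_forall fun s => ?_)
    simp only [Yc, Function.comp]
    congr 2
    module
  have hMpos : ∀ σ ∈ Icc 0 m', 0 < D * ϱ (Yc σ) := fun σ hσ => h.raise_pos _ (hball' σ hσ)
  let T : ℝ → ℝ := fun σ => -D * ((Yc σ).1 - (Yc 0).1)
  have hTd : ∀ σ ∈ Ioo 0 m', HasDerivAt T (2 * σ * (D / ϱ (Yc σ))) σ := by
    intro σ hσ
    have h1 : HasDerivAt (fun σ => (Yc σ).1)
      ((-(σ * ϱ (Yc σ))⁻¹) • (hatField Γ (Yc σ)).1) σ := (hYd σ hσ).fst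
    refine ((h1.sub_const _).const_mul (-D)).congr_deriv ?_
    have hM : ϱ (Yc σ) ≠ 0 := fun h0 => by
      have := hMpos σ ⟨hσ.1.le, hσ.2.le⟩
      rw [h0, mul_zero] at this
      exact lt_irrefl _ this
    have hσ0 := hσ.1.ne'
    simp only [hatField, smul_eq_mul]
    rw [hYx σ ⟨hσ.1.le, hσ.2.le⟩]
    field_simp
  have hTc : ContinuousOn T (Icc 0 m') := by
    have h1 : ContinuousOn (fun σ => (X (q + σ • hatVec)).1) (Icc 0 m') :=
      continuous_fst.comp_continuousOn (h.smooth.continuousOn.comp hcont.continuousOn hball')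
    exact continuousOn_const.mul (h1.sub continuousOn_const)
  have hTpos : ∀ σ ∈ Ioo 0 m', 0 < 2 * σ * (D / ϱ (Yc σ)) := fun σ hσ => by
    have h1 := hMpos σ ⟨hσ.1.le, hσ.2.le⟩
    have h2 : 0 < D / ϱ (Yc σ) := by
      rcases pos_and_pos_or_neg_and_neg_of_mul_pos h1 with ⟨h3, h4⟩ | ⟨h3, h4⟩
      · exact div_pos h3 h4
      · exact div_pos_of_neg_of_neg h3 h4
    have := hσ.1
    positivity
  obtain ⟨g, hTm, hgm, hgs, hglim⟩ := exists_inverse_of_deriv_pos hm hmm' hTc hTd hTpos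
    (by simp [T])
  refine ⟨-(T m / (2 * D * τ)), fun s => g (T m * s), by simpa using hgm, fun s hs => ?_, ?_,
    fun s hs => ?_⟩
  · have h1 := hgs (T m * s) ⟨mul_pos hTm hs.1, mul_le_of_le_one_right hTm.le hs.2⟩
    exact ⟨h1.1, h1.2.1⟩
  · refine hglim.comp ?_
    refine tendsto_nhdsWithin_iff.2 ⟨?_, ?_⟩
    · have : ContinuousAt (fun s => T m * s) 0 := by fun_prop
      have := this.tendsto
      rw [mul_zero] at this
      exact this.mono_left nhdsWithin_le_nhds
    · filter_upwards [self_mem_nhdsWithin] with s hs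
      exact mul_pos hTm hs
  · obtain ⟨h1, h2, h3⟩ := hgs (T m * s) ⟨mul_pos hTm hs.1, mul_le_of_le_one_right hTm.le hs.2⟩
    set σ := g (T m * s) with hσ
    have hσI : σ ∈ Ioo 0 m' := ⟨h1, h2.trans_lt hmm'⟩
    have hσI' : σ ∈ Icc 0 m' := ⟨h1.le, hσI.2.le⟩
    have h4 : HasDerivAt (fun s => T m * s) (T m) s := by
      simpa using (hasDerivAt_id s).const_mul (T m)
    have h5 : HasDerivAt (fun s => g (T m * s)) ((2 * σ * (D / ϱ (Yc σ)))⁻¹ * T m) s := h3.comp s h4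
    have h6 : HasDerivAt (fun s => Yc (g (T m * s))) (((2 * σ * (D / ϱ (Yc σ)))⁻¹ * T m) •
          ((-(σ * ϱ (Yc σ))⁻¹) • hatField Γ (Yc σ))) s :=
      HasDerivAt.scomp (h := fun s => g (T m * s)) (g₁ := Yc) s (hYd σ hσI) h5
    rw [smul_smul] at h6
    have hxpos : 0 < (Yc σ).2.1 0 := by rw [hYx σ hσI']; positivity
    have hu : (Yc σ).2.1 ∈ ball u₀ ε := (h.coeff.half_ball_subset (h.mem_ball _ (hball' σ hσI'))).1
    have h7 := h.coeff.hasDerivAt_canonLift (c := fun s => Yc (g (T m * s))) (τ := τ) hu hxpos hτ h6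
    refine h7.congr_deriv ?_
    have hM : ϱ (Yc σ) ≠ 0 := fun h0 => by
      have := hMpos σ hσI'
      rw [h0, mul_zero] at this
      exact lt_irrefl _ this
    congr 1
    change _ * (Yc σ).2.1 0 / τ = _
    rw [hYx σ hσI']
    have := h1.ne'
    field_simp

/-! ### Symplectic linear algebra -/

theorem canonicalForm_swap (δ δ' : ℙ) : canonicalForm δ' δ = -canonicalForm δ δ' := by
  simp only [canonicalForm, neg_add, ← sum_neg_distrib]
  exact congrArg₂ (· + ·) (by ring) (sum_congr rfl fun i _ => by ring)

theorem canonicalForm_add (δ₁ δ₂ δ' : ℙ) :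
    canonicalForm (δ₁ + δ₂) δ' = canonicalForm δ₁ δ' + canonicalForm δ₂ δ' := by
  simp only [canonicalForm, Prod.fst_add, Prod.snd_add, PiLp.add_apply, add_mul, mul_add,
    add_sub_add_comm, sum_add_distrib]
  ring

theorem canonicalForm_smul (c : ℝ) (δ δ' : ℙ) :
    canonicalForm (c • δ) δ' = c • canonicalForm δ δ' := by
  simp only [canonicalForm, Prod.smul_fst, Prod.smul_snd, PiLp.smul_apply, smul_eq_mul, mul_add,
    mul_sum]
  exact congrArg₂ (· + ·) (by ring) (sum_congr rfl fun i _ => by ring)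

/-- `canonicalForm` as a bilinear map. -/
noncomputable def symplForm : ℙ →L[ℝ] ℙ →L[ℝ] ℝ :=
  (LinearMap.mk₂ ℝ canonicalForm canonicalForm_add canonicalForm_smul
    (fun δ δ₁ δ₂ => by simp only [canonicalForm_swap _ δ, canonicalForm_add, neg_add])
    (fun c δ δ' => by
      simp only [canonicalForm_swap _ δ, canonicalForm_smul, smul_neg])).toContinuousBilinearMap

theorem symplForm_apply (δ δ' : ℙ) : symplForm δ δ' = canonicalForm δ δ' := rfl

theorem symplForm_swap (δ δ' : ℙ) : symplForm δ' δ = -symplForm δ δ' := canonicalForm_swap δ δ'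

theorem symplForm_self (δ : ℙ) : symplForm δ δ = 0 := by
  have := symplForm_swap δ δ
  linarith

/-- The Hamilton vector of a linear functional. -/
noncomputable def linearHamilton (A : ℙ →L[ℝ] ℝ) : ℙ :=
  (A (0, 0, 1, 0), WithLp.toLp 2 fun i => A (0, 0, 0, basisVec i), -A (1, 0, 0, 0),
    WithLp.toLp 2 fun i => -A (0, basisVec i, 0, 0))

theorem coord_eq_sum (u : ℰ) : u = ∑ i, u i • basisVec i := by
  ext j
  simp [basisVec_apply]

theorem functional_apply (A : ℙ →L[ℝ] ℝ) (δ : ℙ) :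
    A δ = δ.1 * A (1, 0, 0, 0) + ∑ i, δ.2.1 i * A (0, basisVec i, 0, 0) +
      δ.2.2.1 * A (0, 0, 1, 0) + ∑ i, δ.2.2.2 i * A (0, 0, 0, basisVec i) := by
  have h1 : ∀ u : ℰ, A (0, u, 0, 0) = ∑ i, u i * A (0, basisVec i, 0, 0) := fun u => by
    have := congrArg ((A : ℙ →ₗ[ℝ] ℝ).comp
      ((LinearMap.inr ℝ ℝ _).comp (LinearMap.inl ℝ ℰ (ℝ × ℰ)))) (coord_eq_sum u)
    simp only [map_sum, map_smul, smul_eq_mul] at this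
    exact this
  have h2 : ∀ v : ℰ, A (0, 0, 0, v) = ∑ i, v i * A (0, 0, 0, basisVec i) := fun u => by
    have := congrArg ((A : ℙ →ₗ[ℝ] ℝ).comp
      ((LinearMap.inr ℝ ℝ _).comp ((LinearMap.inr ℝ ℰ (ℝ × ℰ)).comp (LinearMap.inr ℝ ℝ ℰ))))
      (coord_eq_sum u)
    simp only [map_sum, map_smul, smul_eq_mul] at this
    exact this
  have h3 : δ = δ.1 • ((1, 0, 0, 0) : ℙ) + (0, δ.2.1, 0, 0) +
      δ.2.2.1 • ((0, 0, 1, 0) : ℙ) + (0, 0, 0, δ.2.2.2) := by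
    refine Prod.ext ?_ (Prod.ext ?_ (Prod.ext ?_ ?_)) <;> simp
  conv_lhs => rw [h3]
  rw [map_add, map_add, map_add, map_smul, map_smul, h1, h2, smul_eq_mul, smul_eq_mul]

theorem symplForm_linearHamilton (A : ℙ →L[ℝ] ℝ) (δ : ℙ) :
    symplForm (linearHamilton A) δ = -A δ := by
  rw [functional_apply A δ, symplForm_apply]
  simp only [canonicalForm, linearHamilton]
  simp only [sum_sub_distrib, neg_mul, sum_neg_distrib]
  simp only [mul_comm (A _)]
  ring

theorem symplForm_nondegenerate {δ : ℙ} (h : ∀ δ', symplForm δ δ' = 0) : δ = 0 := by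
  have hA : ∀ A : ℙ →L[ℝ] ℝ, A δ = 0 := fun A => by
    have h1 := symplForm_linearHamilton A δ
    rw [symplForm_swap, h, neg_zero] at h1
    linarith
  refine Prod.ext ?_ (Prod.ext ?_ (Prod.ext ?_ ?_))
  · exact hA (fst ℝ _ _)
  · ext i
    exact hA ((PiLp.proj 2 (fun _ : ℐ => ℝ) i : ℰ →L[ℝ] ℝ).comp ((fst ℝ _ _).comp (snd ℝ _ _)))
  · exact hA ((fst ℝ _ _).comp ((snd ℝ _ _).comp (snd ℝ _ _)))
  · ext i
    exact hA ((PiLp.proj 2 (fun _ : ℐ => ℝ) i : ℰ →L[ℝ] ℝ).comp ((snd ℝ _ _).comp ((snd ℝ _ _).comp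
      (snd ℝ _ _))))

/-- If the common kernel of `m` functionals contains `m` independent vectors that are
symplectically orthogonal to it, then these vectors span its orthocomplement, and the functionals
are independent. -/
theorem orthocomplement_of_null_vectors {ι : Type*} [Fintype ι] {A : ι → ℙ →L[ℝ] ℝ}
    {k : ι → ℙ} (hk : LinearIndependent ℝ k) (hAk : ∀ i j, A i (k j) = 0)
    (hnull : ∀ j δ, (∀ i, A i δ = 0) → symplForm (k j) δ = 0) :
    (∀ i j, A j (linearHamilton (A i)) = 0) ∧
      (∀ δ, (∀ δ', (∀ i, A i δ' = 0) → symplForm δ δ' = 0) → ∀ i, A i δ = 0) ∧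
      LinearIndependent ℝ A := by
  classical
  let Ω : ℙ →ₗ[ℝ] (ℙ →ₗ[ℝ] ℝ) :=
    { toFun := fun δ => (symplForm δ : ℙ →ₗ[ℝ] ℝ)
      map_add' := fun δ δ' => by ext <;> simp
      map_smul' := fun c δ => by ext <;> simp }
  have hΩ : ∀ δ δ', Ω δ δ' = symplForm δ δ' := fun _ _ => rfl
  have hinj : LinearMap.ker Ω = ⊥ := by
    rw [LinearMap.ker_eq_bot']
    intro δ hδ
    refine symplForm_nondegenerate fun δ' => ?_
    rw [← hΩ, hδ]; rfl
  let L := Submodule.span ℝ (range fun i => (A i : ℙ →ₗ[ℝ] ℝ))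
  let S := Submodule.span ℝ (range k)
  have hmemL : ∀ φ : ℙ →ₗ[ℝ] ℝ, (∀ δ, (∀ i, A i δ = 0) → φ δ = 0) → φ ∈ L := fun φ hφ => by
    refine mem_span_of_iInf_ker_le_ker fun δ hδ => ?_
    rw [Submodule.mem_iInf] at hδ
    exact hφ δ fun i => hδ i
  have hle : S.map Ω ≤ L := by
    rw [Submodule.map_span_le]
    rintro _ ⟨j, rfl⟩
    exact hmemL _ fun δ hδ => hnull j δ hδ
  have hSfin : Module.finrank ℝ S = Fintype.card ι := finrank_span_eq_card hk
  have heq : S.map Ω = L := by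
    refine Submodule.eq_of_le_of_finrank_le hle ?_
    rw [← (Submodule.equivMapOfInjective Ω (LinearMap.ker_eq_bot.1 hinj) S).finrank_eq, hSfin]
    exact finrank_range_le_card _
  have hAS : ∀ h ∈ S, ∀ i, A i h = 0 := fun h hh i => by
    have : S ≤ LinearMap.ker (A i : ℙ →ₗ[ℝ] ℝ) := by
      rw [Submodule.span_le]
      rintro _ ⟨j, rfl⟩
      exact hAk i j
    exact this hh
  refine ⟨?_, ?_, ?_⟩
  · intro i j
    have h1 : (A i : ℙ →ₗ[ℝ] ℝ) ∈ S.map Ω := by rw [heq]; exact Submodule.subset_span ⟨i, rfl⟩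
    obtain ⟨h, hh, hhA⟩ := h1
    have h2 : linearHamilton (A i) = -h := by
      rw [← sub_eq_zero]
      refine symplForm_nondegenerate fun δ => ?_
      have h3 : symplForm h δ = A i δ := by rw [← hΩ, hhA]; rfl
      rw [map_sub, map_neg]
      change symplForm (linearHamilton (A i)) δ - -symplForm h δ = 0
      rw [symplForm_linearHamilton, h3]; ring
    rw [h2, map_neg, hAS h hh j, neg_zero]
  · intro δ hδ i
    have h1 : Ω δ ∈ S.map Ω := by rw [heq]; exact hmemL _ hδ
    obtain ⟨h, hh, hhδ⟩ := h1
    rw [← LinearMap.ker_eq_bot.1 hinj hhδ]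
    exact hAS h hh i
  · have h1 : LinearIndependent ℝ fun i => (A i : ℙ →ₗ[ℝ] ℝ) := by
      rw [linearIndependent_iff_card_eq_finrank_span]
      change Fintype.card ι = Module.finrank ℝ L
      rw [← heq, ← (Submodule.equivMapOfInjective Ω (LinearMap.ker_eq_bot.1 hinj) S).finrank_eq,
        hSfin]
    exact h1.of_comp (ContinuousLinearMap.coeLM ℝ)

theorem symplForm_hamiltonField (P : ℙ → ℝ) (w δ : ℙ) :
    symplForm (hamiltonField P w) δ = -fderiv ℝ P w δ :=
  symplForm_linearHamilton _ _

/-- The pull-back of the symplectic form is closed; this is used in the case when the second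
argument `e` is a direction in which two of the three terms vanish. -/
theorem hasDerivAt_symplForm_pullback {W : Type*} [NormedAddCommGroup W] [NormedSpace ℝ W]
    {C : W → ℙ} {x e a c : W} (hC : SmoothAt C x)
    (ha : ∀ᶠ s : ℝ in 𝓝 0, symplForm (fderiv ℝ C (x + s • a) c) (fderiv ℝ C (x + s • a) e) = 0)
    (hc : ∀ᶠ s : ℝ in 𝓝 0, symplForm (fderiv ℝ C (x + s • c) e) (fderiv ℝ C (x + s • c) a) = 0) :
    HasDerivAt (fun s : ℝ =>
      symplForm (fderiv ℝ C (x + s • e) a) (fderiv ℝ C (x + s • e) c)) 0 0 := by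
  have hsymm : IsSymmSndFDerivAt ℝ C x := hC.isSymmSndFDerivAt (by simpa using
    (WithTop.coe_le_coe.2 (le_top : (2 : ℕ∞) ≤ ⊤)))
  have hD : HasFDerivAt (fderiv ℝ C) (fderiv ℝ (fderiv ℝ C) x) x :=
    ((hC.fderiv_right (m := ∞) (by simp)).differentiableAt (by simp)).hasFDerivAt
  have hline : ∀ v : W, HasDerivAt (fun s : ℝ => fderiv ℝ C (x + s • v))
      (fderiv ℝ (fderiv ℝ C) x v) 0 := hasDerivAt_line hD
  have key : ∀ v p q : W, HasDerivAt
      (fun s : ℝ => symplForm (fderiv ℝ C (x + s • v) p) (fderiv ℝ C (x + s • v) q))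
      (symplForm (fderiv ℝ C x p) (fderiv ℝ (fderiv ℝ C) x v q) +
        symplForm (fderiv ℝ (fderiv ℝ C) x v p) (fderiv ℝ C x q)) 0 := fun v p q => by
    have h1 : HasDerivAt (fun s : ℝ => fderiv ℝ C (x + s • v) p)
        (fderiv ℝ (fderiv ℝ C) x v p) 0 := by
      simpa using (hline v).clm_apply (hasDerivAt_const (0 : ℝ) p)
    have h2 : HasDerivAt (fun s : ℝ => fderiv ℝ C (x + s • v) q)
        (fderiv ℝ (fderiv ℝ C) x v q) 0 := by
      simpa using (hline v).clm_apply (hasDerivAt_const (0 : ℝ) q)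
    have := symplForm.hasDerivAt_of_bilinear (x := (0 : ℝ)) (fun _ => h1) (fun _ => h2)
    simpa using this
  have e1 := (key a c e).unique ((hasDerivAt_const (0 : ℝ) (0 : ℝ)).congr_of_eventuallyEq ha)
  have e2 := (key c e a).unique ((hasDerivAt_const (0 : ℝ) (0 : ℝ)).congr_of_eventuallyEq hc)
  refine (key e a c).congr_deriv ?_
  have s1 := hsymm.eq a e
  have s2 := hsymm.eq a c
  have s3 := hsymm.eq c e
  rw [s1, s2] at e1
  rw [s3] at e2
  rw [symplForm_swap (fderiv ℝ (fderiv ℝ C) x e a) (fderiv ℝ C x c)] at e1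
  rw [symplForm_swap (fderiv ℝ (fderiv ℝ C) x c a) (fderiv ℝ C x e),
    symplForm_swap (fderiv ℝ C x a) (fderiv ℝ (fderiv ℝ C) x e c)] at e2
  linarith [symplForm_swap (fderiv ℝ C x c) (fderiv ℝ (fderiv ℝ C) x e a),
    symplForm_swap (fderiv ℝ (fderiv ℝ C) x c a) (fderiv ℝ C x e),
    symplForm_swap (fderiv ℝ C x a) (fderiv ℝ (fderiv ℝ C) x e c)]

/-! ### From canonical to edge coordinates -/

theorem edgeScale_ne_zero {x : ℝ} (hx : x ≠ 0) (i : ℐ) : edgeScale x i ≠ 0 := by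
  unfold edgeScale; split_ifs <;> simp [hx]

theorem phase_halfSpace_mem_nhds {w : ℙ} (hw : 0 < w.2.1 0) : phaseHalfSpace b f ∈ 𝓝 w := by
  have hc : Continuous fun w : ℙ => w.2.1 0 :=
    (𝓍).continuous.comp (continuous_fst.comp continuous_snd)
  exact mem_of_superset ((isOpen_lt continuous_const hc).mem_nhds hw)
    fun v (hv : 0 < v.2.1 0) => hv.le

theorem contDiffAt_toCanonical {w : ℙ} (hx : w.2.1 0 ≠ 0) :
    SmoothAt (toCanonical (b := b) (f := f)) w := by
  obtain ⟨hui, hv⟩ := contDiffAt_phase w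
  refine contDiffAt_fst.prodMk (ContDiffAt.prodMk (contDiff_fst.comp contDiff_snd).contDiffAt
    (ContDiffAt.prodMk ?_ (contDiffAt_euclidean.2 fun i => ?_)))
  · exact (contDiff_fst.comp (contDiff_snd.comp contDiff_snd)).contDiffAt.div hui hx
  · simp only [edgeScale]
    split_ifs
    exacts [(hv i).div hui hx, (hv i).div contDiffAt_const one_ne_zero]

theorem fderiv_toCanonical {w : ℙ} (hx : w.2.1 0 ≠ 0) (δ : ℙ) :
    fderiv ℝ toCanonical w δ = (δ.1, δ.2.1, δ.2.2.1 / w.2.1 0 - w.2.2.1 * δ.2.1 0 / w.2.1 0 ^ 2,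
      WithLp.toLp 2 fun i => δ.2.2.2 i / edgeScale (w.2.1 0) i -
        if i.val ≤ b then w.2.2.2 i * δ.2.1 0 / w.2.1 0 ^ 2 else 0) := by
  have hline : HasDerivAt (fun s : ℝ => w + s • δ) δ 0 :=
    hasDerivAt_add_smul _ _
  have h1 : HasDerivAt (fun s : ℝ => toCanonical (w + s • δ)) (fderiv ℝ toCanonical w δ) 0 :=
    hasDerivAt_line ((contDiffAt_toCanonical hx).differentiableAt (by simp)).hasFDerivAt δ
  refine h1.unique ?_
  have hu : HasDerivAt (fun s : ℝ => (w + s • δ).2.1) δ.2.1 0 := hline.snd.fst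
  have hτ : HasDerivAt (fun s : ℝ => (w + s • δ).2.2.1) δ.2.2.1 0 := hline.snd.snd.fst
  have hv : HasDerivAt (fun s : ℝ => (w + s • δ).2.2.2) δ.2.2.2 0 := hline.snd.snd.snd
  have hx' : (w + (0 : ℝ) • δ).2.1 0 ≠ 0 := by simpa using hx
  have hu0 := hasDerivAt_coord.1 hu 0
  have ht : HasDerivAt (fun s : ℝ => (w + s • δ).1) δ.1 0 := hline.fst
  refine ht.prodMk (hu.prodMk (HasDerivAt.prodMk ?_ (hasDerivAt_coord.2 fun i => ?_)))
  · refine (hτ.div hu0 hx').congr_deriv ?_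
    simp
    field_simp
  · have hvi := hasDerivAt_coord.1 hv i
    simp only [edgeScale]
    split_ifs with hi
    · refine (hvi.div hu0 hx').congr_deriv ?_
      simp
      field_simp
    · simpa using hvi

theorem surjective_fderiv_toCanonical {w : ℙ} (hx : w.2.1 0 ≠ 0) :
    Function.Surjective (fderiv ℝ toCanonical w) := fun δ => by
  refine ⟨(δ.1, δ.2.1, w.2.1 0 * (δ.2.2.1 + w.2.2.1 * δ.2.1 0 / w.2.1 0 ^ 2),
    WithLp.toLp 2 fun i => edgeScale (w.2.1 0) i * (δ.2.2.2 i +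
      if i.val ≤ b then w.2.2.2 i * δ.2.1 0 / w.2.1 0 ^ 2 else 0)), ?_⟩
  rw [fderiv_toCanonical hx]
  refine Prod.ext rfl (Prod.ext rfl (Prod.ext ?_ ?_))
  · simp only
    field_simp
    ring
  · ext i
    have := edgeScale_ne_zero hx i
    simp only
    rw [mul_div_cancel_left₀ _ this]
    ring

/-- Over the interior, the edge bracket is the Poisson bracket in canonical coordinates. -/
theorem edgeBracket_eq {a c : ℙ → ℝ} {w : ℙ} (hx : w.2.1 0 ≠ 0)
    {A C : ℙ →L[ℝ] ℝ} (hA : edgeDeriv a w = A.comp (fderiv ℝ toCanonical w))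
    (hC : edgeDeriv c w = C.comp (fderiv ℝ toCanonical w)) :
    edgeBracket a c w = C (linearHamilton A) := by
  have hT := fderiv_toCanonical hx
  have e1 : fderiv ℝ toCanonical w ((1, 0, 0, 0) : ℙ) = (1, 0, 0, 0) := by
    rw [hT]; refine Prod.ext rfl (Prod.ext rfl (Prod.ext ?_ ?_))
    · simp
    · ext i; simp
  have e2 : fderiv ℝ toCanonical w ((0, 0, 1, 0) : ℙ) = (w.2.1 0)⁻¹ • ((0, 0, 1, 0) : ℙ) := by
    rw [hT]; refine Prod.ext ?_ (Prod.ext ?_ (Prod.ext ?_ ?_))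
    · simp
    · simp
    · simp
    · ext i; simp
  have e3 : ∀ i : ℐ, fderiv ℝ toCanonical w ((0, 0, 0, basisVec i) : ℙ) =
      (edgeScale (w.2.1 0) i)⁻¹ • ((0, 0, 0, basisVec i) : ℙ) := fun i => by
    rw [hT]; refine Prod.ext ?_ (Prod.ext ?_ (Prod.ext ?_ ?_))
    · simp
    · simp
    · simp
    · ext j
      simp only [basisVec_apply, PiLp.zero_apply, mul_zero, zero_div, ite_self, sub_zero,
        Prod.smul_snd, PiLp.smul_apply, smul_eq_mul]
      split_ifs with h
      · rw [h]; ring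
      · simp
  set E : ℙ := fderiv ℝ toCanonical w (slowEuler w) with hE
  have hEv : E = (0, 0, w.2.2.1 / w.2.1 0, WithLp.toLp 2 fun i =>
      if i.val ≤ b then w.2.2.2 i / w.2.1 0 else 0) := by
    rw [hE, hT]; refine Prod.ext rfl (Prod.ext rfl (Prod.ext ?_ ?_))
    · simp [slowEuler]
    · ext i
      simp only [slowEuler, edgeScale, PiLp.zero_apply, mul_zero, zero_div, ite_self, sub_zero]
      split_ifs <;> simp
  have e4 : ∀ i : ℐ, fderiv ℝ toCanonical w ((0, basisVec i, 0, 0) : ℙ) =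
      (0, basisVec i, 0, 0) - if i = 0 then (w.2.1 0)⁻¹ • E else 0 := fun i => by
    rw [hT, hEv]
    by_cases hi : i = 0
    · subst hi
      refine Prod.ext ?_ (Prod.ext ?_ (Prod.ext ?_ ?_))
      · simp
      · simp
      · simp [basisVec_apply]; field_simp
      · ext j
        simp [basisVec_apply]
        split_ifs <;> field_simp <;> simp
    · refine Prod.ext ?_ (Prod.ext ?_ (Prod.ext ?_ ?_))
      · simp [hi]
      · simp [hi]
      · simp [hi, basisVec_apply, Ne.symm hi]
      · ext j
        simp [hi, basisVec_apply, Ne.symm hi]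
  have hs := fun i : ℐ => edgeScale_ne_zero hx i
  simp only [edgeBracket, hA, hC, ContinuousLinearMap.comp_apply, e1, e2, e3, e4, ← hE, map_smul,
    map_sub, smul_eq_mul]
  have hsum : ∀ i : ℐ, edgeScale (w.2.1 0) i *
      ((edgeScale (w.2.1 0) i)⁻¹ * A (0, 0, 0, basisVec i) *
          (C (0, basisVec i, 0, 0) - C (if i = 0 then (w.2.1 0)⁻¹ • E else 0)) -
        (A (0, basisVec i, 0, 0) - A (if i = 0 then (w.2.1 0)⁻¹ • E else 0)) *
          ((edgeScale (w.2.1 0) i)⁻¹ * C (0, 0, 0, basisVec i))) =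
      (A (0, 0, 0, basisVec i) * C (0, basisVec i, 0, 0) -
        A (0, basisVec i, 0, 0) * C (0, 0, 0, basisVec i)) -
      if i = 0 then (w.2.1 0)⁻¹ * (A (0, 0, 0, basisVec 0) * C E - C (0, 0, 0, basisVec 0) * A E)
        else 0 := fun i => by
    have := hs i
    split_ifs with hi
    · subst hi
      rw [map_smul, map_smul, smul_eq_mul, smul_eq_mul]
      field_simp
      ring
    · rw [map_zero, map_zero]
      field_simp
      ring
  rw [sum_congr rfl fun i _ => hsum i, sum_sub_distrib, Finset.sum_ite_eq' Finset.univ (0 : ℐ)]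
  rw [functional_apply C (linearHamilton A)]
  simp only [linearHamilton, sum_sub_distrib, Finset.mem_univ, if_true, edgeScale,
    zero_val_le, neg_mul, sum_neg_distrib]
  have h9 : w.2.1 0 * ((w.2.1 0)⁻¹ * A (0, 0, 1, 0) * C (1, 0, 0, 0) -
      A (1, 0, 0, 0) * ((w.2.1 0)⁻¹ * C (0, 0, 1, 0))) =
      A (0, 0, 1, 0) * C (1, 0, 0, 0) - A (1, 0, 0, 0) * C (0, 0, 1, 0) := by
    field_simp
  rw [h9]
  ring

/-! ### Conservation of the symbol along the rays of the flow box -/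

theorem norm_coord_le {v w : ℰ} (h : ∀ i, |v i| ≤ |w i|) : ‖v‖ ≤ ‖w‖ := by
  rw [EuclideanSpace.norm_eq, EuclideanSpace.norm_eq]
  exact Real.sqrt_le_sqrt (sum_le_sum fun i _ => by
    rw [norm_eq_abs, norm_eq_abs]
    exact pow_le_pow_left₀ (abs_nonneg _) (h i) 2)

theorem eq_of_hasDerivAt_zero {φ : ℝ → ℝ} {m : ℝ} (hm : 0 < m)
    (hc : ContinuousOn φ (Icc 0 m)) (hd : ∀ σ ∈ Ioo 0 m, HasDerivAt φ 0 σ) : φ m = φ 0 := by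
  obtain ⟨c, -, hc'⟩ := exists_hasDerivAt_eq_slope φ (fun _ => 0) hm hc hd
  rw [eq_comm, div_eq_zero_iff] at hc'
  rcases hc' with h | h <;> linarith

theorem HasDerivAt.of_comp_add {E : Type*} [NormedAddCommGroup E] [NormedSpace ℝ E] {F : ℝ → E}
    {v : E} {σ : ℝ} (h : HasDerivAt (fun s => F (σ + s)) v 0) : HasDerivAt F v σ := by
  rw [← sub_self σ] at h
  simpa using h.comp_sub_const σ σ

/-- The end point of the ray of the flow box through `q`. -/
noncomputable def hatBase (q : ℋ) : ℋ := (q.1, setX 0 q.2.1, q.2.2 - fibreProj q.2.2)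

theorem hatBase_time (q : ℋ) : (hatBase q).2.1 0 = 0 := by simp [hatBase, setCoord_xCoord_apply]

theorem fibreProj_hatBase (q : ℋ) : fibreProj (hatBase q).2.2 = 0 := by
  simp [hatBase, fibreProj_fibreProj]

theorem hatBase_add (q : ℋ) : hatBase q + q.2.1 0 • hatVec = q - hatProj q := by
  refine Prod.ext ?_ (Prod.ext ?_ ?_)
  · simp [hatBase, hatVec, hatProj_apply]
  · ext i
    simp only [hatBase, hatVec, hatProj_apply, Prod.snd_add, Prod.fst_add, Prod.smul_snd,
      Prod.smul_fst, PiLp.add_apply, PiLp.smul_apply, setCoord_xCoord_apply, basisVec_apply,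
      Prod.snd_sub, Prod.fst_sub, sub_zero]
    split_ifs with h <;> simp [h]
  · simp [hatBase, hatVec, hatProj_apply]

theorem blowDown_of_boundary {q : ℋ} (h0 : q.2.1 0 = 0) (hP : fibreProj q.2.2 = 0) :
    blowDown q = q := by
  refine Prod.ext rfl (Prod.ext ?_ ?_)
  · ext i
    simp only [blowDown, sq_apply]
    split_ifs with h
    · rw [h, h0]; norm_num
    · rfl
  · ext i
    simp only [blowDown, scaledCovector_apply]
    split_ifs with h
    · rfl
    · have := congrArg (fun v : ℰ => v i) hP
      simp only [fibreProj_apply, h, if_false, PiLp.zero_apply] at this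
      rw [this, mul_zero]

theorem hatBase_add_mem {p₀ q : ℋ} {r : ℝ} (h0 : p₀.2.1 0 = 0)
    (hP : fibreProj p₀.2.2 = 0) (hq : q ∈ ball p₀ r) {σ : ℝ} (hσ : |σ| ≤ |q.2.1 0|) :
    hatBase q + σ • hatVec ∈ ball p₀ r := by
  rw [mem_ball_iff_norm] at hq ⊢
  refine lt_of_le_of_lt ?_ hq
  rw [Prod.norm_def, Prod.norm_def, Prod.norm_def, Prod.norm_def]
  refine max_le_max ?_ (max_le_max ?_ ?_)
  · simp [hatBase, hatVec]
  · refine norm_coord_le fun i => ?_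
    simp only [hatBase, hatVec, Prod.snd_add, Prod.fst_add, Prod.smul_snd,
      Prod.smul_fst, PiLp.add_apply, PiLp.smul_apply, setCoord_xCoord_apply, basisVec_apply,
      Prod.snd_sub, Prod.fst_sub, PiLp.sub_apply, smul_eq_mul]
    split_ifs with h
    · rw [h, h0]; simpa using hσ
    · simp
  · refine norm_coord_le fun i => ?_
    have h2 := congrArg (fun v : ℰ => v i) hP
    simp only [hatBase, hatVec, Prod.snd_add, Prod.smul_snd, PiLp.add_apply, PiLp.smul_apply,
      Prod.snd_sub, PiLp.sub_apply, smul_eq_mul, fibreProj_apply, PiLp.zero_apply] at h2 ⊢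
    split_ifs at h2 ⊢ with h
    · simp
    · rw [h2]; simp

theorem contDiff_blowDown : Smooth (blowDown : ℋ → ℋ) := by
  refine contDiff_fst.prodMk ((contDiff_sq.comp (contDiff_fst.comp contDiff_snd)).prodMk
    (contDiff_euclidean.2 fun i => ?_))
  simp only [scaledCovector_apply]
  split_ifs
  · exact contDiff_hat_cov i
  · exact (contDiff_hat_pos 0).mul (contDiff_hat_cov i)

theorem contDiff_canonLift : Smooth fun x : ℝ × ℋ => canonLift x.1 x.2 := by
  refine (contDiff_fst.comp contDiff_snd).prodMk
    ((contDiff_fst.comp (contDiff_snd.comp contDiff_snd)).prodMk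
      (contDiff_fst.prodMk (contDiff_euclidean.2 fun i => ?_)))
  have h1 : Smooth fun x : ℝ × ℋ => x.2.2.2 i := (contDiff_hat_cov i).comp contDiff_snd
  have h2 : Smooth fun x : ℝ × ℋ => x.2.2.1 0 := (contDiff_hat_pos 0).comp contDiff_snd
  simp only
  split_ifs
  · exact (contDiff_fst.mul contDiff_const).mul h1
  · exact (contDiff_fst.mul h2).mul h1

theorem blowDown_time (q : ℋ) : (blowDown q).2.1 0 = q.2.1 0 ^ 2 := by simp [blowDown, sq_apply]

theorem IsNormalCoeff.continuousOn_quad (hΓ : 𝒩) :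
    ContinuousOn (fun Y : ℋ => quad Γ Y.2.1 Y.2.2) (hatDomain u₀ ε) := by
  unfold quad
  exact continuousOn_finsetSum _ fun j _ =>
    ((contDiff_hat_cov j).continuous.continuousOn).mul (hΓ.contDiffOn_raise j).continuousOn

theorem IsHatGraph.time_eq (h : 𝒢) {q : ℋ}
    (hq : q ∈ ball p₀ r) : (X q).2.1 0 = q.2.1 0 := h.level q hq

theorem IsHatGraph.blowDown_mem (h : 𝒢) {q : ℋ} (hq : q ∈ ball p₀ r) :
    blowDown (X q) ∈ hatDomain u₀ ε :=
  ⟨(h.coeff.half_ball_subset (h.mem_ball q hq)).2, (h.coeff.half_ball_subset (h.mem_ball q hq)).1⟩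

/-- The coefficient which relates the velocity of the rays of the flow box to the Hamilton
field. -/
noncomputable def rayRate (Γ : ℐ → ℐ → ℰ → ℝ) (X : ℋ → ℋ) (τ : ℝ) (q : ℋ) : ℝ :=
  -(q.2.1 0 * ϱ (blowDown (X q)))⁻¹ * (blowDown (X q)).2.1 0 / τ

/-- The rays of the flow box, lifted to the cotangent bundle. -/
noncomputable def flowLift (X : ℋ → ℋ) (x : ℝ × ℋ) : ℙ := canonLift x.1 (blowDown (X x.2))

theorem IsHatGraph.hasDerivAt_flowLift (h : 𝒢) {τ : ℝ} (hτ : τ ≠ 0) {q : ℋ}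
    (hq : q ∈ ball p₀ r) (h0 : q.2.1 0 ≠ 0) :
    HasDerivAt (fun s : ℝ => flowLift X (τ, q + s • hatVec))
      (rayRate Γ X τ q • hamiltonField (modelSymbol Γ) (flowLift X (τ, q))) 0 := by
  have e0 : q + (0 : ℝ) • hatVec = q := by rw [zero_smul, add_zero]
  have h1 := h.flow q hq h0
  have hx : 0 < (blowDown (X q)).2.1 0 := by rw [blowDown_time, h.time_eq hq]; positivity
  have h2 := h.coeff.hasDerivAt_canonLift (c := fun s : ℝ => blowDown (X (q + s • hatVec))) (τ := τ)
    (s := 0) (κ := -(q.2.1 0 * ϱ (blowDown (X q)))⁻¹)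
    (by rw [e0]; exact (h.blowDown_mem hq).2) (by rw [e0]; exact hx) hτ (by rw [e0]; exact h1)
  rw [e0] at h2
  exact h2

theorem IsHatGraph.contDiffAt_flowLift (h : 𝒢)
    {x : ℝ × ℋ} (hq : x.2 ∈ ball p₀ r) : SmoothAt (flowLift X) x := by
  have h1 : SmoothAt X x.2 := h.smooth.contDiffAt (Metric.isOpen_ball.mem_nhds hq)
  have h2 : SmoothAt (fun x : ℝ × ℋ => (x.1, blowDown (X x.2))) x :=
    contDiffAt_fst.prodMk (contDiff_blowDown.contDiffAt.comp x (h1.comp x contDiffAt_snd))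
  exact contDiff_canonLift.contDiffAt.comp x h2

theorem IsHatGraph.quad_blowDown (h : 𝒢) {q : ℋ} (hq : q ∈ ball p₀ r) (hx : 0 ≤ q.2.1 0) :
    quad Γ (blowDown (X q)).2.1 (blowDown (X q)).2.2 = quad Γ (hatBase q).2.1 (hatBase q).2.2 := by
  have hmem : ∀ σ ∈ Icc 0 (q.2.1 0), hatBase q + σ • hatVec ∈ ball p₀ r := fun σ hσ =>
    hatBase_add_mem h.center_time h.fibre hq (by
      rw [abs_of_nonneg hσ.1, abs_of_nonneg hx]; exact hσ.2)
  have hX0 : X (hatBase q) = hatBase q := by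
    have h1 := hmem 0 ⟨le_rfl, hx⟩
    rw [zero_smul, add_zero] at h1
    refine h.initial _ h1 (hatBase_time q) ?_
    rw [hatProj_apply, fibreProj_hatBase]; rfl
  have hb : blowDown (hatBase q) = hatBase q :=
    blowDown_of_boundary (hatBase_time q) (fibreProj_hatBase q)
  let φ : ℝ → ℝ := fun σ =>
    quad Γ (blowDown (X (hatBase q + σ • hatVec))).2.1 (blowDown (X (hatBase q + σ • hatVec))).2.2
  have hφ0 : φ 0 = quad Γ (hatBase q).2.1 (hatBase q).2.2 := by
    simp only [φ]
    rw [zero_smul, add_zero, hX0, hb]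
  have hφm : φ (q.2.1 0) = quad Γ (blowDown (X q)).2.1 (blowDown (X q)).2.2 := by
    simp only [φ]
    rw [hatBase_add, h.proj]
  rcases hx.eq_or_lt with hx | hx
  · rw [← hφm, ← hx, hφ0]
  rw [← hφm, ← hφ0]
  have hline : Continuous fun σ : ℝ => hatBase q + σ • (hatVec : ℋ) := by fun_prop
  refine eq_of_hasDerivAt_zero hx ?_ fun σ hσ => ?_
  · refine h.coeff.continuousOn_quad.comp (contDiff_blowDown.continuous.comp_continuousOn
      (h.smooth.continuousOn.comp hline.continuousOn hmem)) fun σ hσ => ?_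
    exact h.blowDown_mem (hmem σ hσ)
  · have hσ' := hmem σ ⟨hσ.1.le, hσ.2.le⟩
    set qσ := hatBase q + σ • (hatVec : ℋ) with hqσ
    have ht : qσ.2.1 0 = σ := by
      rw [hqσ]
      simp [hatBase_time, hatVec, basisVec_apply]
    have hxσ : 0 < (blowDown (X qσ)).2.1 0 := by
      rw [blowDown_time, h.time_eq hσ', ht]; have := hσ.1; positivity
    have h1 := h.hasDerivAt_flowLift one_ne_zero hσ' (by rw [ht]; exact hσ.1.ne')
    have h2 : HasFDerivAt (modelSymbol Γ) (fderiv ℝ (modelSymbol Γ) (flowLift X (1, qσ)))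
        (flowLift X (1, qσ + (0 : ℝ) • hatVec)) := by
      rw [zero_smul, add_zero]
      exact ((h.coeff.contDiffAt_modelSymbol (w := flowLift X (1, qσ)) (h.blowDown_mem hσ').2
        hxσ).differentiableAt (by simp)).hasFDerivAt
    have h3 := HasFDerivAt.comp_hasDerivAt (l := modelSymbol Γ) (0 : ℝ) h2 h1
    have h4 : fderiv ℝ (modelSymbol Γ) (flowLift X (1, qσ))
        (hamiltonField (modelSymbol Γ) (flowLift X (1, qσ))) = 0 := by
      have := symplForm_hamiltonField (modelSymbol Γ) (flowLift X (1, qσ))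
        (hamiltonField (modelSymbol Γ) (flowLift X (1, qσ)))
      rw [symplForm_self] at this
      linarith
    rw [map_smul, h4, smul_zero] at h3
    refine HasDerivAt.of_comp_add ?_
    have h5 := (hasDerivAt_const 0 1).sub h3
    rw [sub_zero] at h5
    refine h5.congr_of_eventuallyEq ?_
    have hne : ∀ᶠ s : ℝ in 𝓝 0, qσ + s • (hatVec : ℋ) ∈ ball p₀ r ∧ σ + s ≠ 0 := by
      have c2 : ContinuousAt (fun s => σ + s) 0 := by fun_prop
      exact (eventually_add_smul_mem (Metric.isOpen_ball.mem_nhds hσ') _).and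
        (c2.eventually_ne (by simpa using hσ.1.ne'))
    filter_upwards [hne] with s hs
    have e1 : hatBase q + (σ + s) • (hatVec : ℋ) = qσ + s • hatVec := by rw [hqσ]; module
    have e2 : (qσ + s • (hatVec : ℋ)).2.1 0 = σ + s := by
      rw [← e1]; simp [hatBase_time, hatVec, basisVec_apply]
    simp only [φ, Pi.sub_apply, Function.comp]
    rw [e1, flowLift, modelSymbol_canonLift]
    · ring
    · change (blowDown (X (qσ + s • hatVec))).2.1 0 ≠ 0
      rw [blowDown_time, h.time_eq hs.1, e2]
      exact pow_ne_zero 2 hs.2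

/-! ### The defining functions and the null directions -/

/-- The coordinates `x, z_1, …, z_f`. -/
def fibreIdx (i : Fin (f + 1)) : ℐ := if i = 0 then 0 else ⟨b + i.val, by omega⟩

theorem fibreIdx_zero : (fibreIdx 0 : ℐ) = 0 := by simp [fibreIdx]

theorem lt_fibreIdx {i : Fin (f + 1)} (hi : i ≠ 0) : b < (fibreIdx i : ℐ).val := by
  have : 0 < i.val := Nat.pos_of_ne_zero fun h => hi (Fin.ext h)
  simp only [fibreIdx, hi, if_false]
  omega

theorem fibreIdx_injective : Function.Injective (fibreIdx : Fin (f + 1) → ℐ) := by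
  intro i j hij
  by_cases hi : i = 0 <;> by_cases hj : j = 0
  · rw [hi, hj]
  · have := lt_fibreIdx (b := b) hj
    rw [← hij, hi, fibreIdx_zero] at this
    simp at this
  · have := lt_fibreIdx (b := b) hi
    rw [hij, hj, fibreIdx_zero] at this
    simp at this
  · simp only [fibreIdx, hi, hj, if_false, Fin.mk.injEq] at hij
    exact Fin.ext (by omega)

theorem exists_fibreIdx {k : ℐ} (hk : b < k.val) : ∃ i : Fin (f + 1), i ≠ 0 ∧ fibreIdx i = k := by
  have := k.isLt
  have hne : (⟨k.val - b, by omega⟩ : Fin (f + 1)) ≠ 0 := fun h => by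
    have := congrArg Fin.val h
    simp at this
    omega
  refine ⟨⟨k.val - b, by omega⟩, hne, Fin.ext ?_⟩
  simp only [fibreIdx, hne, if_false]
  omega

/-- The defining functions of the flowout, in terms of the position and the components of the
covector divided by the time component: the symbol, and the difference of the fibre
components and their values on the graph of `Z`. -/
noncomputable def hatDef (Γ : ℐ → ℐ → ℰ → ℝ) (Z : ℋ → ℰ) (i : Fin (f + 1)) (Y : ℋ) : ℝ :=
  if i = 0 then 1 - quad Γ Y.2.1 Y.2.2 else defect Z Y (fibreIdx i)

theorem IsHatGraph.contDiffOn_hatDef (h : 𝒢) (i : Fin (f + 1)) :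
    SmoothOn (hatDef Γ Z i) (hatDomain u₀ ε) := by
  unfold hatDef
  split_ifs
  · refine contDiffOn_const.sub (ContDiffOn.sum fun j _ => ?_)
    exact (contDiff_hat_cov j).contDiffOn.mul (h.coeff.contDiffOn_raise j)
  · exact contDiffOn_euclidean.1 (h.contDiffOn_defect.mono fun Y hY => hY.1) _

theorem IsHatGraph.forall_hatDef_eq_zero (h : 𝒢) {Y : ℋ} :
    (∀ i, hatDef Γ Z i Y = 0) ↔ quad Γ Y.2.1 Y.2.2 = 1 ∧ defect Z Y = 0 := by
  constructor
  · intro hY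
    refine ⟨by have := hY 0; simp only [hatDef, if_true] at this; linarith, ?_⟩
    rw [← h.fibreProj_defect]
    ext k
    rw [fibreProj_apply]
    split_ifs with hk
    · rfl
    · obtain ⟨i, hi, rfl⟩ := exists_fibreIdx (not_le.1 hk)
      have := hY i
      simp only [hatDef, hi, if_false] at this
      exact this
  · rintro ⟨h1, h2⟩ i
    unfold hatDef
    split_ifs
    · rw [h1, sub_self]
    · rw [h2]; rfl

/-- The direction of the `i`-th of the coordinates `x, z_1, …, z_f` of the flow box. -/
noncomputable def nullDir (i : Fin (f + 1)) : ℋ := (0, basisVec (fibreIdx i), 0)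

theorem nullDir_zero : (nullDir 0 : ℋ) = hatVec := by rw [nullDir, fibreIdx_zero, hatVec]

theorem hatBase_nullDir (q : ℋ) (i : Fin (f + 1)) (s : ℝ) : (∀ j : ℐ, j.val ≤ b →
      (hatBase (q + s • nullDir i)).2.1 j = (hatBase q).2.1 j) ∧
    (hatBase (q + s • nullDir i)).2.2 = (hatBase q).2.2 := by
  constructor
  · intro j hj
    simp only [hatBase, setCoord_xCoord_apply, nullDir, Prod.snd_add, Prod.fst_add, Prod.smul_snd,
      Prod.smul_fst, PiLp.add_apply, PiLp.smul_apply, basisVec_apply]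
    split_ifs with h0 h1
    · rfl
    · exfalso
      by_cases hi : i = 0
      · rw [hi, fibreIdx_zero] at h1; exact h0 h1
      · have := lt_fibreIdx (b := b) hi
        rw [← h1] at this
        omega
    · simp
  · simp [hatBase, nullDir]

theorem nullDir_time {i : Fin (f + 1)} (q : ℋ) (s : ℝ) (hi : i ≠ 0) :
    (q + s • nullDir i).2.1 0 = q.2.1 0 := by
  have : (0 : ℐ) ≠ fibreIdx i := fun h => by
    have := lt_fibreIdx (b := b) hi
    rw [← h] at this
    simp at this
  simp [nullDir, basisVec_apply, this]

/-- The value of the symbol on the ray of the flow box through `q`. -/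
noncomputable def raySymbol (Γ : ℐ → ℐ → ℰ → ℝ) (x : ℝ × ℋ) : ℝ :=
  x.1 ^ 2 * (1 - quad Γ (hatBase x.2).2.1 (hatBase x.2).2.2)

theorem IsNormalCoeff.raySymbol_nullDir (hΓ : 𝒩) {x : ℝ × ℋ}
    (i : Fin (f + 1)) {s : ℝ} (h1 : (hatBase x.2).2.1 ∈ ball u₀ ε)
    (h2 : (hatBase (x.2 + s • nullDir i)).2.1 ∈ ball u₀ ε) :
    raySymbol Γ (x + s • (0, (nullDir i : ℋ))) = raySymbol Γ x := by
  have e1 : x + s • (0, (nullDir i : ℋ)) = (x.1, x.2 + s • nullDir i) := by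
    refine Prod.ext ?_ rfl
    simp
  obtain ⟨h3, h4⟩ := hatBase_nullDir x.2 i s
  rw [e1]
  simp only [raySymbol]
  rw [h4]
  congr 2
  simp only [quad, raise]
  refine sum_congr rfl fun j _ => ?_
  rw [mul_sum, mul_sum]
  refine sum_congr rfl fun k _ => ?_
  have hz : ∀ l : ℐ, ¬ l.val ≤ b → (hatBase x.2).2.2 l = 0 := fun l hl => by
    have := congrArg (fun v : ℰ => v l) (fibreProj_hatBase x.2)
    simpa only [fibreProj_apply, hl, if_false, PiLp.zero_apply] using this
  by_cases hj : j.val ≤ b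
  · by_cases hk : k.val ≤ b
    · rw [hΓ.base _ h2 _ h1 (hatBase_time _) (hatBase_time _) h3 j k hj hk]
    · rw [hz k hk]; simp
  · rw [hz j hj]; simp

/-- The region of the flow box over `x > 0`. -/
def flowRegion (p₀ : ℋ) (r : ℝ) : Set (ℝ × ℋ) := {x | x.2 ∈ ball p₀ r ∧ 0 < x.2.2.1 0 ∧ x.1 ≠ 0}

theorem isOpen_flowRegion : IsOpen (flowRegion p₀ r) := by
  have h1 : Continuous fun x : ℝ × ℋ => x.2.2.1 0 :=
    (contDiff_hat_pos 0).continuous.comp continuous_snd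
  exact (Metric.isOpen_ball.preimage continuous_snd).inter
    ((isOpen_lt continuous_const h1).inter (isOpen_ne_fun continuous_fst continuous_const))

theorem IsHatGraph.hatBase_mem (h : 𝒢) {q : ℋ}
    (hq : q ∈ ball p₀ r) : hatBase q ∈ ball p₀ r ∧ X (hatBase q) = hatBase q ∧
      (hatBase q).2.1 ∈ ball u₀ ε := by
  have h1 := hatBase_add_mem h.center_time h.fibre hq (σ := 0) (by simp)
  rw [zero_smul, add_zero] at h1
  have hX0 : X (hatBase q) = hatBase q := by
    refine h.initial _ h1 (hatBase_time q) ?_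
    rw [hatProj_apply, fibreProj_hatBase]; rfl
  refine ⟨h1, hX0, ?_⟩
  have := h.mem_ball _ h1
  rw [hX0] at this
  exact h.coeff.mem_ball_of_half this

theorem IsHatGraph.modelSymbol_flowLift (h : 𝒢) {x : ℝ × ℋ} (hx : x ∈ flowRegion p₀ r) :
    modelSymbol Γ (flowLift X x) = raySymbol Γ x := by
  rw [flowLift, modelSymbol_canonLift, h.quad_blowDown hx.1 hx.2.1.le, raySymbol]
  rw [blowDown_time, h.time_eq hx.1]
  exact pow_ne_zero 2 hx.2.1.ne'

theorem IsHatGraph.flowLift_time (h : 𝒢)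
    {x : ℝ × ℋ} (hx : x ∈ flowRegion p₀ r) : 0 < (flowLift X x).2.1 0 := by
  change 0 < (blowDown (X x.2)).2.1 0
  rw [blowDown_time, h.time_eq hx.1]
  exact pow_pos hx.2.1 2

theorem IsHatGraph.hasFDerivAt_flowLift (h : 𝒢) {x : ℝ × ℋ} (hx : x ∈ flowRegion p₀ r) :
    HasFDerivAt (flowLift X) (fderiv ℝ (flowLift X) x) x :=
  ((h.contDiffAt_flowLift hx.1).differentiableAt (by simp)).hasFDerivAt

theorem IsHatGraph.hasFDerivAt_raySymbol (h : 𝒢) {x : ℝ × ℋ} (hx : x ∈ flowRegion p₀ r) :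
    HasFDerivAt (raySymbol Γ)
      ((fderiv ℝ (modelSymbol Γ) (flowLift X x)).comp (fderiv ℝ (flowLift X) x)) x := by
  have hu : (flowLift X x).2.1 ∈ ball u₀ ε := (h.blowDown_mem hx.1).2
  have hs : SmoothAt (modelSymbol Γ) (flowLift X x) :=
    h.coeff.contDiffAt_modelSymbol hu (h.flowLift_time hx)
  have h1 : HasFDerivAt (modelSymbol Γ) (fderiv ℝ (modelSymbol Γ) (flowLift X x)) (flowLift X x) :=
    (hs.differentiableAt (by simp)).hasFDerivAt
  refine (h1.comp x (h.hasFDerivAt_flowLift hx)).congr_of_eventuallyEq ?_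
  filter_upwards [isOpen_flowRegion.mem_nhds hx] with y hy
  exact (h.modelSymbol_flowLift hy).symm

/-- Moving along the null directions changes neither the symbol nor its derivative. -/
theorem IsHatGraph.fderiv_raySymbol_add (h : 𝒢)
    {x : ℝ × ℋ} (hx : x ∈ flowRegion p₀ r) (i : Fin (f + 1)) {s : ℝ}
    (hxs : x + s • (0, (nullDir i : ℋ)) ∈ flowRegion p₀ r) :
    fderiv ℝ (raySymbol Γ) (x + s • (0, (nullDir i : ℋ))) = fderiv ℝ (raySymbol Γ) x := by
  set c : ℝ × ℋ := (0, (nullDir i : ℋ)) with hc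
  rw [← fderiv_comp_add_right]
  refine EventuallyEq.fderiv_eq ?_
  have hcont : Continuous fun y : ℝ × ℋ => y + s • c := by fun_prop
  filter_upwards [isOpen_flowRegion.mem_nhds hx,
    hcont.continuousAt.eventually (isOpen_flowRegion.mem_nhds hxs)] with y hy hys
  refine h.coeff.raySymbol_nullDir i (h.hatBase_mem hy.1).2.2 ?_
  exact (h.hatBase_mem hys.1).2.2

theorem IsHatGraph.fderiv_raySymbol_nullDir (h : 𝒢)
    {x : ℝ × ℋ} (hx : x ∈ flowRegion p₀ r) (i : Fin (f + 1)) :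
    fderiv ℝ (raySymbol Γ) x (0, (nullDir i : ℋ)) = 0 := by
  have hd : HasFDerivAt (raySymbol Γ) (fderiv ℝ (raySymbol Γ) x) x :=
    (h.hasFDerivAt_raySymbol hx).differentiableAt.hasFDerivAt
  have h1 := hasDerivAt_line hd (0, (nullDir i : ℋ))
  refine h1.unique ((hasDerivAt_const 0 (raySymbol Γ x)).congr_of_eventuallyEq ?_)
  have hmem : ∀ᶠ s : ℝ in 𝓝 0, x + s • (0, (nullDir i : ℋ)) ∈ flowRegion p₀ r :=
    eventually_add_smul_mem (isOpen_flowRegion.mem_nhds hx) _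
  filter_upwards [hmem] with s hs
  exact h.coeff.raySymbol_nullDir i (h.hatBase_mem hx.1).2.2 (h.hatBase_mem hs.1).2.2

theorem IsHatGraph.fderiv_flowLift_hatVec (h : 𝒢) {x : ℝ × ℋ} (hx : x ∈ flowRegion p₀ r) :
    fderiv ℝ (flowLift X) x (0, (hatVec : ℋ)) =
      rayRate Γ X x.1 x.2 • hamiltonField (modelSymbol Γ) (flowLift X x) := by
  refine (hasDerivAt_line (h.hasFDerivAt_flowLift hx) _).unique ?_
  refine (h.hasDerivAt_flowLift hx.2.2 hx.1 hx.2.1.ne').congr_of_eventuallyEq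
    (Eventually.of_forall fun s => ?_)
  simp only
  congr 1
  exact Prod.ext (by simp) rfl

/-- The velocity of the rays is proportional to the Hamilton field, so that its symplectic product
with a tangent vector is the derivative of the symbol. -/
theorem IsHatGraph.symplForm_hatVec (h : 𝒢) {x : ℝ × ℋ} (hx : x ∈ flowRegion p₀ r) (c : ℝ × ℋ) :
    symplForm (fderiv ℝ (flowLift X) x (0, (hatVec : ℋ)))
      (fderiv ℝ (flowLift X) x c) = -(rayRate Γ X x.1 x.2 * fderiv ℝ (raySymbol Γ) x c) := by
  rw [h.fderiv_flowLift_hatVec hx, map_smul, (h.hasFDerivAt_raySymbol hx).fderiv]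
  change rayRate Γ X x.1 x.2 * symplForm (hamiltonField (modelSymbol Γ) (flowLift X x)) _ = _
  rw [symplForm_hamiltonField]
  simp

/-- The fibre directions of the flow box are symplectically orthogonal to the tangent vectors which
annihilate the symbol: the product is constant along the rays since the symplectic form is
closed, and vanishes at the end point. -/
theorem IsHatGraph.symplForm_nullDir (h : 𝒢)
    {x : ℝ × ℋ} (hx : x ∈ flowRegion p₀ r) (hPx : fibreProj x.2.2.2 = 0)
    (i : Fin (f + 1)) {c : ℝ × ℋ} (hc : fderiv ℝ (raySymbol Γ) x c = 0) :
    symplForm (fderiv ℝ (flowLift X) x ((0 : ℝ), (nullDir i : ℋ)))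
      (fderiv ℝ (flowLift X) x c) = 0 := by
  by_cases hi : i = 0
  · rw [hi, nullDir_zero, h.symplForm_hatVec hx, hc, mul_zero, neg_zero]
  set m := x.2.2.1 0 with hm
  set a : ℝ × ℋ := ((0 : ℝ), (nullDir i : ℋ)) with ha
  set e : ℝ × ℋ := ((0 : ℝ), (hatVec : ℋ)) with he
  let y : ℝ → ℝ × ℋ := fun σ => (x.1, hatBase x.2 + σ • hatVec)
  have hym : y m = x := by
    refine Prod.ext rfl ?_
    change hatBase x.2 + m • hatVec = x.2
    rw [hm, hatBase_add, hatProj_apply, hPx]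
    exact sub_zero _
  have hadd : ∀ σ s : ℝ, y (σ + s) = y σ + s • e := fun σ s => by
    refine Prod.ext (by simp [y, he]) ?_
    simp only [y, he, Prod.snd_add, Prod.smul_snd]
    module
  have htime : ∀ σ, (y σ).2.2.1 0 = σ := fun σ => by simp [y, hatBase_time, hatVec, basisVec_apply]
  have hball : ∀ σ ∈ Icc 0 m, (y σ).2 ∈ ball p₀ r := fun σ hσ =>
    hatBase_add_mem h.center_time h.fibre hx.1 (by
      rw [abs_of_nonneg hσ.1, abs_of_nonneg hx.2.1.le]; exact hσ.2)
  have hreg : ∀ σ ∈ Ioc 0 m, y σ ∈ flowRegion p₀ r := fun σ hσ =>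
    ⟨hball σ ⟨hσ.1.le, hσ.2⟩, by rw [htime]; exact hσ.1, hx.2.2⟩
  have hyc : Continuous y := by
    have : Continuous fun σ : ℝ => hatBase x.2 + σ • (hatVec : ℋ) := by fun_prop
    exact continuous_const.prodMk this
  let φ : ℝ → ℝ := fun σ =>
    symplForm (fderiv ℝ (flowLift X) (y σ) a) (fderiv ℝ (flowLift X) (y σ) c)
  have hφm : φ m = symplForm (fderiv ℝ (flowLift X) x a) (fderiv ℝ (flowLift X) x c) := by
    simp only [φ, hym]
  rw [← hφm]
  have hmpos : 0 < m := hx.2.1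
  have key : φ m = φ 0 := by
    refine eq_of_hasDerivAt_zero hmpos ?_ fun σ hσ => ?_
    · have hD : ContinuousOn (fun σ => fderiv ℝ (flowLift X) (y σ)) (Icc 0 m) := fun σ hσ => by
        have h1 := ((h.contDiffAt_flowLift (hball σ hσ)).fderiv_right (m := ∞)
          (by simp)).continuousAt
        exact (ContinuousAt.comp (g := fderiv ℝ (flowLift X)) h1
          hyc.continuousAt).continuousWithinAt
      have h2 : ContinuousOn (fun σ => symplForm (fderiv ℝ (flowLift X) (y σ) a)) (Icc 0 m) :=
        symplForm.continuous.comp_continuousOn (hD.clm_apply continuousOn_const)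
      exact h2.clm_apply (hD.clm_apply continuousOn_const)
    · have hσ' := hreg σ ⟨hσ.1, hσ.2.le⟩
      have hev : ∀ v : ℝ × ℋ, ∀ᶠ s : ℝ in 𝓝 0, y σ + s • v ∈ flowRegion p₀ r := by
        exact eventually_add_smul_mem (isOpen_flowRegion.mem_nhds hσ')
      refine HasDerivAt.of_comp_add ?_
      simp only [φ, hadd]
      refine hasDerivAt_symplForm_pullback (h.contDiffAt_flowLift hσ'.1) ?_ ?_
      · filter_upwards [hev a] with s hs
        rw [symplForm_swap, h.symplForm_hatVec hs, ha, h.fderiv_raySymbol_add hσ' i hs]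
        have h3 : fderiv ℝ (raySymbol Γ) (y σ) = fderiv ℝ (raySymbol Γ) x := by
          have h4 : y σ + (m - σ) • ((0 : ℝ), (nullDir 0 : ℋ)) = x := by
            rw [nullDir_zero, ← hym, ← hadd]
            congr 1; ring
          have h5 := h.fderiv_raySymbol_add hσ' 0 (s := m - σ) (by rw [h4]; exact hx)
          rw [h4] at h5
          exact h5.symm
        rw [h3, hc]; simp
      · filter_upwards [hev c] with s hs
        rw [h.symplForm_hatVec hs, ha, h.fderiv_raySymbol_nullDir hs i]
        simp
  rw [key]
  have hy0 : y 0 = (x.1, hatBase x.2) := by simp [y]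
  have hq0 := hball 0 ⟨le_rfl, hmpos.le⟩
  have hF : HasFDerivAt (flowLift X) (fderiv ℝ (flowLift X) (y 0)) (y 0) :=
    ((h.contDiffAt_flowLift hq0).differentiableAt (by simp)).hasFDerivAt
  have hA : fderiv ℝ (flowLift X) (y 0) a = (0, basisVec (fibreIdx i), 0, 0) := by
    refine (hasDerivAt_line hF a).unique ?_
    have h1 : HasDerivAt (fun s : ℝ => flowLift X (y 0) +
        s • ((0, basisVec (fibreIdx i), 0, 0) : ℙ)) (0, basisVec (fibreIdx i), 0, 0) 0 := by
      simpa using ((hasDerivAt_id (0 : ℝ)).smul_const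
        ((0, basisVec (fibreIdx i), 0, 0) : ℙ)).const_add (flowLift X (y 0))
    refine h1.congr_of_eventuallyEq ?_
    have hmem : ∀ᶠ s : ℝ in 𝓝 0, (y 0 + s • a).2 ∈ ball p₀ r :=
      eventually_add_smul_mem (Metric.isOpen_ball.mem_nhds hq0) a.2
    have hz : ∀ s : ℝ, (y 0 + s • a).2 ∈ ball p₀ r → flowLift X (y 0 + s • a) =
        canonLift x.1 (hatBase x.2 + s • nullDir i) := fun s hs => by
      have e1 : (y 0 + s • a) = (x.1, hatBase x.2 + s • nullDir i) := by
        rw [hy0]; exact Prod.ext (by simp [ha]) rfl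
      rw [e1] at hs ⊢
      have e2 : (hatBase x.2 + s • nullDir i).2.1 0 = 0 := by rw [nullDir_time _ _ hi, hatBase_time]
      have e3 : fibreProj (hatBase x.2 + s • nullDir i).2.2 = 0 := by
        have : (hatBase x.2 + s • nullDir i).2.2 = (hatBase x.2).2.2 := by simp [nullDir]
        rw [this, fibreProj_hatBase]
      simp only [flowLift]
      rw [h.initial _ hs e2 (by rw [hatProj_apply, e3]; rfl), blowDown_of_boundary e2 e3]
    filter_upwards [hmem] with s hs
    have h2 := hz 0 (by rw [zero_smul, add_zero]; exact hq0)
    rw [zero_smul, add_zero, zero_smul, add_zero] at h2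
    rw [hz s hs, h2]
    refine Prod.ext ?_ (Prod.ext ?_ (Prod.ext ?_ ?_))
    · simp [canonLift, nullDir]
    · simp [canonLift, nullDir]
    · simp [canonLift]
    · ext j
      simp only [canonLift]
      rw [nullDir_time _ _ hi]
      simp [nullDir]
  simp only [φ]
  rw [hA, symplForm_apply]
  have hk := lt_fibreIdx (b := b) hi
  have hB : (fderiv ℝ (flowLift X) (y 0) c).2.2.2 (fibreIdx i) = 0 := by
    have h1 := hasDerivAt_line hF c
    have h2 : HasDerivAt (fun s : ℝ => (flowLift X (y 0 + s • c)).2.2.2)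
        (fderiv ℝ (flowLift X) (y 0) c).2.2.2 0 := h1.snd.snd.snd
    refine (hasDerivAt_coord.1 h2 (fibreIdx i)).unique ?_
    have hXs : HasDerivAt (fun s : ℝ => X (y 0 + s • c).2) (fderiv ℝ X (y 0).2 c.2) 0 :=
      hasDerivAt_line ((h.smooth.contDiffAt (Metric.isOpen_ball.mem_nhds hq0)).differentiableAt
        (by simp)).hasFDerivAt c.2
    have hN : HasDerivAt (fun s : ℝ => (X (y 0 + s • c).2).2.2 (fibreIdx i))
        ((fderiv ℝ X (y 0).2 c.2).2.2 (fibreIdx i)) 0 :=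
      hasDerivAt_coord.1 hXs.snd.snd (fibreIdx i)
    have hU : HasDerivAt (fun s : ℝ => (X (y 0 + s • c).2).2.1 0)
        ((fderiv ℝ X (y 0).2 c.2).2.1 0) 0 := hasDerivAt_coord.1 hXs.snd.fst 0
    have hτ : HasDerivAt (fun s : ℝ => x.1 + s * c.1) c.1 0 := by
      simpa using ((hasDerivAt_id (0 : ℝ)).mul_const c.1).const_add x.1
    have hU0' : (X (y 0).2).2.1 0 = 0 := by rw [h.time_eq hq0, htime]
    have h3 := (hτ.mul (hU.pow 3)).mul hN
    refine (h3.congr_deriv ?_).congr_of_eventuallyEq (Eventually.of_forall fun s => ?_)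
    · simp [hU0']
    · simp only [flowLift, canonLift, blowDown, sq_apply, scaledCovector_apply, not_le.2 hk,
        if_false, if_true, Pi.mul_apply, Pi.pow_apply, hy0, Prod.fst_add, Prod.smul_fst,
        smul_eq_mul]
      ring
  have h9 : canonicalForm ((0, basisVec (fibreIdx i), 0, 0) : ℙ)
      (fderiv ℝ (flowLift X) (y 0) c) = -(fderiv ℝ (flowLift X) (y 0) c).2.2.2 (fibreIdx i) := by
    simp only [canonicalForm, basisVec_apply]
    simp
  rw [h9, hB, neg_zero]

/-! ### The flowout is coisotropic -/

theorem continuous_phase_x : Continuous fun w : ℙ => w.2.1 0 :=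
  (𝓍).continuous.comp (continuous_fst.comp continuous_snd)

theorem contDiffAt_hatOf {w : ℙ} (hx : w.2.1 0 ≠ 0) (hτ : w.2.2.1 ≠ 0) :
    SmoothAt (hatOf : ℙ → ℋ) w := by
  obtain ⟨hui, hv⟩ := contDiffAt_phase w
  have ht : SmoothAt (fun w : ℙ => w.2.2.1) w :=
    (contDiff_fst.comp (contDiff_snd.comp contDiff_snd)).contDiffAt
  refine contDiffAt_fst.prodMk (ContDiffAt.prodMk (contDiff_fst.comp contDiff_snd).contDiffAt
    (contDiffAt_euclidean.2 fun i => ?_))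
  simp only
  split_ifs
  · exact (hv i).div (contDiffAt_const.mul ht) (by simpa using hτ)
  · exact (hv i).div (hui.mul ht) (mul_ne_zero hx hτ)

theorem contDiffAt_sqrtLift {Y : ℋ} (hx : Y.2.1 0 ≠ 0) : SmoothAt (sqrtLift : ℋ → ℋ) Y := by
  have hui : SmoothAt (fun Y : ℋ => Y.2.1 0) Y := (contDiff_hat_pos 0).contDiffAt
  have hu : SmoothAt (fun Y : ℋ => Y.2.1) Y := (contDiff_fst.comp contDiff_snd).contDiffAt
  have hv : SmoothAt (fun Y : ℋ => Y.2.2) Y := (contDiff_snd.comp contDiff_snd).contDiffAt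
  refine contDiffAt_fst.prodMk (ContDiffAt.prodMk ?_ (hv.sub ?_))
  · exact hu.add (((hui.sqrt hx).sub hui).smul contDiffAt_const)
  · exact fibreProj.contDiff.contDiffAt.comp Y hv

theorem hatDomain_mem_nhds {Y : ℋ} (hu : Y.2.1 ∈ ball u₀ ε) (hx : 0 < Y.2.1 0) :
    hatDomain u₀ ε ∈ 𝓝 Y :=
  inter_mem (hat_halfSpace_mem_nhds hx) ((isOpen_hatBall u₀ ε).mem_nhds hu)

/-- A left inverse of `flowLift`, up to the components which `flowLift` ignores. -/
noncomputable def flowUnlift (Ξ : ℋ → ℋ) (w : ℙ) : ℝ × ℋ := (w.2.2.1, Ξ (sqrtLift (hatOf w)))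

theorem IsHatGraph.flowLift_flowUnlift (h : 𝒢) {w : ℙ}
    (hx : 0 < w.2.1 0) (hτ : w.2.2.1 ≠ 0) (hY : hatOf w ∈ ball p₀ η) :
    flowLift X (flowUnlift Ξ w) = w - (0, 0, 0, (w.2.2.1 * w.2.1 0) • defect Z (hatOf w)) := by
  have h1 := h.graph _ hY (show 0 ≤ (hatOf w).2.1 0 from hx.le)
  have hx' := hx.ne'
  simp only [flowLift, flowUnlift, h1]
  refine Prod.ext ?_ (Prod.ext ?_ (Prod.ext ?_ ?_))
  · simp [canonLift, hatOf]
  · simp [canonLift, hatOf]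
  · simp [canonLift]
  · ext i
    have h2 : defect Z (hatOf w) i = fibreProj (defect Z (hatOf w)) i := by rw [h.fibreProj_defect]
    rw [fibreProj_apply] at h2
    have hZ : Z (hatOf w) i = fibreProj (Z (hatOf w)) i := by rw [h.fibre_Z]
    rw [fibreProj_apply] at hZ
    simp only [Prod.snd_sub, PiLp.sub_apply, PiLp.smul_apply, smul_eq_mul]
    simp only [canonLift, PiLp.add_apply, PiLp.sub_apply]
    rw [h2, fibreProj_apply, hZ]
    split_ifs with hi
    · simp [hatOf, hi]
      field_simp
    · simp only [defect, PiLp.sub_apply, fibreProj_apply, hatOf, hi, if_false]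
      field_simp
      ring

theorem IsHatGraph.flowUnlift_flowLift (h : 𝒢) {x : ℝ × ℋ} (hx : x ∈ flowRegion p₀ r) :
    flowUnlift Ξ (flowLift X x) = (x.1, x.2 - hatProj x.2) := by
  refine Prod.ext rfl ?_
  have h1 : (blowDown (X x.2)).2.1 0 ≠ 0 := by
    rw [blowDown_time, h.time_eq hx.1]; exact pow_ne_zero 2 hx.2.1.ne'
  simp only [flowUnlift, flowLift]
  rw [hatOf_canonLift hx.2.2 h1, h.lift_blowDown _ hx.1 hx.2.1.le, h.left_inv _ hx.1]

theorem IsHatGraph.flowUnlift_mem (h : 𝒢) {w : ℙ}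
    (hx : 0 < w.2.1 0) (hτ : w.2.2.1 ≠ 0) (hY : hatOf w ∈ ball p₀ η) :
    flowUnlift Ξ w ∈ flowRegion p₀ r := by
  refine ⟨h.maps_inv _ (h.lift_mem _ hY hx.le), ?_, hτ⟩
  simp only [flowUnlift]
  rw [h.time_pos hY hx.le]
  exact Real.sqrt_pos.2 hx

theorem IsHatGraph.contDiffAt_flowUnlift (h : 𝒢) {w : ℙ}
    (hx : 0 < w.2.1 0) (hτ : w.2.2.1 ≠ 0) (hY : hatOf w ∈ ball p₀ η) :
    SmoothAt (flowUnlift Ξ) w := by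
  have h1 : SmoothAt Ξ (sqrtLift (hatOf w)) :=
    h.smooth_inv.contDiffAt (Metric.isOpen_ball.mem_nhds (h.lift_mem _ hY hx.le))
  have h2 : SmoothAt (sqrtLift : ℋ → ℋ) (hatOf w) :=
    contDiffAt_sqrtLift (show (hatOf w).2.1 0 ≠ 0 from hx.ne')
  have h3 : SmoothAt (fun w : ℙ => w.2.2.1) w :=
    (contDiff_fst.comp (contDiff_snd.comp contDiff_snd)).contDiffAt
  exact h3.prodMk (h1.comp w (h2.comp w (contDiffAt_hatOf hx.ne' hτ)))

theorem IsHatGraph.hatDef_flowLift (h : 𝒢)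
    {x : ℝ × ℋ} (hx : x ∈ flowRegion p₀ r) (i : Fin (f + 1)) :
    hatDef Γ Z i (hatOf (flowLift X x)) = if i = 0 then raySymbol Γ x / x.1 ^ 2 else 0 := by
  have h1 : (blowDown (X x.2)).2.1 0 ≠ 0 := by
    rw [blowDown_time, h.time_eq hx.1]; exact pow_ne_zero 2 hx.2.1.ne'
  rw [flowLift, hatOf_canonLift hx.2.2 h1, hatDef]
  split_ifs
  · rw [h.quad_blowDown hx.1 hx.2.1.le, raySymbol, mul_div_cancel_left₀]
    exact pow_ne_zero 2 hx.2.2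
  · rw [defect, h.fibre_blowDown _ hx.1 hx.2.1.le, sub_self]; rfl

/-- Coisotropy in canonical coordinates: the rays and the fibre directions of the flow box give
`f + 1` null directions. -/
theorem IsHatGraph.coisotropic_canonical (h : 𝒢) {w : ℙ}
    (hx : 0 < w.2.1 0) (hτ : w.2.2.1 ≠ 0) (hY : hatOf w ∈ ball p₀ η)
    (hu : w.2.1 ∈ ball u₀ ε) (hz : ∀ i, hatDef Γ Z i (hatOf w) = 0)
    {A : Fin (f + 1) → ℙ →L[ℝ] ℝ}
    (hA : ∀ i, HasFDerivAt (fun w => hatDef Γ Z i (hatOf w)) (A i) w) :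
    (∀ i j, A j (linearHamilton (A i)) = 0) ∧
      (∀ δ, (∀ δ', (∀ i, A i δ' = 0) → symplForm δ δ' = 0) → ∀ i, A i δ = 0) ∧
      LinearIndependent ℝ A := by
  set x := flowUnlift Ξ w with hxdef
  have hxr : x ∈ flowRegion p₀ r := h.flowUnlift_mem hx hτ hY
  obtain ⟨hz1, hz2⟩ := h.forall_hatDef_eq_zero.1 hz
  have hw : flowLift X x = w := by
    rw [hxdef, h.flowLift_flowUnlift hx hτ hY, hz2, smul_zero]
    exact sub_zero _
  have hPx : fibreProj x.2.2.2 = 0 := by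
    have h1 := h.proj_inv _ (h.lift_mem _ hY (show 0 ≤ (hatOf w).2.1 0 from hx.le))
    have h2 : fibreProj x.2.2.2 = fibreProj (sqrtLift (hatOf w)).2.2 :=
      congrArg (fun Y : ℋ => Y.2.2) h1
    rw [h2]
    simp [sqrtLift, fibreProj_fibreProj]
  have hF := h.hasFDerivAt_flowLift hxr
  rw [← hw] at hA
  have hR : HasFDerivAt (flowUnlift Ξ) (fderiv ℝ (flowUnlift Ξ) w) w :=
    ((h.contDiffAt_flowUnlift hx hτ hY).differentiableAt (by simp)).hasFDerivAt
  let k : Fin (f + 1) → ℙ := fun j => fderiv ℝ (flowLift X) x ((0 : ℝ), (nullDir j : ℋ))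
  -- the null directions are independent, since `flowUnlift` maps them back to coordinate vectors
  have hk : LinearIndependent ℝ k := by
    have h1 : ∀ j, fderiv ℝ (flowUnlift Ξ) w (k j) = ((0 : ℝ), (nullDir j : ℋ)) := fun j => by
      have h2 : HasDerivAt (fun s : ℝ => flowUnlift Ξ
          (flowLift X (x + s • ((0 : ℝ), (nullDir j : ℋ)))))
          (fderiv ℝ (flowUnlift Ξ) w (k j)) 0 := by
        refine HasFDerivAt.comp_hasDerivAt (l := flowUnlift Ξ) (0 : ℝ) ?_ (hasDerivAt_line hF _)
        rw [zero_smul, add_zero, hw]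
        exact hR
      have h3 : HasDerivAt (fun s : ℝ => x + s • ((0 : ℝ), (nullDir j : ℋ)))
          ((0 : ℝ), (nullDir j : ℋ)) 0 :=
        hasDerivAt_add_smul _ _
      refine h2.unique (h3.congr_of_eventuallyEq ?_)
      filter_upwards [eventually_add_smul_mem (isOpen_flowRegion.mem_nhds hxr)
        ((0 : ℝ), (nullDir j : ℋ))] with s hs
      rw [h.flowUnlift_flowLift hs]
      refine Prod.ext rfl ?_
      have h4 : fibreProj (x + s • ((0 : ℝ), (nullDir j : ℋ))).2.2.2 = 0 := by simp [nullDir, hPx]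
      simp only [hatProj_apply, h4]
      exact sub_zero _
    have h5 : LinearIndependent ℝ fun j : Fin (f + 1) => ((0 : ℝ), (nullDir j : ℋ)) := by
      rw [Fintype.linearIndependent_iff]
      intro a ha i
      let L : ℝ × ℋ →ₗ[ℝ] ℝ := ((EuclideanSpace.proj (fibreIdx i) : ℰ →L[ℝ] ℝ) : ℰ →ₗ[ℝ] ℝ).comp
        ((LinearMap.fst ℝ _ _).comp ((LinearMap.snd ℝ _ _).comp (LinearMap.snd ℝ _ _)))
      have h6 := congrArg L ha
      rw [map_sum, map_zero] at h6
      have h7 : ∀ j, L (a j • ((0 : ℝ), (nullDir j : ℋ))) = if i = j then a j else 0 := fun j => by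
        have : L ((0 : ℝ), (nullDir j : ℋ)) = if i = j then 1 else 0 := by
          change (basisVec (fibreIdx j) : ℰ) (fibreIdx i) = _
          rw [basisVec_apply]
          simp only [fibreIdx_injective.eq_iff]
        rw [map_smul, this]
        simp
      simp only [h7, Finset.sum_ite_eq, Finset.mem_univ, if_true] at h6
      exact h6
    refine LinearIndependent.of_comp (fderiv ℝ (flowUnlift Ξ) w : ℙ →ₗ[ℝ] ℝ × ℋ) ?_
    have : (fderiv ℝ (flowUnlift Ξ) w : ℙ →ₗ[ℝ] ℝ × ℋ) ∘ k =
        fun j : Fin (f + 1) => ((0 : ℝ), (nullDir j : ℋ)) := funext h1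
    rw [this]
    exact h5
  have hPs := h.hasFDerivAt_raySymbol hxr
  have hcomp : ∀ i c, HasDerivAt (fun s : ℝ => hatDef Γ Z i (hatOf (flowLift X (x + s • c))))
      (A i (fderiv ℝ (flowLift X) x c)) 0 := fun i c => by
    exact hasDerivAt_line ((hA i).comp x hF) c
  have hev : ∀ i c, (fun s : ℝ => hatDef Γ Z i (hatOf (flowLift X (x + s • c)))) =ᶠ[𝓝 0]
      fun s : ℝ => if i = 0 then raySymbol Γ (x + s • c) / (x + s • c).1 ^ 2 else 0 := fun i c => by
    filter_upwards [eventually_add_smul_mem (isOpen_flowRegion.mem_nhds hxr) c] with s hs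
    exact h.hatDef_flowLift hs i
  have hAk : ∀ i j, A i (k j) = 0 := fun i j => by
    refine (hcomp i _).unique (HasDerivAt.congr_of_eventuallyEq ?_ (hev i _))
    by_cases hi : i = 0
    · simp only [hi, if_true]
      have h1 := hasDerivAt_line hPs ((0 : ℝ), (nullDir j : ℋ))
      rw [← hPs.fderiv, h.fderiv_raySymbol_nullDir hxr j] at h1
      have h2 := h1.div_const (x.1 ^ 2)
      rw [zero_div] at h2
      refine h2.congr_of_eventuallyEq (Eventually.of_forall fun s => ?_)
      simp
    · simp only [hi, if_false]
      exact hasDerivAt_const _ _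
  have hray : raySymbol Γ x = 0 := by
    have h1 := h.hatDef_flowLift hxr 0
    rw [hw, hz 0, if_pos rfl, eq_comm, div_eq_zero_iff] at h1
    exact h1.resolve_right (pow_ne_zero 2 hxr.2.2)
  refine orthocomplement_of_null_vectors hk hAk fun j δ' hδ' => ?_
  -- every common null vector of the differentials is tangent to the image of `flowLift`
  have hδeq : fderiv ℝ (flowLift X) x (fderiv ℝ (flowUnlift Ξ) w δ') = δ' := by
    have h1 : HasDerivAt (fun s : ℝ => flowLift X (flowUnlift Ξ (w + s • δ')))
        (fderiv ℝ (flowLift X) x (fderiv ℝ (flowUnlift Ξ) w δ')) 0 :=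
      hasDerivAt_line (HasFDerivAt.comp (g := flowLift X) w (hxdef ▸ hF) hR) δ'
    have hd0 : HasDerivAt (fun s : ℝ => defect Z (hatOf (w + s • δ'))) 0 0 := by
      have h2 : DifferentiableAt ℝ (fun w => defect Z (hatOf w)) w := by
        have := h.hasFDerivAt_defect (Y := hatOf w) hx
        exact this.differentiableAt.comp w ((contDiffAt_hatOf hx.ne' hτ).differentiableAt (by simp))
      have h3 := hasDerivAt_line h2.hasFDerivAt δ'
      refine h3.congr_deriv ?_
      ext i
      by_cases hi : i.val ≤ b
      · refine (hasDerivAt_coord.1 h3 i).unique ?_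
        refine (hasDerivAt_const (0 : ℝ) (0 : ℝ)).congr_of_eventuallyEq
          (Eventually.of_forall fun s => ?_)
        simp only
        rw [← h.fibreProj_defect, fibreProj_apply, if_pos hi]
      · obtain ⟨i', hi', rfl⟩ := exists_fibreIdx (not_le.1 hi)
        refine (hasDerivAt_coord.1 h3 _).unique ?_
        have h4 := hasDerivAt_line (hw ▸ hA i') δ'
        rw [hδ' i'] at h4
        refine h4.congr_of_eventuallyEq (Eventually.of_forall fun s => ?_)
        simp only [hatDef, hi', if_false]
    have hline : HasDerivAt (fun s : ℝ => w + s • δ') δ' 0 := hasDerivAt_add_smul _ _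
    have hτs : HasDerivAt (fun s : ℝ => (w + s • δ').2.2.1) δ'.2.2.1 0 := hline.snd.snd.fst
    have hxs : HasDerivAt (fun s : ℝ => (w + s • δ').2.1 0) (δ'.2.1 0) 0 :=
      hasDerivAt_coord.1 hline.snd.fst 0
    have hprod : HasDerivAt (fun s : ℝ => ((w + s • δ').2.2.1 * (w + s • δ').2.1 0) •
        defect Z (hatOf (w + s • δ'))) 0 0 := by
      refine ((hτs.mul hxs).smul hd0).congr_deriv ?_
      rw [zero_smul, add_zero, hz2, smul_zero, smul_zero, add_zero]
    have h5 : HasDerivAt (fun s : ℝ => ((0, 0, 0, ((w + s • δ').2.2.1 * (w + s • δ').2.1 0) •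
        defect Z (hatOf (w + s • δ'))) : ℙ)) 0 0 :=
      (hasDerivAt_const (0 : ℝ) (0 : ℝ)).prodMk ((hasDerivAt_const (0 : ℝ) (0 : ℰ)).prodMk
        ((hasDerivAt_const (0 : ℝ) (0 : ℝ)).prodMk hprod))
    have h6 := hline.sub h5
    rw [sub_zero] at h6
    refine h1.unique (h6.congr_of_eventuallyEq ?_)
    have hopen : {w : ℙ | 0 < w.2.1 0 ∧ w.2.2.1 ≠ 0 ∧ hatOf w ∈ ball p₀ η} ∈ 𝓝 w := by
      have c1 : ContinuousAt (fun w : ℙ => w.2.1 0) w := continuous_phase_x.continuousAt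
      have c2 : ContinuousAt (fun w : ℙ => w.2.2.1) w := by fun_prop
      exact (c1.eventually (lt_mem_nhds hx)).and ((c2.eventually_ne hτ).and
        ((contDiffAt_hatOf hx.ne' hτ).continuousAt.eventually (Metric.isOpen_ball.mem_nhds hY)))
    filter_upwards [eventually_add_smul_mem hopen δ'] with s hs
    exact h.flowLift_flowUnlift hs.1 hs.2.1 hs.2.2
  rw [← hδeq]
  refine h.symplForm_nullDir hxr hPx j ?_
  set c := fderiv ℝ (flowUnlift Ξ) w δ' with hc
  -- the symbol is `τ²` times the first defining function
  have h1 := hcomp 0 c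
  rw [hδeq, hδ' 0] at h1
  have hτs : HasDerivAt (fun s : ℝ => (x + s • c).1) c.1 0 := (hasDerivAt_add_smul x c).fst
  have h2 := (hτs.pow 2).mul h1
  have h3 : hatDef Γ Z 0 (hatOf (flowLift X (x + (0 : ℝ) • c))) = 0 := by
    rw [zero_smul, add_zero, hw, hz 0]
  rw [h3, mul_zero, mul_zero, add_zero] at h2
  have h4 := hasDerivAt_line hPs.differentiableAt.hasFDerivAt c
  refine h4.unique (h2.congr_of_eventuallyEq ?_)
  filter_upwards [hev 0 c, eventually_add_smul_mem (isOpen_flowRegion.mem_nhds hxr) c] with s hs hs'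
  simp only [Pi.mul_apply, Pi.pow_apply]
  rw [hs, if_pos rfl, mul_div_cancel₀]
  exact pow_ne_zero 2 hs'.2.2

/-! ### The defining functions in edge coordinates -/

/-- The position and the components of an edge covector, divided by its time component. -/
noncomputable def hatEdge (w : ℙ) : ℋ := (w.1, w.2.1, w.2.2.1⁻¹ • w.2.2.2)

/-- The edge covector with time component `τ` and given quotients by `τ`. -/
noncomputable def edgeLift (τ : ℝ) (Y : ℋ) : ℙ := (Y.1, Y.2.1, τ, τ • Y.2.2)

theorem hatEdge_edgeLift {τ : ℝ} (hτ : τ ≠ 0) (Y : ℋ) : hatEdge (edgeLift τ Y) = Y := by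
  simp [hatEdge, edgeLift, smul_smul, inv_mul_cancel₀ hτ]

theorem edgeLift_hatEdge {w : ℙ} (hτ : w.2.2.1 ≠ 0) : edgeLift w.2.2.1 (hatEdge w) = w := by
  simp [hatEdge, edgeLift, smul_smul, mul_inv_cancel₀ hτ]

theorem hatOf_toCanonical {w : ℙ} (hx : w.2.1 0 ≠ 0) : hatOf (toCanonical w) = hatEdge w := by
  refine Prod.ext rfl (Prod.ext rfl ?_)
  ext i
  simp only [hatOf, toCanonical, hatEdge, edgeScale, PiLp.smul_apply, smul_eq_mul]
  split_ifs <;> field_simp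

theorem toCanonical_edgeLift {τ : ℝ} {Y : ℋ} (hx : Y.2.1 0 ≠ 0) :
    toCanonical (edgeLift τ Y) = canonLift (τ / Y.2.1 0) Y := by
  refine Prod.ext rfl (Prod.ext rfl (Prod.ext rfl ?_))
  ext i
  simp only [toCanonical, edgeLift, canonLift, edgeScale, PiLp.smul_apply, smul_eq_mul]
  split_ifs <;> field_simp

theorem contDiffOn_hatEdge : SmoothOn (hatEdge : ℙ → ℋ) {w | w.2.2.1 ≠ 0} := by
  have ht : Smooth (fun w : ℙ => w.2.2.1) := contDiff_fst.comp (contDiff_snd.comp contDiff_snd)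
  have hv : Smooth (fun w : ℙ => w.2.2.2) := contDiff_snd.comp (contDiff_snd.comp contDiff_snd)
  exact contDiff_fst.contDiffOn.prodMk ((contDiff_fst.comp contDiff_snd).contDiffOn.prodMk
    ((ht.contDiffOn.inv fun w hw => hw).smul hv.contDiffOn))

theorem uniqueDiffOn_phaseHalfSpace : UniqueDiffOn ℝ (phaseHalfSpace b f) := by
  have hv : (xCoord.comp ((fst ℝ _ _).comp (snd ℝ _ _)) : ℙ →L[ℝ] ℝ) (0, basisVec 0, 0, 0) = 1 := by
    change xCoord (basisVec 0 : ℰ) = 1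
    exact xCoord_basisVec
  exact uniqueDiffOn_halfSpace hv

/-- The region in which the defining functions are used. -/
def edgeRegion (u₀ : ℰ) (ε : ℝ) : Set ℙ := {w | w.2.1 ∈ ball u₀ ε ∧ w.2.2.1 ≠ 0}

theorem isOpen_edgeRegion (u₀ : ℰ) (ε : ℝ) : IsOpen (edgeRegion u₀ ε) := by
  have h1 : Continuous fun w : ℙ => w.2.1 := by fun_prop
  have h2 : Continuous fun w : ℙ => w.2.2.1 := by fun_prop
  exact (Metric.isOpen_ball.preimage h1).inter (isOpen_ne_fun h2 continuous_const)

theorem continuousOn_edgeDeriv {a : ℙ → ℝ} {O : Set ℙ} (hO : IsOpen O)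
    (ha : SmoothOn a (phaseHalfSpace b f ∩ O)) :
    ContinuousOn (edgeDeriv a) (phaseHalfSpace b f ∩ O) := by
  have h := (ha.fderivWithin (uniqueDiffOn_phaseHalfSpace.inter hO) (m := ∞) (by simp)).continuousOn
  refine h.congr fun w hw => ?_
  rw [fderivWithin_inter (hO.mem_nhds hw.2)]
  rfl

theorem continuousOn_edgeBracket {a c : ℙ → ℝ} {O : Set ℙ} (hO : IsOpen O)
    (ha : SmoothOn a (phaseHalfSpace b f ∩ O))
    (hc : SmoothOn c (phaseHalfSpace b f ∩ O)) :
    ContinuousOn (edgeBracket a c) (phaseHalfSpace b f ∩ O) := by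
  have hA := continuousOn_edgeDeriv hO ha
  have hC := continuousOn_edgeDeriv hO hc
  have hx : ContinuousOn (fun w : ℙ => w.2.1 0) (phaseHalfSpace b f ∩ O) :=
    continuous_phase_x.continuousOn
  have hs : ∀ i : ℐ, ContinuousOn (fun w : ℙ => edgeScale (w.2.1 0) i)
      (phaseHalfSpace b f ∩ O) := fun i => by
    simp only [edgeScale]
    split_ifs
    exacts [hx, continuousOn_const]
  have hE : ContinuousOn (slowEuler : ℙ → ℙ) (phaseHalfSpace b f ∩ O) := by
    refine Continuous.continuousOn ?_
    refine continuous_const.prodMk (continuous_const.prodMk ((by fun_prop : Continuous fun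
      w : ℙ => w.2.2.1).prodMk ?_))
    refine (PiLp.continuous_toLp 2 _).comp (continuous_pi fun i => ?_)
    have hv : Continuous fun w : ℙ => w.2.2.2 i :=
      (EuclideanSpace.proj (𝕜 := ℝ) i).continuous.comp (by fun_prop : Continuous fun
        w : ℙ => w.2.2.2)
    split_ifs
    exacts [hv, continuous_const]
  have hAc : ∀ δ : ℙ, ContinuousOn (fun w => edgeDeriv a w δ) (phaseHalfSpace b f ∩ O) :=
    fun δ => hA.clm_apply continuousOn_const
  have hCc : ∀ δ : ℙ, ContinuousOn (fun w => edgeDeriv c w δ) (phaseHalfSpace b f ∩ O) :=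
    fun δ => hC.clm_apply continuousOn_const
  unfold edgeBracket
  refine ((hx.mul (((hAc _).mul (hCc _)).sub ((hAc _).mul (hCc _)))).add
    (((hAc _).mul (hC.clm_apply hE)).sub ((hCc _).mul (hA.clm_apply hE)))).add ?_
  exact continuousOn_finsetSum _ fun i _ => (hs i).mul
    (((hAc _).mul (hCc _)).sub ((hAc _).mul (hCc _)))

/-- The defining functions of the flowout in edge coordinates. -/
noncomputable def edgeDef (Γ : ℐ → ℐ → ℰ → ℝ) (Z : ℋ → ℰ) (i : Fin (f + 1)) (w : ℙ) : ℝ :=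
  hatDef Γ Z i (hatEdge w)

theorem IsHatGraph.contDiffOn_edgeDef (h : 𝒢) (i : Fin (f + 1)) :
    SmoothOn (edgeDef Γ Z i) (phaseHalfSpace b f ∩ edgeRegion u₀ ε) :=
  (h.contDiffOn_hatDef i).comp (contDiffOn_hatEdge.mono fun _ hw => hw.2.2)
    fun _ hw => ⟨hw.1, hw.2.1⟩

theorem hasFDerivAt_toCanonical {w : ℙ} (hx : w.2.1 0 ≠ 0) :
    HasFDerivAt toCanonical (fderiv ℝ toCanonical w) w :=
  ((contDiffAt_toCanonical hx).differentiableAt (by simp)).hasFDerivAt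

/-- Coisotropy over the interior in edge coordinates. -/
theorem IsHatGraph.coisotropic_interior (h : 𝒢) {w : ℙ}
    (hx : 0 < w.2.1 0) (hw : w ∈ edgeRegion u₀ ε) (hY : hatEdge w ∈ ball p₀ η)
    (hz : ∀ i, edgeDef Γ Z i w = 0) :
    (∀ i j, edgeBracket (edgeDef Γ Z i) (edgeDef Γ Z j) w = 0) ∧
      (∀ δ, (∀ δ' ∈ tangentVectors (edgeDef Γ Z) w, edgeForm w δ δ' = 0) →
        δ ∈ tangentVectors (edgeDef Γ Z) w) ∧
      LinearIndependent ℝ fun i => edgeDeriv (edgeDef Γ Z i) w := by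
  set c := toCanonical w with hc
  have hxc : 0 < c.2.1 0 := hx
  have hτc : c.2.2.1 ≠ 0 := div_ne_zero hw.2 hx.ne'
  have hhat : hatOf c = hatEdge w := hatOf_toCanonical hx.ne'
  have hdiff : ∀ i, HasFDerivAt (fun w => hatDef Γ Z i (hatOf w))
      (fderiv ℝ (fun w => hatDef Γ Z i (hatOf w)) c) c := fun i => by
    have h1 : SmoothAt (hatDef Γ Z i) (hatOf c) :=
      (h.contDiffOn_hatDef i).contDiffAt (hatDomain_mem_nhds (by exact hw.1) (by exact hx))
    exact ((h1.comp c (contDiffAt_hatOf hxc.ne' hτc)).differentiableAt (by simp)).hasFDerivAt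
  set A : Fin (f + 1) → ℙ →L[ℝ] ℝ := fun i => fderiv ℝ (fun w => hatDef Γ Z i (hatOf w)) c with hA
  obtain ⟨k1, k2, k3⟩ := h.coisotropic_canonical hxc hτc (by rw [hhat]; exact hY) hw.1
    (fun i => by rw [hhat]; exact hz i) hdiff
  have hT := hasFDerivAt_toCanonical hx.ne'
  have hedge : ∀ i, edgeDeriv (edgeDef Γ Z i) w = (A i).comp (fderiv ℝ toCanonical w) := fun i => by
    have h1 : HasFDerivAt (edgeDef Γ Z i) ((A i).comp (fderiv ℝ toCanonical w)) w := by
      refine ((hdiff i).comp w hT).congr_of_eventuallyEq ?_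
      have : ∀ᶠ v : ℙ in 𝓝 w, v.2.1 0 ≠ 0 := continuous_phase_x.continuousAt.eventually_ne hx.ne'
      filter_upwards [this] with v hv
      simp only [edgeDef, Function.comp, hatOf_toCanonical hv]
    rw [edgeDeriv, fderivWithin_of_mem_nhds (phase_halfSpace_mem_nhds hx), h1.fderiv]
  have hsurj := surjective_fderiv_toCanonical hx.ne'
  refine ⟨fun i j => ?_, fun δ₁ hδ i => ?_, ?_⟩
  · rw [edgeBracket_eq hx.ne' (hedge i) (hedge j)]
    exact k1 i j
  · rw [hedge]
    refine k2 (fderiv ℝ toCanonical w δ₁) (fun δ₂ hδ₂ => ?_) i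
    obtain ⟨δ₃, rfl⟩ := hsurj δ₂
    refine hδ δ₃ fun j => ?_
    rw [hedge]
    exact hδ₂ j
  · rw [Fintype.linearIndependent_iff] at k3 ⊢
    intro a ha
    refine k3 a (ContinuousLinearMap.ext fun δ₂ => ?_)
    obtain ⟨δ₃, rfl⟩ := hsurj δ₂
    have := congrArg (fun L : ℙ →L[ℝ] ℝ => L δ₃) ha
    simpa [hedge] using this

/-- At the boundary the differentials of the defining functions are independent of each other and
of `dx`, since there `Z = 0`. -/
theorem IsHatGraph.transversal (h : 𝒢) {w : ℙ} (hx : w.2.1 0 = 0) (hw : w ∈ edgeRegion u₀ ε)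
    (hM : raise Γ 0 w.2.1 (hatEdge w).2.2 ≠ 0) {a : Fin (f + 1) → ℝ} {a₀ : ℝ}
    (ha : ∀ δ : ℙ, ∑ i, a i * edgeDeriv (edgeDef Γ Z i) w δ + a₀ * δ.2.1 0 = 0) :
    (∀ i, a i = 0) ∧ a₀ = 0 := by
  have hmem : w ∈ phaseHalfSpace b f := hx.ge
  have hd : ∀ i, HasFDerivWithinAt (edgeDef Γ Z i) (edgeDeriv (edgeDef Γ Z i) w)
      (phaseHalfSpace b f) w := fun i => by
    have h1 := ((h.contDiffOn_edgeDef i).contDiffWithinAt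
      ⟨hmem, hw⟩).mono_of_mem_nhdsWithin (inter_mem_nhdsWithin _
        ((isOpen_edgeRegion u₀ ε).mem_nhds hw))
    exact (h1.differentiableWithinAt (by simp)).hasFDerivWithinAt
  have hτ := hw.2
  have hline : ∀ i (ν : ℰ), HasDerivAt (fun s : ℝ => edgeDef Γ Z i (w + s • ((0, 0, 0, ν) : ℙ)))
      (edgeDeriv (edgeDef Γ Z i) w (0, 0, 0, ν)) 0 := by
    refine fun i ν => hasDerivAt_line_of_within (hd i) (.of_forall fun s => ?_)
    simp [phaseHalfSpace, hx]
  have hhat : ∀ (s : ℝ) (ν : ℰ), hatEdge (w + s • ((0, 0, 0, ν) : ℙ)) =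
      (w.1, w.2.1, (hatEdge w).2.2 + (s / w.2.2.1) • ν) := fun s ν => by
    refine Prod.ext ?_ (Prod.ext ?_ ?_)
    · simp [hatEdge]
    · simp [hatEdge]
    · simp [hatEdge, smul_smul, div_eq_inv_mul]
  have hfib : ∀ i : Fin (f + 1), i ≠ 0 → ∀ ν : ℰ,
      edgeDeriv (edgeDef Γ Z i) w (0, 0, 0, ν) = ν (fibreIdx i) / w.2.2.1 := fun i hi ν => by
    refine (hline i ν).unique ?_
    have h1 : HasDerivAt (fun s : ℝ => (hatEdge w).2.2 (fibreIdx i) +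
        s / w.2.2.1 * ν (fibreIdx i)) (1 / w.2.2.1 * ν (fibreIdx i)) 0 :=
      (((hasDerivAt_id (0 : ℝ)).div_const w.2.2.1).mul_const _).const_add _
    refine (h1.congr_deriv (by ring)).congr_of_eventuallyEq (Eventually.of_forall fun s => ?_)
    have h2 := not_le.2 (lt_fibreIdx (b := b) hi)
    have h3 : Z (w.1, w.2.1, (hatEdge w).2.2 + (s / w.2.2.1) • ν) = 0 := h.zero_Z _ hx
    simp only [edgeDef, hatDef, hi, if_false, hhat, defect, h3, fibreProj_apply, h2, sub_zero]
    simp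
  have hsym : edgeDeriv (edgeDef Γ Z 0) w (0, 0, 0, basisVec 0) =
      -(2 * raise Γ 0 w.2.1 (hatEdge w).2.2) / w.2.2.1 := by
    refine (hline 0 (basisVec 0)).unique ?_
    have hq : ∀ j : ℐ, HasDerivAt (fun s : ℝ => ((hatEdge w).2.2 +
        (s / w.2.2.1) • basisVec 0 : ℰ) j) (1 / w.2.2.1 * (basisVec 0 : ℰ) j) 0 :=
      fun j => (((hasDerivAt_id (0 : ℝ)).div_const w.2.2.1).mul_const _).const_add _
    have h1 := hasDerivAt_quadraticForm (G := fun j k _ => Γ j k w.2.1) (G' := fun _ _ => 0)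
      (fun j k => h.coeff.symm j k w.2.1) (fun j k => hasDerivAt_const (0 : ℝ) _) hq
    refine ((h1.const_sub 1).congr_deriv ?_).congr_of_eventuallyEq
      (Eventually.of_forall fun s => ?_)
    · simp only [basisVec_apply, raise]
      simp [Finset.sum_ite_eq']
      ring
    · simp only [edgeDef, hatDef, if_true, hhat, quad, raise]
      congr 1
      refine sum_congr rfl fun j _ => ?_
      rw [mul_sum]
      exact sum_congr rfl fun k _ => by ring
  have hx0 : ∀ i : Fin (f + 1), i ≠ 0 → (basisVec 0 : ℰ) (fibreIdx i) = 0 := fun i hi => by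
    have h1 := lt_fibreIdx (b := b) hi
    rw [basisVec_apply, if_neg]
    intro h2
    rw [h2] at h1
    simp at h1
  have ha0 : a 0 = 0 := by
    have h1 := ha (0, 0, 0, basisVec 0)
    rw [sum_eq_single 0 (fun i _ hi => by rw [hfib i hi, hx0 i hi]; simp) (by simp), hsym] at h1
    have h2 : -(2 * raise Γ 0 w.2.1 (hatEdge w).2.2) / w.2.2.1 ≠ 0 :=
      div_ne_zero (neg_ne_zero.2 (mul_ne_zero two_ne_zero hM)) hτ
    have h3 : a 0 * (-(2 * raise Γ 0 w.2.1 (hatEdge w).2.2) / w.2.2.1) = 0 := by simpa using h1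
    exact (mul_eq_zero.1 h3).resolve_right h2
  have hai : ∀ i, a i = 0 := fun i => by
    by_cases hi : i = 0
    · rw [hi, ha0]
    have h1 := ha (0, 0, 0, basisVec (fibreIdx i))
    rw [sum_eq_single i (fun j _ hj => ?_) (by simp), hfib i hi, basisVec_apply, if_pos rfl] at h1
    · have h3 : a i * (1 / w.2.2.1) = 0 := by simpa using h1
      exact (mul_eq_zero.1 h3).resolve_right (one_div_ne_zero hτ)
    · by_cases hj0 : j = 0
      · rw [hj0, ha0, zero_mul]
      · rw [hfib j hj0, basisVec_apply, if_neg (fun h => hj (fibreIdx_injective h))]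
        simp
  refine ⟨hai, ?_⟩
  have h1 := ha (0, basisVec 0, 0, 0)
  simpa [hai, basisVec_apply] using h1

/-- The brackets vanish at the boundary as well, by continuity along the rays. -/
theorem IsHatGraph.bracket_boundary (h : 𝒢) {w : ℙ}
    (hx : w.2.1 0 = 0) (hw : w ∈ edgeRegion u₀ ε) (hY : hatEdge w ∈ ball p₀ η)
    (hr : hatEdge w ∈ ball p₀ r) (hz : ∀ i, edgeDef Γ Z i w = 0) (i j : Fin (f + 1)) :
    edgeBracket (edgeDef Γ Z i) (edgeDef Γ Z j) w = 0 := by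
  set q := hatEdge w with hq
  obtain ⟨hz1, hz2⟩ := h.forall_hatDef_eq_zero.1 hz
  have hqx : q.2.1 0 = 0 := hx
  have hqP : fibreProj q.2.2 = 0 := by
    have := hz2
    rw [defect, h.zero_Z _ hqx, sub_zero] at this
    exact this
  have hqb : ∀ s : ℝ, hatBase (q + s • hatVec) = q := fun s => by
    refine Prod.ext (by simp [hatBase, hatVec]) (Prod.ext ?_ ?_)
    · ext k
      simp only [hatBase, setCoord_xCoord_apply]
      split_ifs with hk
      · rw [hk, hqx]
      · simp [hatVec, basisVec_apply, hk]
    · simp [hatBase, hatVec, hqP]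
  let W : ℝ → ℙ := fun s => edgeLift w.2.2.1 (blowDown (X (q + s • hatVec)))
  have hW0 : W 0 = w := by
    simp only [W]
    rw [zero_smul, add_zero, h.initial q hr hqx (by rw [hatProj_apply, hqP]; rfl),
      blowDown_of_boundary hqx hqP, hq, edgeLift_hatEdge hw.2]
  have hWc : ContinuousAt W 0 := by
    have h1 : ContinuousAt (fun s : ℝ => q + s • (hatVec : ℋ)) 0 := by fun_prop
    have h2 : ContinuousAt X (q + (0 : ℝ) • hatVec) := by
      rw [zero_smul, add_zero]
      exact h.smooth.continuousOn.continuousAt (Metric.isOpen_ball.mem_nhds hr)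
    have h3 : Continuous (edgeLift w.2.2.1 : ℋ → ℙ) := by unfold edgeLift; fun_prop
    exact (h3.comp contDiff_blowDown.continuous).continuousAt.comp
      (ContinuousAt.comp (f := fun s : ℝ => q + s • (hatVec : ℋ)) h2 h1)
  have hev : ∀ᶠ s in 𝓝[>] (0 : ℝ), W s ∈ phaseHalfSpace b f ∩ edgeRegion u₀ ε ∧
      edgeBracket (edgeDef Γ Z i) (edgeDef Γ Z j) (W s) = 0 := by
    have e1 : ∀ᶠ s in 𝓝 (0 : ℝ), W s ∈ edgeRegion u₀ ε :=
      hWc.eventually (by rw [hW0]; exact (isOpen_edgeRegion u₀ ε).mem_nhds hw)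
    have e2 : ∀ᶠ s in 𝓝 (0 : ℝ), q + s • (hatVec : ℋ) ∈ ball p₀ r :=
      eventually_add_smul_mem (Metric.isOpen_ball.mem_nhds hr) _
    have e3 : ∀ᶠ s in 𝓝 (0 : ℝ), hatEdge (W s) ∈ ball p₀ η := by
      have : ContinuousAt (fun s => hatEdge (W s)) 0 := by
        have hh : ContinuousAt (hatEdge : ℙ → ℋ) (W 0) := by
          rw [hW0]
          exact contDiffOn_hatEdge.continuousOn.continuousAt ((isOpen_ne_fun
            (by fun_prop : Continuous fun w : ℙ => w.2.2.1) continuous_const).mem_nhds hw.2)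
        exact ContinuousAt.comp (g := hatEdge) hh hWc
      exact this.eventually (by
        change ∀ᶠ Y in 𝓝 (hatEdge (W 0)), Y ∈ ball p₀ η
        rw [hW0]; exact Metric.isOpen_ball.mem_nhds hY)
    filter_upwards [nhdsWithin_le_nhds e1, nhdsWithin_le_nhds e2, nhdsWithin_le_nhds e3,
      self_mem_nhdsWithin] with s h1 h2 h3 (hs : 0 < s)
    have ht : (q + s • (hatVec : ℋ)).2.1 0 = s := by simp [hqx, hatVec, basisVec_apply]
    have hpos : 0 < (W s).2.1 0 := by
      change 0 < (blowDown (X (q + s • hatVec))).2.1 0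
      rw [blowDown_time, h.time_eq h2, ht]
      exact pow_pos hs 2
    have hhat : hatEdge (W s) = blowDown (X (q + s • hatVec)) := hatEdge_edgeLift hw.2 _
    refine ⟨⟨hpos.le, h1⟩, (h.coisotropic_interior hpos h1 h3 ?_).1 i j⟩
    refine h.forall_hatDef_eq_zero.2 ?_
    rw [hhat]
    refine ⟨?_, ?_⟩
    · rw [h.quad_blowDown h2 (by rw [ht]; exact hs.le), hqb]
      exact hz1
    · rw [defect, h.fibre_blowDown _ h2 (by rw [ht]; exact hs.le), sub_self]
  have hcont := continuousOn_edgeBracket (isOpen_edgeRegion u₀ ε) (h.contDiffOn_edgeDef i)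
    (h.contDiffOn_edgeDef j) w ⟨hx.ge, hw⟩
  have hlim : Tendsto W (𝓝[>] 0) (𝓝[phaseHalfSpace b f ∩ edgeRegion u₀ ε] w) := by
    refine tendsto_nhdsWithin_iff.2 ⟨?_, hev.mono fun s hs => hs.1⟩
    rw [← hW0]
    exact hWc.tendsto.mono_left nhdsWithin_le_nhds
  refine tendsto_nhds_unique (hcont.tendsto.comp hlim) ?_
  exact tendsto_const_nhds.congr' (hev.mono fun s hs => hs.2.symm)

end Model

section Charts

set_option hygiene false in
local notation "ℳ" => 𝓡∂ (b + f + 1)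

variable {X Y : Type*} [TopologicalSpace X] [ChartedSpace (EuclideanHalfSpace (b + f + 1)) X]
  [TopologicalSpace Y] [ChartedSpace (EuclideanSpace ℝ (Fin b)) Y] [IsManifold ℳ ∞ X]

set_option hygiene false in
local notation "𝒯" => ∀ p : X, TangentSpace ℳ p →L[ℝ] TangentSpace ℳ p →L[ℝ] ℝ

variable {fib : (ℳ).boundary X → Y} {e e' e'' : EdgeChart fib} {g : 𝒯} {γ : ℰ → Matrix ℐ ℐ ℝ}
  {u₀ : ℰ} {ε : ℝ} {p₀ : ℋ} {K Φ Ξ : ℋ → ℋ} {Z : ℋ → ℰ} {r δ η θ : ℝ}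
set_option hygiene false in
local notation "𝒮" => Set (EdgeCotangent fib)
set_option hygiene false in
local notation "ℛ" => radialSet g 1 ∪ radialSet g (-1)
set_option hygiene false in
local notation "𝓉" => EdgeChart.transition e e'
set_option hygiene false in
local notation "𝒥" => Matrix.diagonal (fun i : Fin (b + f + 1) => if i.val ≤ b then (1 : ℝ) else 0)

/-! ### Changes of adapted charts -/

theorem isOpen_coordPos : IsOpen ℍ₊ := isOpen_lt continuous_const (𝓍).continuous

theorem mem_closure_coordPos {u : ℰ} (hu : 0 ≤ u 0) : u ∈ closure ℍ₊ := by
  rw [Metric.mem_closure_iff]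
  intro ε hε
  refine ⟨u + (ε / 2) • basisVec 0, ?_, ?_⟩
  · change 0 < (u + (ε / 2) • basisVec 0 : ℰ) 0
    simp only [PiLp.add_apply, PiLp.smul_apply, basisVec_apply, if_true, smul_eq_mul]
    linarith
  · rw [dist_eq_norm]
    have h1 : ‖(basisVec 0 : ℰ)‖ = 1 := by simp [basisVec]
    simp only [sub_add_cancel_left, norm_neg, norm_smul, h1, norm_eq_abs]
    rw [abs_of_pos (by linarith)]
    linarith

theorem nhdsWithin_coordPos_neBot {u : ℰ} (hu : 0 ≤ u 0) : (𝓝[ℍ₊] u).NeBot :=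
  mem_closure_iff_nhdsWithin_neBot.1 (mem_closure_coordPos hu)

namespace EdgeChart

variable (e e' e'')

theorem isOpen_source : IsOpen e.source := e.1.open_source

variable {e} in
theorem coord_mem {p : X} (hp : p ∈ e.source) : e.coord p ∈ e.target :=
  (e.1.extend ℳ).map_source (by rw [e.1.extend_source]; exact hp)

variable {e} in
theorem symm_mem {u : ℰ} (hu : u ∈ e.target) : e.symm u ∈ e.source := by
  have := (e.1.extend ℳ).map_target hu
  rwa [e.1.extend_source] at this

variable {e} in
theorem symm_coord {p : X} (hp : p ∈ e.source) : e.symm (e.coord p) = p := e.1.extend_left_inv hp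

variable {e} in
theorem coord_symm {u : ℰ} (hu : u ∈ e.target) : e.coord (e.symm u) = u :=
  (e.1.extend ℳ).right_inv hu

variable {e} in
theorem target_nonneg {u : ℰ} (hu : u ∈ e.target) : 0 ≤ u 0 := by
  have h1 := e.1.extend_target_subset_range hu
  rw [range_modelWithCornersEuclideanHalfSpace] at h1
  exact h1

theorem continuousOn_symm : ContinuousOn e.symm e.target :=
  e.1.continuousOn_extend_symm (I := 𝓡∂ (b + f + 1))

/-- The domain of the change of coordinates. -/
def overlap : Set ℰ := e.target ∩ e.symm ⁻¹' e'.source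

theorem exists_isOpen_overlap : ∃ O : Set ℰ, IsOpen O ∧ e.overlap e' = O ∩ ℍ := by
  obtain ⟨O, hO, h⟩ : ∃ O : Set (EuclideanHalfSpace (b + f + 1)), IsOpen O ∧
      O = e.1.target ∩ e.1.symm ⁻¹' e'.source :=
    ⟨_, e.1.isOpen_inter_preimage_symm e'.isOpen_source, rfl⟩
  refine ⟨(ℳ).symm ⁻¹' O, hO.preimage (ℳ).continuous_symm, ?_⟩
  have h1 : range ℳ = ℍ := range_modelWithCornersEuclideanHalfSpace _
  rw [overlap, target, e.1.extend_target, h1, h]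
  ext u
  simp only [symm, OpenPartialHomeomorph.extend_coe_symm, Set.mem_inter_iff, mem_preimage,
    Function.comp]
  tauto

theorem overlap_self : e.overlap e = e.target := Set.inter_eq_left.2 fun _ hu => symm_mem hu

theorem exists_isOpen_target : ∃ O : Set ℰ, IsOpen O ∧ e.target = O ∩ ℍ := by
  rw [← e.overlap_self]
  exact e.exists_isOpen_overlap e

variable {e e' e''}

theorem overlap_mem_nhdsWithin {u : ℰ} (hu : u ∈ e.overlap e') : e.overlap e' ∈ 𝓝[ℍ] u := by
  obtain ⟨O, hO, h⟩ := e.exists_isOpen_overlap e'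
  rw [h] at hu ⊢
  exact inter_mem_nhdsWithin_of_mem_nhds' hO hu
where
  inter_mem_nhdsWithin_of_mem_nhds' {O S : Set ℰ} {u : ℰ} (hO : IsOpen O)
      (hu : u ∈ O ∩ S) : O ∩ S ∈ 𝓝[S] u :=
    inter_mem (mem_nhdsWithin_of_mem_nhds (hO.mem_nhds hu.1)) self_mem_nhdsWithin

theorem overlap_mem_nhds {u : ℰ} (hu : u ∈ e.overlap e') (h0 : 0 < u 0) : e.overlap e' ∈ 𝓝 u := by
  have := overlap_mem_nhdsWithin hu
  rwa [nhdsWithin_eq_nhds.2 (coord_halfSpace_mem_nhds h0)] at this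

theorem uniqueDiffOn_overlap : UniqueDiffOn ℝ (e.overlap e') := by
  obtain ⟨O, hO, h⟩ := e.exists_isOpen_overlap e'
  rw [h, Set.inter_comm]
  exact uniqueDiffOn_coordHalf.inter hO

theorem contDiffOn_transition : SmoothOn 𝓉 (e.overlap e') := by
  have h := ModelWithCorners.contDiffOn_extendCoordChange (I := 𝓡∂ (b + f + 1)) e.2.1 e'.2.1
  refine h.mono fun u hu => ?_
  rw [ModelWithCorners.extendCoordChange, PartialEquiv.trans_source, PartialEquiv.symm_source]
  exact ⟨hu.1, by rw [mem_preimage, e'.1.extend_source]; exact hu.2⟩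

theorem coord_eq_transition {p : X} (hp : p ∈ e.source) : 𝓉 (e.coord p) = e'.coord p := by
  rw [transition, symm_coord hp]

theorem coord_mem_overlap {p : X} (hp : p ∈ e.source) (hp' : p ∈ e'.source) :
    e.coord p ∈ e.overlap e' := ⟨coord_mem hp, by rw [mem_preimage, symm_coord hp]; exact hp'⟩

theorem symm_transition {u : ℰ} (hu : u ∈ e.overlap e') : e'.symm (𝓉 u) = e.symm u := by
  rw [transition, symm_coord hu.2]

theorem transition_mem {u : ℰ} (hu : u ∈ e.overlap e') : 𝓉 u ∈ e'.overlap e := by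
  rw [transition]
  exact coord_mem_overlap hu.2 (symm_mem hu.1)

theorem transition_transition {u : ℰ} (hu : u ∈ e.overlap e') :
    e'.transition e'' (𝓉 u) = e.transition e'' u := by
  rw [transition, symm_transition hu]; rfl

theorem transition_self {u : ℰ} (hu : u ∈ e.target) : e.transition e u = u := coord_symm hu

theorem transition_mem' {u : ℰ} (hu : u ∈ e.overlap e') (hu' : u ∈ e.overlap e'') :
    𝓉 u ∈ e'.overlap e'' := by
  refine ⟨(transition_mem hu).1, ?_⟩
  rw [mem_preimage, symm_transition hu]
  exact hu'.2

theorem contDiffAt_transition {u : ℰ} (hu : u ∈ e.overlap e') (h0 : 0 < u 0) : SmoothAt 𝓉 u :=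
  contDiffOn_transition.contDiffAt (overlap_mem_nhds hu h0)

theorem hasFDerivAt_transition {u : ℰ} (hu : u ∈ e.overlap e') (h0 : 0 < u 0) :
    HasFDerivAt 𝓉 (fderiv ℝ 𝓉 u) u :=
  ((contDiffAt_transition hu h0).differentiableAt (by simp)).hasFDerivAt

end EdgeChart

/-- A coordinate change between charts of the maximal atlas maps interior points to interior
points. -/
theorem extend_pos_of_pos {e e' : OpenPartialHomeomorph X (EuclideanHalfSpace (b + f + 1))}
    (he : e ∈ IsManifold.maximalAtlas ℳ ∞ X)
    (he' : e' ∈ IsManifold.maximalAtlas ℳ ∞ X) {p : X} (hp : p ∈ e.source)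
    (hp' : p ∈ e'.source) (h0 : 0 < (e.extend ℳ p : ℰ) 0) :
    0 < (e'.extend ℳ p : ℰ) 0 := by
  set I := 𝓡∂ (b + f + 1)
  let φ := I.extendCoordChange e e'
  have hφ : SmoothOn φ φ.source := ModelWithCorners.contDiffOn_extendCoordChange he he'
  have hmem : e.extend I p ∈ φ.source := by simp [φ, hp, hp', ModelWithCorners.extendCoordChange]
  have hsurj := (ModelWithCorners.isInvertible_fderivWithin_extendCoordChange (n := ∞) (by simp)
    he he' hmem).surjective
  have hint : e.extend I p ∈ interior (range I) := by
    rw [interior_range_modelWithCornersEuclideanHalfSpace]; exact h0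
  have hnhds : φ.source ∈ 𝓝 (e.extend I p) := by
    have h1 : (e.extend I).target ∈ 𝓝 (e.extend I p) := by
      have := e.extend_target_mem_nhdsWithin (I := I) hp
      rwa [nhdsWithin_eq_nhds.2 (mem_interior_iff_mem_nhds.1 hint)] at this
    have h2 : (e.extend I).symm ⁻¹' e'.source ∈ 𝓝 (e.extend I p) :=
      e.extend_preimage_mem_nhds hp (e'.open_source.mem_nhds hp')
    filter_upwards [h1, h2] with u hu hu'
    change u ∈ (I.extendCoordChange e e').source
    rw [ModelWithCorners.extendCoordChange, PartialEquiv.trans_source, PartialEquiv.symm_source]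
    exact ⟨hu, by rw [mem_preimage, e'.extend_source]; exact hu'⟩
  have hpe : e'.extend I p = φ (e.extend I p) := by simp [φ, ModelWithCorners.extendCoordChange, hp]
  rw [fderivWithin_of_mem_nhds hnhds] at hsurj
  have hd : DifferentiableAt ℝ φ (e.extend I p) := (hφ.contDiffAt hnhds).differentiableAt (by simp)
  have hres := hd.mem_interior_convex_of_surjective_fderiv hnhds I.convex_range I.isClosed_range
    I.nonempty_interior (s := range I) (fun u hu => ?_) hsurj
  · rw [← hpe, interior_range_modelWithCornersEuclideanHalfSpace] at hres
    exact hres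
  · exact e'.extend_target_subset_range (φ.map_source hu).1

namespace EdgeChart

theorem transition_pos {u : ℰ} (hu : u ∈ e.overlap e') (h0 : 0 < u 0) : 0 < 𝓉 u 0 := by
  refine extend_pos_of_pos e.2.1 e'.2.1 (symm_mem hu.1) hu.2 ?_
  change 0 < e.coord (e.symm u) 0
  rwa [coord_symm hu.1]

theorem transition_eq_zero {u : ℰ} (hu : u ∈ e.overlap e') (h0 : u 0 = 0) : 𝓉 u 0 = 0 := by
  by_contra h
  have h1 : 0 < 𝓉 u 0 := lt_of_le_of_ne (target_nonneg (transition_mem hu).1) (Ne.symm h)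
  have h2 := transition_pos (transition_mem hu) h1
  rw [transition_transition hu, transition_self hu.1, h0] at h2
  exact lt_irrefl _ h2

theorem mem_interior_iff {p : X} (hp : p ∈ e.source) : p ∈ (ℳ).interior X ↔ 0 < e.coord p 0 := by
  have h1 : p ∈ (ℳ).interior X ↔
      0 < ((chartAt (EuclideanHalfSpace (b + f + 1)) p).extend ℳ p : ℰ) 0 := by
    change (ℳ).IsInteriorPoint p ↔ _
    rw [ModelWithCorners.IsInteriorPoint, interior_range_modelWithCornersEuclideanHalfSpace]
    rfl
  rw [h1]
  exact ⟨fun h => extend_pos_of_pos (IsManifold.chart_mem_maximalAtlas p) e.2.1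
    (mem_chart_source _ p) hp h, fun h => extend_pos_of_pos e.2.1
    (IsManifold.chart_mem_maximalAtlas p) hp (mem_chart_source _ p) h⟩

theorem mem_boundary_iff {p : X} (hp : p ∈ e.source) : p ∈ (ℳ).boundary X ↔ e.coord p 0 = 0 := by
  rw [← (ℳ).compl_interior, Set.mem_compl_iff, mem_interior_iff hp, not_lt]
  exact ⟨fun h => le_antisymm h (target_nonneg (coord_mem hp)), fun h => h.le⟩

end EdgeChart

/-! ### The boundary values of the edge frame changes -/

theorem exists_tendsto_div_coord {b f : ℕ} {h : ℰ → ℝ} {O : Set ℰ} (hO : IsOpen O)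
    (hh : SmoothOn h (O ∩ ℍ)) (hz : ∀ u ∈ O, u 0 = 0 → h u = 0)
    {u₀ : ℰ} (hu₀ : u₀ ∈ O) (h0 : u₀ 0 = 0) :
    ∃ y, Tendsto (fun u => h u / u 0) (𝓝[ℍ₊] u₀) (𝓝 y) := by
  obtain ⟨ρ, hρ, hball⟩ := Metric.isOpen_iff.1 hO u₀ hu₀
  set C := ℍ ∩ ball u₀ ρ with hC
  have hconv : Convex ℝ C := by
    refine Convex.inter ?_ (convex_ball _ _)
    exact convex_halfSpace_ge (𝓍).isLinear 0
  have hhC : SmoothOn h C := hh.mono fun u hu => ⟨hball hu.2, hu.1⟩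
  have hud : UniqueDiffOn ℝ C := uniqueDiffOn_coordHalf.inter isOpen_ball
  have hu₀C : u₀ ∈ C := ⟨h0.ge, mem_ball_self hρ⟩
  refine ⟨fderivWithin ℝ h C u₀ (basisVec 0), Metric.tendsto_nhdsWithin_nhds.2 fun ε hε => ?_⟩
  obtain ⟨ν, hν, hest⟩ := exists_ball_norm_sub_sub_le hconv
    (fun y hy => ((hhC y hy).differentiableWithinAt (by simp)).hasFDerivWithinAt)
    ((hhC.fderivWithin hud (m := ∞) (by simp)).continuousOn u₀ hu₀C) (half_pos hε)
  refine ⟨min ν ρ, lt_min hν hρ, fun u (hu : 0 < u 0) hdist => ?_⟩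
  set v := setX 0 u with hv
  have hv0 : v 0 = 0 := by simp [hv, setCoord_xCoord_apply]
  have hvd : dist v u₀ < min ν ρ := by
    refine lt_of_le_of_lt ?_ hdist
    rw [dist_eq_norm, dist_eq_norm]
    refine norm_coord_le fun i => ?_
    simp only [PiLp.sub_apply, hv, setCoord_xCoord_apply]
    split_ifs with hi
    · rw [hi, h0]; simp
    · exact le_rfl
  have huv : u - v = u 0 • basisVec 0 := by
    ext i
    simp only [PiLp.sub_apply, hv, setCoord_xCoord_apply, PiLp.smul_apply, basisVec_apply]
    split_ifs with hi
    · simp [hi]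
    · simp
  have h1 := hest v ⟨lt_of_lt_of_le hvd (min_le_left _ _), hv0.ge,
    lt_of_lt_of_le hvd (min_le_right _ _)⟩ u ⟨lt_of_lt_of_le hdist (min_le_left _ _), hu.le,
    lt_of_lt_of_le hdist (min_le_right _ _)⟩
  have hn : ‖(basisVec 0 : ℰ)‖ = 1 := by simp [basisVec]
  rw [huv, hz v (hball (lt_of_lt_of_le hvd (min_le_right _ _))) hv0, map_smul, norm_smul, hn,
    sub_zero, mul_one, smul_eq_mul, norm_eq_abs, norm_eq_abs, abs_of_pos hu] at h1
  rw [Real.dist_eq]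
  have h2 : h u / u 0 - fderivWithin ℝ h C u₀ (basisVec 0) =
      (h u - u 0 * fderivWithin ℝ h C u₀ (basisVec 0)) / u 0 := by field_simp
  rw [h2, abs_div, abs_of_pos hu, div_lt_iff₀ hu]
  nlinarith

namespace EdgeChart

section Overlap

variable {u : ℰ} (hu : u ∈ e.overlap e')

include hu

theorem overlap_mem_nhdsWithin_pos : e.overlap e' ∈ 𝓝[ℍ₊] u := by
  have hsub : ℍ₊ ⊆ ℍ := fun v (hv : 0 < v 0) => hv.le
  exact nhdsWithin_mono u hsub (overlap_mem_nhdsWithin hu)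

theorem tendsto_transition : Tendsto 𝓉 (𝓝[ℍ₊] u) (𝓝[ℍ₊] (𝓉 u)) := by
  have hle : 𝓝[ℍ₊] u ≤ 𝓝[e.overlap e'] u := nhdsWithin_le_of_mem (overlap_mem_nhdsWithin_pos hu)
  refine tendsto_nhdsWithin_iff.2 ⟨?_, ?_⟩
  · exact (contDiffOn_transition.continuousOn u hu).tendsto.mono_left hle
  · filter_upwards [hle self_mem_nhdsWithin, self_mem_nhdsWithin] with v hv hv'
    exact transition_pos hv hv'

theorem eventually_mem_overlap : ∀ᶠ v in 𝓝[ℍ₊] u, v ∈ e.overlap e' ∧ 0 < v 0 :=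
  Eventually.and (overlap_mem_nhdsWithin_pos hu) self_mem_nhdsWithin

theorem exists_tendsto_ratio_aux (h0 : u 0 = 0) :
    ∃ y, Tendsto (fun u => 𝓉 u 0 / u 0) (𝓝[ℍ₊] u) (𝓝 y) := by
  obtain ⟨O, hO, h⟩ := e.exists_isOpen_overlap e'
  have hsm : SmoothOn (fun u => 𝓉 u 0) (O ∩ ℍ) := by
    rw [← h]; exact contDiffOn_euclidean.1 contDiffOn_transition 0
  refine exists_tendsto_div_coord hO hsm (fun v hv hv0 => ?_) (by rw [h] at hu; exact hu.1) h0
  exact transition_eq_zero (by rw [h]; exact ⟨hv, hv0.ge⟩) hv0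

theorem exists_tendsto_ratio : ∃ y, Tendsto (fun u => u 0 / 𝓉 u 0) (𝓝[ℍ₊] u) (𝓝 y) := by
  rcases (target_nonneg hu.1).eq_or_lt with h0 | h0
  · obtain ⟨a, ha⟩ := exists_tendsto_ratio_aux hu h0.symm
    obtain ⟨a', ha'⟩ := exists_tendsto_ratio_aux (transition_mem hu) (transition_eq_zero hu h0.symm)
    have := nhdsWithin_coordPos_neBot h0.le
    have h1 : a * a' = 1 := by
      refine tendsto_nhds_unique (ha.mul (ha'.comp (tendsto_transition hu))) ?_
      refine tendsto_const_nhds.congr' ?_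
      filter_upwards [eventually_mem_overlap hu] with v hv
      have h2 := transition_pos hv.1 hv.2
      have h3 := hv.2
      simp only [Function.comp]
      rw [transition_transition hv.1, transition_self hv.1.1]
      field_simp
    have hne : a ≠ 0 := left_ne_zero_of_mul_eq_one h1
    refine ⟨a⁻¹, (ha.inv₀ hne).congr fun v => by rw [inv_div]⟩
  · refine ⟨u 0 / 𝓉 u 0, Tendsto.mono_left ?_ nhdsWithin_le_nhds⟩
    have h1 : ContinuousAt (fun u : ℰ => u 0) u := (𝓍).continuous.continuousAt
    have h2 : ContinuousAt (fun u => 𝓉 u 0) u :=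
      (𝓍).continuous.continuousAt.comp (contDiffAt_transition hu h0).continuousAt
    exact h1.div h2 (transition_pos hu h0).ne'

/-- At the boundary, the new `x` and `y` coordinates depend on the old ones only. -/
theorem transition_base {v : ℰ} (hv : v ∈ e.overlap e')
    (hu0 : u 0 = 0) (hv0 : v 0 = 0) (huv : ∀ j : ℐ, j.val ≤ b → u j = v j)
    {k : ℐ} (hk : k.val ≤ b) : 𝓉 u k = 𝓉 v k := by
  by_cases hk0 : k = 0
  · rw [hk0, transition_eq_zero hu hu0, transition_eq_zero hv hv0]
  have hkpos : 0 < k.val := Nat.pos_of_ne_zero fun h => hk0 (Fin.ext h)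
  have hk' : k = (Fin.castAdd f (⟨k.val - 1, by omega⟩ : Fin b)).succ := Fin.ext (by simp; omega)
  obtain ⟨ψ, -, hψ⟩ := e.2.2
  obtain ⟨ψ', -, hψ'⟩ := e'.2.2
  have hb : ∀ w ∈ e.overlap e', w 0 = 0 → e.symm w ∈ (ℳ).boundary X := fun w hw hw0 =>
    (mem_boundary_iff (symm_mem hw.1)).2 (by rw [coord_symm hw.1]; exact hw0)
  let qu : (ℳ).boundary X := ⟨e.symm u, hb u hu hu0⟩
  let qv : (ℳ).boundary X := ⟨e.symm v, hb v hv hv0⟩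
  have h1 := hψ qu (symm_mem hu.1)
  have h2 := hψ qv (symm_mem hv.1)
  have hq : fib qu = fib qv := by
    refine ψ.injOn h1.1 h2.1 ?_
    ext j
    rw [← h1.2 j, ← h2.2 j]
    change (e.coord (e.symm u)) _ = (e.coord (e.symm v)) _
    rw [coord_symm hu.1, coord_symm hv.1]
    refine huv _ ?_
    have := j.isLt
    simp
  have h3 := (hψ' qu hu.2).2 ⟨k.val - 1, by omega⟩
  have h4 := (hψ' qv hv.2).2 ⟨k.val - 1, by omega⟩
  rw [hk']
  change (e'.coord (e.symm u)) _ = (e'.coord (e.symm v)) _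
  exact h3.trans ((by rw [hq] : _ = _).trans h4.symm)

theorem fderivWithin_transition_eq_zero (h0 : u 0 = 0) {k i : ℐ} (hk : k.val ≤ b) (hi : b < i.val) :
    fderivWithin ℝ 𝓉 (e.overlap e') u (basisVec i) k = 0 := by
  have hd := ((contDiffOn_transition u hu).differentiableWithinAt (by simp)).hasFDerivWithinAt
  have hi0 : (basisVec i : ℰ) 0 = 0 := by
    rw [basisVec_apply, if_neg]
    intro h; rw [← h] at hi; simp at hi
  obtain ⟨O, hO, h⟩ := e.exists_isOpen_overlap e'
  have huO : u ∈ O := by rw [h] at hu; exact hu.1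
  have hx : ∀ s : ℝ, (u + s • basisVec i : ℰ) 0 = 0 := fun s => by simp [h0, hi0]
  have hev : ∀ᶠ s : ℝ in 𝓝 0, u + s • basisVec i ∈ e.overlap e' := by
    filter_upwards [eventually_add_smul_mem (hO.mem_nhds huO) (basisVec i)] with s hs
    rw [h]
    exact ⟨hs, (hx s).ge⟩
  refine (hasDerivAt_coord.1 (hasDerivAt_line_of_within hd hev) k).unique ?_
  refine (hasDerivAt_const 0 (𝓉 u k)).congr_of_eventuallyEq ?_
  filter_upwards [hev] with s hs
  refine transition_base hs hu (hx s) h0 (fun j hj => ?_) hk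
  have : j ≠ i := fun h => by rw [h] at hj; omega
  simp [basisVec_apply, this]

theorem exists_tendsto_frameChange (k i : ℐ) :
    ∃ y, Tendsto (fun u => e.frameChange e' u k i) (𝓝[ℍ₊] u) (𝓝 y) := by
  have hD : SmoothOn (fun u => fderivWithin ℝ 𝓉 (e.overlap e') u (basisVec i) k) (e.overlap e') :=
    contDiffOn_euclidean.1 ((contDiffOn_transition.fderivWithin uniqueDiffOn_overlap (m := ∞)
      (by simp)).clm_apply contDiffOn_const) k
  have hle : 𝓝[ℍ₊] u ≤ 𝓝[e.overlap e'] u := nhdsWithin_le_of_mem (overlap_mem_nhdsWithin_pos hu)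
  have hD' : Tendsto (fun u => fderiv ℝ 𝓉 u (basisVec i) k) (𝓝[ℍ₊] u)
      (𝓝 (fderivWithin ℝ 𝓉 (e.overlap e') u (basisVec i) k)) := by
    refine ((hD.continuousOn u hu).tendsto.mono_left hle).congr' ?_
    filter_upwards [eventually_mem_overlap hu] with v hv
    rw [fderivWithin_of_mem_nhds (overlap_mem_nhds hv.1 hv.2)]
  have hx : Tendsto (fun u : ℰ => u 0) (𝓝[ℍ₊] u) (𝓝 (u 0)) :=
    (𝓍).continuous.continuousAt.tendsto.mono_left nhdsWithin_le_nhds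
  obtain ⟨a, ha⟩ := exists_tendsto_ratio hu
  by_cases hk : k.val ≤ b
  · by_cases hi : i.val ≤ b
    · refine ⟨_, (ha.mul hD').congr fun v => ?_⟩
      simp only [frameChange, edgeScale, hk, hi, if_true]
      ring
    · rcases (target_nonneg hu.1).eq_or_lt with h0 | h0
      · obtain ⟨O, hO, h⟩ := e.exists_isOpen_overlap e'
        obtain ⟨y, hy⟩ := exists_tendsto_div_coord hO (by rw [← h]; exact hD) (fun v hv hv0 =>
          fderivWithin_transition_eq_zero (by rw [h]; exact ⟨hv, hv0.ge⟩) hv0 hk (not_le.1 hi))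
          (by rw [h] at hu; exact hu.1) h0.symm
        refine ⟨_, (hy.mul ha).congr' ?_⟩
        filter_upwards [eventually_mem_overlap hu] with v hv
        have h3 := hv.2.ne'
        rw [fderivWithin_of_mem_nhds (overlap_mem_nhds hv.1 hv.2)]
        simp only [frameChange, edgeScale, hk, hi, if_true, if_false]
        field_simp
      · have h2 : Tendsto (fun u => 𝓉 u 0) (𝓝[ℍ₊] u) (𝓝 (𝓉 u 0)) :=
          (((𝓍).continuous.continuousAt.comp
            (contDiffAt_transition hu h0).continuousAt).tendsto).mono_left nhdsWithin_le_nhds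
        refine ⟨_, (hD'.div h2 (transition_pos hu h0).ne').congr fun v => ?_⟩
        simp only [frameChange, edgeScale, hk, hi, if_true, if_false, one_mul, Pi.div_apply]
  · by_cases hi : i.val ≤ b
    · refine ⟨_, (hx.mul hD').congr fun v => ?_⟩
      simp only [frameChange, edgeScale, hk, hi, if_true, if_false, div_one]
    · refine ⟨_, hD'.congr fun v => ?_⟩
      simp only [frameChange, edgeScale, hk, hi, if_false, div_one, one_mul]

/-- The extension of `frameChange` to the boundary. -/
noncomputable def frameLim (e e' : EdgeChart fib) (k i : ℐ) : ℰ → ℝ :=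
  extendFrom ℍ₊ fun u => e.frameChange e' u k i

/-- The extension to the boundary of the quotient of the two boundary defining coordinates. -/
noncomputable def ratioLim (e e' : EdgeChart fib) : ℰ → ℝ := extendFrom ℍ₊ fun u => u 0 / 𝓉 u 0

theorem tendsto_frameLim (k i : ℐ) :
    Tendsto (fun u => e.frameChange e' u k i) (𝓝[ℍ₊] u) (𝓝 (frameLim e e' k i u)) :=
  tendsto_extendFrom (exists_tendsto_frameChange hu k i)

theorem tendsto_ratioLim : Tendsto (fun u => u 0 / 𝓉 u 0) (𝓝[ℍ₊] u) (𝓝 (ratioLim e e' u)) :=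
  tendsto_extendFrom (exists_tendsto_ratio hu)

theorem fderiv_transition_comp (hu' : u ∈ e.overlap e'')
    (h0 : 0 < u 0) : fderiv ℝ (e.transition e'') u =
      (fderiv ℝ (e'.transition e'') (𝓉 u)).comp (fderiv ℝ 𝓉 u) := by
  have h1 := (hasFDerivAt_transition (transition_mem' hu hu') (transition_pos hu h0)).comp u
    (hasFDerivAt_transition hu h0)
  refine HasFDerivAt.fderiv (h1.congr_of_eventuallyEq ?_)
  filter_upwards [overlap_mem_nhds hu h0] with v hv
  exact (transition_transition hv).symm

theorem frameChange_comp (hu' : u ∈ e.overlap e'')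
    (h0 : 0 < u 0) (k i : ℐ) : e.frameChange e'' u k i =
      ∑ l, e'.frameChange e'' (𝓉 u) k l * e.frameChange e' u l i := by
  have h1 : fderiv ℝ (e.transition e'') u (basisVec i) k = ∑ l, fderiv ℝ 𝓉 u (basisVec i) l *
        fderiv ℝ (e'.transition e'') (𝓉 u) (basisVec l) k := by
    rw [fderiv_transition_comp hu hu' h0]
    change fderiv ℝ (e'.transition e'') (𝓉 u) (fderiv ℝ 𝓉 u _) k = _
    conv_lhs => rw [coord_eq_sum (fderiv ℝ 𝓉 u (basisVec i))]
    rw [map_sum]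
    simp [map_smul]
  simp only [frameChange, h1, transition_transition hu]
  rw [mul_sum, Finset.sum_div]
  refine sum_congr rfl fun l _ => ?_
  have := edgeScale_ne_zero (b := b) (f := f) (transition_pos hu h0).ne' l
  field_simp

theorem frameLim_comp (hu' : u ∈ e.overlap e'') (k i : ℐ) : frameLim e e'' k i u =
      ∑ l, frameLim e' e'' k l (𝓉 u) * frameLim e e' l i u := by
  have := nhdsWithin_coordPos_neBot (target_nonneg hu.1)
  refine tendsto_nhds_unique (tendsto_frameLim hu' k i) ?_
  refine (tendsto_finsetSum Finset.univ fun l _ =>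
    ((tendsto_frameLim (transition_mem' hu hu') k l).comp (tendsto_transition hu)).mul
      (tendsto_frameLim hu l i)).congr' ?_
  filter_upwards [eventually_mem_overlap hu, eventually_mem_overlap hu'] with v hv hv'
  exact (frameChange_comp hv.1 hv'.1 hv.2 k i).symm

theorem ratioLim_comp (hu' : u ∈ e.overlap e'') :
    ratioLim e e'' u = ratioLim e' e'' (𝓉 u) * ratioLim e e' u := by
  have := nhdsWithin_coordPos_neBot (target_nonneg hu.1)
  refine tendsto_nhds_unique (tendsto_ratioLim hu') ?_
  refine (((tendsto_ratioLim (transition_mem' hu hu')).comp (tendsto_transition hu)).mul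
      (tendsto_ratioLim hu)).congr' ?_
  filter_upwards [eventually_mem_overlap hu, eventually_mem_overlap hu'] with v hv hv'
  have := (transition_pos hv.1 hv.2).ne'
  simp only [Function.comp]
  rw [transition_transition hv.1]
  field_simp

theorem continuousAt_transition_x (h0 : 0 < u 0) : ContinuousAt (fun u => 𝓉 u 0) u :=
  (𝓍).continuous.continuousAt.comp (contDiffAt_transition hu h0).continuousAt

theorem frameLim_interior (h0 : 0 < u 0)
    (k i : ℐ) : frameLim e e' k i u = e.frameChange e' u k i := by
  refine extendFrom_eq (mem_closure_coordPos h0.le) (Tendsto.mono_left ?_ nhdsWithin_le_nhds)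
  have h1 : ContinuousAt (fun u => fderiv ℝ 𝓉 u (basisVec i) k) u := by
    have h2 : ContinuousAt (fderiv ℝ 𝓉) u :=
      ((contDiffAt_transition hu h0).fderiv_right (m := ∞) (by simp)).continuousAt
    exact (EuclideanSpace.proj (𝕜 := ℝ) k).continuous.continuousAt.comp
      (h2.clm_apply continuousAt_const)
  have hx : ContinuousAt (fun u : ℰ => u 0) u := (𝓍).continuous.continuousAt
  have hx' := continuousAt_transition_x hu h0
  have hs : ∀ (φ : ℰ → ℝ) (j : ℐ), ContinuousAt φ u →
      ContinuousAt (fun u => edgeScale (φ u) j) u := fun φ j hφ => by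
    simp only [edgeScale]
    split_ifs
    exacts [hφ, continuousAt_const]
  exact ((hs _ i hx).mul h1).div (hs _ k hx') (edgeScale_ne_zero (transition_pos hu h0).ne' k)

theorem ratioLim_interior (h0 : 0 < u 0) : ratioLim e e' u = u 0 / 𝓉 u 0 := by
  refine extendFrom_eq (mem_closure_coordPos h0.le) (Tendsto.mono_left ?_ nhdsWithin_le_nhds)
  have hx : ContinuousAt (fun u : ℰ => u 0) u := (𝓍).continuous.continuousAt
  have hx' := continuousAt_transition_x hu h0
  exact hx.div hx' (transition_pos hu h0).ne'

end Overlap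

theorem continuousOn_frameLim (k i : ℐ) : ContinuousOn (frameLim e e' k i) (e.overlap e') :=
  continuousOn_extendFrom (fun _ hu => mem_closure_coordPos (target_nonneg hu.1))
    fun _ hu => exists_tendsto_frameChange hu k i

theorem continuousOn_ratioLim : ContinuousOn (ratioLim e e') (e.overlap e') :=
  continuousOn_extendFrom (fun _ hu => mem_closure_coordPos (target_nonneg hu.1))
    fun _ hu => exists_tendsto_ratio hu

theorem frameLim_self {u : ℰ} (hu : u ∈ e.target) (k i : ℐ) :
    frameLim e e k i u = if k = i then 1 else 0 := by
  have hu' : u ∈ e.overlap e := by rw [overlap_self]; exact hu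
  have := nhdsWithin_coordPos_neBot (target_nonneg hu)
  refine tendsto_nhds_unique (tendsto_frameLim hu' k i) ?_
  refine tendsto_const_nhds.congr' ?_
  filter_upwards [eventually_mem_overlap hu'] with v hv
  have h1 : fderiv ℝ (e.transition e) v = ContinuousLinearMap.id ℝ _ := by
    refine HasFDerivAt.fderiv ((hasFDerivAt_id v).congr_of_eventuallyEq ?_)
    filter_upwards [overlap_mem_nhds hv.1 hv.2] with w hw
    exact transition_self hw.1
  have h2 := edgeScale_ne_zero (b := b) (f := f) hv.2.ne' k
  simp only [frameChange, h1, transition_self hv.1.1, ContinuousLinearMap.id_apply, basisVec_apply]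
  split_ifs with h
  · rw [← h]; field_simp
  · simp

theorem ratioLim_self {u : ℰ} (hu : u ∈ e.target) : ratioLim e e u = 1 := by
  have hu' : u ∈ e.overlap e := by rw [overlap_self]; exact hu
  have := nhdsWithin_coordPos_neBot (target_nonneg hu)
  refine tendsto_nhds_unique (tendsto_ratioLim hu') ?_
  refine tendsto_const_nhds.congr' ?_
  filter_upwards [eventually_mem_overlap hu'] with v hv
  rw [transition_self hv.1.1, div_self hv.2.ne']

end EdgeChart

/-! ### Coordinates on the edge cotangent bundle -/

namespace EdgeCotangent

open EdgeChart

variable {w w' : EdgeCotangent fib}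

/-- The coordinate change of the edge cotangent bundle. -/
noncomputable def changeCoords (e e' : EdgeChart fib) (w : ℙ) : ℙ :=
  (w.1, 𝓉 w.2.1, ratioLim e' e (𝓉 w.2.1) * w.2.2.1,
    WithLp.toLp 2 fun i => ∑ k, frameLim e' e k i (𝓉 w.2.1) * w.2.2.2 k)

/-- The part over an open set of an adapted chart. -/
def patch (e : EdgeChart fib) (N : Set ℙ) : 𝒮 := {w | w.pt ∈ e.source ∧ coords e w ∈ N}

theorem isOpen_patch (e : EdgeChart fib) {N : Set ℙ} (hN : IsOpen N) : IsOpen (patch e N) :=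
  TopologicalSpace.isOpen_generateFrom_of_mem ⟨e, N, hN, rfl⟩

theorem coords_mem (hw : w.pt ∈ e.source) : (coords e w).2.1 ∈ e.target := coord_mem hw

theorem continuous_dilate (c : ℝ) :
    Continuous (dilate c : EdgeCotangent fib → EdgeCotangent fib) := by
  refine continuous_generateFrom_iff.2 ?_
  rintro _ ⟨e, N, hN, rfl⟩
  refine isOpen_patch e (N := {w | (w.1, w.2.1, c • w.2.2) ∈ N}) (hN.preimage ?_)
  fun_prop

theorem dilate_dilate (c c' : ℝ) (w : EdgeCotangent fib) :
    dilate c (dilate c' w) = dilate (c * c') w := by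
  simp only [dilate, smul_smul]

theorem dilate_one (w : EdgeCotangent fib) : dilate 1 w = w := by simp only [dilate, one_smul]

theorem isConic_closure {S : 𝒮} (hS : IsConic S) : IsConic (closure S) :=
  fun c hc _ hw => map_mem_closure (continuous_dilate c) hw fun v hv => hS c hc v hv

theorem coords_change (he : w.pt ∈ e.source) (he' : w.pt ∈ e'.source) :
    coords e' w = changeCoords e e' (coords e w) := by
  have hu := coord_mem_overlap he' he
  have := nhdsWithin_coordPos_neBot (target_nonneg hu.1)
  obtain ⟨h1, h2⟩ := w.compat e' e he' he
  have hT : 𝓉 (coords e w).2.1 = e'.coord w.pt := coord_eq_transition he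
  refine Prod.ext rfl (Prod.ext hT.symm (Prod.ext ?_ ?_))
  · simp only [changeCoords, hT]
    exact tendsto_nhds_unique h1 ((tendsto_ratioLim hu).mul_const _)
  · ext i
    simp only [changeCoords, hT]
    exact tendsto_nhds_unique (h2 i)
      (tendsto_finsetSum _ fun k _ => (tendsto_frameLim hu k i).mul_const _)

theorem continuousOn_changeCoords :
    ContinuousOn (changeCoords e e') {w | w.2.1 ∈ e.overlap e'} := by
  have h0 : ContinuousOn (fun w : ℙ => 𝓉 w.2.1) {w | w.2.1 ∈ e.overlap e'} :=
    contDiffOn_transition.continuousOn.comp (by fun_prop) fun w hw => hw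
  have hm : Set.MapsTo (fun w : ℙ => 𝓉 w.2.1) {w | w.2.1 ∈ e.overlap e'}
    (e'.overlap e) := fun w hw => transition_mem hw
  refine continuousOn_fst.prodMk (h0.prodMk (((continuousOn_ratioLim.comp h0 hm).mul
    (by fun_prop)).prodMk ((PiLp.continuous_toLp 2 _).comp_continuousOn
      (continuousOn_pi.2 fun i => continuousOn_finsetSum _ fun k _ => ?_))))
  have hv : Continuous fun w : ℙ => w.2.2.2 k :=
    (EuclideanSpace.proj (𝕜 := ℝ) k).continuous.comp (by fun_prop : Continuous fun w : ℙ => w.2.2.2)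
  exact ((continuousOn_frameLim k i).comp h0 hm).mul hv.continuousOn

theorem ext_coords (he : w.pt ∈ e.source) (he' : w'.pt ∈ e.source)
    (h : coords e w = coords e w') : w = w' := by
  have hpt : w.pt = w'.pt := by
    rw [← symm_coord he, ← symm_coord he']
    exact congrArg (fun v : ℙ => e.symm v.2.1) h
  have ht : w.time = w'.time := congrArg (fun v : ℙ => v.1) h
  have hc : w.comp = w'.comp := by
    funext e'
    by_cases he'' : w.pt ∈ e'.source
    · have h1 := coords_change he he''
      rw [h, ← coords_change he' (hpt ▸ he'')] at h1
      exact congrArg (fun v : ℙ => v.2.2) h1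
    · rw [w.comp_eq_zero e' he'', w'.comp_eq_zero e' (hpt ▸ he'')]
  cases w; cases w'
  simp only at hpt ht hc
  subst hpt ht hc
  rfl

theorem changeCoords_self {w : ℙ} (hw : w.2.1 ∈ e.target) : changeCoords e e w = w := by
  simp only [changeCoords, transition_self hw, ratioLim_self hw, frameLim_self hw, one_mul]
  refine Prod.ext rfl (Prod.ext rfl (Prod.ext rfl ?_))
  ext i
  simp

/-- The edge covector with given coordinates. -/
noncomputable def ofCoords (e : EdgeChart fib) (w : ℙ) : EdgeCotangent fib := by
  classical
  exact
  { time := w.1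
    pt := e.symm w.2.1
    comp := fun e' => if w.2.1 ∈ e.overlap e' then (changeCoords e e' w).2.2 else 0
    comp_eq_zero := fun e' he' => if_neg fun h => he' h.2
    compat := fun e₁ e₂ he₁ he₂ => by
      by_cases hw : w.2.1 ∈ e.target
      · have h1 : w.2.1 ∈ e.overlap e₁ := ⟨hw, he₁⟩
        have h2 : w.2.1 ∈ e.overlap e₂ := ⟨hw, he₂⟩
        have hu := transition_mem' h1 h2
        rw [if_pos h1, if_pos h2]
        have hT : e₁.coord (e.symm w.2.1) = e.transition e₁ w.2.1 := rfl
        have hT2 : e₁.transition e₂ (e.transition e₁ w.2.1) = e.transition e₂ w.2.1 :=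
          transition_transition h1
        rw [hT]
        refine ⟨?_, fun i => ?_⟩
        · have h3 := (tendsto_ratioLim hu).mul_const (changeCoords e e₂ w).2.2.1
          have h4 := ratioLim_comp hu (transition_mem h1)
          rw [hT2] at h4
          simp only [changeCoords] at h3 ⊢
          rwa [h4, mul_assoc, mul_left_comm]
        · have h3 := tendsto_finsetSum Finset.univ fun k _ =>
            (tendsto_frameLim hu k i).mul_const ((changeCoords e e₂ w).2.2.2 k)
          have h4 := fun k => frameLim_comp hu (transition_mem h1) k i
          rw [hT2] at h4
          simp only [changeCoords] at h3 ⊢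
          refine h3.trans (le_of_eq (congrArg 𝓝 ?_))
          simp only [h4, mul_sum, sum_mul]
          rw [sum_comm]
          exact sum_congr rfl fun k _ => sum_congr rfl fun l _ => by ring
      · have h1 : ∀ e', w.2.1 ∉ e.overlap e' := fun e' h => hw h.1
        simp [h1, tendsto_const_nhds] }

theorem ofCoords_pt {w : ℙ} (hw : w.2.1 ∈ e.target) : (ofCoords e w).pt ∈ e.source := symm_mem hw

theorem coords_ofCoords {w : ℙ} (hw : w.2.1 ∈ e.target) : coords e (ofCoords e w) = w := by
  have h1 : w.2.1 ∈ e.overlap e := by rwa [overlap_self]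
  refine Prod.ext rfl (Prod.ext (coord_symm hw) ?_)
  exact (if_pos h1).trans (by rw [changeCoords_self hw])

theorem ofCoords_coords (hw : w.pt ∈ e.source) : ofCoords e (coords e w) = w :=
  ext_coords (ofCoords_pt (coords_mem hw)) hw (coords_ofCoords (coords_mem hw))

/-- The coordinates of any adapted chart determine the topology over its domain. -/
theorem exists_patch_subset {S : 𝒮} (hS : IsOpen S) (hw : w ∈ S)
    (he : w.pt ∈ e.source) : ∃ N, IsOpen N ∧ coords e w ∈ N ∧ patch e N ⊆ S := by
  induction hS with
  | basic S hS =>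
    obtain ⟨e', N, hN, rfl⟩ := hS
    obtain ⟨O, hO, hOe⟩ := e.exists_isOpen_overlap e'
    have hu : (coords e w).2.1 ∈ e.overlap e' := coord_mem_overlap he hw.1
    have hmem := continuousOn_changeCoords (e := e) (e' := e') (coords e w) hu
      (hN.mem_nhds (by rw [← coords_change he hw.1]; exact hw.2))
    obtain ⟨N', hN', hw', hsub⟩ := mem_nhdsWithin.1 hmem
    refine ⟨N' ∩ {v | v.2.1 ∈ O}, hN'.inter (hO.preimage (by fun_prop)),
      ⟨hw', by rw [hOe] at hu; exact hu.1⟩, fun v hv => ?_⟩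
    have h1 : (coords e v).2.1 ∈ e.overlap e' := by
      rw [hOe]; exact ⟨hv.2.2, target_nonneg (coords_mem hv.1)⟩
    have h2 : v.pt ∈ e'.source := by
      have := h1.2
      rwa [mem_preimage, show e.symm (coords e v).2.1 = v.pt from symm_coord hv.1] at this
    exact ⟨h2, by rw [coords_change hv.1 h2]; exact hsub ⟨hv.2.1, h1⟩⟩
  | univ => exact ⟨univ, isOpen_univ, trivial, fun _ _ => trivial⟩
  | inter S T _ _ hS hT =>
    obtain ⟨N, h1, h2, h3⟩ := hS hw.1
    obtain ⟨N', h1', h2', h3'⟩ := hT hw.2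
    exact ⟨N ∩ N', h1.inter h1', ⟨h2, h2'⟩, fun v hv => ⟨h3 ⟨hv.1, hv.2.1⟩, h3' ⟨hv.1, hv.2.2⟩⟩⟩
  | sUnion T _ hT =>
    obtain ⟨S, hS, hwS⟩ := hw
    obtain ⟨N, h1, h2, h3⟩ := hT S hS hwS
    exact ⟨N, h1, h2, h3.trans (Set.subset_sUnion_of_mem hS)⟩

theorem tendsto_of_coords {ι : Type*} {l : Filter ι} {φ : ι → EdgeCotangent fib}
    (he : w.pt ∈ e.source) (hφ : ∀ᶠ a in l, (φ a).pt ∈ e.source)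
    (h : Tendsto (fun a => coords e (φ a)) l (𝓝 (coords e w))) : Tendsto φ l (𝓝 w) := by
  refine tendsto_nhds.2 fun S hS hw => ?_
  obtain ⟨N, h1, h2, h3⟩ := exists_patch_subset hS hw he
  filter_upwards [hφ, h.eventually (h1.mem_nhds h2)] with a ha ha'
  exact h3 ⟨ha, ha'⟩

theorem tendsto_coords {ι : Type*} {l : Filter ι} {φ : ι → EdgeCotangent fib}
    (he : w.pt ∈ e.source) (h : Tendsto φ l (𝓝 w)) :
    (∀ᶠ a in l, (φ a).pt ∈ e.source) ∧ Tendsto (fun a => coords e (φ a)) l (𝓝 (coords e w)) := by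
  refine ⟨?_, tendsto_nhds.2 fun N hN hw => ?_⟩
  · filter_upwards [h.eventually ((isOpen_patch e isOpen_univ).mem_nhds ⟨he, trivial⟩)] with a ha
    exact ha.1
  · filter_upwards [h.eventually ((isOpen_patch e hN).mem_nhds ⟨he, hw⟩)] with a ha
    exact ha.2

/-- Over the domain of a chart, open covers have countable subcovers. -/
theorem exists_countable_cover {R : 𝒮} (hR : ∀ w ∈ R, w.pt ∈ e.source)
    {V : EdgeCotangent fib → 𝒮} (hV : ∀ w ∈ R, IsOpen (V w) ∧ w ∈ V w) :
    ∃ T ⊆ R, T.Countable ∧ R ⊆ ⋃ w ∈ T, V w := by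
  have h1 : ∀ y ∈ coords e '' R, ∃ w N, w ∈ R ∧ coords e w = y ∧ IsOpen N ∧ y ∈ N ∧
      patch e N ⊆ V w := by
    rintro _ ⟨w, hw, rfl⟩
    obtain ⟨N, h1, h2, h3⟩ := exists_patch_subset (hV w hw).1 (hV w hw).2 (hR w hw)
    exact ⟨w, N, hw, rfl, h1, h2, h3⟩
  obtain rfl | ⟨w₀, -⟩ := R.eq_empty_or_nonempty
  · exact ⟨∅, subset_rfl, Set.countable_empty, Set.empty_subset _⟩
  have : Nonempty (EdgeCotangent fib) := ⟨w₀⟩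
  choose! φ N hφ hφe hN hyN hsub using h1
  obtain ⟨t, htR, htc, hcov⟩ := TopologicalSpace.countable_cover_nhdsWithin
    fun y hy => mem_nhdsWithin_of_mem_nhds ((hN y hy).mem_nhds (hyN y hy))
  refine ⟨φ '' t, ?_, htc.image _, fun w hw => ?_⟩
  · rintro _ ⟨y, hy, rfl⟩
    exact hφ y (htR hy)
  · obtain ⟨y, hy, hwy⟩ := Set.mem_iUnion₂.1 (hcov ⟨w, hw, rfl⟩)
    exact Set.mem_iUnion₂.2 ⟨φ y, ⟨y, hy, rfl⟩, hsub y (htR hy) ⟨hR w hw, hwy⟩⟩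

end EdgeCotangent

/-! ### Invariance of the bicharacteristics under changes of charts -/

namespace EdgeChart

variable {w : ℙ}

/-- The change of canonical coordinates over the interior. -/
noncomputable def canonicalChange (e e' : EdgeChart fib) (w : ℙ) : ℙ :=
  (w.1, 𝓉 w.2.1, w.2.2.1, WithLp.toLp 2 fun k =>
    ∑ i, fderiv ℝ (e'.transition e) (𝓉 w.2.1) (basisVec k) i * w.2.2.2 i)

theorem fderiv_transition_left {u : ℰ} (hu : u ∈ e.overlap e') (h0 : 0 < u 0)
    (ζ : ℰ) : fderiv ℝ (e'.transition e) (𝓉 u) (fderiv ℝ 𝓉 u ζ) = ζ := by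
  have h1 := (hasFDerivAt_transition (transition_mem hu) (transition_pos hu h0)).comp u
    (hasFDerivAt_transition hu h0)
  have h2 : HasFDerivAt (e'.transition e ∘ 𝓉) (ContinuousLinearMap.id ℝ _) u := by
    refine (hasFDerivAt_id u).congr_of_eventuallyEq ?_
    filter_upwards [overlap_mem_nhds hu h0] with v hv
    simp only [Function.comp, transition_transition hv, transition_self hv.1, id]
  exact congrArg (fun A : ℰ →L[ℝ] ℰ => A ζ) (h1.unique h2)

/-- The canonical one-form is invariant. -/
theorem canonicalChange_pairing (hu : w.2.1 ∈ e.overlap e') (h0 : 0 < w.2.1 0) (ζ : ℰ) :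
    ∑ k, (canonicalChange e e' w).2.2.2 k * fderiv ℝ 𝓉 w.2.1 ζ k = ∑ i, w.2.2.2 i * ζ i := by
  have h1 : ∀ i, ζ i = ∑ k, fderiv ℝ 𝓉 w.2.1 ζ k *
      fderiv ℝ (e'.transition e) (𝓉 w.2.1) (basisVec k) i := fun i => by
    conv_lhs => rw [← fderiv_transition_left hu h0 ζ, coord_eq_sum (fderiv ℝ 𝓉 w.2.1 ζ), map_sum]
    simp [map_smul]
  simp only [canonicalChange, sum_mul]
  rw [sum_comm]
  refine sum_congr rfl fun i _ => ?_
  rw [h1 i, mul_sum]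
  exact sum_congr rfl fun k _ => by ring

theorem canonicalChange_canonicalChange (hu : w.2.1 ∈ e.overlap e') (h0 : 0 < w.2.1 0) :
    canonicalChange e' e (canonicalChange e e' w) = w := by
  refine Prod.ext rfl (Prod.ext ?_ (Prod.ext rfl ?_))
  · exact (transition_transition hu).trans (transition_self hu.1)
  · ext k
    have h1 := canonicalChange_pairing (w := canonicalChange e e' w) (transition_mem hu)
      (transition_pos hu h0) (fderiv ℝ 𝓉 w.2.1 (basisVec k))
    rw [canonicalChange_pairing hu h0] at h1
    have h2 : fderiv ℝ (e'.transition e) (canonicalChange e e' w).2.1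
        (fderiv ℝ 𝓉 w.2.1 (basisVec k)) = basisVec k :=
      fderiv_transition_left hu h0 _
    rw [h2] at h1
    simpa [basisVec_apply] using h1

theorem preimage_overlap_mem_nhds (hu : w.2.1 ∈ e.overlap e') (h0 : 0 < w.2.1 0) :
    ∀ᶠ v : ℙ in 𝓝 w, v.2.1 ∈ e.overlap e' ∧ 0 < v.2.1 0 := by
  have h1 : Tendsto (fun v : ℙ => v.2.1) (𝓝 w) (𝓝 w.2.1) :=
    (by fun_prop : Continuous fun v : ℙ => v.2.1).tendsto w
  exact (h1.eventually (overlap_mem_nhds hu h0)).and (h1.eventually (isOpen_coordPos.mem_nhds h0))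

theorem hasFDerivAt_canonicalChange (hu : w.2.1 ∈ e.overlap e') (h0 : 0 < w.2.1 0) :
    HasFDerivAt (canonicalChange e e') (fderiv ℝ (canonicalChange e e') w) w := by
  have hT : SmoothAt (fun w : ℙ => 𝓉 w.2.1) w :=
    ContDiffAt.comp (g := 𝓉) w (contDiffAt_transition hu h0) (by fun_prop)
  have hD : SmoothAt (fun w : ℙ => fderiv ℝ (e'.transition e) (𝓉 w.2.1)) w :=
    ContDiffAt.comp (g := fderiv ℝ (e'.transition e)) w
      ((contDiffAt_transition (transition_mem hu) (transition_pos hu h0)).fderiv_right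
      (m := ∞) (by simp)) hT
  have hv : ∀ k, SmoothAt (fun w : ℙ =>
      ∑ i, fderiv ℝ (e'.transition e) (𝓉 w.2.1) (basisVec k) i * w.2.2.2 i) w :=
    fun k => ContDiffAt.sum fun i _ =>
      (contDiffAt_euclidean.1 (hD.clm_apply contDiffAt_const) i).mul
        (contDiffAt_euclidean.1 (by fun_prop : SmoothAt (fun w : ℙ => w.2.2.2) w) i)
  exact ((contDiffAt_fst.prodMk (hT.prodMk (ContDiffAt.prodMk (by fun_prop)
    (contDiffAt_euclidean.2 hv)))).differentiableAt (n := ∞) (by simp)).hasFDerivAt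

theorem symplForm_canonicalChange (hu : w.2.1 ∈ e.overlap e') (h0 : 0 < w.2.1 0)
    (δ δ' : ℙ) : symplForm (fderiv ℝ (canonicalChange e e') w δ)
      (fderiv ℝ (canonicalChange e e') w δ') = symplForm δ δ' := by
  set D := fderiv ℝ (canonicalChange e e') w
  have hline : ∀ δ, HasDerivAt (fun s : ℝ => canonicalChange e e' (w + s • δ)) (D δ) 0 := fun δ =>
    hasDerivAt_line (hasFDerivAt_canonicalChange hu h0) δ
  have hid : ∀ δ, HasDerivAt (fun s : ℝ => w + s • δ) δ 0 := fun δ =>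
    hasDerivAt_line (hasFDerivAt_id w) δ
  have hD1 : ∀ δ, (D δ).1 = δ.1 := fun δ => by
    have h1 : HasDerivAt (fun s : ℝ => (w + s • δ).1) (D δ).1 0 := (hline δ).fst
    exact h1.unique (hid δ).fst
  have hD3 : ∀ δ, (D δ).2.2.1 = δ.2.2.1 := fun δ => by
    have h1 : HasDerivAt (fun s : ℝ => (w + s • δ).2.2.1) (D δ).2.2.1 0 := (hline δ).snd.snd.fst
    exact h1.unique (hid δ).snd.snd.fst
  have hD2 : ∀ δ, (D δ).2.1 = fderiv ℝ 𝓉 w.2.1 δ.2.1 := fun δ => by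
    have h1 : HasDerivAt (fun s : ℝ => 𝓉 (w.2.1 + s • δ.2.1)) (D δ).2.1 0 := (hline δ).snd.fst
    exact h1.unique (hasDerivAt_line (hasFDerivAt_transition hu h0) _)
  have hcd := contDiffAt_transition hu h0
  have hsymm : IsSymmSndFDerivAt ℝ 𝓉 w.2.1 := hcd.isSymmSndFDerivAt (by
      rw [minSmoothness_of_isRCLikeNormedField]; exact WithTop.coe_le_coe.2 le_top)
  have h2 : HasFDerivAt (fderiv ℝ 𝓉) (fderiv ℝ (fderiv ℝ 𝓉) w.2.1)
      w.2.1 := ((hcd.fderiv_right (m := ∞) (by simp)).differentiableAt (by simp)).hasFDerivAt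
  have key : ∀ δ ζ, ∑ k, (D δ).2.2.2 k * fderiv ℝ 𝓉 w.2.1 ζ k +
      ∑ k, (canonicalChange e e' w).2.2.2 k *
        fderiv ℝ (fderiv ℝ 𝓉) w.2.1 δ.2.1 ζ k = ∑ i, δ.2.2.2 i * ζ i := by
    intro δ ζ
    have h3 : HasDerivAt (fun s : ℝ => ∑ k, (canonicalChange e e' (w + s • δ)).2.2.2 k *
        fderiv ℝ 𝓉 (w.2.1 + s • δ.2.1) ζ k)
        (∑ k, ((D δ).2.2.2 k * fderiv ℝ 𝓉 w.2.1 ζ k + (canonicalChange e e' w).2.2.2 k *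
          fderiv ℝ (fderiv ℝ 𝓉) w.2.1 δ.2.1 ζ k)) 0 := by
      refine HasDerivAt.fun_sum fun k _ => ?_
      have h4 : HasDerivAt (fun s : ℝ => (canonicalChange e e' (w + s • δ)).2.2.2)
        (D δ).2.2.2 0 := (hline δ).snd.snd.snd
      have h5 := (hasDerivAt_line h2 δ.2.1).clm_apply (hasDerivAt_const (0 : ℝ) ζ)
      rw [map_zero, add_zero] at h5
      have h6 := (hasDerivAt_coord.1 h4 k).fun_mul (hasDerivAt_coord.1 h5 k)
      simpa only [zero_smul, add_zero] using h6
    have h7 : HasDerivAt (fun s : ℝ => ∑ i, (w + s • δ).2.2.2 i * ζ i) (∑ i, δ.2.2.2 i * ζ i) 0 :=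
      HasDerivAt.fun_sum fun i _ => (hasDerivAt_coord.1 ((hid δ).snd.snd.snd) i).mul_const _
    rw [← sum_add_distrib]
    refine h3.unique (h7.congr_of_eventuallyEq ?_)
    filter_upwards [eventually_add_smul_mem (preimage_overlap_mem_nhds hu h0) δ] with s hs
    exact canonicalChange_pairing hs.1 hs.2 ζ
  have k1 := key δ δ'.2.1
  have k2 := key δ' δ.2.1
  rw [hsymm δ'.2.1 δ.2.1] at k2
  simp only [symplForm_apply, canonicalForm, sum_sub_distrib, hD1, hD2, hD3]
  linarith

theorem hamiltonField_canonicalChange {P P' : ℙ → ℝ} (hu : w.2.1 ∈ e.overlap e')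
    (h0 : 0 < w.2.1 0) (hP : DifferentiableAt ℝ P w)
    (h : ∀ v : ℙ, v.2.1 ∈ e'.overlap e → 0 < v.2.1 0 → P' v = P (canonicalChange e' e v)) :
    hamiltonField P' (canonicalChange e e' w) =
      fderiv ℝ (canonicalChange e e') w (hamiltonField P w) := by
  set w' := canonicalChange e e' w with hw'
  have hu' : w'.2.1 ∈ e'.overlap e := transition_mem hu
  have h0' : 0 < w'.2.1 0 := transition_pos hu h0
  have hback : canonicalChange e' e w' = w := canonicalChange_canonicalChange hu h0
  have hL' := hasFDerivAt_canonicalChange hu' h0'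
  have hPd : HasFDerivAt P' ((fderiv ℝ P w).comp (fderiv ℝ (canonicalChange e' e) w')) w' := by
    have h1 : HasFDerivAt P (fderiv ℝ P w) (canonicalChange e' e w') := by
      rw [hback]; exact hP.hasFDerivAt
    refine (h1.comp w' hL').congr_of_eventuallyEq ?_
    filter_upwards [preimage_overlap_mem_nhds hu' h0'] with v hv
    exact h v hv.1 hv.2
  have hinv : ∀ δ,
      fderiv ℝ (canonicalChange e e') w (fderiv ℝ (canonicalChange e' e) w' δ) = δ := by
    intro δ
    have h1 : HasFDerivAt (canonicalChange e e') (fderiv ℝ (canonicalChange e e') w)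
        (canonicalChange e' e w') := by
      rw [hback]; exact hasFDerivAt_canonicalChange hu h0
    have h2 : HasFDerivAt (canonicalChange e e' ∘ canonicalChange e' e)
        (ContinuousLinearMap.id ℝ _) w' := by
      refine (hasFDerivAt_id w').congr_of_eventuallyEq ?_
      filter_upwards [preimage_overlap_mem_nhds hu' h0'] with v hv
      exact canonicalChange_canonicalChange hv.1 hv.2
    exact congrArg (fun A : ℙ →L[ℝ] ℙ => A δ) ((h1.comp w' hL').unique h2)
  refine sub_eq_zero.1 (symplForm_nondegenerate fun δ => ?_)
  rw [map_sub, sub_apply, symplForm_hamiltonField, hPd.fderiv]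
  conv_lhs => rw [← hinv δ]
  rw [symplForm_canonicalChange hu h0, symplForm_hamiltonField, hinv]
  simp


theorem mdifferentiableAt_symm {u : ℰ} (hu : u ∈ e.target) (h0 : 0 < u 0) :
    MDifferentiableAt 𝓘(ℝ, ℰ) ℳ e.symm u := by
  have h1 : ContMDiffOn 𝓘(ℝ, ℰ) ℳ ∞ e.symm (ℳ '' e.1.target) := contMDiffOn_extend_symm e.2.1
  have h2 : e.target ⊆ ℳ '' e.1.target := fun v hv => by
    rw [target, e.1.extend_target_eq_image_source] at hv
    obtain ⟨p, hp, rfl⟩ := hv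
    exact ⟨e.1 p, e.1.map_source hp, rfl⟩
  have h3 := overlap_mem_nhds (e := e) (e' := e) (by rwa [overlap_self]) h0
  rw [overlap_self] at h3
  exact ((h1.mono h2).contMDiffAt h3).mdifferentiableAt (by simp)

theorem metricMatrix_transition {u : ℰ} (hu : u ∈ e.overlap e') (h0 : 0 < u 0) :
    metricMatrix g e u = Matrix.transpose (Matrix.of fun k i => fderiv ℝ 𝓉 u (basisVec i) k) *
      metricMatrix g e' (𝓉 u) *
      Matrix.of fun k i => fderiv ℝ 𝓉 u (basisVec i) k := by
  have h1 := mdifferentiableAt_symm (transition_mem hu).1 (transition_pos hu h0)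
  have h2 : HasMFDerivAt 𝓘(ℝ, ℰ) ℳ (e'.symm ∘ 𝓉) u
      ((mfderiv 𝓘(ℝ, ℰ) ℳ e'.symm (𝓉 u)).comp (fderiv ℝ 𝓉 u)) :=
    h1.hasMFDerivAt.comp u (hasFDerivAt_transition hu h0).hasMFDerivAt
  have h3 : e.symm =ᶠ[𝓝 u] e'.symm ∘ 𝓉 := by
    filter_upwards [overlap_mem_nhds hu h0] with v hv
    exact (symm_transition hv).symm
  have h4 := (h2.congr_of_eventuallyEq h3).mfderiv
  ext i j
  have h5 : metricMatrix g e u i j = g (e'.symm (𝓉 u))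
      (mfderiv 𝓘(ℝ, ℰ) ℳ e'.symm (𝓉 u) (fderiv ℝ 𝓉 u (basisVec i)))
      (mfderiv 𝓘(ℝ, ℰ) ℳ e'.symm (𝓉 u) (fderiv ℝ 𝓉 u (basisVec j))) := by
    rw [metricMatrix, Matrix.of_apply, h4]
    have : ∀ p q : X, p = q → ∀ V W : ℰ, g p V W = g q V W := by rintro p _ rfl V W; rfl
    exact this _ _ (symm_transition hu).symm _ _
  have h6 : ∀ (q : X) (A : ℰ →L[ℝ] TangentSpace ℳ q) (V W : ℰ),
      g q (A V) (A W) = ∑ l, (∑ k, V k * g q (A (basisVec k)) (A (basisVec l))) * W l := by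
    intro q A V W
    conv_lhs => rw [coord_eq_sum V, coord_eq_sum W]
    simp only [map_sum, map_smul, sum_apply, FunLike.coe_smul, Pi.smul_apply, smul_eq_mul]
    refine sum_congr rfl fun l _ => ?_
    rw [mul_sum, sum_mul]
    exact sum_congr rfl fun k _ => by ring
  exact h5.trans ((h6 _ _ _ _).trans rfl)

/-- The symbol of the wave operator is a function on the cotangent bundle. -/
theorem waveSymbol_canonicalChange (hu : w.2.1 ∈ e.overlap e') (h0 : 0 < w.2.1 0) :
    waveSymbol g e w = waveSymbol g e' (canonicalChange e e' w) := by
  set J : Matrix ℐ ℐ ℝ := Matrix.of fun k i => fderiv ℝ 𝓉 w.2.1 (basisVec i) k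
  set v' := (canonicalChange e e' w).2.2.2
  have hv : w.2.2.2 = WithLp.toLp 2 (J.transpose.mulVec v') := by
    ext i
    have := canonicalChange_pairing hu h0 (basisVec i)
    simp [basisVec_apply] at this
    simp [Matrix.mulVec, dotProduct, J, ← this, mul_comm, v']
  have hJ : IsUnit J.det := by
    refine Matrix.isUnit_det_of_left_inverse (B := Matrix.of fun k i =>
      fderiv ℝ (e'.transition e) (𝓉 w.2.1) (basisVec i) k) ?_
    ext i j
    have h1 := congrArg (fun v : ℰ => v i) (fderiv_transition_left hu h0 (basisVec j))
    rw [coord_eq_sum (fderiv ℝ 𝓉 w.2.1 (basisVec j)), map_sum] at h1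
    simp only [map_smul, WithLp.ofLp_sum, WithLp.ofLp_smul, Finset.sum_apply, Pi.smul_apply,
      smul_eq_mul, basisVec_apply] at h1
    rw [Matrix.mul_apply, Matrix.one_apply, ← h1]
    exact sum_congr rfl fun k _ => mul_comm _ _
  have h1 : ∀ (A : Matrix ℐ ℐ ℝ) (v : ℰ),
      ∑ i, ∑ j, A i j * v i * v j = dotProduct v.ofLp (A.mulVec v.ofLp) := fun A v => by
    simp only [dotProduct, Matrix.mulVec, mul_sum]
    exact sum_congr rfl fun i _ => sum_congr rfl fun j _ => by ring
  have hJt : IsUnit J.transpose.det := by rwa [Matrix.det_transpose]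
  simp only [waveSymbol, h1, metricMatrix_transition hu h0]
  change _ = w.2.2.1 ^ 2 - dotProduct v'.ofLp ((metricMatrix g e' (𝓉 w.2.1))⁻¹.mulVec v')
  rw [hv, Matrix.mul_inv_rev, Matrix.mul_inv_rev, Matrix.mulVec_mulVec, Matrix.mul_assoc,
    Matrix.mul_assoc, Matrix.nonsing_inv_mul _ hJt, Matrix.mul_one, Matrix.mulVec_transpose,
    ← Matrix.dotProduct_mulVec, Matrix.mulVec_mulVec, ← Matrix.mul_assoc,
    Matrix.mul_nonsing_inv _ hJ, Matrix.one_mul]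


end EdgeChart

namespace EdgeCotangent

open EdgeChart

variable {w : EdgeCotangent fib}

theorem toCanonical_coords (he : w.pt ∈ e.source) (he' : w.pt ∈ e'.source)
    (h0 : 0 < e.coord w.pt 0) :
    toCanonical (coords e' w) = canonicalChange e e' (toCanonical (coords e w)) := by
  have hu : (coords e w).2.1 ∈ e.overlap e' := coord_mem_overlap he he'
  have hu' := transition_mem hu
  have h0' : 0 < 𝓉 (coords e w).2.1 0 := transition_pos hu h0
  rw [coords_change he he']
  refine Prod.ext rfl (Prod.ext rfl (Prod.ext ?_ ?_))
  · have h1 : 0 < (coords e w).2.1 0 := h0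
    simp only [changeCoords, toCanonical, ratioLim_interior hu' h0', transition_transition hu,
      transition_self hu.1, canonicalChange]
    field_simp
  · ext i
    simp only [changeCoords, toCanonical, canonicalChange, frameLim_interior hu' h0', frameChange,
      transition_transition hu, transition_self hu.1, Finset.sum_div]
    refine sum_congr rfl fun k _ => ?_
    have h1 := edgeScale_ne_zero (b := b) (f := f) (show (coords e w).2.1 0 ≠ 0 from h0.ne') k
    have h2 := edgeScale_ne_zero (b := b) (f := f) h0'.ne' i
    field_simp

/-- The bicharacteristic equation need only be checked in one adapted chart. -/
theorem bicharacteristic_of_chart {c : ℝ → EdgeCotangent fib} {s κ : ℝ} {S : Set ℝ} (hs : s ∈ S)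
    (hc : ContinuousOn c S) (he : (c s).pt ∈ e.source) (h0 : 0 < e.coord (c s).pt 0)
    (hP : DifferentiableAt ℝ (waveSymbol g e) (toCanonical (coords e (c s))))
    (hz : waveSymbol g e (toCanonical (coords e (c s))) = 0)
    (hd : HasDerivWithinAt (fun s' => toCanonical (coords e (c s')))
      (κ • hamiltonField (waveSymbol g e) (toCanonical (coords e (c s)))) S s)
    (he' : (c s).pt ∈ e'.source) :
    waveSymbol g e' (toCanonical (coords e' (c s))) = 0 ∧
      HasDerivWithinAt (fun s' => toCanonical (coords e' (c s')))
        (κ • hamiltonField (waveSymbol g e') (toCanonical (coords e' (c s)))) S s := by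
  have hu : (toCanonical (coords e (c s))).2.1 ∈ e.overlap e' := coord_mem_overlap he he'
  have hx : 0 < (toCanonical (coords e (c s))).2.1 0 := h0
  have hT := toCanonical_coords he he' h0
  rw [hT]
  refine ⟨(waveSymbol_canonicalChange hu hx).symm.trans hz, ?_⟩
  rw [hamiltonField_canonicalChange hu hx hP fun v hv hv0 => waveSymbol_canonicalChange hv hv0,
    ← map_smul]
  have hd' := (hasFDerivAt_canonicalChange hu hx).comp_hasDerivWithinAt s hd
  refine hd'.congr_of_eventuallyEq ?_ hT
  obtain ⟨h1, h1'⟩ := tendsto_coords he (hc s hs)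
  obtain ⟨h2, -⟩ := tendsto_coords he' (hc s hs)
  have hopen : IsOpen {v : ℙ | 0 < v.2.1 0} := isOpen_coordPos.preimage (by fun_prop)
  filter_upwards [h1, h2, h1'.eventually (hopen.mem_nhds h0)] with s' h h' h''
  exact toCanonical_coords h h' h''

end EdgeCotangent

/-! ### Normal charts -/

theorem contDiffOn_det {E n : Type*} [NormedAddCommGroup E] [NormedSpace ℝ E] [Fintype n]
    [DecidableEq n] {S : Set E} {A : E → Matrix n n ℝ}
    (hA : ∀ i j, SmoothOn (fun u => A u i j) S) : SmoothOn (fun u => (A u).det) S := by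
  simp only [Matrix.det_apply']
  exact ContDiffOn.sum fun σ _ => contDiffOn_const.mul (contDiffOn_prod fun i _ => hA _ _)

theorem contDiffOn_matrix_inv {E n : Type*} [NormedAddCommGroup E] [NormedSpace ℝ E] [Fintype n]
    [DecidableEq n] {S : Set E} {A : E → Matrix n n ℝ}
    (hA : ∀ i j, SmoothOn (fun u => A u i j) S) (hd : ∀ u ∈ S, (A u).det ≠ 0) (i j : n) :
    SmoothOn (fun u => (A u)⁻¹ i j) S := by
  simp only [Matrix.inv_def, Ring.inverse_eq_inv', Matrix.smul_apply, smul_eq_mul,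
    Matrix.adjugate_apply]
  refine ((contDiffOn_det hA).inv hd).mul (contDiffOn_det fun k l => ?_)
  by_cases h : k = j
  · subst h
    simp only [Matrix.updateRow_self]
    exact contDiffOn_const
  · simp only [Matrix.updateRow_ne h]
    exact hA k l

/-- The inverse of `γ`, symmetrized where `γ` is not symmetric. -/
noncomputable def normalCoeff (γ : ℰ → Matrix ℐ ℐ ℝ)
    (j k : ℐ) (u : ℰ) : ℝ := ((γ u)⁻¹ j k + (γ u)⁻¹ k j) / 2

theorem normalCoeff_eq {u : ℰ} (h : (γ u).IsSymm) (j k : ℐ) :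
    normalCoeff γ j k u = (γ u)⁻¹ j k := by
  have h1 : (γ u)⁻¹ k j = (γ u)⁻¹ j k := by
    conv_rhs => rw [← h.eq, ← Matrix.transpose_nonsing_inv]
    rfl
  rw [normalCoeff, h1, add_self_div_two]

namespace IsNormalChart

theorem isSymm_boundary (h : IsNormalChart g e γ) {u : ℰ} (hu : u ∈ e.target)
    (h0 : u 0 = 0) : (γ u).IsSymm := by
  have := (h.posDef u hu h0).isHermitian.eq
  rwa [Matrix.conjTranspose_eq_transpose_of_trivial] at this

theorem mul_projection (h : IsNormalChart g e γ) {u : ℰ} (hu : u ∈ e.target)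
    (h0 : u 0 = 0) : (γ u)⁻¹ * 𝒥 = 𝒥 * (γ u)⁻¹ := by
  have hd : IsUnit (γ u).det := (h.posDef u hu h0).det_pos.ne'.isUnit
  have h1 : γ u * 𝒥 = 𝒥 * γ u := by
    ext i j
    rw [Matrix.mul_diagonal, Matrix.diagonal_mul]
    have h2 := h.base_fibre u hu h0 i j
    have h3 := h.base_fibre u hu h0 j i
    rw [(h.isSymm_boundary hu h0).apply i j] at h3
    split_ifs with hj hi hi
    · ring
    · rw [h3 hj (not_le.1 hi)]; ring
    · rw [h2 hi (not_le.1 hj)]; ring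
    · ring
  have h2 := congrArg (fun A => (γ u)⁻¹ * A * (γ u)⁻¹) h1
  simp only [Matrix.mul_assoc, Matrix.mul_nonsing_inv _ hd, Matrix.mul_one] at h2
  rw [← Matrix.mul_assoc, Matrix.nonsing_inv_mul _ hd, Matrix.one_mul] at h2
  exact h2.symm

theorem inv_projection (h : IsNormalChart g e γ) {u u' : ℰ} (hu : u ∈ e.target)
    (hu' : u' ∈ e.target) (h0 : u 0 = 0) (h0' : u' 0 = 0)
    (huu : ∀ j : ℐ, j.val ≤ b → u j = u' j) :
    (γ u)⁻¹ * 𝒥 = (γ u')⁻¹ * 𝒥 := by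
  have hd : IsUnit (γ u).det := (h.posDef u hu h0).det_pos.ne'.isUnit
  have hd' : IsUnit (γ u').det := (h.posDef u' hu' h0').det_pos.ne'.isUnit
  have h1 : γ u * 𝒥 = γ u' * 𝒥 := by
    ext i j
    rw [Matrix.mul_diagonal, Matrix.mul_diagonal]
    split_ifs with hj
    · by_cases hi : i.val ≤ b
      · rw [h.base u hu u' hu' h0 h0' huu i j hi hj]
      · rw [← (h.isSymm_boundary hu h0).apply i j, ← (h.isSymm_boundary hu' h0').apply i j,
          h.base_fibre u hu h0 j i hj (not_le.1 hi), h.base_fibre u' hu' h0' j i hj (not_le.1 hi)]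
    · ring
  have h2 := congrArg (fun A => (γ u)⁻¹ * A * (γ u')⁻¹) h1
  simp only [Matrix.mul_assoc, ← h.mul_projection hu' h0'] at h2
  rw [← Matrix.mul_assoc, Matrix.nonsing_inv_mul _ hd, Matrix.one_mul,
    ← Matrix.mul_assoc (γ u'), Matrix.mul_nonsing_inv _ hd', Matrix.one_mul] at h2
  exact h2.symm

theorem inv_normal (h : IsNormalChart g e γ) {u : ℰ} (hu : u ∈ e.target)
    (h0 : u 0 = 0) (j : ℐ) : (γ u)⁻¹ j 0 = if j = 0 then 1 else 0 := by
  have hd : IsUnit (γ u).det := (h.posDef u hu h0).det_pos.ne'.isUnit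
  have h1 : (γ u).mulVec (Pi.single 0 1) = Pi.single 0 1 := by
    ext i
    rw [Matrix.mulVec_single_one, Matrix.col_apply, Pi.single_apply,
      ← (h.isSymm_boundary hu h0).apply i 0]
    split_ifs with hi
    · rw [hi]; exact (h.normal u hu h0).1
    · exact (h.normal u hu h0).2 i hi
  have h2 := congrArg (fun v => (γ u)⁻¹.mulVec v j) h1
  simp only [Matrix.mulVec_mulVec, Matrix.nonsing_inv_mul _ hd, Matrix.one_mulVec] at h2
  rw [Matrix.mulVec_single_one, Matrix.col_apply, Pi.single_apply] at h2
  exact h2.symm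

theorem isSymm (h : IsNormalChart g e γ) (hg : IsEdgeMetric fib g) {u : ℰ}
    (hu : u ∈ e.target) : (γ u).IsSymm := by
  rcases (EdgeChart.target_nonneg hu).eq_or_lt with h0 | h0
  · exact h.isSymm_boundary hu h0.symm
  have hp : e.symm u ∈ (ℳ).interior X :=
    (EdgeChart.mem_interior_iff (EdgeChart.symm_mem hu)).2 (by rwa [EdgeChart.coord_symm hu])
  refine Matrix.IsSymm.ext fun i j => ?_
  have h1 := h.eq_metric u hu h0 i j
  have h2 := h.eq_metric u hu h0 j i
  have h3 : metricMatrix g e u i j = metricMatrix g e u j i := hg.symm _ hp _ _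
  rw [h3, mul_comm (edgeScale (u 0) i), h2] at h1
  exact mul_left_cancel₀ (pow_ne_zero 2 h0.ne') h1

theorem waveSymbol_eq (h : IsNormalChart g e γ) (hg : IsEdgeMetric fib g) {w : ℙ}
    (hw : w.2.1 ∈ e.target) (h0 : 0 < w.2.1 0) :
    waveSymbol g e w = modelSymbol (normalCoeff γ) w := by
  set x := w.2.1 0
  set D : Matrix ℐ ℐ ℝ := Matrix.diagonal fun i => edgeScale x i / x
  have hD : ∀ i : ℐ, edgeScale x i / x ≠ 0 := fun i =>
    div_ne_zero (edgeScale_ne_zero h0.ne' i) h0.ne'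
  have hDu : IsUnit D.det := by
    rw [Matrix.det_diagonal]
    exact (Finset.prod_ne_zero_iff.2 fun i _ => hD i).isUnit
  have h1 : D * metricMatrix g e w.2.1 * D = γ w.2.1 := by
    ext i j
    rw [Matrix.mul_diagonal, Matrix.diagonal_mul]
    have := h.eq_metric w.2.1 hw h0 i j
    have hx : x ≠ 0 := h0.ne'
    field_simp
    linarith
  have h2 : (metricMatrix g e w.2.1)⁻¹ = D * (γ w.2.1)⁻¹ * D := by
    rw [← h1, Matrix.mul_inv_rev, Matrix.mul_inv_rev, ← Matrix.mul_assoc, ← Matrix.mul_assoc,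
      Matrix.mul_nonsing_inv _ hDu, Matrix.one_mul, Matrix.mul_assoc, Matrix.nonsing_inv_mul _ hDu,
      Matrix.mul_one]
  have h3 : ∀ i : ℐ, edgeScale x i / x = (if i.val ≤ b then 1 else x)⁻¹ := fun i => by
    simp only [edgeScale]
    split_ifs
    · rw [div_self h0.ne', inv_one]
    · rw [one_div]
  rw [waveSymbol, modelSymbol, h2]
  congr 1
  refine sum_congr rfl fun i _ => sum_congr rfl fun j _ => ?_
  rw [Matrix.mul_diagonal, Matrix.diagonal_mul, h3, h3, normalCoeff_eq (h.isSymm hg hw)]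
  ring

theorem exists_isNormalCoeff (h : IsNormalChart g e γ) {u₀ : ℰ}
    (hu₀ : u₀ ∈ e.target) (h0 : u₀ 0 = 0) : ∃ ε, IsNormalCoeff (normalCoeff γ) u₀ ε ∧
      ball u₀ ε ∩ ℍ ⊆ e.target := by
  obtain ⟨O, hO, hOe⟩ := e.exists_isOpen_target
  have hdet : ContinuousOn (fun u => (γ u).det) e.target := (contDiffOn_det h.smooth).continuousOn
  have hne := hdet u₀ hu₀ (isOpen_ne.mem_nhds (h.posDef u₀ hu₀ h0).det_pos.ne')
  obtain ⟨O', hO', hu', hsub'⟩ := mem_nhdsWithin.1 hne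
  rw [hOe] at hu₀
  obtain ⟨ε, hε, hball⟩ := Metric.isOpen_iff.1 (hO.inter hO') u₀ ⟨hu₀.1, hu'⟩
  have hsub : ball u₀ ε ∩ ℍ ⊆ e.target := fun u hu => by rw [hOe]; exact ⟨(hball hu.1).1, hu.2⟩
  have hmem : ∀ u ∈ ball u₀ ε, u 0 = 0 → u ∈ e.target := fun u hu hu0 => hsub ⟨hu, hu0.ge⟩
  refine ⟨ε, ⟨hε, h0, fun j k => ?_, fun j k u => ?_, fun u hu hu0 j k hj hk => ?_,
    fun u hu u' hu' hu0 hu0' huu j k hj hk => ?_⟩, hsub⟩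
  · have hinv := contDiffOn_matrix_inv (S := ball u₀ ε ∩ ℍ)
      (fun i j => (h.smooth i j).mono hsub) fun u hu => hsub' ⟨(hball hu.1).2, hsub hu⟩
    exact ((hinv j k).add (hinv k j)).div_const 2
  · rw [normalCoeff, normalCoeff, add_comm]
  · rw [normalCoeff_eq (h.isSymm_boundary (hmem u hu hu0) hu0)]
    have := congrFun (congrFun (h.mul_projection (hmem u hu hu0) hu0) j) k
    rw [Matrix.mul_diagonal, Matrix.diagonal_mul, if_neg (not_le.2 hk), if_pos hj] at this
    simpa using this.symm
  · rw [normalCoeff_eq (h.isSymm_boundary (hmem u hu hu0) hu0),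
      normalCoeff_eq (h.isSymm_boundary (hmem u' hu' hu0') hu0')]
    have := congrFun (congrFun (h.inv_projection (hmem u hu hu0) (hmem u' hu' hu0') hu0 hu0' huu)
      j) k
    rw [Matrix.mul_diagonal, Matrix.mul_diagonal, if_pos hk] at this
    simpa using this

theorem raise_normalCoeff (h : IsNormalChart g e γ) {u : ℰ} (hu : u ∈ e.target)
    (h0 : u 0 = 0) (v : ℰ) : raise (normalCoeff γ) 0 u v = v 0 := by
  rw [raise, sum_eq_single 0]
  · rw [normalCoeff_eq (h.isSymm_boundary hu h0), h.inv_normal hu h0, if_pos rfl, one_mul]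
  · intro j _ hj
    rw [show normalCoeff γ 0 j u = normalCoeff γ j 0 u by
      rw [normalCoeff, normalCoeff, add_comm], normalCoeff_eq (h.isSymm_boundary hu h0),
      h.inv_normal hu h0, if_neg hj, zero_mul]
  · simp

end IsNormalChart

/-! ### The flowout near a radial point -/

open EdgeCotangent EdgeChart

/-- A ball in a normal chart in which both the description of the bicharacteristics by the singular
flow and the decay of the defect are available. -/
structure IsNormalBox (g : 𝒯) (e : EdgeChart fib) (γ : ℰ → Matrix ℐ ℐ ℝ) (u₀ : ℰ) (ε : ℝ)
    (p₀ : ℋ) (K Φ Ξ : ℋ → ℋ) (Z : ℋ → ℰ)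
    (r δ η θ : ℝ) : Prop where
  metric : IsEdgeMetric fib g
  normal : IsNormalChart g e γ
  subset : ball u₀ ε ∩ ℍ ⊆ e.target
  graph : IsHatGraph (normalCoeff γ) u₀ ε p₀ K Φ Ξ Z r δ η
  decay : IsDecayBall (normalCoeff γ) u₀ ε p₀ Z θ
  le_graph : θ ≤ η
  le_flow : θ ≤ r

/-- The edge covectors over `e` whose quotients by the time component lie in a ball. -/
def hatCone (p₀ : ℋ) (θ : ℝ) : Set ℙ := {w | w.2.2.1 ≠ 0 ∧ hatEdge w ∈ ball p₀ θ}

/-- The common zero set of the defining functions. -/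
def zeroSet (e : EdgeChart fib) (γ : ℰ → Matrix ℐ ℐ ℝ) (p₀ : ℋ) (Z : ℋ → ℰ) (θ : ℝ) : 𝒮 :=
  {w | w ∈ patch e (hatCone p₀ θ) ∧ ∀ i, edgeDef (normalCoeff γ) Z i (coords e w) = 0}

theorem continuousAt_hatEdge {w : ℙ} (hw : w.2.2.1 ≠ 0) : ContinuousAt hatEdge w :=
  contDiffOn_hatEdge.continuousOn.continuousAt
    ((isOpen_ne_fun (by fun_prop) continuous_const).mem_nhds hw)

theorem isOpen_preimage_hatEdge {S : Set ℋ} (hS : IsOpen S) :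
    IsOpen {w : ℙ | w.2.2.1 ≠ 0 ∧ hatEdge w ∈ S} :=
  contDiffOn_hatEdge.continuousOn.isOpen_inter_preimage
    (isOpen_ne_fun (by fun_prop) continuous_const) hS

theorem isOpen_hatCone : IsOpen (hatCone p₀ θ) := isOpen_preimage_hatEdge isOpen_ball

theorem hatEdge_dilate {c : ℝ} (hc : c ≠ 0) (w : EdgeCotangent fib) :
    hatEdge (coords e (dilate c w)) = hatEdge (coords e w) := by
  change ((_, _, (c * (w.comp e).1)⁻¹ • (c • (w.comp e).2)) : ℋ) = (_, _, _)
  rw [mul_inv, smul_smul, mul_right_comm, inv_mul_cancel₀ hc, one_mul]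
  rfl

theorem mem_hatCone_dilate {c : ℝ} (hc : 0 < c) {w : EdgeCotangent fib}
    (hw : coords e w ∈ hatCone p₀ θ) : coords e (dilate c w) ∈ hatCone p₀ θ :=
  ⟨mul_ne_zero hc.ne' hw.1, by rw [hatEdge_dilate hc.ne']; exact hw.2⟩

theorem isConic_patch_hatCone : IsConic (patch e (hatCone p₀ θ)) := fun _ hc _ hw =>
  ⟨hw.1, mem_hatCone_dilate hc hw.2⟩

theorem isConic_zeroSet : IsConic (zeroSet e γ p₀ Z θ) := fun c hc w hw =>
  ⟨isConic_patch_hatCone c hc w hw.1, fun i => by rw [edgeDef, hatEdge_dilate hc.ne']; exact hw.2 i⟩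

theorem IsDecayBall.pos_mem {Γ : ℐ → ℐ → ℰ → ℝ}
    (h : IsDecayBall Γ u₀ ε p₀ Z θ) {w : ℙ} (hw : w ∈ hatCone p₀ θ) :
    w.2.1 ∈ ball u₀ ε := by
  have h1 : (hatEdge w).2.1 ∈ ball u₀ ε := h.mem_ball _ hw.2
  exact h1

theorem IsDecayBall.raise_ne {Γ : ℐ → ℐ → ℰ → ℝ}
    (h : IsDecayBall Γ u₀ ε p₀ Z θ) {w : ℙ} (hw : w ∈ hatCone p₀ θ) (hx : w.2.1 0 = 0) :
    raise Γ 0 w.2.1 (hatEdge w).2.2 ≠ 0 := fun h0 => by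
  have h1 : 0 < raise Γ 0 u₀ p₀.2.2 * raise Γ 0 (hatEdge w).2.1 (hatEdge w).2.2 :=
    h.raise_pos _ hw.2 hx.ge
  rw [show (hatEdge w).2.1 = w.2.1 from rfl, h0, mul_zero] at h1
  exact lt_irrefl _ h1

theorem continuousAt_pt {w : EdgeCotangent fib} (hw : w.pt ∈ e.source) :
    ContinuousAt EdgeCotangent.pt w := by
  obtain ⟨h1, h2⟩ := tendsto_coords hw (tendsto_id : Tendsto id (𝓝 w) (𝓝 w))
  have h3 : Tendsto (fun v : EdgeCotangent fib => e.coord v.pt) (𝓝 w) (𝓝[e.target] e.coord w.pt) :=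
    tendsto_nhdsWithin_iff.2 ⟨h2.snd_nhds.fst_nhds, h1.mono fun v hv => coord_mem hv⟩
  have h4 := (e.continuousOn_symm _ (coord_mem hw)).tendsto.comp h3
  rw [symm_coord hw] at h4
  exact h4.congr' (h1.mono fun v hv => symm_coord hv)

namespace IsNormalBox

variable (h : IsNormalBox g e γ u₀ ε p₀ K Φ Ξ Z r δ η θ)
include h

theorem mem_region {w : EdgeCotangent fib} (hw : w ∈ patch e (hatCone p₀ θ)) :
    coords e w ∈ phaseHalfSpace b f ∩ edgeRegion u₀ ε :=
  ⟨target_nonneg (coords_mem hw.1), h.decay.pos_mem hw.2, hw.2.1⟩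

theorem mem_zeroSet {w : EdgeCotangent fib} (hw : w ∈ patch e (hatCone p₀ θ)) :
    w ∈ zeroSet e γ p₀ Z θ ↔ quad (normalCoeff γ) (coords e w).2.1 (hatEdge (coords e w)).2.2 = 1 ∧
      defect Z (hatEdge (coords e w)) = 0 :=
  ⟨fun hz => h.graph.forall_hatDef_eq_zero.1 hz.2,
    fun hz => ⟨hw, h.graph.forall_hatDef_eq_zero.2 hz⟩⟩

theorem isOpen_diff : IsOpen (patch e (hatCone p₀ θ) \ zeroSet e γ p₀ Z θ) := by
  have hc : ∀ i, ContinuousOn (edgeDef (normalCoeff γ) Z i)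
      (phaseHalfSpace b f ∩ edgeRegion u₀ ε) :=
    fun i => (h.graph.contDiffOn_edgeDef i).continuousOn
  refine isOpen_iff_mem_nhds.2 fun w hw => ?_
  obtain ⟨i, hi⟩ : ∃ i, edgeDef (normalCoeff γ) Z i (coords e w) ≠ 0 := by
    by_contra! hcon
    exact hw.2 ⟨hw.1, hcon⟩
  have hG := (isOpen_patch e (isOpen_hatCone (p₀ := p₀) (θ := θ))).mem_nhds hw.1
  obtain ⟨-, h2⟩ := tendsto_coords hw.1.1 (tendsto_id : Tendsto id (𝓝 w) (𝓝 w))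
  have h3 := tendsto_nhdsWithin_iff.2 ⟨h2, (show ∀ᶠ v in 𝓝 w, coords e (id v) ∈ _ from by
    filter_upwards [hG] with v hv using h.mem_region hv)⟩
  filter_upwards [hG, ((hc i _ (h.mem_region hw.1)).tendsto.comp h3).eventually_ne hi] with v hv hv'
  exact ⟨hv, fun hz => hv' (hz.2 i)⟩

theorem isCoisotropicSubmanifold_zeroSet :
    IsCoisotropicSubmanifold (f + 1) (zeroSet e γ p₀ Z θ) := fun w₀ hw₀ => by
  have hpos : ∀ w ∈ zeroSet e γ p₀ Z θ, w.pt ∈ (ℳ).interior X →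
      0 < (coords e w).2.1 0 := fun w hw hp => (mem_interior_iff hw.1.1).1 hp
  have hzero : ∀ w ∈ zeroSet e γ p₀ Z θ, w.pt ∈ (ℳ).boundary X →
      (coords e w).2.1 0 = 0 := fun w hw hp => (mem_boundary_iff hw.1.1).1 hp
  have hint : ∀ w ∈ zeroSet e γ p₀ Z θ, ∀ hx : 0 < (coords e w).2.1 0, _ := fun w hw hx =>
    h.graph.coisotropic_interior hx (h.mem_region hw.1).2
      (ball_subset_ball h.le_graph hw.1.2.2) hw.2
  have htrans : ∀ w ∈ zeroSet e γ p₀ Z θ, (coords e w).2.1 0 = 0 →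
      ∀ (a : Fin (f + 1) → ℝ) (a₀ : ℝ), (∀ δ : ℙ,
        ∑ i, a i * edgeDeriv (edgeDef (normalCoeff γ) Z i) (coords e w) δ + a₀ * δ.2.1 0 = 0) →
      (∀ i, a i = 0) ∧ a₀ = 0 := fun w hw hx a a₀ ha =>
    h.graph.transversal hx (h.mem_region hw.1).2 (h.decay.raise_ne hw.1.2 hx) ha
  refine ⟨e, hatCone p₀ θ, edgeDef (normalCoeff γ) Z, hw₀.1.1, isOpen_hatCone, hw₀.1.2,
    ⟨fun i => ?_, fun w hw hN => ⟨fun hz => hz.2, fun hz => ⟨⟨hw, hN⟩, hz⟩⟩, fun w hw _ _ => ?_,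
      fun w hw _ _ hp => htrans w hw (hzero w hw hp)⟩, fun w hw _ _ => ⟨fun i j => ?_, fun hp =>
      (hint w hw (hpos w hw hp)).2.1⟩⟩
  · exact (h.graph.contDiffOn_edgeDef i).mono fun v hv =>
      ⟨target_nonneg hv.2, h.decay.pos_mem hv.1, hv.1.1⟩
  · rcases (target_nonneg (coords_mem hw.1.1)).eq_or_lt with hx | hx
    · refine Fintype.linearIndependent_iff.2 fun a ha => (htrans w hw hx.symm a 0 fun δ => ?_).1
      have := congrArg (fun A : ℙ →L[ℝ] ℝ => A δ) ha
      simpa [sum_apply] using this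
    · exact (hint w hw hx).2.2
  · rcases (target_nonneg (coords_mem hw.1.1)).eq_or_lt with hx | hx
    · exact h.graph.bracket_boundary hx.symm (h.mem_region hw.1).2
        (ball_subset_ball h.le_graph hw.1.2.2) (ball_subset_ball h.le_flow hw.1.2.2)
        hw.2 i j
    · exact (hint w hw hx).1 i j

theorem mem_radialSet {w : EdgeCotangent fib} (hw : w ∈ zeroSet e γ p₀ Z θ)
    (hb : w.pt ∈ (ℳ).boundary X) : w ∈ ℛ := by
  have hx : (coords e w).2.1 0 = 0 := (mem_boundary_iff hw.1.1).1 hb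
  have ht := coords_mem hw.1.1
  obtain ⟨hq, hd⟩ := (h.mem_zeroSet hw.1).1 hw
  have hτ : (w.comp e).1 ≠ 0 := hw.1.2.1
  have hN : ∀ i, (w.comp e).2 i = (w.comp e).1 * (hatEdge (coords e w)).2.2 i := fun i => by
    change _ = (w.comp e).1 * ((w.comp e).1⁻¹ * (w.comp e).2 i)
    rw [mul_inv_cancel_left₀ hτ]
  have hf : ∀ k : ℐ, b < k.val → (w.comp e).2 k = 0 := fun k hk => by
    rw [defect, h.graph.zero_Z _ hx, sub_zero] at hd
    have := congrArg (fun v : ℰ => v k) hd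
    rw [fibreProj_apply, if_neg (not_le.2 hk)] at this
    rw [hN, this]; simp
  have hq' : (w.comp e).1 ^ 2 =
      ∑ i, ∑ j, (γ (e.coord w.pt))⁻¹ i j * (w.comp e).2 i * (w.comp e).2 j := by
    have h1 : ∀ i j, (γ (e.coord w.pt))⁻¹ i j = normalCoeff γ i j (coords e w).2.1 := fun i j =>
      (normalCoeff_eq (h.normal.isSymm_boundary ht hx) i j).symm
    simp only [h1, hN]
    rw [← mul_one ((w.comp e).1 ^ 2), ← hq, quad, mul_sum]
    refine sum_congr rfl fun i _ => ?_
    rw [raise, mul_sum, mul_sum]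
    exact sum_congr rfl fun j _ => by ring
  have hξ : (w.comp e).2 0 * (w.comp e).1 ≠ 0 := by
    have h1 := h.decay.raise_ne hw.1.2 hx
    rw [h.normal.raise_normalCoeff ht hx] at h1
    rw [hN]
    exact mul_ne_zero (mul_ne_zero hτ h1) hτ
  rcases hξ.lt_or_gt with h1 | h1
  · exact Or.inr ⟨hb, e, γ, hw.1.1, h.normal, hf, hq', by linarith⟩
  · exact Or.inl ⟨hb, e, γ, hw.1.1, h.normal, hf, hq', by linarith⟩

theorem waveSymbol_eventuallyEq {w : ℙ} (hw : w.2.1 ∈ ball u₀ ε)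
    (hx : 0 < w.2.1 0) : waveSymbol g e =ᶠ[𝓝 w] modelSymbol (normalCoeff γ) := by
  have hc : Continuous fun w : ℙ => w.2.1 := by fun_prop
  filter_upwards [((Metric.isOpen_ball.inter isOpen_coordPos).preimage hc).mem_nhds ⟨hw, hx⟩]
    with v hv
  have hv0 : 0 < v.2.1 0 := hv.2
  exact h.normal.waveSymbol_eq h.metric (h.subset ⟨hv.1, hv0.le⟩) hv0

theorem hamiltonField_eq {w : ℙ} (hw : w.2.1 ∈ ball u₀ ε)
    (hx : 0 < w.2.1 0) : hamiltonField (waveSymbol g e) w =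
      hamiltonField (modelSymbol (normalCoeff γ)) w := by
  simp only [hamiltonField, (h.waveSymbol_eventuallyEq hw hx).fderiv_eq]

/-- The equation of the bicharacteristics in the quotients of the components by the time
component. -/
theorem exists_hatField {U : 𝒮} {κ : ℝ} {c : ℝ → EdgeCotangent fib}
    (hc : IsBicharacteristic g U κ c) {S : Set ℝ} (hS : S ⊆ Ioc 0 1) (hconv : Convex ℝ S)
    (hG : ∀ s ∈ S, c s ∈ patch e (hatCone p₀ θ)) :
    (∀ s ∈ S, quad (normalCoeff γ) (coords e (c s)).2.1 (hatEdge (coords e (c s))).2.2 = 1 ∧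
      0 < (hatEdge (coords e (c s))).2.1 0) ∧
    ∃ k : ℝ, ∀ s ∈ S, HasDerivWithinAt (fun s => hatEdge (coords e (c s)))
      ((k / (hatEdge (coords e (c s))).2.1 0) • hatField (normalCoeff γ) (hatEdge (coords e (c s))))
      S s := by
  set C : ℝ → ℙ := fun s => toCanonical (coords e (c s)) with hC
  have hx : ∀ s ∈ S, 0 < (C s).2.1 0 := fun s hs =>
    (mem_interior_iff (hG s hs).1).1 (hc.2 s (hS hs)).2.1
  have hu : ∀ s ∈ S, (C s).2.1 ∈ ball u₀ ε := fun s hs => (h.mem_region (hG s hs)).2.1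
  have hY : ∀ s ∈ S, hatOf (C s) = hatEdge (coords e (c s)) := fun s hs =>
    hatOf_toCanonical (hx s hs).ne'
  have hτ : ∀ s ∈ S, (C s).2.2.1 ≠ 0 := fun s hs => div_ne_zero (hG s hs).2.1 (hx s hs).ne'
  have hd : ∀ s ∈ S,
      HasDerivWithinAt C (κ • hamiltonField (modelSymbol (normalCoeff γ)) (C s)) S s :=
    fun s hs => by
      rw [← h.hamiltonField_eq (hu s hs) (hx s hs)]
      exact ((hc.2 s (hS hs)).2.2 e (hG s hs).1).2.mono hS
  have hquad : ∀ s ∈ S, quad (normalCoeff γ) (C s).2.1 (hatOf (C s)).2.2 = 1 := fun s hs => by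
    have h1 := ((hc.2 s (hS hs)).2.2 e (hG s hs).1).1
    rw [(h.waveSymbol_eventuallyEq (hu s hs) (hx s hs)).eq_of_nhds,
      ← canonLift_hatOf (hτ s hs) (hx s hs).ne', modelSymbol_canonLift (hx s hs).ne'] at h1
    have h2 := (mul_eq_zero.1 h1).resolve_left (pow_ne_zero 2 (hτ s hs))
    exact (sub_eq_zero.1 h2).symm
  have hconst : ∀ s ∈ S, ∀ s' ∈ S, (C s').2.2.1 = (C s).2.2.1 := fun s hs s' hs' => by
    have h1 : ∀ s ∈ S, HasDerivWithinAt (fun s => (C s).2.2.1) 0 S s := fun s hs => by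
      have h2 : HasDerivWithinAt (fun s => (C s).2.2.1)
        (κ • hamiltonField (modelSymbol (normalCoeff γ)) (C s)).2.2.1 S s := (hd s hs).snd.snd.fst
      have h3 := h.graph.coeff.hamiltonField_modelSymbol (τ := (C s).2.2.1) (Y := hatOf (C s))
        (hu s hs) (hx s hs)
      rw [canonLift_hatOf (hτ s hs) (hx s hs).ne'] at h3
      rw [h3] at h2
      simpa [modelField] using h2
    have h4 := hconv.norm_image_sub_le_of_norm_hasDerivWithin_le h1 (C := 0)
      (fun _ _ => norm_zero.le) hs hs'
    rw [zero_mul] at h4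
    exact sub_eq_zero.1 (norm_le_zero_iff.1 h4)
  refine ⟨fun s hs => ⟨by rw [← hY s hs]; exact hquad s hs, hx s hs⟩, ?_⟩
  obtain rfl | ⟨s₀, hs₀⟩ := S.eq_empty_or_nonempty
  · exact ⟨0, fun s hs => hs.elim⟩
  refine ⟨κ * (C s₀).2.2.1, fun s hs => ?_⟩
  have h1 := h.graph.coeff.hasDerivWithinAt_hatOf (hu s hs) (hx s hs) (hτ s hs) (hd s hs)
  rw [hconst s₀ hs₀ s hs, hY s hs] at h1
  exact h1.congr (fun s' hs' => (hY s' hs').symm) (hY s hs).symm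

theorem mem_zeroSet_of_tendsto {U : 𝒮} {κ s₂ : ℝ} {c : ℝ → EdgeCotangent fib}
    {l : ℝ → ℝ} {w : EdgeCotangent fib} (hc : IsBicharacteristic g U κ c) (h2 : s₂ ≤ 1)
    (hG : ∀ s ∈ Ioc 0 s₂, c s ∈ patch e (hatCone p₀ θ))
    (hl : Tendsto (fun s => dilate (l s) (c s)) (𝓝[>] 0) (𝓝 w)) (hw : w.pt ∈ e.source)
    (hb : w.pt ∈ (ℳ).boundary X) : ∀ s ∈ Ioc 0 s₂, c s ∈ zeroSet e γ p₀ Z θ := by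
  obtain ⟨h3, k, h4⟩ := h.exists_hatField hc (Set.Ioc_subset_Ioc_right h2) (convex_Ioc _ _) hG
  have hlim : Tendsto (fun s => (hatEdge (coords e (c s))).2.1 0) (𝓝[>] 0) (𝓝 0) := by
    have h5 := (tendsto_coords hw hl).2.snd_nhds.fst_nhds
    have h6 := ((𝓍).continuous.tendsto _).comp h5
    have h7 : xCoord (coords e w).2.1 = 0 := (mem_boundary_iff hw).1 hb
    rw [h7] at h6
    exact h6
  intro s hs
  exact (h.mem_zeroSet (hG s hs)).2 ⟨(h3 s hs).1, h.graph.defect_eq_zero_of_tendsto h.decay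
    (fun s hs => ⟨(hG s hs).2.2, (h3 s hs).2⟩) h4 hlim s hs⟩

theorem mem_zeroSet_of_left {U : 𝒮} {κ s₁ s₂ : ℝ} {c : ℝ → EdgeCotangent fib}
    (hc : IsBicharacteristic g U κ c) (h1 : 0 < s₁) (h2 : s₂ ≤ 1)
    (hG : ∀ s ∈ Icc s₁ s₂, c s ∈ patch e (hatCone p₀ θ)) (hs₁ : c s₁ ∈ zeroSet e γ p₀ Z θ) :
    ∀ s ∈ Icc s₁ s₂, c s ∈ zeroSet e γ p₀ Z θ := by
  obtain ⟨h3, k, h4⟩ := h.exists_hatField hc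
    (fun s hs => ⟨h1.trans_le hs.1, hs.2.trans h2⟩) (convex_Icc _ _) hG
  intro s hs
  exact (h.mem_zeroSet (hG s hs)).2 ⟨(h3 s hs).1, h.graph.defect_eq_zero_of_left h.decay
    (fun s hs => ⟨(hG s hs).2.2, (h3 s hs).2⟩) h4 ((h.mem_zeroSet hs₁.1).1 hs₁).2 s hs⟩

end IsNormalBox

/-- The time component of a radial point does not vanish, in any chart. -/
theorem time_ne_zero_of_mem_radialSet {w : EdgeCotangent fib} {σ : ℝ} (hw : w ∈ radialSet g σ)
    (he : w.pt ∈ e.source) : (coords e w).2.2.1 ≠ 0 := by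
  obtain ⟨-, e', γ, he', -, -, -, hpos⟩ := hw
  intro h0
  have h1 := congrArg (fun v : ℙ => v.2.2.1) (coords_change he he')
  simp only [changeCoords, h0, mul_zero] at h1
  have h2 : (w.comp e').1 = 0 := h1
  rw [h2, mul_zero, mul_zero] at hpos
  exact lt_irrefl _ hpos

theorem IsNormalBox.closure_subset [T2Space X] (h : IsNormalBox g e γ u₀ ε p₀ K Φ Ξ Z r δ η θ)
    {θ' : ℝ} (hθ : θ' < θ) {w : EdgeCotangent fib}
    (hw : w ∈ closure (patch e (hatCone p₀ θ'))) {σ : ℝ} (hr : w ∈ radialSet g σ) :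
    w ∈ patch e (hatCone p₀ θ) := by
  obtain ⟨-, e', -, he', -⟩ := id hr
  have hball : ∀ {u : ℰ}, u ∈ closedBall u₀ θ' → 0 ≤ u 0 → u ∈ e.target := fun {u} hu hu0 => by
    have h1 := h.decay.mem_ball (p₀ + (0, u - u₀, 0)) (by
      rw [mem_ball_iff_norm, add_sub_cancel_left, Prod.norm_def, Prod.norm_def]
      simp only [norm_zero]
      rw [mem_closedBall_iff_norm] at hu
      simpa [h.decay.pos] using hu.trans_lt hθ)
    rw [show (p₀ + (0, u - u₀, 0) : ℋ).2.1 = u by simp [h.graph.center]] at h1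
    exact h.subset ⟨h1, hu0⟩
  set S : Set ℰ := closedBall u₀ θ' ∩ ℍ with hS
  have hSc : IsCompact S := (isCompact_closedBall _ _).inter_right
    (isClosed_le continuous_const (𝓍).continuous)
  have hcl : IsClosed (e.symm '' S) :=
    (hSc.image_of_continuousOn (e.continuousOn_symm.mono fun u hu => hball hu.1 hu.2)).isClosed
  have hpt : w.pt ∈ e.symm '' S := by
    rw [← hcl.closure_eq]
    refine mem_closure_of_frequently_of_tendsto ?_ (continuousAt_pt he').tendsto
    refine (mem_closure_iff_frequently.1 hw).mono fun v hv => ?_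
    refine ⟨e.coord v.pt, ⟨?_, target_nonneg (coord_mem hv.1)⟩, symm_coord hv.1⟩
    have h1 := mem_ball_iff_norm.1 hv.2.2
    rw [mem_closedBall_iff_norm, ← h.graph.center]
    exact ((norm_fst_le (hatEdge (coords e v) - p₀).2).trans (norm_snd_le _)).trans h1.le
  have he : w.pt ∈ e.source := by
    obtain ⟨u, hu, hu'⟩ := hpt
    rw [← hu']; exact symm_mem (hball hu.1 hu.2)
  have hτ := time_ne_zero_of_mem_radialSet hr he
  refine ⟨he, hτ, Metric.closedBall_subset_ball hθ ?_⟩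
  rw [← Metric.isClosed_closedBall.closure_eq]
  obtain ⟨-, h2⟩ := tendsto_coords he (tendsto_id : Tendsto id (𝓝 w) (𝓝 w))
  refine mem_closure_of_frequently_of_tendsto ?_ ((continuousAt_hatEdge hτ).tendsto.comp h2)
  exact (mem_closure_iff_frequently.1 hw).mono fun v hv => Metric.ball_subset_closedBall hv.2.2

/-! ### Neighbourhoods of radial points that are swept out by rays -/

open EdgeCotangent EdgeChart

theorem hatBase_add_smul {q : ℋ} (hx : q.2.1 0 = 0) (hP : fibreProj q.2.2 = 0) (σ : ℝ) :
    hatBase (q + σ • hatVec) = q := by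
  have ht : (q + σ • (hatVec : ℋ)).2.1 0 = σ := by simp [hatVec, basisVec_apply, hx]
  have h1 := hatBase_add (q + σ • (hatVec : ℋ))
  rw [ht, hatProj_apply, show fibreProj (q + σ • (hatVec : ℋ)).2.2 = 0 by simp [hatVec, hP]] at h1
  exact add_right_cancel (h1.trans (sub_zero _))

theorem time_add_smul {q : ℋ} (hx : q.2.1 0 = 0) (σ : ℝ) :
    (q + σ • (hatVec : ℋ)).2.1 0 = σ := by simp [hatVec, basisVec_apply, hx]

theorem dilate_ofCoords [IsManifold ℳ ∞ X] {w : ℙ} (hw : w.2.1 ∈ e.target)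
    (c : ℝ) : coords e (dilate c (ofCoords e w)) = (w.1, w.2.1, c • w.2.2) := by
  exact congrArg (fun v : ℙ => ((v.1, v.2.1, c • v.2.2) : ℙ)) (coords_ofCoords hw)

namespace IsNormalBox

variable (h : IsNormalBox g e γ u₀ ε p₀ K Φ Ξ Z r δ η θ)
include h

theorem blowDown_target {q : ℋ} (hq : q ∈ ball p₀ r) : (blowDown (Φ q)).2.1 ∈ e.target := by
  have h1 := h.graph.blowDown_mem hq
  exact h.subset ⟨h1.2, h1.1⟩

theorem blowDown_base {q : ℋ} (hq : q ∈ ball p₀ r) (hx : q.2.1 0 = 0)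
    (hP : fibreProj q.2.2 = 0) : blowDown (Φ q) = q := by
  rw [h.graph.initial q hq hx (by rw [hatProj_apply, hP]; rfl), blowDown_of_boundary hx hP]

/-- The bicharacteristic of the flow box that ends at the boundary point with parameter `q`. -/
theorem exists_bicharacteristic {q : ℋ} (hx : q.2.1 0 = 0) (hP : fibreProj q.2.2 = 0)
    (hquad : quad (normalCoeff γ) q.2.1 q.2.2 = 1) {m τ : ℝ} (hm : 0 < m) (hτ : τ ≠ 0)
    (hball : ∀ σ ∈ Icc 0 m, q + σ • hatVec ∈ ball p₀ r) {N : 𝒮}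
    (hN : ∀ σ ∈ Icc 0 m, 0 < σ →
      ofCoords e (edgeLift (τ * σ ^ 2) (blowDown (Φ (q + σ • hatVec)))) ∈ N) :
    ∃ (κ : ℝ) (c : ℝ → EdgeCotangent fib) (l : ℝ → ℝ), IsBicharacteristic g N κ c ∧
      c 1 = ofCoords e (edgeLift (τ * m ^ 2) (blowDown (Φ (q + m • hatVec)))) ∧ (∀ s, 0 < l s) ∧
      Tendsto (fun s => dilate (l s) (c s)) (𝓝[>] 0) (𝓝 (ofCoords e (edgeLift τ q))) := by
  obtain ⟨κ, k, hk1, hk, hk0, hd⟩ := h.graph.exists_ray hx hm hball hτ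
  set V : ℝ → ℋ := fun σ => blowDown (Φ (q + σ • hatVec)) with hV
  have hVt : ∀ σ ∈ Icc 0 m, (V σ).2.1 ∈ e.target := fun σ hσ => h.blowDown_target (hball σ hσ)
  have hVu : ∀ σ ∈ Icc 0 m, (V σ).2.1 ∈ ball u₀ ε := fun σ hσ =>
    (h.graph.blowDown_mem (hball σ hσ)).2
  have hVx : ∀ σ ∈ Icc 0 m, (V σ).2.1 0 = σ ^ 2 := fun σ hσ => by
    rw [hV, blowDown_time, h.graph.time_eq (hball σ hσ), time_add_smul hx]
  have hVq : ∀ σ ∈ Icc 0 m, quad (normalCoeff γ) (V σ).2.1 (V σ).2.2 = 1 := fun σ hσ => by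
    rw [hV, h.graph.quad_blowDown (hball σ hσ)
      (by rw [time_add_smul hx]; exact hσ.1), hatBase_add_smul hx hP, hquad]
  have hV0 : V 0 = q := by
    have h1 := hball 0 ⟨le_rfl, hm.le⟩
    simp only [hV]
    rw [zero_smul, add_zero] at h1 ⊢
    exact h.blowDown_base h1 hx hP
  have hVc : ContinuousOn V (Icc 0 m) :=
    contDiff_blowDown.continuous.comp_continuousOn (h.graph.smooth.continuousOn.comp
      (by fun_prop) hball)
  let c : ℝ → EdgeCotangent fib := fun s => ofCoords e (edgeLift (τ * k s ^ 2) (V (k s)))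
  have hks : ∀ s ∈ Ioc (0 : ℝ) 1, k s ∈ Icc 0 m := fun s hs => ⟨(hk s hs).1.le, (hk s hs).2⟩
  have hcs : ∀ s ∈ Ioc (0 : ℝ) 1, (c s).pt ∈ e.source ∧
      coords e (c s) = edgeLift (τ * k s ^ 2) (V (k s)) := fun s hs =>
    ⟨ofCoords_pt (hVt _ (hks s hs)), coords_ofCoords (hVt _ (hks s hs))⟩
  have hxs : ∀ s ∈ Ioc (0 : ℝ) 1, 0 < (V (k s)).2.1 0 := fun s hs => by
    rw [hVx _ (hks s hs)]; exact pow_pos (hk s hs).1 2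
  have hcan : ∀ s ∈ Ioc (0 : ℝ) 1, toCanonical (coords e (c s)) = canonLift τ (V (k s)) :=
    fun s hs => by
      rw [(hcs s hs).2, toCanonical_edgeLift (hxs s hs).ne', hVx _ (hks s hs),
        mul_div_cancel_right₀ _ (pow_ne_zero 2 (hk s hs).1.ne')]
  have hVcont : ContinuousOn (fun s => V (k s)) (Ioc 0 1) := fun s hs => by
    have h1 : ContinuousWithinAt (fun s => hatOf (canonLift τ (V (k s)))) (Ioc 0 1) s :=
      ContinuousAt.comp_continuousWithinAt (g := hatOf) (contDiffAt_hatOf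
        (w := canonLift τ (V (k s)))
        (hxs s hs).ne' hτ).continuousAt (hd s hs).continuousAt.continuousWithinAt
    exact h1.congr (fun s' hs' => (hatOf_canonLift hτ (hxs s' hs').ne').symm)
      (hatOf_canonLift hτ (hxs s hs).ne').symm
  have hcc : ContinuousOn c (Ioc 0 1) := fun s hs => by
    have h1 : ContinuousOn (fun s => edgeLift (τ * (V (k s)).2.1 0) (V (k s))) (Ioc 0 1) := by
      have h2 : Continuous fun Y : ℋ => edgeLift (τ * Y.2.1 0) Y := by
        have h3 : Continuous fun Y : ℋ => Y.2.1 0 := (contDiff_hat_pos 0).continuous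
        unfold edgeLift
        fun_prop
      exact h2.comp_continuousOn hVcont
    refine tendsto_of_coords (hcs s hs).1 ?_ ?_
    · filter_upwards [self_mem_nhdsWithin] with s' hs' using (hcs s' hs').1
    · rw [(hcs s hs).2, ← hVx _ (hks s hs)]
      refine (h1 s hs).tendsto.congr' ?_
      filter_upwards [self_mem_nhdsWithin] with s' hs'
      rw [(hcs s' hs').2, hVx _ (hks s' hs')]
  refine ⟨κ, c, fun s => if 0 < k s then (k s ^ 2)⁻¹ else 1, ⟨hcc, fun s hs =>
    ⟨hN _ (hks s hs) (hk s hs).1, (mem_interior_iff (hcs s hs).1).2 ?_, fun e' he' => ?_⟩⟩, ?_,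
    fun s => ?_, ?_⟩
  · change 0 < (coords e (c s)).2.1 0
    rw [(hcs s hs).2]
    exact hxs s hs
  · have hx0 : 0 < (coords e (c s)).2.1 0 := by rw [(hcs s hs).2]; exact hxs s hs
    have hu : (canonLift τ (V (k s))).2.1 ∈ ball u₀ ε := hVu _ (hks s hs)
    have hx' : 0 < (canonLift τ (V (k s))).2.1 0 := hxs s hs
    have hev := h.waveSymbol_eventuallyEq hu hx'
    refine bicharacteristic_of_chart hs hcc (hcs s hs).1 hx0 ?_ ?_ ?_ he'
    · rw [hcan s hs]
      exact ((h.graph.coeff.contDiffAt_modelSymbol hu hx').differentiableAt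
        (by simp)).congr_of_eventuallyEq
        hev
    · rw [hcan s hs, hev.eq_of_nhds, modelSymbol_canonLift (hxs s hs).ne', hVq _ (hks s hs)]
      ring
    · rw [hcan s hs, h.hamiltonField_eq hu hx']
      exact (hd s hs).hasDerivWithinAt.congr (fun s' hs' => hcan s' hs') (hcan s hs)
  · simp only [c, hk1, hV]
  · dsimp only
    split_ifs with h1
    · positivity
    · exact one_pos
  · have hmem : Ioc (0 : ℝ) 1 ∈ 𝓝[>] (0 : ℝ) := Ioc_mem_nhdsGT one_pos
    have ht0 : (edgeLift τ q).2.1 ∈ e.target := by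
      have := hVt 0 ⟨le_rfl, hm.le⟩
      rwa [hV0] at this
    refine tendsto_of_coords (e := e) (ofCoords_pt ht0) ?_ ?_
    · filter_upwards [hmem] with s hs using (hcs s hs).1
    · rw [coords_ofCoords ht0]
      have h1 : Tendsto (fun s => V (k s)) (𝓝[>] 0) (𝓝 q) := by
        have h2 := (hVc 0 ⟨le_rfl, hm.le⟩).tendsto.comp (tendsto_nhdsWithin_iff.2 ⟨hk0,
          mem_of_superset hmem hks⟩)
        rwa [hV0] at h2
      have h3 : Continuous (edgeLift (b := b) (f := f) τ) := by unfold edgeLift; fun_prop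
      refine ((h3.tendsto q).comp h1).congr' ?_
      filter_upwards [hmem] with s hs
      have h4 := (hk s hs).1.ne'
      rw [if_pos (hk s hs).1, dilate_ofCoords (hVt _ (hks s hs))]
      refine Prod.ext rfl (Prod.ext rfl (Prod.ext ?_ ?_))
      · change τ = (k s ^ 2)⁻¹ * (τ * k s ^ 2)
        field_simp
      · change τ • (V (k s)).2.2 = (k s ^ 2)⁻¹ • ((τ * k s ^ 2) • (V (k s)).2.2)
        rw [smul_smul]
        congr 1
        field_simp

/-- A boundary point of the flowout has arbitrarily small neighbourhoods that contain with every
point of the flowout a bicharacteristic leading from it to the boundary. -/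
theorem exists_swept_nhds {w₀ : EdgeCotangent fib} (hw₀ : w₀ ∈ zeroSet e γ p₀ Z θ)
    (hb : w₀.pt ∈ (ℳ).boundary X) {W : 𝒮} (hW : IsOpen W)
    (hWc : IsConic W) (hw₀W : w₀ ∈ W) :
    ∃ N, IsOpen N ∧ IsConic N ∧ w₀ ∈ N ∧ N ⊆ W ∧
      (∀ w ∈ zeroSet e γ p₀ Z θ ∩ N, ∃ w' ∈ zeroSet e γ p₀ Z θ ∩ N,
        w'.pt ∈ (ℳ).boundary X ∧ w ∈ ray g N w') ∧
      ∃ (κ : ℝ) (c : ℝ → EdgeCotangent fib) (l : ℝ → ℝ), IsBicharacteristic g N κ c ∧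
        (∀ s, 0 < l s) ∧ Tendsto (fun s => dilate (l s) (c s)) (𝓝[>] 0) (𝓝 w₀) := by
  obtain ⟨NW, hNW, hwNW, hNsub⟩ := exists_patch_subset hW hw₀W hw₀.1.1
  set v₀ := coords e w₀
  set τ₀ := v₀.2.2.1
  set Y₀ := hatEdge v₀ with hY₀
  have hτ₀ : τ₀ ≠ 0 := hw₀.1.2.1
  obtain ⟨hq₀, hd₀⟩ := (h.mem_zeroSet hw₀.1).1 hw₀
  have hx₀ : Y₀.2.1 0 = 0 := (mem_boundary_iff hw₀.1.1).1 hb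
  have hP₀ : fibreProj Y₀.2.2 = 0 := by rwa [defect, h.graph.zero_Z _ hx₀, sub_zero] at hd₀
  have hlift : ∀ τ, Continuous (edgeLift (b := b) (f := f) τ) := fun τ => by
    unfold edgeLift; fun_prop
  set W' : Set ℋ := ball p₀ θ ∩ edgeLift τ₀ ⁻¹' NW
  have hW' : IsOpen W' := Metric.isOpen_ball.inter (hNW.preimage (hlift τ₀))
  have hY₀W : Y₀ ∈ W' := ⟨hw₀.1.2.2, by rw [mem_preimage, hY₀, edgeLift_hatEdge hτ₀]; exact hwNW⟩
  have hY₀r : Y₀ ∈ ball p₀ r := ball_subset_ball h.le_flow hw₀.1.2.2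
  obtain ⟨σ, hσ, hσr, hσW⟩ : ∃ σ > 0, ball Y₀ σ ⊆ ball p₀ r ∧
      ∀ q ∈ ball Y₀ σ, blowDown (Φ q) ∈ W' := by
    have hc : ContinuousOn (fun q => blowDown (Φ q)) (ball p₀ r) :=
      contDiff_blowDown.continuous.comp_continuousOn h.graph.smooth.continuousOn
    obtain ⟨σ, hσ, hsub⟩ := Metric.isOpen_iff.1
      (hc.isOpen_inter_preimage isOpen_ball hW') Y₀ ⟨hY₀r, by
        rw [mem_preimage, h.blowDown_base hY₀r hx₀ hP₀]; exact hY₀W⟩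
    exact ⟨σ, hσ, fun q hq => (hsub hq).1, fun q hq => (hsub hq).2⟩
  set S : Set ℋ := W' ∩ sqrtLift ⁻¹' (ball p₀ δ ∩ Ξ ⁻¹' ball Y₀ σ)
  have hS : IsOpen S := hW'.inter ((h.graph.smooth_inv.continuousOn.isOpen_inter_preimage
    isOpen_ball isOpen_ball).preimage continuous_sqrtLift)
  -- the points of the flow box over the ball around `Y₀`
  have hflow : ∀ q ∈ ball Y₀ σ, 0 ≤ q.2.1 0 → fibreProj q.2.2 = 0 → blowDown (Φ q) ∈ S := by
    intro q hq hx hP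
    have h1 := hσW q hq
    have h2 := h.graph.lift_mem _ (ball_subset_ball h.le_graph h1.1)
      (by rw [blowDown_time]; positivity)
    refine ⟨h1, h2, ?_⟩
    rw [mem_preimage, h.graph.lift_blowDown q (hσr hq) hx, h.graph.left_inv q (hσr hq),
      hatProj_apply, hP]
    exact (sub_zero q).symm ▸ hq
  set N : 𝒮 := patch e ({v | v.2.2.1 ≠ 0 ∧ hatEdge v ∈ S} ∩ {v | 0 < v.2.2.1 * τ₀})
  have hNo : IsOpen N := isOpen_patch e ((isOpen_preimage_hatEdge hS).inter
    (isOpen_lt continuous_const (by fun_prop)))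
  have hofN : ∀ q ∈ ball Y₀ σ, 0 ≤ q.2.1 0 → fibreProj q.2.2 = 0 → ∀ τ, 0 < τ * τ₀ →
      ofCoords e (edgeLift τ (blowDown (Φ q))) ∈ N := fun q hq hx hP τ hτ => by
    have h1 : (edgeLift τ (blowDown (Φ q))).2.1 ∈ e.target := h.blowDown_target (hσr hq)
    have hτ' : τ ≠ 0 := left_ne_zero_of_mul hτ.ne'
    refine ⟨ofCoords_pt h1, ?_⟩
    rw [coords_ofCoords h1]
    refine ⟨⟨hτ', ?_⟩, hτ⟩
    rw [hatEdge_edgeLift hτ']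
    exact hflow q hq hx hP
  have hself : ofCoords e (edgeLift τ₀ Y₀) = w₀ := by
    rw [hY₀, edgeLift_hatEdge hτ₀, ofCoords_coords hw₀.1.1]
  have hbase : ∀ q ∈ ball Y₀ σ, q.2.1 0 = 0 → fibreProj q.2.2 = 0 → ∀ τ, 0 < τ * τ₀ →
      ofCoords e (edgeLift τ q) ∈ N := fun q hq hx hP τ hτ => by
    have h1 := hofN q hq hx.ge hP τ hτ
    rwa [h.blowDown_base (hσr hq) hx hP] at h1
  refine ⟨N, hNo, fun c hc w hw => ?_, ?_, fun w hw => ?_, fun w hw => ?_, ?_⟩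
  · refine ⟨hw.1, ⟨mul_ne_zero hc.ne' hw.2.1.1, ?_⟩, ?_⟩
    · rw [hatEdge_dilate hc.ne']; exact hw.2.1.2
    · change 0 < (c * _) * τ₀
      rw [mul_assoc]
      exact mul_pos hc hw.2.2
  · rw [← hself]
    exact hbase Y₀ (mem_ball_self hσ) hx₀ hP₀ τ₀ (mul_self_pos.2 hτ₀)
  · set τ := (coords e w).2.2.1
    have hτ : τ ≠ 0 := hw.2.1.1
    have hpos : 0 < τ * τ₀ := hw.2.2
    have hc : 0 < τ₀ / τ := by
      rw [← mul_div_mul_left _ _ hτ]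
      exact div_pos hpos (mul_self_pos.2 hτ)
    have h1 : dilate (τ₀ / τ) w ∈ W := by
      refine hNsub ⟨hw.1, ?_⟩
      have h2 : coords e (dilate (τ₀ / τ) w) = edgeLift τ₀ (hatEdge (coords e w)) := by
        refine Prod.ext rfl (Prod.ext rfl (Prod.ext ?_ ?_))
        · exact div_mul_cancel₀ _ hτ
        · change (τ₀ / τ) • (w.comp e).2 = τ₀ • (τ⁻¹ • (w.comp e).2)
          rw [smul_smul, div_eq_mul_inv]
      rw [h2]
      exact hw.2.1.2.1.2
    have h3 := hWc (τ / τ₀) (by rw [← inv_div]; exact inv_pos.2 hc) _ h1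
    rwa [dilate_dilate, div_mul_div_cancel₀ hτ₀, div_self hτ, dilate_one] at h3
  · rcases (target_nonneg (coords_mem hw.1.1.1)).eq_or_lt with hx | hx
    · exact ⟨w, hw, (mem_boundary_iff hw.1.1.1).2 hx.symm, hw.2, Or.inl rfl⟩
    set v := coords e w
    set y := hatEdge v with hy
    have hτ : v.2.2.1 ≠ 0 := hw.2.2.1.1
    have hyη : y ∈ ball p₀ η := ball_subset_ball h.le_graph hw.1.1.2.2
    obtain ⟨hqy, hdy⟩ := (h.mem_zeroSet hw.1.1).1 hw.1
    set q := Ξ (sqrtLift y) with hq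
    have hqσ : q ∈ ball Y₀ σ := hw.2.2.1.2.2.2
    have hqm : q.2.1 0 = √(y.2.1 0) := h.graph.time_pos hyη hx.le
    have hqb : blowDown (Φ q) = y := h.graph.blowDown_eq hyη hx.le hdy
    have hm : 0 < √(y.2.1 0) := Real.sqrt_pos.2 hx
    have hqP : hatProj q = 0 := by
      rw [hq, h.graph.proj_inv _ hw.2.2.1.2.2.1, hatProj_apply]
      simp [sqrtLift, fibreProj_fibreProj]
    have hqq : hatBase q + √(y.2.1 0) • hatVec = q := by rw [← hqm, hatBase_add, hqP, sub_zero]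
    have hmem : ∀ s ∈ Icc 0 √(y.2.1 0), hatBase q + s • hatVec ∈ ball Y₀ σ :=
      fun s hs => hatBase_add_mem hx₀ hP₀ hqσ (by
        rw [hqm, abs_of_nonneg hs.1, abs_of_nonneg hm.le]; exact hs.2)
    have hquad : quad (normalCoeff γ) (hatBase q).2.1 (hatBase q).2.2 = 1 := by
      rw [← h.graph.quad_blowDown (hσr hqσ) (by rw [hqm]; exact hm.le), hqb]
      exact hqy
    have hb0 := hmem 0 ⟨le_rfl, hm.le⟩
    rw [zero_smul, add_zero] at hb0
    have hx2 : v.2.2.1 / y.2.1 0 * √(y.2.1 0) ^ 2 = v.2.2.1 := by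
      rw [Real.sq_sqrt (show 0 ≤ y.2.1 0 from hx.le)]; exact div_mul_cancel₀ _ hx.ne'
    have hpos : 0 < v.2.2.1 / y.2.1 0 * τ₀ := by rw [div_mul_eq_mul_div]; exact div_pos hw.2.2.2 hx
    have hτc : v.2.2.1 / y.2.1 0 ≠ 0 := div_ne_zero hτ hx.ne'
    obtain ⟨κ, c, l, hc, hc1, hl, hlim⟩ := h.exists_bicharacteristic (hatBase_time q)
      (fibreProj_hatBase q) hquad hm hτc (fun s hs => hσr (hmem s hs))
      (N := N) fun s hs hs0 => hofN _ (hmem s hs)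
        (by rw [time_add_smul (hatBase_time q)]; exact hs0.le)
        (by simp [hatVec, fibreProj_hatBase]) _ (by
          rw [mul_right_comm]; exact mul_pos hpos (pow_pos hs0 2))
    have hN' := hbase _ hb0 (hatBase_time q) (fibreProj_hatBase q) _ hpos
    have ht : (edgeLift (v.2.2.1 / y.2.1 0) (hatBase q)).2.1 ∈ e.target := by
      have h1 := h.blowDown_target (hσr hb0)
      rwa [h.blowDown_base (hσr hb0) (hatBase_time q) (fibreProj_hatBase q)] at h1
    refine ⟨_, ⟨?_, hN'⟩, (mem_boundary_iff hN'.1).2 ?_, hw.2, Or.inr ⟨κ, c, l, hc, ?_, hl, hlim⟩⟩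
    · have hpatch :
          ofCoords e (edgeLift (v.2.2.1 / y.2.1 0) (hatBase q)) ∈ patch e (hatCone p₀ θ) :=
        ⟨hN'.1, hN'.2.1.1, hN'.2.1.2.1.1⟩
      refine (h.mem_zeroSet hpatch).2 ?_
      rw [coords_ofCoords ht, hatEdge_edgeLift hτc]
      refine ⟨hquad, ?_⟩
      rw [defect, fibreProj_hatBase, h.graph.zero_Z _ (hatBase_time q), sub_zero]
    · change (coords e _).2.1 0 = 0
      rw [coords_ofCoords ht]
      exact hatBase_time q
    · rw [hc1, hqq, hqb, hx2, hy, edgeLift_hatEdge hτ]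
      exact ofCoords_coords hw.1.1.1
  · have hn : ‖(hatVec : ℋ)‖ ≤ 1 := by simp [hatVec, Prod.norm_def, basisVec]
    have hmem : ∀ s ∈ Icc 0 (σ / 2), Y₀ + s • hatVec ∈ ball Y₀ σ := fun s hs => by
      rw [mem_ball_iff_norm, add_sub_cancel_left, norm_smul, norm_eq_abs, abs_of_nonneg hs.1]
      nlinarith [hs.1, hs.2, norm_nonneg (hatVec : ℋ)]
    obtain ⟨κ, c, l, hc, -, hl, hlim⟩ := h.exists_bicharacteristic hx₀ hP₀ hq₀ (half_pos hσ) hτ₀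
      (fun s hs => hσr (hmem s hs)) (N := N) fun s hs hs0 => hofN _ (hmem s hs)
        (by rw [time_add_smul hx₀]; exact hs0.le) (by simp [hatVec, hP₀]) _ (by
          rw [mul_right_comm]; exact mul_pos (mul_self_pos.2 hτ₀) (pow_pos hs0 2))
    rw [hself] at hlim
    exact ⟨κ, c, l, hc, hl, hlim⟩

end IsNormalBox

/-! ### Patching the local flowouts -/

open EdgeCotangent EdgeChart

/-- The union `F` of the bicharacteristics ending in the conic open set `G`, as far as it can be
described locally: `F` contains the bicharacteristics in `G` that tend to a boundary point of
`G` or that start in `F`. The core `B` has no radial points on its boundary outside of `G`. -/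
structure IsFlowoutBox (g : 𝒯) (G F B : 𝒮) : Prop where
  isOpen : IsOpen G
  isConic_zero : IsConic F
  isOpen_core : IsOpen B
  isConic : IsConic G
  isConic_core : IsConic B
  core_subset : B ⊆ G
  closure_core : ∀ w ∈ closure B, w ∈ ℛ → w ∈ G
  isOpen_diff : IsOpen (G \ F)
  radial : ∀ w ∈ F, w.pt ∈ (ℳ).boundary X → w ∈ ℛ
  enter : ∀ {U : 𝒮} {κ s₂ : ℝ} {c : ℝ → EdgeCotangent fib} {l : ℝ → ℝ}
    {w : EdgeCotangent fib}, IsBicharacteristic g U κ c → s₂ ≤ 1 → (∀ s ∈ Ioc 0 s₂, c s ∈ G) →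
    Tendsto (fun s => dilate (l s) (c s)) (𝓝[>] 0) (𝓝 w) → w ∈ G →
    w.pt ∈ (ℳ).boundary X → ∀ s ∈ Ioc 0 s₂, c s ∈ F
  stay : ∀ {U : 𝒮} {κ s₁ s₂ : ℝ} {c : ℝ → EdgeCotangent fib},
    IsBicharacteristic g U κ c → 0 < s₁ → s₂ ≤ 1 → (∀ s ∈ Icc s₁ s₂, c s ∈ G) → c s₁ ∈ F →
    ∀ s ∈ Icc s₁ s₂, c s ∈ F
  swept : ∀ w₀ ∈ F, w₀.pt ∈ (ℳ).boundary X → ∀ W : 𝒮,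
    IsOpen W → IsConic W → w₀ ∈ W → ∃ N, IsOpen N ∧ IsConic N ∧ w₀ ∈ N ∧ N ⊆ W ∧
      (∀ w ∈ F ∩ N, ∃ w' ∈ F ∩ N, w'.pt ∈ (ℳ).boundary X ∧ w ∈ ray g N w') ∧
      ∃ (κ : ℝ) (c : ℝ → EdgeCotangent fib) (l : ℝ → ℝ), IsBicharacteristic g N κ c ∧
        (∀ s, 0 < l s) ∧ Tendsto (fun s => dilate (l s) (c s)) (𝓝[>] 0) (𝓝 w₀)
  coisotropic : IsCoisotropicSubmanifold (f + 1) F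

variable {G F B G' F' B' U : 𝒮} {w : EdgeCotangent fib}

theorem ray_mono {V : 𝒮} (hVU : V ⊆ U) (w : EdgeCotangent fib) : ray g V w ⊆ ray g U w := by
  rintro v ⟨hv, h | ⟨κ, c, l, hc, h⟩⟩
  · exact ⟨hVU hv, Or.inl h⟩
  · exact ⟨hVU hv, Or.inr ⟨κ, c, l, ⟨hc.1, fun s hs => ⟨hVU (hc.2 s hs).1, (hc.2 s hs).2⟩⟩, h⟩⟩

theorem isConic_compl (hU : IsConic U) : IsConic Uᶜ := fun c hc w hw hcw => hw (by
  have := hU c⁻¹ (inv_pos.2 hc) _ hcw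
  rwa [dilate_dilate, inv_mul_cancel₀ hc.ne', dilate_one] at this)

theorem isConic_inter {V : 𝒮} (hU : IsConic U) (hV : IsConic V) :
    IsConic (U ∩ V) := fun c hc w hw => ⟨hU c hc w hw.1, hV c hc w hw.2⟩

theorem mem_of_dilate (hU : IsConic U) {c : ℝ} (hc : 0 < c) (hw : dilate c w ∈ U) : w ∈ U :=
  by_contra fun h => isConic_compl hU c hc w h hw

theorem pt_mem_boundary (hw : w ∈ ℛ) : w.pt ∈ (ℳ).boundary X := hw.elim (fun h => h.1) fun h => h.1

theorem exists_mem_radialSet (hw : w ∈ ℛ) :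
    ∃ σ, w ∈ radialSet g σ := hw.elim (fun h => ⟨_, h⟩) fun h => ⟨_, h⟩

theorem exists_isFlowoutBox [T2Space X]   (hg : IsEdgeMetric fib g) (hw : w ∈ ℛ) :
    ∃ G F B : 𝒮, IsFlowoutBox g G F B ∧ w ∈ F ∧ w ∈ B := by
  obtain ⟨σ, hb, e, γ, he, hγ, hfib, hchar, hpos⟩ := exists_mem_radialSet hw
  have ht := coords_mem he
  have hx : (coords e w).2.1 0 = 0 := (mem_boundary_iff he).1 hb
  have hτ : (coords e w).2.2.1 ≠ 0 := fun h0 => by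
    rw [show (w.comp e).1 = 0 from h0, mul_zero, mul_zero] at hpos
    exact lt_irrefl _ hpos
  have hξ : (w.comp e).2 0 ≠ 0 := fun h0 => by
    rw [h0, zero_mul, mul_zero] at hpos
    exact lt_irrefl _ hpos
  obtain ⟨ε, hΓ, hsub⟩ := hγ.exists_isNormalCoeff ht hx
  set p₀ := hatEdge (coords e w) with hp₀
  have hN : ∀ i, p₀.2.2 i = (w.comp e).1⁻¹ * (w.comp e).2 i := fun i => rfl
  have hP : fibreProj p₀.2.2 = 0 := by
    ext i
    rw [fibreProj_apply]
    split_ifs with hi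
    · rfl
    · rw [hN, hfib i (not_le.1 hi), mul_zero]; rfl
  have hD : raise (normalCoeff γ) 0 (coords e w).2.1 p₀.2.2 ≠ 0 := by
    rw [hγ.raise_normalCoeff ht hx, hN]
    exact mul_ne_zero (inv_ne_zero hτ) hξ
  obtain ⟨K, Φ, Ξ, Z, r, δ, η, hgr⟩ := exists_isHatGraph hΓ (coords e w).1 hP hD
  obtain ⟨θ₀, hθ₀⟩ := hgr.exists_isDecayBall hD
  set θ := min θ₀ (min η r)
  have hθ : 0 < θ := lt_min hθ₀.pos (lt_min hgr.pos_hat hgr.pos)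
  have h : IsNormalBox g e γ (coords e w).2.1 ε p₀ K Φ Ξ Z r δ η θ :=
    ⟨hg, hγ, hsub, hgr, hθ₀.mono hθ (min_le_left _ _),
      (min_le_right _ _).trans (min_le_left _ _), (min_le_right _ _).trans (min_le_right _ _)⟩
  refine ⟨patch e (hatCone p₀ θ), zeroSet e γ p₀ Z θ, patch e (hatCone p₀ (θ / 2)),
    { isOpen := isOpen_patch e isOpen_hatCone
      isConic_zero := isConic_zeroSet
      isOpen_core := isOpen_patch e isOpen_hatCone
      isConic := isConic_patch_hatCone
      isConic_core := isConic_patch_hatCone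
      core_subset := fun v hv => ⟨hv.1, hv.2.1, ball_subset_ball (half_le_self hθ.le) hv.2.2⟩
      closure_core := fun v hv hr => by
        obtain ⟨σ, hr⟩ := exists_mem_radialSet hr
        exact h.closure_subset (half_lt_self hθ) hv hr
      isOpen_diff := h.isOpen_diff
      radial := fun v hv hb => h.mem_radialSet hv hb
      enter := fun hc h2 hG hl hv hb => h.mem_zeroSet_of_tendsto hc h2 hG hl hv.1 hb
      stay := fun hc h1 h2 hG hs => h.mem_zeroSet_of_left hc h1 h2 hG hs
      swept := fun v hv hb W hW hWc hvW => h.exists_swept_nhds hv hb hW hWc hvW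
      coisotropic := h.isCoisotropicSubmanifold_zeroSet },
    (h.mem_zeroSet ⟨he, hτ, mem_ball_self hθ⟩).2 ⟨?_, ?_⟩,
    ⟨he, hτ, mem_ball_self (half_pos hθ)⟩⟩
  · have h1 : ∀ i j, normalCoeff γ i j (coords e w).2.1 = (γ (e.coord w.pt))⁻¹ i j := fun i j =>
      normalCoeff_eq (hγ.isSymm_boundary ht hx) i j
    have h2 : quad (normalCoeff γ) (coords e w).2.1 p₀.2.2 = ((w.comp e).1 ^ 2)⁻¹ *
        ∑ i, ∑ j, (γ (e.coord w.pt))⁻¹ i j * (w.comp e).2 i * (w.comp e).2 j := by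
      rw [quad, mul_sum]
      refine sum_congr rfl fun i _ => ?_
      rw [raise, mul_sum, mul_sum]
      refine sum_congr rfl fun j _ => ?_
      rw [h1, hN, hN, pow_two, mul_inv]
      ring
    exact h2.trans (by rw [← hchar]; exact inv_mul_cancel₀ (pow_ne_zero 2 hτ))
  · rw [defect, hP, hgr.zero_Z _ hx, sub_zero]

namespace IsFlowoutBox

theorem eventually_mem_of_tendsto (hU : IsOpen U) (hUc : IsConic U) {c : ℝ → EdgeCotangent fib}
    {l : ℝ → ℝ} (hl : ∀ s, 0 < l s)
    (hlim : Tendsto (fun s => dilate (l s) (c s)) (𝓝[>] 0) (𝓝 w)) (hw : w ∈ U) :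
    ∃ s₀ > 0, s₀ ≤ 1 ∧ ∀ s ∈ Ioc 0 s₀, c s ∈ U := by
  have h1 : ∀ᶠ s in 𝓝[>] 0, c s ∈ U := by
    filter_upwards [hlim.eventually (hU.mem_nhds hw)] with s hs using mem_of_dilate hUc (hl s) hs
  obtain ⟨s₀, hs₀, h2⟩ := mem_nhdsGT_iff_exists_Ioc_subset.1 h1
  exact ⟨min s₀ 1, lt_min hs₀ one_pos, min_le_right _ _, fun s hs =>
    h2 ⟨hs.1, hs.2.trans (min_le_left _ _)⟩⟩

/-- The radial points of `G` belong to `F`. -/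
theorem mem_of_radial [T2Space X] [IsManifold ℳ ∞ X] (hg : IsEdgeMetric fib g)
    (h : IsFlowoutBox g G F B) (hw : w ∈ ℛ) (hG : w ∈ G) : w ∈ F := by
  obtain ⟨G', F', B', h', hwF, -⟩ := exists_isFlowoutBox hg hw
  obtain ⟨N, -, -, -, hNG, -, κ, c, l, hc, hl, hlim⟩ :=
    h'.swept w hwF (pt_mem_boundary hw) G h.isOpen h.isConic hG
  have h1 := h.enter hc le_rfl (fun s hs => hNG (hc.2 s hs).1) hlim hG (pt_mem_boundary hw)
  by_contra hwn
  have h2 := hlim.eventually (h.isOpen_diff.mem_nhds ⟨hG, hwn⟩)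
  obtain ⟨s, hs, hs'⟩ := (h2.and (Ioc_mem_nhdsGT (one_pos (α := ℝ)))).exists
  exact hs.2 (h.isConic_zero _ (hl s) _ (h1 s hs'))

/-- Two local flowouts agree near a common radial point. -/
theorem exists_inter_eq [T2Space X] [IsManifold ℳ ∞ X] (hg : IsEdgeMetric fib g)
    (h : IsFlowoutBox g G F B) (h' : IsFlowoutBox g G' F' B')
    (hw : w ∈ ℛ) (hG : w ∈ G) (hG' : w ∈ G') :
    ∃ V, IsOpen V ∧ IsConic V ∧ w ∈ V ∧ V ⊆ G' ∧ F ∩ V = F' ∩ V := by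
  have key : ∀ {G F B G' F' B' N : 𝒮}, IsFlowoutBox g G F B →
      IsFlowoutBox g G' F' B' → N ⊆ G' → (∀ w ∈ F ∩ N, ∃ w' ∈ F ∩ N,
        w'.pt ∈ (ℳ).boundary X ∧ w ∈ ray g N w') → F ∩ N ⊆ F' := by
    intro G F B G' F' B' N h h' hN hs v hv
    obtain ⟨v', hv', hb, -, rfl | ⟨κ, c, l, hc, rfl, hl, hlim⟩⟩ := hs v hv
    · exact h'.mem_of_radial hg (h.radial _ hv.1 hb) (hN hv.2)
    · exact h'.enter hc le_rfl (fun s hs => hN (hc.2 s hs).1) hlim (hN hv'.2) hb 1 ⟨one_pos, le_rfl⟩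
  have hwb := pt_mem_boundary hw
  obtain ⟨N, hN, hNc, hwN, hNG, hs, -⟩ := h.swept w (h.mem_of_radial hg hw hG) hwb (G ∩ G')
    (h.isOpen.inter h'.isOpen) (isConic_inter h.isConic h'.isConic) ⟨hG, hG'⟩
  obtain ⟨N', hN', hNc', hwN', hNG', hs', -⟩ := h'.swept w (h'.mem_of_radial hg hw hG') hwb (G ∩ G')
    (h.isOpen.inter h'.isOpen) (isConic_inter h.isConic h'.isConic) ⟨hG, hG'⟩
  refine ⟨N ∩ N', hN.inter hN', isConic_inter hNc hNc', ⟨hwN, hwN'⟩, fun v hv => (hNG hv.1).2,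
    Set.Subset.antisymm (fun v hv => ⟨?_, hv.2⟩) fun v hv => ⟨?_, hv.2⟩⟩
  · exact key h h' (fun v hv => (hNG hv).2) hs ⟨hv.1, hv.2.1⟩
  · exact key h' h (fun v hv => (hNG' hv).1) hs' ⟨hv.1, hv.2.2⟩

end IsFlowoutBox

/-- The conic open sets `V`, swept out by rays, in which the `i`-th local flowout agrees with those
of smaller index. -/
def coherentSets (g : 𝒯) (G F B : ℕ → 𝒮) (i : ℕ) : Set 𝒮 := {V | IsOpen V ∧ IsConic V ∧ V ⊆ B i ∧
    (∀ w ∈ F i ∩ V, ∃ w' ∈ F i ∩ V, w'.pt ∈ (ℳ).boundary X ∧ w ∈ ray g V w') ∧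
    ∀ j < i, V ∩ B j = ∅ ∨ F i ∩ V = F j ∩ V}

theorem isCoisotropicSubmanifold_of_forall {m : ℕ} {S : 𝒮} [IsManifold ℳ ∞ X]
    (h : ∀ w ∈ S, ∃ Q F : 𝒮, IsOpen Q ∧ w ∈ Q ∧ S ∩ Q = F ∩ Q ∧
      IsCoisotropicSubmanifold m F) : IsCoisotropicSubmanifold m S := fun w₀ hw₀ => by
  obtain ⟨Q, F, hQ, hwQ, hSF, hF⟩ := h w₀ hw₀
  have hiff : ∀ w ∈ Q, (w ∈ S ↔ w ∈ F) := fun w hw => by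
    have h1 : w ∈ S ∩ Q ↔ w ∈ F ∩ Q := by rw [hSF]
    exact ⟨fun hs => (h1.1 ⟨hs, hw⟩).1, fun hs => (h1.2 ⟨hs, hw⟩).1⟩
  obtain ⟨e, N, α, he, hN, hwN, hα, hbr⟩ := hF w₀ ((hiff w₀ hwQ).1 hw₀)
  obtain ⟨N', hN', hwN', hsub⟩ := exists_patch_subset hQ hwQ he
  have hmem : ∀ w ∈ S, w.pt ∈ e.source → coords e w ∈ N ∩ N' → w ∈ F := fun w hw hp hc =>
    (hiff w (hsub ⟨hp, hc.2⟩)).1 hw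
  exact ⟨e, N ∩ N', α, he, hN.inter hN', ⟨hwN, hwN'⟩,
    { smooth := fun i => (hα.smooth i).mono fun v hv => ⟨hv.1.1, hv.2⟩
      mem_iff := fun w hp hc => (hiff w (hsub ⟨hp, hc.2⟩)).trans (hα.mem_iff w hp hc.1)
      indep := fun w hw hp hc => hα.indep w (hmem w hw hp hc) hp hc.1
      transversal := fun w hw hp hc => hα.transversal w (hmem w hw hp hc) hp hc.1 },
    fun w hw hp hc => hbr w (hmem w hw hp hc) hp hc.1⟩

section Global

variable [T2Space X] {G F B : ℕ → 𝒮}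

theorem exists_mem_coherentSets (hg : IsEdgeMetric fib g)
    (h : ∀ i, IsFlowoutBox g (G i) (F i) (B i))
    (hw : w ∈ ℛ) {i : ℕ} (hi : w ∈ B i) :
    ∃ V ∈ coherentSets g G F B i, w ∈ V := by
  have hb := pt_mem_boundary hw
  have hG := (h i).core_subset hi
  have hV : ∀ j, ∃ V, IsOpen V ∧ IsConic V ∧ w ∈ V ∧
      (V ∩ B j = ∅ ∨ F i ∩ V = F j ∩ V) := fun j => by
    by_cases hj : w ∈ closure (B j)
    · obtain ⟨V, h1, h2, h3, -, h4⟩ := (h i).exists_inter_eq hg (h j) hw hG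
        ((h j).closure_core w hj hw)
      exact ⟨V, h1, h2, h3, Or.inr h4⟩
    · exact ⟨(closure (B j))ᶜ, isClosed_closure.isOpen_compl,
        isConic_compl (isConic_closure (h j).isConic_core), hj, Or.inl
        (Set.eq_empty_of_forall_notMem fun v hv => hv.1 (subset_closure hv.2))⟩
  choose V hVo hVc hwV hVor using hV
  obtain ⟨N, hN, hNc, hwN, hNW, hs, -⟩ := (h i).swept w ((h i).mem_of_radial hg hw hG) hb
    (B i ∩ ⋂ j ∈ Finset.range i, V j) ((h i).isOpen_core.inter
      (isOpen_biInter_finset fun j _ => hVo j))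
    (isConic_inter (h i).isConic_core fun c hc v hv => Set.mem_iInter₂.2 fun j hj =>
      hVc j c hc v (Set.mem_iInter₂.1 hv j hj)) ⟨hi, Set.mem_iInter₂.2 fun j _ => hwV j⟩
  refine ⟨N, ⟨hN, hNc, fun v hv => (hNW hv).1, hs, fun j hj => ?_⟩, hwN⟩
  have hsub : N ⊆ V j := fun v hv => Set.mem_iInter₂.1 (hNW hv).2 j (Finset.mem_range.2 hj)
  refine (hVor j).imp (fun h1 => ?_) fun h1 => ?_
  · exact Set.subset_eq_empty (Set.inter_subset_inter_left _ hsub) h1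
  · rw [← Set.inter_eq_right.2 hsub, ← Set.inter_assoc, ← Set.inter_assoc, h1]

theorem mem_iff_of_coherent {i j : ℕ} {V V' : 𝒮}
    (hV : V ∈ coherentSets g G F B i) (hV' : V' ∈ coherentSets g G F B j) (hw : w ∈ V)
    (hw' : w ∈ V') : w ∈ F i ↔ w ∈ F j := by
  have key : ∀ {i j : ℕ} {V V' : 𝒮}, V ∈ coherentSets g G F B i →
      V' ∈ coherentSets g G F B j → w ∈ V → w ∈ V' → j < i → (w ∈ F i ↔ w ∈ F j) := by
    intro i j V V' hV hV' hw hw' hji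
    rcases hV.2.2.2.2 j hji with h1 | h1
    · exact ((Set.ext_iff.1 h1 w).1 ⟨hw, hV'.2.2.1 hw'⟩).elim
    · have h2 := Set.ext_iff.1 h1 w
      exact ⟨fun h => (h2.1 ⟨h, hw⟩).1, fun h => (h2.2 ⟨h, hw⟩).1⟩
  rcases lt_trichotomy i j with h1 | rfl | h1
  · exact (key hV' hV hw' hw h1).symm
  · rfl
  · exact key hV hV' hw hw' h1

/-- In the union of the coherent sets, the flowout is given by the local flowouts. -/
theorem flowout_inter (hg : IsEdgeMetric fib g) (h : ∀ i, IsFlowoutBox g (G i) (F i) (B i))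
    (hU : U = ⋃ i, ⋃₀ coherentSets g G F B i) {i : ℕ} {V : 𝒮}
    (hV : V ∈ coherentSets g G F B i) :
    (flowout g 1 U ∪ flowout g (-1) U) ∩ V = F i ∩ V := by
  have hsubU : ∀ {j V'}, V' ∈ coherentSets g G F B j → V' ⊆ U := fun hV' v hv => by
    rw [hU]; exact mem_iUnion.2 ⟨_, Set.mem_sUnion.2 ⟨_, hV', hv⟩⟩
  have hUmem : ∀ {v}, v ∈ U → ∃ j, ∃ V' ∈ coherentSets g G F B j, v ∈ V' := fun hv => by
    rw [hU] at hv
    obtain ⟨j, hj⟩ := mem_iUnion.1 hv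
    exact ⟨j, Set.mem_sUnion.1 hj⟩
  have hBG : ∀ {j V'}, V' ∈ coherentSets g G F B j → V' ⊆ G j := fun hV' v hv =>
    (h _).core_subset (hV'.2.2.1 hv)
  refine Set.Subset.antisymm (fun w hw => ⟨?_, hw.2⟩) fun w hw => ⟨?_, hw.2⟩
  · obtain ⟨ρ, hρ, hρU, hray⟩ : ∃ ρ ∈ ℛ, ρ ∈ U ∧ w ∈ ray g U ρ := by
      rcases hw.1 with h1 | h1
      · obtain ⟨ρ, hρ, h2⟩ := Set.mem_iUnion₂.1 h1
        exact ⟨ρ, Or.inl hρ.1, hρ.2, h2⟩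
      · obtain ⟨ρ, hρ, h2⟩ := Set.mem_iUnion₂.1 h1
        exact ⟨ρ, Or.inr hρ.1, hρ.2, h2⟩
    obtain ⟨-, rfl | ⟨κ, c, l, hc, rfl, hl, hlim⟩⟩ := hray
    · exact (h i).mem_of_radial hg hρ (hBG hV hw.2)
    obtain ⟨j, V', hV', hρV⟩ := hUmem hρU
    obtain ⟨s₀, hs₀, hs₁, hmem⟩ := IsFlowoutBox.eventually_mem_of_tendsto hV'.1 hV'.2.1 hl hlim hρV
    have hstart := (h j).enter hc hs₁ (fun s hs => hBG hV' (hmem s hs)) hlim (hBG hV' hρV)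
      (pt_mem_boundary hρ)
    -- the ray stays in the local flowouts, by continuous induction from `s₀` to `1`
    let A : Set ℝ := {s | ∀ j V', V' ∈ coherentSets g G F B j → c s ∈ V' → c s ∈ F j}
    have hcU : ∀ s ∈ Icc s₀ 1, ∃ j, ∃ V' ∈ coherentSets g G F B j, c s ∈ V' := fun s hs =>
      hUmem (hc.2 s ⟨hs₀.trans_le hs.1, hs.2⟩).1
    have hopen : ∀ s ∈ Icc s₀ 1, ∀ {W : 𝒮}, IsOpen W → c s ∈ W →
        ∀ᶠ s' in 𝓝[Icc s₀ 1] s, c s' ∈ W := fun s hs W hW hsW =>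
      ((hc.1 s ⟨hs₀.trans_le hs.1, hs.2⟩).mono fun s' hs' => ⟨hs₀.trans_le hs'.1, hs'.2⟩).eventually
        (hW.mem_nhds hsW)
    have hA : Icc s₀ 1 ⊆ A := by
      refine IsClosed.Icc_subset_of_forall_exists_gt ?_ ?_ fun s hs y hy => ?_
      · refine isClosed_of_closure_subset fun s hs => ?_
        have hsI : s ∈ Icc s₀ 1 := closure_minimal Set.inter_subset_right isClosed_Icc hs
        refine ⟨fun k V₁ hV₁ hsV => ?_, hsI⟩
        by_contra hn
        have h1 := (hopen s hsI hV₁.1 hsV).and (hopen s hsI (h k).isOpen_diff ⟨hBG hV₁ hsV, hn⟩)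
        obtain ⟨O, hO, hsO, hOs⟩ := mem_nhdsWithin.1 h1
        obtain ⟨s', hs'O, hs'⟩ := mem_closure_iff.1 hs O hO hsO
        have h2 := hOs ⟨hs'O, hs'.2⟩
        exact h2.2.2 (hs'.1 k V₁ hV₁ h2.1)
      · intro k V₁ hV₁ hsV
        exact (mem_iff_of_coherent hV' hV₁ (hmem s₀ ⟨hs₀, le_rfl⟩) hsV).1 (hstart s₀ ⟨hs₀, le_rfl⟩)
      · have hsI : s ∈ Icc s₀ 1 := Set.Ico_subset_Icc_self hs.2
        obtain ⟨k, V₁, hV₁, hsV⟩ := hcU s hsI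
        obtain ⟨ν, hν, hνs⟩ := Metric.mem_nhdsWithin_iff.1 (hopen s hsI hV₁.1 hsV)
        set s' := min (min (s + ν / 2) 1) y
        have hs's : s < s' := lt_min (lt_min (by linarith) hs.2.2) hy
        have hI : ∀ t ∈ Icc s s', c t ∈ V₁ := fun t ht => by
          have h1 : t ≤ s + ν / 2 := ht.2.trans ((min_le_left _ _).trans (min_le_left _ _))
          have h2 : t ≤ 1 := ht.2.trans ((min_le_left _ _).trans (min_le_right _ _))
          refine hνs ⟨?_, hsI.1.trans ht.1, h2⟩
          rw [Metric.mem_ball, Real.dist_eq, abs_of_nonneg (by linarith [ht.1])]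
          linarith
        have hF := (h k).stay hc (hs₀.trans_le hsI.1)
          ((min_le_left _ _).trans (min_le_right _ _)) (fun t ht => hBG hV₁ (hI t ht))
          (hs.1 k V₁ hV₁ hsV)
        have hs'm : s' ∈ Icc s s' := ⟨hs's.le, le_rfl⟩
        exact ⟨s', fun k' V₂ hV₂ hs'V => (mem_iff_of_coherent hV₁ hV₂ (hI s' hs'm) hs'V).1
          (hF s' hs'm), hs's, min_le_right _ _⟩
    exact hA ⟨hs₁, le_rfl⟩ i V hV hw.2
  · obtain ⟨w', hw', hb, hray⟩ := hV.2.2.2.1 w hw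
    have h1 := ray_mono (hsubU hV) w' hray
    rcases (h i).radial w' hw'.1 hb with h2 | h2
    · exact Or.inl (Set.mem_iUnion₂.2 ⟨w', ⟨h2, hsubU hV hw'.2⟩, h1⟩)
    · exact Or.inr (Set.mem_iUnion₂.2 ⟨w', ⟨h2, hsubU hV hw'.2⟩, h1⟩)

theorem exists_countable_radial [SecondCountableTopology X] (hg : IsEdgeMetric fib g)
    {B : EdgeCotangent fib → 𝒮}
    (hB : ∀ w ∈ ℛ, IsOpen (B w) ∧ w ∈ B w) :
    ∃ T ⊆ ℛ, T.Countable ∧ ℛ ⊆ ⋃ w ∈ T, B w := by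
  have h1 : ∀ q : (ℳ).boundary X, ∃ e : EdgeChart fib, (q : X) ∈ e.source := fun q =>
    let ⟨e, _, he, _⟩ := hg.edge q q.2
    ⟨e, he⟩
  choose e he using h1
  obtain ⟨t, htc, htU⟩ := TopologicalSpace.isOpen_iUnion_countable (fun q => (e q).source)
    fun q => (e q).isOpen_source
  have h2 : ∀ q, ∃ T ⊆ {w | w ∈ ℛ ∧ w.pt ∈ (e q).source},
      T.Countable ∧ {w | w ∈ ℛ ∧ w.pt ∈ (e q).source} ⊆ ⋃ w ∈ T, B w := fun q =>
    exists_countable_cover (fun w hw => hw.2) fun w hw => hB w hw.1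
  choose T hTR hTc hTcov using h2
  refine ⟨⋃ q ∈ t, T q, fun w hw => ?_, htc.biUnion fun q _ => hTc q, fun w hw => ?_⟩
  · obtain ⟨q, -, hq⟩ := Set.mem_iUnion₂.1 hw
    exact (hTR q hq).1
  · have h3 : w.pt ∈ ⋃ q ∈ t, (e q).source := by
      rw [htU]
      exact mem_iUnion.2 ⟨⟨w.pt, pt_mem_boundary hw⟩, he _⟩
    obtain ⟨q, hq, hwq⟩ := Set.mem_iUnion₂.1 h3
    obtain ⟨v, hv, hwv⟩ := Set.mem_iUnion₂.1 (hTcov q ⟨hw, hwq⟩)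
    exact Set.mem_iUnion₂.2 ⟨v, Set.mem_iUnion₂.2 ⟨q, hq, hv⟩, hwv⟩

theorem exists_coisotropic_flowout [SecondCountableTopology X] (hg : IsEdgeMetric fib g) :
    ∃ U : 𝒮, IsOpen U ∧ IsConic U ∧ ℛ ⊆ U ∧
      IsCoisotropicSubmanifold (f + 1) (flowout g 1 U ∪ flowout g (-1) U) := by
  have h1 : ∀ w ∈ ℛ, ∃ G F B : 𝒮,
      IsFlowoutBox g G F B ∧ w ∈ F ∧ w ∈ B := fun w hw => exists_isFlowoutBox hg hw
  choose! G F B hbox hF hB using h1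
  obtain ⟨T, hTR, hTc, hcov⟩ := exists_countable_radial hg fun w hw =>
    ⟨(hbox w hw).isOpen_core, hB w hw⟩
  obtain rfl | hne := T.eq_empty_or_nonempty
  · refine ⟨∅, isOpen_empty, fun _ _ _ hw => hw.elim, fun w hw => by simpa using hcov hw,
      fun w hw => ?_⟩
    simp [flowout] at hw
  obtain ⟨φ, rfl⟩ := hTc.exists_eq_range hne
  have hφ : ∀ i, IsFlowoutBox g (G (φ i)) (F (φ i)) (B (φ i)) := fun i => hbox _ (hTR ⟨i, rfl⟩)
  set C := coherentSets g (fun i => G (φ i)) (fun i => F (φ i)) fun i => B (φ i)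
  refine ⟨⋃ i, ⋃₀ C i, isOpen_iUnion fun i => isOpen_sUnion fun V hV => hV.1, fun c hc w hw => ?_,
    fun w hw => ?_, isCoisotropicSubmanifold_of_forall fun w hw => ?_⟩
  · obtain ⟨i, V, hV, hwV⟩ := mem_iUnion.1 hw
    exact mem_iUnion.2 ⟨i, V, hV, hV.2.1 c hc w hwV⟩
  · obtain ⟨_, ⟨i, rfl⟩, hi⟩ := Set.mem_iUnion₂.1 (hcov hw)
    obtain ⟨V, hV, hwV⟩ := exists_mem_coherentSets hg hφ hw hi
    exact mem_iUnion.2 ⟨i, V, hV, hwV⟩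
  · have hwU : w ∈ ⋃ i, ⋃₀ C i := by
      rcases hw with h1 | h1
      · obtain ⟨ρ, -, h2⟩ := Set.mem_iUnion₂.1 h1; exact h2.1
      · obtain ⟨ρ, -, h2⟩ := Set.mem_iUnion₂.1 h1; exact h2.1
    obtain ⟨i, V, hV, hwV⟩ := mem_iUnion.1 hwU
    exact ⟨V, F (φ i), hV.1, hwV, flowout_inter hg hφ rfl hV, (hφ i).coisotropic⟩

end Global

end Charts

end EdgeGeometry

theorem mainTheorem8 {b f : ℕ} {X Y Z : Type*}
    [TopologicalSpace X] [T2Space X] [SecondCountableTopology X]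
    [ChartedSpace (EuclideanHalfSpace (b + f + 1)) X] [IsManifold (𝓡∂ (b + f + 1)) ∞ X]
    [TopologicalSpace Y] [T2Space Y] [SecondCountableTopology Y]
    [ChartedSpace (EuclideanSpace ℝ (Fin b)) Y] [IsManifold (𝓡 b) ∞ Y]
    [TopologicalSpace Z] [T2Space Z] [SecondCountableTopology Z]
    [ChartedSpace (EuclideanSpace ℝ (Fin f)) Z] [IsManifold (𝓡 f) ∞ Z]
    (fib : (𝓡∂ (b + f + 1)).boundary X → Y)
    (hfib : EdgeGeometry.IsBoundaryFibration Z fib)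
    (g : ∀ p : X, TangentSpace (𝓡∂ (b + f + 1)) p →L[ℝ]
      TangentSpace (𝓡∂ (b + f + 1)) p →L[ℝ] ℝ)
    (hg : EdgeGeometry.IsEdgeMetric fib g) :
    ∃ U : Set (EdgeGeometry.EdgeCotangent fib),
      IsOpen U ∧ EdgeGeometry.EdgeCotangent.IsConic U ∧
      EdgeGeometry.radialSet g 1 ∪ EdgeGeometry.radialSet g (-1) ⊆ U ∧
      EdgeGeometry.IsCoisotropicSubmanifold (f + 1)
        (EdgeGeometry.flowout g 1 U ∪ EdgeGeometry.flowout g (-1) U) :=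
  EdgeGeometry.exists_coisotropic_flowout hg
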